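/- **Local anomaly cancellation for twenty local Weierstrass families.** *Conventions.* Work near $z=t=0$ with $y^2=x^3+ux^2+vx+w$, $u,v,w\in\mathbb C[[t]][[z]]$. Put $f=v-\frac13u^2$, $g=\frac2{27}u^3-\frac13uv+w$, $\Delta=4f^3+27g^2$. For a smooth curve $\Sigma=\{\sigma=0\}$, $\sigma=z-\varphi(t)$, $\varphi(0)=0$, the Kodaira type along $\Sigma$ is read off from the orders of $f,g,\Delta$ along $\Sigma$. The *special type* is the Kodaira type of the restriction to a general disk $t=cz$ (all but finitely many $c\in\mathbb C$); for families 6–20 it is also the type on the disk $t=0$. Restrictions to $\Sigma$ are expressed in $t$. *Tate invariants.* With $q=-\frac{9g}{2f}$ (divided by the appropriate power of $\sigma$ and restricted to $\Sigma$): - $I_m$: $\gamma=(\Delta/\sigma^m)|_\Sigma/q|_\Sigma^2$, and $\beta=q|_\Sigma$ if $m\ge3$; - $III$: $\gamma=(f/\sigma)|_\Sigma$; $IV$: $\beta=(g/\sigma^2)|_\Sigma$; $IV^*$: $\beta=(g/\sigma^4)|_\Sigma$; $III^*$: $\gamma=(f/\sigma^3)|_\Sigma$; - $I_j^*$, $j\ge1$: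 $\gamma=(q/\sigma)|_\Sigma$, $\beta=(\Delta/\sigma^{6+j})|_\Sigma/\gamma^3$ for $j$ odd, $\beta=-(\Delta/\sigma^{6+j})|_\Sigma/\gamma^2$ for $j$ even. A quantity that is not listed is undefined ($\Box$). *Gauge algebras.* The covering algebras are $\mathfrak{su}(m)$ for $I_m$, $\mathfrak{su}(2)$, $\mathfrak{su}(3)$ for $III$, $IV$, $\mathfrak{so}(2j+8)$ for $I_j^*$, $\mathfrak e_6,\mathfrak e_7,\mathfrak e_8$ for $IV^*,III^*,II^*$. For $I_m$ ($m\ge3$), $IV$, $I_j^*$ ($j\ge1$), $IV^*$ there is a double monodromy cover, and the gauge algebra $\mathfrak g(\Sigma)$ is either the covering algebra, allowed if $\beta$ is a square in $\mathbb C((t))$, or $\mathfrak{sp}([m/2])$, $\mathfrak{sp}(1)$, $\mathfrak{so}(2j+7)$, $\mathfrak f_4$ respectively (always allowed; the global monodromy may be nontrivial). For the other types occurring along $\Sigma$ it is the covering algebra. In the first situation $\rho_0$ is defined by $\mathrm{adj}(\text{covering algebra})|_{\mathfrak g(\Sigma)}=\mathrm{adj}+\rho_0$ when $\mathfrak g(\Sigma)$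 is the smaller algebra. *Representations* have coefficients in $\mathbb Q$ and are identified with their characters. $\rho,\rho'$ are *Casimir equivalent* if $\mathrm{Tr}_\rho F^k=\mathrm{Tr}_{\rho'}F^k$ for $k=2,4$. The *local Tate representation* is $\frac12\mathrm{ord}_t(\beta)\,\rho_{\sqrt\beta}+\mathrm{ord}_t(\gamma)\,\rho_\gamma$ (undefined terms are dropped), where $\rho_{\sqrt\beta}$ is: $\Lambda^2$ for $\mathfrak{su}(m)$, $m\ge3$; $\Lambda^2_{irr}$ (resp. $\Lambda^2_{irr}+\mathrm{fund}$) for $\mathfrak{sp}([m/2])$, type $I_m$ with $m$ even (resp. odd); $3\,\mathrm{fund}$ for type $IV$; $\mathrm{vect}$ for $I_j^*$; $\mathbf{27}$ for $\mathfrak e_6$, $\mathbf{26}$ for $\mathfrak f_4$; and $\rho_\gamma$ is: $\mathrm{fund}$ for $I_m$; $2\,\mathrm{fund}$ for $III$; $\mathrm{spin}$, $\frac12\mathrm{spin}$, $\frac14\mathrm{spin}+\mathrm{vect}$ for $I_1^*,I_2^*,I_3^*$; $0$ for $I_j^*$, $j\ge4$ (in the families below $\gamma$ does not vanish for these); $\frac12\mathbf{56}$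 for $III^*$. (For $\mathfrak{su}(3)$, $\Lambda^2$ is the dual of $\mathrm{fund}$ and has the same traces; for $\mathfrak{so}(2n)$, $\mathrm{spin}$ is a half-spin representation.) *Matter.* Let $\mathfrak g'$ be the covering algebra of the special type and let $\bigoplus_i\mathfrak g_i\subset\mathfrak g'$ be a regular embedding of the covering algebras of the components. A *branching rule* is a $\rho$ with $\mathrm{adj}(\mathfrak g')|=\bigoplus_i\mathrm{adj}(\mathfrak g_i)+\rho+\bar\rho+(\mathrm{rk}\,\mathfrak g'-\sum_i\mathrm{rk}\,\mathfrak g_i)\cdot\mathbf1$. The *matter representation* is $\frac1k\rho$ restricted to $\bigoplus_i\mathfrak g(\Sigma_i)$ (trivial summands are irrelevant), where $t=s^k$ is the substitution to the versal simultaneous resolution. For families 6–20, which are weighted homogeneous in $(x,z,t)$ with weights $(a,b,d)$, the equation having weight $3a$, one has $k\cdot 3a=h\,d$ with $h$ the Coxeter number of $\mathfrak g'$. *Cancellation.* Local anomaly cancellation means: for each component $\Sigma_i$ the restriction of the matter representation to $\mathfrak g(\Sigma_i)$ is Casimir equivalent to the local Tate representation of $\Sigma_i$; and for $i\ne j$ the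 representation-multiplicity $\mu$ of the matter representation at $(i,j)$, defined for $F\in\mathfrak g(\Sigma_i)$, $G\in\mathfrak g(\Sigma_j)$ by $\sum\mathrm{Tr}_{\sigma}F^2\,\mathrm{Tr}_{\tau}G^2=\mu\,\mathrm{tr}F^2\,\mathrm{tr}G^2$ (sum over the summands $\sigma\otimes\tau$; $\mathrm{tr}$ is the normalized trace: $\mathrm{Tr}_{fund}$ for $\mathfrak{su},\mathfrak{sp}$, $\frac12\mathrm{Tr}_{vect}$ for $\mathfrak{so}$, $\frac16\mathrm{Tr}_{27}$, $\frac16\mathrm{Tr}_{26}$, $\frac1{12}\mathrm{Tr}_{56}$ for $\mathfrak e_6,\mathfrak f_4,\mathfrak e_7$), equals the intersection multiplicity $\dim_{\mathbb C}\mathbb C[[z,t]]/(\sigma_i,\sigma_j)$. **Theorem.** For each of the families below, the special type, the discriminant, the type along each listed component, $\beta$ and $\gamma$ are as stated, the stated $\rho$ is a branching rule for an embedding in $\mathfrak g'$, and local anomaly cancellation holds for every allowed choice of gauge algebras. The same holds after every base change $t\mapsto t^e$, $e\ge1$ (with $k$ replaced by $k/e$ and intersection multiplicities multiplied by $e$;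 special type, branching rule and homogeneity refer to $e=1$). For families 6–20, all other components of $\Delta=0$ have type $I_1$ or $II$. *Families with arbitrary functions* (all coefficients in $\mathbb C[[t]][[z]]$; a "unit" does not vanish at $z=t=0$; $\Sigma=\{z=0\}$; $\beta,\gamma$ are restricted to $z=0$): 1. $m\ge3$, $a_2$ a unit, $c,h$ arbitrary, with $z\mid c$ if $m=3$: $y^2=x^3+a_2(x+cz^{[m/2]})^2+tz^m+hz^{m+1}$; $I_m\to I_{m+1}$; $\Delta=4a_2^3tz^m+O(z^{m+1})$; $\beta=a_2$, $\gamma=4a_2t$; $k=1$; $\rho=\mathrm{fund}$. 2. $n\ge2$, $a_4$ a unit: $y^2=x^3+tx^2+a_4z^nx+a_6z^{2n}$; $I_{2n}\to I_{2n-4}^*$; $\Delta=t^2(4ta_6-a_4^2)z^{2n}+O(z^{2n+2})$; $\beta=t$, $\gamma=4ta_6-a_4^2$; $k=2$; $\rho=\Lambda^2$. 3. $n\ge4$, $\nu$ and $\theta=\xi^2a_2-\nu\xi a_4+\nu^2a_6$ units: $y^2=x^3+(\frac14t\nu^2+a_2z)x^2+(\frac12t\nu\xi+a_4z)z^nx+(\frac14t\xi^2+a_6z)z^{2n}$;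 $I_{2n+1}\to I_{2n-2}^*$; $\Delta=(\frac14t\nu^2+a_2z)^2[t\theta+(4a_2a_6-a_4^2)z]z^{2n+1}+O(z^{2n+4})$; $\beta=\frac14t\nu^2$, $\gamma=t\theta$; $k=2$; $\rho=2\,\mathrm{fund}+\Lambda^2$. 4. $n\ge3$, $\mu,\xi,a_2$ units, $\theta=\xi^2a_2-t\xi a_4+t^2a_6$: $y^2=x^3+(\frac14\mu t^2+a_2z)x^2+(\frac12\mu t\xi+a_4z)z^nx+(\frac14\mu\xi^2+a_6z)z^{2n}$; $I_{2n+1}\to I_{2n-3}^*$; $\Delta=(\frac14\mu t^2+a_2z)^2[\mu\theta+(4a_2a_6-a_4^2)z]z^{2n+1}+O(z^{2n+3})$; $\beta=\frac14\mu t^2$, $\gamma=\mu\theta$; $k=1$; $\rho=\Lambda^2$. 5. $m\ge7$, $a_2$ a unit, $c,h$ arbitrary: $y^2=x^3+a_2z(x+cz^{[(m-1)/2]})^2+tz^{m-1}+hz^m$; $I_{m-4}^*\to I_{m-3}^*$; $\Delta=4a_2^3tz^{m+2}+O(z^{m+3})$; $\beta=4t$ ($m$ odd), $-4a_2t$ ($m$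 even), $\gamma=a_2$; $k=2$; $\rho=\mathrm{vect}$. *Weighted homogeneous families, one component* $\Sigma=\{z=0\}$ (weights of $(x,z,t)$ in brackets): 6. $y^2=x^3+2tzx+z^2$; $III\to IV$; $\Delta=z^3(27z+32t^3)$; $\beta=\Box$, $\gamma=2t$; $[2,3,1]$, $k=\frac12$; $\rho=\mathrm{fund}$. 7. $a,b\in\mathbb C$, $d=4a^3+27b^2\ne0$: $y^2=x^3+az^2x+tz^2+bz^3$; $IV\to I_0^*$; $\Delta=z^4(dz^2+54btz+27t^2)$; $\beta=t$, $\gamma=\Box$; $[2,2,2]$, $k=2$; $\rho=3\,\mathrm{fund}$. 8. $y^2=x^3+(tx+z^2)^2$; $I_6\to IV^*$; $\Delta=z^6(27z^2-4t^3)$; $\beta=t^2$, $\gamma=-4t^{-1}$; $[4,3,2]$, $k=2$; $\rho=\mathbf1+\Lambda^3$. 9. $y^2=x^3+(-4tz+16t^3)x^2+(z^3-8t^2z^2)x+tz^4$; $I_7\to III^*$; $\Delta=z^7(4z^2-13t^2z+32t^4)$; $\beta=16t^3$, $\gamma=\frac18t^{-2}$; $[6,4,2]$, $k=2$; $\rho=\mathrm{fund}+\Lambda^3$.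 10. $y^2=x^3+(3t^2z+t^5)x^2-(4tz^3+2t^4z^2)x+z^5+t^3z^4$; $I_8\to II^*$; $\Delta=z^8(27z^2+14t^3z+3t^6)$; $\beta=t^5$, $\gamma=3t^{-4}$; $[10,6,2]$, $k=2$; for two embeddings $A_7\subset E_8$ (as the subdiagram $\alpha_1,\alpha_3,\dots,\alpha_8$, and through $\mathfrak{su}(8)\subset\mathfrak{so}(16)$) respectively $\rho=\mathrm{fund}+\Lambda^2+\Lambda^3$ and $\rho'=\mathbf1+2\Lambda^2+\frac12\Lambda^4$. The restrictions to $\mathfrak{sp}(4)$ are $\frac12\rho=\frac12\mathbf1+\frac12\rho_0+\mathrm{fund}+\frac12\Lambda^3_{irr}$ and $\frac12\rho'=\frac74\mathbf1+\frac12\rho_0+\frac34\Lambda^2_{irr}+\frac14\Lambda^4_{irr}$. After removing $\frac12\rho_0$ and trivial summands the first is pre-quaternionic and the second is not, whatever rational multiple of $\mathbf 1$ is removed. Here $\chi$ is *pre-quaternionic* if $\chi+\bar\chi$ is the character of an actual representation with an invariant nondegenerate alternating form. 11. $y^2=x^3+tzx^2+z^4$; $I_1^*\to IV^*$; $\Delta=z^7(27z+4t^3)$;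 $\beta=4$, $\gamma=t$; $[4,3,1]$, $k=1$; $\rho=\mathrm{spin}$. 12. $y^2=x^3+tzx^2+z^3x$; $I_2^*\to III^*$; $\Delta=z^8(4z-t^2)$; $\beta=1$, $\gamma=t$; $[6,4,2]$, $k=2$; $\rho=\mathbf1+\mathrm{spin}$. 13. $y^2=x^3+z(tx+z^2)^2$; $I_3^*\to II^*$; $\Delta=z^9(27z-4t^3)$; $\beta=-4t^{-3}$, $\gamma=t^2$; $[10,6,2]$, $k=2$; $\rho=\mathrm{vect}+\mathrm{spin}$. 14. $y^2=x^3+z^3x+tz^4$; $IV^*\to III^*$; $\Delta=z^8(4z+27t^2)$; $\beta=t$, $\gamma=\Box$; $[6,4,2]$, $k=2$; $\rho=\mathbf{27}$. 15. $y^2=x^3+tz^3x+z^5$; $III^*\to II^*$; $\Delta=z^9(27z+4t^3)$; $\beta=\Box$, $\gamma=t$; $[10,6,2]$, $k=2$; $\rho=\mathbf1+\mathbf{56}$. *Weighted homogeneous families, several components:* 16. $y^2=x^3+(4tz+t^4)x^2+2t^2z^2x+z^4$; $\to IV^*$; $\Delta=(z+2t^3)^2z^5(27z+4t^3)$; on $z=-2t^3$: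 $I_2$, $\beta=\Box$, $\gamma=64t^{10}$; on $z=0$: $I_5$, $\beta=t^4$, $\gamma=16t$; intersection multiplicity $3$; $[4,3,1]$, $k=1$; $\rho=\mathbf1\otimes\mathrm{fund}+\mathrm{fund}\otimes\Lambda^2$. 17. $y^2=x^3+tzx^2+z^3x+tz^4$; $\to III^*$; $\Delta=4(z+t^2)^2z^7$; on $z=-t^2$: $I_2$, $\Box$, $\gamma=-t^8$; on $z=0$: $I_1^*$, $\beta=4t$, $\gamma=t$; multiplicity $2$; $[6,4,2]$, $k=2$; $\rho=\mathbf1\otimes\mathrm{vect}+\mathrm{fund}\otimes\mathrm{spin}$. 18. $y^2=x^3-3tz^3x+z^5+t^3z^4$; $\to II^*$; $\Delta=27(z-t^3)^2z^8$; on $z=t^3$: $I_2$, $\Box$, $\gamma=3t^{14}$; on $z=0$: $IV^*$, $\beta=t^3$, $\Box$; multiplicity $3$; $[10,6,2]$, $k=2$; $\rho=\mathbf1\otimes\mathbf{27}+\mathrm{fund}\otimes\mathbf1+\mathrm{fund}\otimes\mathbf{27}$. 19. $y^2=x^3+(400t^3-15tz)x^2+(480t^4z-45t^2z^2+z^3)x+144t^5z^2-5t^3z^3$;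 $\to III^*$; $\Delta=z^3(z-32t^2)^5(4z-125t^2)$; on $z=0$: $I_3$, $\beta=400t^3$, $\gamma=\frac{131072}5t^6$; on $z=32t^2$: $I_5$, $\beta=16t^3$, $\gamma=384t^2$; multiplicity $2$; $[6,4,2]$, $k=2$; $\rho=\mathbf1\otimes\mathrm{fund}+\mathrm{fund}\otimes\mathrm{fund}+\mathrm{fund}\otimes\Lambda^2$. 20. $y^2=x^3-3t^4x^2-6t^2z^2x+16t^6z^2+z^4$; $\to IV^*$; $\Delta=27z^2(z-2t^3)^3(z+2t^3)^3$; on $z=0$: $I_2$, $\Box$, $\gamma=-192t^{10}$; on $z=\pm2t^3$: $I_3$, $\beta=9t^4$, $\gamma=\pm\frac{256}3t^7$; each pair has multiplicity $3$; $[4,3,1]$, $k=1$; $\rho=\mathbf1\otimes\mathrm{fund}\otimes\mathrm{fund}+\mathrm{fund}\otimes\mathbf1\otimes\mathbf1+\mathrm{fund}\otimes\mathrm{fund}\otimes\mathrm{fund}$. -/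

import Mathlib

noncomputable section

namespace EllipticAnomaly

/-! ### Gauge algebras: Cartan subalgebras and roots -/

/-- The compact simple Lie algebras that occur: `A m` is `𝔰𝔲(m)`, `B n` is `𝔰𝔬(2n+1)`, `C n` is
`𝔰𝔭(n)` (of rank `n`), `D n` is `𝔰𝔬(2n)`, and the exceptional algebras. -/
inductive GaugeAlg
  | A (m : ℕ) | B (n : ℕ) | C (n : ℕ) | D (n : ℕ) | E6 | E7 | E8 | F4

open GaugeAlg

/-- The number of standard coordinates in which the Cartan subalgebra is described. -/
@[reducible]
def GaugeAlg.N : GaugeAlg → ℕ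
  | A m => m | B n => n | C n => n | D n => n | E6 => 8 | E7 => 8 | E8 => 8 | F4 => 4

def GaugeAlg.rank : GaugeAlg → ℕ
  | A m => m - 1 | B n => n | C n => n | D n => n | E6 => 6 | E7 => 7 | E8 => 8 | F4 => 4

/-- Trace-zero diagonal matrices. -/
def cartanA (m : ℕ) : Submodule ℂ (Fin m → ℂ) :=
  LinearMap.ker (∑ i : Fin m, (LinearMap.proj i : (Fin m → ℂ) →ₗ[ℂ] ℂ))

/-- The orthogonal complement of `ε₇ + ε₈`. -/
def cartanE7 : Submodule ℂ (Fin 8 → ℂ) :=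
  LinearMap.ker ((LinearMap.proj 6 : (Fin 8 → ℂ) →ₗ[ℂ] ℂ) + LinearMap.proj 7)

/-- The orthogonal complement of `ε₇ + ε₈` and `ε₆ - ε₇`. -/
def cartanE6 : Submodule ℂ (Fin 8 → ℂ) :=
  cartanE7 ⊓ LinearMap.ker ((LinearMap.proj 5 : (Fin 8 → ℂ) →ₗ[ℂ] ℂ) - LinearMap.proj 6)

/-- A Cartan subalgebra of the complexified algebra, in the standard (Bourbaki) coordinates, with
`E6 ⊂ E7 ⊂ E8`. -/
@[reducible]
def Cartan : (g : GaugeAlg) → Submodule ℂ (Fin g.N → ℂ)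
  | A m => cartanA m
  | B _ => ⊤
  | C _ => ⊤
  | D _ => ⊤
  | E6 => cartanE6
  | E7 => cartanE7
  | E8 => ⊤
  | F4 => ⊤

/-- The standard basis vector `ε i`. -/
def ε {n : ℕ} (i : Fin n) : Fin n → ℚ := Pi.single i 1

def rootsA (m : ℕ) : Finset (Fin m → ℚ) :=
  (Finset.univ : Finset (Fin m)).offDiag.image fun p => ε p.1 - ε p.2

/-- The vectors `±ε i ± ε j` with `i ≠ j`. -/
def rootsD (n : ℕ) : Finset (Fin n → ℚ) :=
  ((Finset.univ : Finset (Fin n)).offDiag.image fun p => ε p.1 - ε p.2) ∪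
  ((Finset.univ : Finset (Fin n)).offDiag.image fun p => ε p.1 + ε p.2) ∪
  ((Finset.univ : Finset (Fin n)).offDiag.image fun p => -ε p.1 - ε p.2)

/-- The vectors `±c ε i`. -/
def axisVectors (n : ℕ) (c : ℚ) : Finset (Fin n → ℚ) :=
  ((Finset.univ : Finset (Fin n)).image fun i => c • ε i) ∪
  ((Finset.univ : Finset (Fin n)).image fun i => (-c) • ε i)

/-- The vector `½(± ε₁ ± ⋯ ± εₙ)` with minus signs exactly where `b i = true`. -/
def spinVector {n : ℕ} (b : Fin n → Bool) : Fin n → ℚ := fun i => if b i then -1 / 2 else 1 / 2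

def spinVectors (n : ℕ) : Finset (Fin n → ℚ) :=
  (Finset.univ : Finset (Fin n → Bool)).image spinVector

/-- The spin vectors with an even number of minus signs. -/
def evenSpinVectors (n : ℕ) : Finset (Fin n → ℚ) :=
  ((Finset.univ : Finset (Fin n → Bool)).filter
    fun b => Even (Finset.univ.filter fun i => b i = true).card).image spinVector

def rootsE8 : Finset (Fin 8 → ℚ) := rootsD 8 ∪ evenSpinVectors 8

/-- `ε₇ + ε₈` and `ε₆ - ε₇`; they span an `A₂` in `E₈`, whose orthogonal complement is `E₆`, and
the first spans an `A₁`, whose orthogonal complement is `E₇`. -/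
def vecA1 : Fin 8 → ℚ := ε 6 + ε 7

def vecA2 : Fin 8 → ℚ := ε 5 - ε 6

/-- The root system. -/
def GaugeAlg.roots : (g : GaugeAlg) → Finset (Fin g.N → ℚ)
  | A m => rootsA m
  | B n => rootsD n ∪ axisVectors n 1
  | C n => rootsD n ∪ axisVectors n 2
  | D n => rootsD n
  | E6 => rootsE8.filter fun α => α ⬝ᵥ vecA1 = 0 ∧ α ⬝ᵥ vecA2 = 0
  | E7 => rootsE8.filter fun α => α ⬝ᵥ vecA1 = 0
  | E8 => rootsE8
  | F4 => rootsD 4 ∪ axisVectors 4 1 ∪ spinVectors 4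

/-- An element of the Cartan subalgebra that is the coroot `2 α / (α, α)` of a root `α`. -/
def IsCoroot {g : GaugeAlg} (x : Cartan g) : Prop :=
  ∃ α ∈ g.roots, ∀ i, (x : Fin g.N → ℂ) i = ((2 / (α ⬝ᵥ α) * α i : ℚ) : ℂ)

/-! ### Representation rings with rational coefficients

A finite-dimensional representation is recorded by its character, i.e. its weights (linear forms on
a Cartan subalgebra) with their multiplicities. So the representation ring with `ℚ`-coefficients is
a subring of the group algebra of the weights; the sum is the direct sum, the product is the tensor
product and `1` is the trivial representation. Invariant polynomials are determined by their
restriction to the Cartan subalgebra. -/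

/-- Formal characters, with rational coefficients, on a Cartan subalgebra `h`. -/
abbrev Rep (h : Type) [AddCommGroup h] [Module ℂ h] : Type :=
  AddMonoidAlgebra ℚ (Module.Dual ℂ h)

section Characters

variable {h h' : Type} [AddCommGroup h] [Module ℂ h] [AddCommGroup h'] [Module ℂ h']

/-- Restriction of a representation along a map of Cartan subalgebras. -/
def pull (i : h →ₗ[ℂ] h') (χ : Rep h') : Rep h := χ.mapDomain fun w => w.comp i

/-- The complex conjugate (dual) representation. -/
def conj (χ : Rep h) : Rep h := χ.mapDomain fun w => -w

/-- `Tr_χ F^k`, for `F` in the Cartan subalgebra. -/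
def Tr (k : ℕ) (χ : Rep h) (F : h) : ℂ := χ.coeff.sum fun w c => (c : ℂ) * (w F) ^ k

/-- Casimir equivalence in degrees `2` and `4`. -/
def CasimirEquiv (χ χ' : Rep h) : Prop :=
  ∀ F : h, Tr 2 χ F = Tr 2 χ' F ∧ Tr 4 χ F = Tr 4 χ' F

end Characters

/-- The linear form on the Cartan subalgebra with coordinate vector `v`. -/
def wt (g : GaugeAlg) (v : Fin g.N → ℚ) : Module.Dual ℂ (Cartan g) :=
  ∑ i, (v i : ℂ) • (LinearMap.proj i).comp (Cartan g).subtype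

/-- The character with the given weights, each of multiplicity one. -/
def ofWeights (g : GaugeAlg) (s : Finset (Fin g.N → ℚ)) : Rep (Cartan g) :=
  ∑ v ∈ s, AddMonoidAlgebra.single (wt g v) 1

/-- The adjoint representation. -/
def adj (g : GaugeAlg) : Rep (Cartan g) := (g.rank : ℚ) • 1 + ofWeights g g.roots

/-- The exterior power `Λ^k` of the standard representation of `𝔰𝔲(m)`. -/
def extA (m k : ℕ) : Rep (Cartan (A m)) :=
  ∑ s ∈ (Finset.univ : Finset (Fin m)).powersetCard k,
    AddMonoidAlgebra.single (wt (A m) (∑ i ∈ s, ε i)) 1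

def fundA (m : ℕ) : Rep (Cartan (A m)) := extA m 1

/-- The exterior power `Λ^k` of the standard representation of `𝔰𝔭(n)`, whose weights are
`ε i` and `-ε i`. -/
def extC (n k : ℕ) : Rep (Cartan (C n)) :=
  ∑ s ∈ (Finset.univ : Finset (Fin n × Bool)).powersetCard k,
    AddMonoidAlgebra.single (wt (C n) (∑ p ∈ s, if p.2 then -ε p.1 else ε p.1)) 1

def fundC (n : ℕ) : Rep (Cartan (C n)) := extC n 1

/-- The nontrivial irreducible component of `Λ^k`, namely `Λ^k - Λ^(k-2)`, for `2 ≤ k ≤ n`; for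
`k = 2`, `n = 1` it is zero. -/
def extIrrC (n k : ℕ) : Rep (Cartan (C n)) := extC n k - extC n (k - 2)

def vectB (n : ℕ) : Rep (Cartan (B n)) := 1 + ofWeights (B n) (axisVectors n 1)

def vectD (n : ℕ) : Rep (Cartan (D n)) := ofWeights (D n) (axisVectors n 1)

def spinB (n : ℕ) : Rep (Cartan (B n)) := ofWeights (B n) (spinVectors n)

/-- The half-spin representation `spin₊`. -/
def spinD (n : ℕ) : Rep (Cartan (D n)) := ofWeights (D n) (evenSpinVectors n)

/-- The half-spin representation `spin₋`. -/
def spinD' (n : ℕ) : Rep (Cartan (D n)) := ofWeights (D n) (spinVectors n \ evenSpinVectors n)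

/-- The `27` of `E₆`: under `E₆ × A₂ ⊂ E₈`, the weights of the adjoint representation of `E₈` that
restrict to a fixed weight of the standard representation of `A₂`. -/
def rep27 : Rep (Cartan E6) :=
  ofWeights E6 (rootsE8.filter fun α => α ⬝ᵥ vecA1 = 0 ∧ α ⬝ᵥ vecA2 = 1)

/-- The `56` of `E₇`: under `E₇ × A₁ ⊂ E₈`, the weights of the adjoint representation of `E₈` that
restrict to the highest weight of the standard representation of `A₁`. -/
def rep56 : Rep (Cartan E7) := ofWeights E7 (rootsE8.filter fun α => α ⬝ᵥ vecA1 = 1)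

/-- The `26` of `F₄`: the short roots, and zero with multiplicity two. -/
def rep26 : Rep (Cartan F4) :=
  (2 : ℚ) • 1 + ofWeights F4 (axisVectors 4 1 ∪ spinVectors 4)

/-- The normalized trace `tr F²`. -/
def normTr : (g : GaugeAlg) → Cartan g → ℂ
  | A m, F => Tr 2 (fundA m) F
  | B n, F => 1 / 2 * Tr 2 (vectB n) F
  | C n, F => Tr 2 (fundC n) F
  | D n, F => 1 / 2 * Tr 2 (vectD n) F
  | E6, F => 1 / 6 * Tr 2 rep27 F
  | E7, F => 1 / 12 * Tr 2 rep56 F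
  | E8, F => 1 / 60 * Tr 2 (adj E8) F
  | F4, F => 1 / 6 * Tr 2 rep26 F

/-! ### Kodaira types, gauge algebras and Tate representations -/

/-- Kodaira types: `I m` is `I_m`, `Istar j` is `I_j^*`. -/
inductive Kodaira
  | I (m : ℕ) | III | IV | Istar (j : ℕ) | IVstar | IIIstar | IIstar

open Kodaira

/-- The Kodaira type is read off from the orders of vanishing of `f`, `g` and `4f³+27g²`. -/
def Kodaira.HasOrders (a b d : ℕ∞) : Kodaira → Prop
  | I m => if m = 0 then d = 0 else a = 0 ∧ b = 0 ∧ d = m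
  | III => a = 1 ∧ 2 ≤ b ∧ d = 3
  | IV => 2 ≤ a ∧ b = 2 ∧ d = 4
  | Istar j => if j = 0 then 2 ≤ a ∧ 3 ≤ b ∧ d = 6 else a = 2 ∧ b = 3 ∧ d = (6 + j : ℕ)
  | IVstar => 3 ≤ a ∧ b = 4 ∧ d = 8
  | IIIstar => a = 3 ∧ 5 ≤ b ∧ d = 9
  | IIstar => 4 ≤ a ∧ b = 5 ∧ d = 10

/-- Minimal orders of vanishing of `f`, `g` and `4f³+27g²`. -/
def Kodaira.fOrd : Kodaira → ℕ
  | I _ => 0 | III => 1 | IV => 2 | Istar _ => 2 | IVstar => 3 | IIIstar => 3 | IIstar => 4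

def Kodaira.gOrd : Kodaira → ℕ
  | I _ => 0 | III => 2 | IV => 2 | Istar _ => 3 | IVstar => 4 | IIIstar => 5 | IIstar => 5

def Kodaira.discOrd : Kodaira → ℕ
  | I m => m | III => 3 | IV => 4 | Istar j => 6 + j | IVstar => 8 | IIIstar => 9 | IIstar => 10

/-- Types for which a (double) monodromy cover is defined. -/
def Kodaira.HasMonodromyCover : Kodaira → Prop
  | I m => 3 ≤ m | IV => True | Istar j => 1 ≤ j | IVstar => True | _ => False

/-- The gauge algebra: `true` if the monodromy cover is reducible (or if there is none), `false` if
it is irreducible. -/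
@[reducible]
def Kodaira.gauge : Kodaira → Bool → GaugeAlg
  | I m, true => A m
  | I m, false => C (m / 2)
  | III, _ => A 2
  | IV, true => A 3
  | IV, false => C 1
  | Istar j, true => D (j + 4)
  | Istar j, false => B (j + 3)
  | IVstar, true => E6
  | IVstar, false => F4
  | IIIstar, _ => E7
  | IIstar, _ => E8

/-- The covering algebra. -/
abbrev Kodaira.cover (T : Kodaira) : GaugeAlg := T.gauge true

/-- The Coxeter number of the covering algebra. -/
def Kodaira.coxeter : Kodaira → ℕ
  | I m => m | III => 2 | IV => 3 | Istar j => 2 * (j + 4) - 2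
  | IVstar => 12 | IIIstar => 18 | IIstar => 30

/-- Padding by zeros, or truncation. -/
def pad (a b : ℕ) : (Fin a → ℂ) →ₗ[ℂ] (Fin b → ℂ) :=
  LinearMap.pi fun i => if hi : (i : ℕ) < a then LinearMap.proj ⟨i, hi⟩ else 0

/-- `(x₁,…,xₙ) ↦ (x₁,…,xₙ,-xₙ,…,-x₁)`, with a zero in the middle if `m` is odd; `n = [m/2]`. -/
def mirror (m : ℕ) : (Fin (m / 2) → ℂ) →ₗ[ℂ] (Fin m → ℂ) :=
  LinearMap.pi fun i =>
    if hi : (i : ℕ) < m / 2 then LinearMap.proj ⟨i, hi⟩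
    else if hi : (i.rev : ℕ) < m / 2 then -LinearMap.proj ⟨i.rev, hi⟩ else 0

theorem mirror_rev (m : ℕ) (x : Fin (m / 2) → ℂ) (i : Fin m) :
    mirror m x i.rev = -mirror m x i := by
  simp only [mirror, LinearMap.pi_apply, Fin.rev_rev]
  have h1 : (i.rev : ℕ) = m - (i + 1) := Fin.val_rev i
  have h2 : (i : ℕ) < m := i.2
  by_cases ha : (i : ℕ) < m / 2
  · have hb : ¬ (i.rev : ℕ) < m / 2 := by omega
    rw [dif_neg hb, dif_pos ha, dif_pos ha]
    simp
  · by_cases hb : (i.rev : ℕ) < m / 2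
    · rw [dif_pos hb, dif_neg ha, dif_pos hb]
      simp
    · rw [dif_neg hb, dif_neg ha, dif_neg ha, dif_neg hb]
      simp

theorem mirror_mem (m : ℕ) (x : Fin (m / 2) → ℂ) : mirror m x ∈ cartanA m := by
  have h := Equiv.sum_comp Fin.revPerm (mirror m x)
  simp only [Fin.revPerm_apply, mirror_rev, Finset.sum_neg_distrib] at h
  simp only [cartanA, LinearMap.mem_ker, LinearMap.sum_apply, LinearMap.proj_apply]
  linear_combination (-(1 : ℂ) / 2) * h

/-- The inclusion `𝔰𝔭([m/2]) ⊂ 𝔰𝔲(m)`, on Cartan subalgebras. -/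
def foldA (m : ℕ) : Cartan (C (m / 2)) →ₗ[ℂ] Cartan (A m) :=
  LinearMap.codRestrict (Cartan (A m)) ((mirror m).comp (Cartan (C (m / 2))).subtype)
    fun x => mirror_mem m x.1

/-- The inclusion `𝔰𝔬(2j+7) ⊂ 𝔰𝔬(2j+8)`, on Cartan subalgebras. -/
def foldD (j : ℕ) : Cartan (B (j + 3)) →ₗ[ℂ] Cartan (D (j + 4)) :=
  LinearMap.codRestrict (Cartan (D (j + 4)))
    ((pad (j + 3) (j + 4)).comp (Cartan (B (j + 3))).subtype) fun _ => Submodule.mem_top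

/-- The inclusion `F₄ ⊂ E₆`, on Cartan subalgebras. -/
def foldE : Cartan F4 →ₗ[ℂ] Cartan E6 :=
  LinearMap.codRestrict (Cartan E6) ((pad 4 8).comp (Cartan F4).subtype) fun x => by
    simp [Cartan, cartanE6, cartanE7, pad]

/-- The inclusion of the gauge algebra in the covering algebra, on Cartan subalgebras. -/
def foldMap : (T : Kodaira) → (s : Bool) → Cartan (T.gauge s) →ₗ[ℂ] Cartan T.cover
  | _, true => LinearMap.id
  | I m, false => foldA m
  | III, false => LinearMap.id
  | IV, false => foldA 3
  | Istar j, false => foldD j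
  | IVstar, false => foldE
  | IIIstar, false => LinearMap.id
  | IIstar, false => LinearMap.id

/-- `ρ₀`, defined by `adj(covering algebra) = adj(gauge algebra) + ρ₀` for a double cover. -/
def rhoZero (T : Kodaira) : Rep (Cartan (T.gauge false)) :=
  pull (foldMap T false) (adj T.cover) - adj (T.gauge false)

/-- The representation `ρ_√β` (zero where `β` is not defined). -/
def rhoSqrtBeta : (T : Kodaira) → (s : Bool) → Rep (Cartan (T.gauge s))
  | I m, true => if m ≤ 2 then 0 else if m = 3 then fundA m else extA m 2
  | I m, false => if m % 2 = 0 then extIrrC (m / 2) 2 else extIrrC (m / 2) 2 + fundC (m / 2)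
  | IV, true => (3 : ℚ) • fundA 3
  | IV, false => (3 : ℚ) • fundC 1
  | Istar j, true => vectD (j + 4)
  | Istar j, false => vectB (j + 3)
  | IVstar, true => rep27
  | IVstar, false => rep26
  | III, _ => 0
  | IIIstar, _ => 0
  | IIstar, _ => 0

/-- The representation `ρ_γ` (zero where `γ` is not defined, or may not vanish). -/
def rhoGamma : (T : Kodaira) → (s : Bool) → Rep (Cartan (T.gauge s))
  | I m, true => fundA m
  | I m, false => fundC (m / 2)
  | III, _ => (2 : ℚ) • fundA 2
  | Istar 1, true => spinD 5
  | Istar 1, false => spinB 4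
  | Istar 2, true => (1 / 2 : ℚ) • spinD 6
  | Istar 2, false => (1 / 2 : ℚ) • spinB 5
  | Istar 3, true => (1 / 4 : ℚ) • spinD 7 + vectD 7
  | Istar 3, false => (1 / 4 : ℚ) • spinB 6 + vectB 6
  | IIIstar, _ => (1 / 2 : ℚ) • rep56
  | IV, _ => 0
  | Istar _, _ => 0
  | IVstar, _ => 0
  | IIstar, _ => 0

/-! ### Weierstrass families near `z = t = 0` -/

/-- Functions of `t` alone: `ℂ⟦t⟧`. -/
abbrev Base : Type := PowerSeries ℂ

/-- Functions near `z = t = 0`: `ℂ⟦t⟧⟦z⟧`. -/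
abbrev Germ : Type := PowerSeries Base

/-- Meromorphic functions on a curve parametrized by `t`. -/
abbrev Mero : Type := LaurentSeries ℂ

/-- The coordinate `z`. -/
def z : Germ := PowerSeries.X

/-- A function of `t` as a function of `(z, t)`. -/
def lift (a : Base) : Germ := PowerSeries.C a

/-- A function of `t` as a meromorphic function. -/
def mero (a : Base) : Mero := HahnSeries.ofPowerSeries ℤ ℂ a

/-- The restriction of a function to `z = 0`. -/
def atZero (F : Germ) : Base := PowerSeries.constantCoeff F

/-- The family `y² = x³ + u x² + v x + w`. -/
structure Weierstrass where
  u : Germ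
  v : Germ
  w : Germ

namespace Weierstrass

variable (W : Weierstrass)

/-- The coefficient `f` after completing the cube: `y² = x³ + f x + g`. -/
def f : Germ := W.v - (1 / 3 : ℂ) • W.u ^ 2

/-- The coefficient `g` after completing the cube. -/
def g : Germ := (2 / 27 : ℂ) • W.u ^ 3 - (1 / 3 : ℂ) • (W.u * W.v) + W.w

def disc : Germ := 4 * W.f ^ 3 + 27 * W.g ^ 2

end Weierstrass

/-- The local equation `z - φ(t)` of a smooth curve `Σ`. -/
def curve (φ : Base) : Germ := z - lift φ

/-- `a` is the restriction of `F / (z - φ)^k` to the curve `z = φ(t)`. -/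
def RestrictsTo (φ : Base) (k : ℕ) (F : Germ) (a : Base) : Prop :=
  ∃ H : Germ, F = curve φ ^ k * H ∧ curve φ ∣ H - lift a

/-- The Kodaira type along the curve `z = φ(t)`. -/
def HasKodairaType (W : Weierstrass) (φ : Base) (T : Kodaira) : Prop :=
  T.HasOrders (emultiplicity (curve φ) W.f) (emultiplicity (curve φ) W.g)
    (emultiplicity (curve φ) W.disc)

/-- Restriction to the disk `t = c z`. -/
def onDisk (c : ℂ) (F : Germ) : PowerSeries ℂ :=
  PowerSeries.mk fun n => ∑ j ∈ Finset.range (n + 1),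
    PowerSeries.coeff j (PowerSeries.coeff (n - j) F) * c ^ j

/-- The Kodaira type on the disk `t = c z`. -/
def HasTypeOnDisk (W : Weierstrass) (c : ℂ) (T : Kodaira) : Prop :=
  T.HasOrders (emultiplicity PowerSeries.X (onDisk c W.f))
    (emultiplicity PowerSeries.X (onDisk c W.g)) (emultiplicity PowerSeries.X (onDisk c W.disc))

/-- The Kodaira type on a general disk through `z = t = 0`. -/
def HasSpecialType (W : Weierstrass) (T : Kodaira) : Prop :=
  {c : ℂ | ¬ HasTypeOnDisk W c T}.Finite

/-- Weighted homogeneity, for weights `a`, `b`, `d` of `x`, `z`, `t`, of the equation, of weight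
`3 a`. -/
def IsHomogeneous (W : Weierstrass) (a b d : ℕ) : Prop :=
  ∀ i j : ℕ,
    (PowerSeries.coeff j (PowerSeries.coeff i W.u) ≠ 0 → b * i + d * j = a) ∧
    (PowerSeries.coeff j (PowerSeries.coeff i W.v) ≠ 0 → b * i + d * j = 2 * a) ∧
    (PowerSeries.coeff j (PowerSeries.coeff i W.w) ≠ 0 → b * i + d * j = 3 * a)

/-- `β` in terms of the restrictions to `Σ` of `f`, `g` and the discriminant, divided by the minimal
powers of the equation of `Σ`. -/
def betaOf : Kodaira → Mero → Mero → Mero → Option Mero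
  | I m, f, g, _ => if m ≤ 2 then none else some (-9 * g / (2 * f))
  | IV, _, g, _ => some g
  | Istar j, f, g, δ =>
    if j = 0 then none
    else if j % 2 = 1 then some (δ / (-9 * g / (2 * f)) ^ 3)
    else some (-δ / (-9 * g / (2 * f)) ^ 2)
  | IVstar, _, g, _ => some g
  | _, _, _, _ => none

/-- `γ`, likewise. -/
def gammaOf : Kodaira → Mero → Mero → Mero → Option Mero
  | I _, f, g, δ => some (δ / (-9 * g / (2 * f)) ^ 2)
  | III, f, _, _ => some f
  | Istar j, f, g, _ => if j = 0 then none else some (-9 * g / (2 * f))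
  | IIIstar, f, _, _ => some f
  | IIstar, _, g, _ => some g
  | _, _, _, _ => none

/-- `β` and `γ` are the Tate invariants of the family along `z = φ(t)`, of type `T`. -/
def HasTateInvariants (W : Weierstrass) (φ : Base) (T : Kodaira) (β γ : Option Mero) : Prop :=
  ∃ f g δ : Base, RestrictsTo φ T.fOrd W.f f ∧ RestrictsTo φ T.gOrd W.g g ∧
    RestrictsTo φ T.discOrd W.disc δ ∧
    β = betaOf T (mero f) (mero g) (mero δ) ∧ γ = gammaOf T (mero f) (mero g) (mero δ)

/-- The order in `t`, which is zero for an undefined quantity. -/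
def ord : Option Mero → ℤ
  | none => 0
  | some b => HahnSeries.order b

/-- The local contribution at `t = 0` to the Tate cycle `½ div(β) ⊗ ρ_√β + div(γ) ⊗ ρ_γ`. -/
def tateRep (T : Kodaira) (s : Bool) (β γ : Option Mero) : Rep (Cartan (T.gauge s)) :=
  ((ord β : ℚ) / 2) • rhoSqrtBeta T s + (ord γ : ℚ) • rhoGamma T s

/-- The intersection multiplicity at `z = t = 0`. -/
def intersectionMult (φ ψ : Base) : ℕ :=
  Module.finrank ℂ (Germ ⧸ Ideal.span ({curve φ, curve ψ} : Set Germ))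

/-- Apart from the given curves, the discriminant has only components of type `I_1` or `II`. -/
def NoOtherGauge {r : ℕ} (W : Weierstrass) (φ : Fin r → Base) : Prop :=
  ∀ p : Germ, Prime p → p ∣ W.disc →
    (∃ i, Associated p (curve (φ i))) ∨ ¬ p ^ 2 ∣ W.disc ∨ (p ∣ W.f ∧ p ∣ W.g ∧ ¬ p ^ 2 ∣ W.g)

/-! ### Several components -/

/-- A Cartan subalgebra of the direct sum of the gauge algebras. -/
abbrev CartanSum {r : ℕ} (T : Fin r → Kodaira) (s : Fin r → Bool) : Type :=
  (i : Fin r) → Cartan ((T i).gauge (s i))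

/-- A Cartan subalgebra of the direct sum of the covering algebras. -/
abbrev CoverSum {r : ℕ} (T : Fin r → Kodaira) : Type := (i : Fin r) → Cartan (T i).cover

section Sums

variable {r : ℕ} (T : Fin r → Kodaira)

/-- A representation of the `i`-th covering algebra, as a representation of the direct sum. -/
def on (i : Fin r) (χ : Rep (Cartan (T i).cover)) : Rep (CoverSum T) :=
  pull (LinearMap.proj (R := ℂ) (φ := fun i => Cartan (T i).cover) i) χ

/-- The embedding of the Cartan subalgebra sends coroots to coroots, i.e. it comes from an inclusion
of the covering algebras in the algebra of type `T'` as a regular subalgebra, and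
`adj = (sum of the adjoint representations) + ρ + conj ρ + trivial`, the number of trivial summands
being the difference of the ranks. -/
def BranchingRule (T' : Kodaira) (ι : CoverSum T →ₗ[ℂ] Cartan T'.cover)
    (ρ : Rep (CoverSum T)) : Prop :=
  (∀ (i : Fin r) (x : Cartan (T i).cover), IsCoroot x → IsCoroot (ι (Pi.single i x))) ∧
  pull ι (adj T'.cover) = ∑ i, on T i (adj (T i).cover) + ρ + conj ρ +
    ((T'.cover.rank : ℚ) - ∑ i, ((T i).cover.rank : ℚ)) • 1

/-- The matter representation `(1/k) ρ`, restricted to the gauge algebra. (Trivial summands, which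
are to be discarded, do not affect the traces.) -/
def matter (s : Fin r → Bool) (k : ℚ) (ρ : Rep (CoverSum T)) : Rep (CartanSum T s) :=
  k⁻¹ • pull (LinearMap.pi fun i => (foldMap (T i) (s i)).comp
    (LinearMap.proj (R := ℂ) (φ := fun i => Cartan ((T i).gauge (s i))) i)) ρ

/-- Restriction of a representation of the direct sum to the `i`-th summand. -/
def restrictTo (s : Fin r → Bool) (i : Fin r) (ρ : Rep (CartanSum T s)) :
    Rep (Cartan ((T i).gauge (s i))) :=
  pull (LinearMap.single ℂ (fun i => Cartan ((T i).gauge (s i))) i) ρ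

/-- The representation-multiplicity of the `i`-th and `j`-th summand at `ρ` is `n`. For an
irreducible summand `σ ⊗ τ` of the restriction, the left hand side is `Tr_σ(F²) Tr_τ(G²)`, and it is
additive. -/
def HasRepMult (s : Fin r → Bool) (ρ : Rep (CartanSum T s)) (i j : Fin r) (n : ℚ) : Prop :=
  ∀ (F : Cartan ((T i).gauge (s i))) (G : Cartan ((T j).gauge (s j))),
    (ρ.coeff.sum fun w c => (c : ℂ) * (w (Pi.single i F)) ^ 2 * (w (Pi.single j G)) ^ 2) =
      n * normTr _ F * normTr _ G

/-- A choice of gauge algebra for each component that is compatible with the local monodromy: the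
larger algebra needs a reducible monodromy cover, the smaller one is possible whenever there is a
monodromy cover (as the global monodromy may be nontrivial). -/
def IsAdmissible (β : Fin r → Option Mero) (s : Fin r → Bool) : Prop :=
  ∀ i, (s i = false → (T i).HasMonodromyCover) ∧
    (s i = true → (T i).HasMonodromyCover → ∃ b, β i = some b ∧ IsSquare b)

/-- Local anomaly cancellation at `z = t = 0`. -/
def LocalAnomalyCancellation (s : Fin r → Bool) (φ : Fin r → Base) (β γ : Fin r → Option Mero)
    (ρ : Rep (CartanSum T s)) : Prop :=
  (∀ i, CasimirEquiv (restrictTo T s i ρ) (tateRep (T i) (s i) (β i) (γ i))) ∧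
  ∀ i j, i ≠ j → HasRepMult T s ρ i j (intersectionMult (φ i) (φ j))

/-- The family has types `T` and Tate invariants `β`, `γ` along the curves `z = φ i`, and local
anomaly cancellation holds with matter representation `(1/k) ρ`, for every gauge algebra that is
compatible with the local monodromy. -/
def AnomaliesCancel (W : Weierstrass) (φ : Fin r → Base) (β γ : Fin r → Option Mero) (k : ℚ)
    (ρ : Rep (CoverSum T)) : Prop :=
  (∀ i, PowerSeries.constantCoeff (φ i) = 0) ∧
  (∀ i, HasKodairaType W (φ i) (T i)) ∧
  (∀ i, HasTateInvariants W (φ i) (T i) (β i) (γ i)) ∧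
  ∀ s, IsAdmissible T β s → LocalAnomalyCancellation T s φ β γ (matter T s k ρ)

/-- The verification for a weighted homogeneous family `W t`, `Δ t` being its discriminant,
`φ t` the curves `Σ`, `n` the intersection multiplicity of any two of these, `k` the exponent of the
base change `t = s^k` to the versal simultaneous resolution (the weight of `t`, when the equation
has the Coxeter number as its weight), `T'` the type of the special fibre (on the disk `t = 0`, and
on a general disk), `ι` and `ρ` the embedding and the branching rule. It includes the base changes
`t = s^e`, for which `k` is replaced by `k/e`. -/
def Verified (T' : Kodaira) (W : Germ → Weierstrass) (Δ : Germ → Germ)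
    (φ : Base → Fin r → Base) (n : ℕ) (β γ : Mero → Fin r → Option Mero)
    (a b d : ℕ) (k : ℚ) (ι : CoverSum T →ₗ[ℂ] Cartan T'.cover) (ρ : Rep (CoverSum T)) : Prop :=
  HasTypeOnDisk (W (lift PowerSeries.X)) 0 T' ∧ HasSpecialType (W (lift PowerSeries.X)) T' ∧
  IsHomogeneous (W (lift PowerSeries.X)) a b d ∧ k * (3 * a) = T'.coxeter * d ∧
  BranchingRule T T' ι ρ ∧
  ∀ e : ℕ, 1 ≤ e →
    (W (lift (PowerSeries.X ^ e))).disc = Δ (lift (PowerSeries.X ^ e)) ∧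
    NoOtherGauge (W (lift (PowerSeries.X ^ e))) (φ (PowerSeries.X ^ e)) ∧
    (∀ i j, i ≠ j →
      intersectionMult (φ (PowerSeries.X ^ e) i) (φ (PowerSeries.X ^ e) j) = e * n) ∧
    AnomaliesCancel T (W (lift (PowerSeries.X ^ e))) (φ (PowerSeries.X ^ e))
      (β (mero (PowerSeries.X ^ e))) (γ (mero (PowerSeries.X ^ e))) (k / e) ρ

end Sums

/-! ### The embeddings of covering algebras -/

/-- A linear map on the Cartan subalgebra of `𝔰𝔲(m)` is given by the images `c` of the simple coroots
`ε₁-ε₂, ε₂-ε₃, …`. -/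
def chain (m : ℕ) {V : Type} [AddCommGroup V] [Module ℂ V] (c : Fin (m - 1) → V) :
    Cartan (A m) →ₗ[ℂ] V :=
  ∑ l : Fin (m - 1), (∑ i ∈ Finset.filter (fun i : Fin m => (i : ℕ) ≤ (l : ℕ)) Finset.univ,
    (LinearMap.proj i).comp (cartanA m).subtype).smulRight (c l)

/-- The simple coroots of `E₈`: `simple 0, …, simple 7` are `α₁, …, α₈` in Bourbaki's numbering; the
first six (seven) are those of `E₆` (`E₇`). -/
def simple : Fin 8 → Fin 8 → ℂ :=
  ![![1 / 2, -1 / 2, -1 / 2, -1 / 2, -1 / 2, -1 / 2, -1 / 2, 1 / 2],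
    ![1, 1, 0, 0, 0, 0, 0, 0],
    ![-1, 1, 0, 0, 0, 0, 0, 0],
    ![0, -1, 1, 0, 0, 0, 0, 0],
    ![0, 0, -1, 1, 0, 0, 0, 0],
    ![0, 0, 0, -1, 1, 0, 0, 0],
    ![0, 0, 0, 0, -1, 1, 0, 0],
    ![0, 0, 0, 0, 0, -1, 1, 0]]

theorem simple_six_add_seven (l : Fin 8) (hl : (l : ℕ) < 7) : simple l 6 + simple l 7 = 0 := by
  fin_cases l <;> first | (simp at hl; done) | (simp [simple, Matrix.cons_val]; try norm_num)

theorem simple_five_sub_six (l : Fin 8) (hl : (l : ℕ) < 6) : simple l 5 - simple l 6 = 0 := by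
  fin_cases l <;> first | (simp at hl; done) | simp [simple, Matrix.cons_val]

def simpleE6 (l : Fin 6) : Cartan E6 :=
  ⟨simple ⟨l, by omega⟩, LinearMap.mem_ker.mpr
    (simple_six_add_seven ⟨l, by omega⟩ (Nat.lt_succ_of_lt l.2)),
    LinearMap.mem_ker.mpr (simple_five_sub_six ⟨l, by omega⟩ l.2)⟩

def simpleE7 (l : Fin 7) : Cartan E7 :=
  ⟨simple ⟨l, by omega⟩, LinearMap.mem_ker.mpr (simple_six_add_seven ⟨l, by omega⟩ l.2)⟩

def simpleE8 (l : Fin 8) : Cartan E8 := ⟨simple l, Submodule.mem_top⟩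

/-- `ε₇ - ε₈`, a coroot of `E₇`. -/
def coroot78 : Cartan E7 := ⟨![0, 0, 0, 0, 0, 0, 1, -1], by
  simp [Cartan, cartanE7]⟩

theorem pad_mem (m : ℕ) (x : Fin m → ℂ) (hx : x ∈ cartanA m) :
    pad m (m + 1) x ∈ cartanA (m + 1) := by
  simp only [cartanA, LinearMap.mem_ker, LinearMap.sum_apply, LinearMap.proj_apply] at hx ⊢
  rw [Fin.sum_univ_castSucc]
  simp [pad, hx]

/-- `𝔰𝔲(m) ⊂ 𝔰𝔲(m+1)`. -/
def embAA (m : ℕ) : Cartan (A m) →ₗ[ℂ] Cartan (A (m + 1)) :=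
  LinearMap.codRestrict (Cartan (A (m + 1))) ((pad m (m + 1)).comp (Cartan (A m)).subtype)
    fun x => pad_mem m x.1 x.2

/-- `𝔰𝔲(m) ⊂ 𝔰𝔬(2n)`, for `m ≤ n`. -/
def embAD (m n : ℕ) : Cartan (A m) →ₗ[ℂ] Cartan (D n) :=
  LinearMap.codRestrict (Cartan (D n)) ((pad m n).comp (Cartan (A m)).subtype)
    fun _ => Submodule.mem_top

/-- `𝔰𝔬(2m) ⊂ 𝔰𝔬(2n)`, for `m ≤ n`. -/
def embDD (m n : ℕ) : Cartan (D m) →ₗ[ℂ] Cartan (D n) :=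
  LinearMap.codRestrict (Cartan (D n)) ((pad m n).comp (Cartan (D m)).subtype)
    fun _ => Submodule.mem_top

/-- `𝔰𝔬(10) ⊂ E₆`. -/
def embD5E6 : Cartan (D 5) →ₗ[ℂ] Cartan E6 :=
  LinearMap.codRestrict (Cartan E6) ((pad 5 8).comp (Cartan (D 5)).subtype) fun x => by
    simp [Cartan, cartanE6, cartanE7, pad]

/-- `𝔰𝔬(2m) ⊂ 𝔰𝔬(12) ⊂ E₇`, for `m = 5, 6`. -/
def embDE7 (m : ℕ) (hm : m ≤ 6) : Cartan (D m) →ₗ[ℂ] Cartan E7 :=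
  LinearMap.codRestrict (Cartan E7) ((pad m 8).comp (Cartan (D m)).subtype) fun x => by
    have h6 : ¬ (6 : ℕ) < m := by omega
    have h7 : ¬ (7 : ℕ) < m := by omega
    simp [Cartan, cartanE7, pad, h6, h7]

/-- `𝔰𝔬(14) ⊂ E₈`. -/
def embD7E8 : Cartan (D 7) →ₗ[ℂ] Cartan E8 :=
  LinearMap.codRestrict (Cartan E8) ((pad 7 8).comp (Cartan (D 7)).subtype)
    fun _ => Submodule.mem_top

/-- `E₆ ⊂ E₇`. -/
def embE6E7 : Cartan E6 →ₗ[ℂ] Cartan E7 :=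
  LinearMap.codRestrict (Cartan E7) (Cartan E6).subtype fun x => x.2.1

/-- `E₇ ⊂ E₈`. -/
def embE7E8 : Cartan E7 →ₗ[ℂ] Cartan E8 :=
  LinearMap.codRestrict (Cartan E8) (Cartan E7).subtype fun _ => Submodule.mem_top

/-- `E₆ ⊂ E₈`. -/
def embE6E8 : Cartan E6 →ₗ[ℂ] Cartan E8 := embE7E8.comp embE6E7

/-- The two embeddings `A₇ ⊂ E₈`: as the subdiagram `α₁, α₃, α₄, …, α₈`, and through
`𝔰𝔲(8) ⊂ 𝔰𝔬(16) ⊂ E₈`. -/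
def embA7E8 : Cartan (A 8) →ₗ[ℂ] Cartan E8 :=
  chain 8 ![simpleE8 0, simpleE8 2, simpleE8 3, simpleE8 4, simpleE8 5, simpleE8 6, simpleE8 7]

def embA7E8' : Cartan (A 8) →ₗ[ℂ] Cartan E8 :=
  LinearMap.codRestrict (Cartan E8) (Cartan (A 8)).subtype fun _ => Submodule.mem_top

/-- Assembling the embeddings of the covering algebras of the components. -/
def assemble {r : ℕ} {T : Fin r → Kodaira} {T' : Kodaira}
    (ι : (i : Fin r) → Cartan (T i).cover →ₗ[ℂ] Cartan T'.cover) :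
    CoverSum T →ₗ[ℂ] Cartan T'.cover :=
  ∑ i, (ι i).comp (LinearMap.proj (R := ℂ) (φ := fun i => Cartan (T i).cover) i)

/-! ### Families with a single gauge component -/

/-- The case of one component, `Σ` being `z = 0`. -/
def VerifiedOne (T T' : Kodaira) (W : Germ → Weierstrass) (Δ : Germ → Germ)
    (β γ : Mero → Option Mero) (a b d : ℕ) (k : ℚ) (ι : Cartan T.cover →ₗ[ℂ] Cartan T'.cover)
    (ρ : Rep (Cartan T.cover)) : Prop :=
  Verified (fun _ : Fin 1 => T) T' W Δ (fun _ _ => 0) 0 (fun t _ => β t) (fun t _ => γ t) a b d k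
    (assemble fun _ => ι) (on (fun _ : Fin 1 => T) 0 ρ)

/-- The verification for a family `W t` that depends on arbitrary functions, with one component
`z = 0`. The discriminant `Δ t` is given up to `O(z^N)`, and `β t`, `γ t` are functions whose
restrictions to `z = 0` are the Tate invariants. -/
def VerifiedGeneral (T T' : Kodaira) (W : Germ → Weierstrass) (Δ : Germ → Germ) (N : ℕ)
    (β γ : Germ → Germ) (k : ℚ) (ι : Cartan T.cover →ₗ[ℂ] Cartan T'.cover)
    (ρ : Rep (Cartan T.cover)) : Prop :=
  HasSpecialType (W (lift PowerSeries.X)) T' ∧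
  BranchingRule (fun _ : Fin 1 => T) T' (assemble fun _ => ι) (on (fun _ : Fin 1 => T) 0 ρ) ∧
  ∀ e : ℕ, 1 ≤ e →
    z ^ N ∣ (W (lift (PowerSeries.X ^ e))).disc - Δ (lift (PowerSeries.X ^ e)) ∧
    AnomaliesCancel (fun _ : Fin 1 => T) (W (lift (PowerSeries.X ^ e))) (fun _ => 0)
      (fun _ => some (mero (atZero (β (lift (PowerSeries.X ^ e))))))
      (fun _ => some (mero (atZero (γ (lift (PowerSeries.X ^ e)))))) (k / e)
      (on (fun _ : Fin 1 => T) 0 ρ)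

/-! ### Pre-quaternionic representations of `𝔰𝔭(n)` -/

section Quaternionic

variable {n : ℕ}

/-- The weight space of an `𝔰𝔭(n)`-module: the diagonal matrices `diag(x, -x)` act through the
linear form `w`. -/
def weightSpace (V : Type) [AddCommGroup V] [Module ℂ V]
    [LieRingModule (LieAlgebra.Symplectic.sp (Fin n) ℂ) V]
    [LieModule ℂ (LieAlgebra.Symplectic.sp (Fin n) ℂ) V]
    (w : Module.Dual ℂ (Cartan (C n))) : Submodule ℂ V :=
  ⨅ (X : LieAlgebra.Symplectic.sp (Fin n) ℂ) (x : Cartan (C n))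
    (_ : (X : Matrix (Fin n ⊕ Fin n) (Fin n ⊕ Fin n) ℂ) =
      Matrix.fromBlocks (Matrix.diagonal x.1) 0 0 (-Matrix.diagonal x.1)),
    LinearMap.ker (LieModule.toEnd ℂ (LieAlgebra.Symplectic.sp (Fin n) ℂ) V X -
      w x • LinearMap.id)

/-- `χ` is pre-quaternionic: `χ + conj χ` is the character of an actual quaternionic representation,
i.e. of one with an invariant nondegenerate alternating form. -/
def IsPreQuaternionic (χ : Rep (Cartan (C n))) : Prop :=
  ∃ (V : Type) (_ : AddCommGroup V) (_ : Module ℂ V) (_ : FiniteDimensional ℂ V)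
    (_ : LieRingModule (LieAlgebra.Symplectic.sp (Fin n) ℂ) V)
    (_ : LieModule ℂ (LieAlgebra.Symplectic.sp (Fin n) ℂ) V),
    (∀ w, (Module.finrank ℂ (weightSpace V w) : ℚ) = (χ + conj χ).coeff w) ∧
    ∃ B : LinearMap.BilinForm ℂ V, B.IsAlt ∧ B.Nondegenerate ∧
      ∀ (X : LieAlgebra.Symplectic.sp (Fin n) ℂ) (x y : V), B ⁅X, x⁆ y + B x ⁅X, y⁆ = 0

end Quaternionic

end EllipticAnomaly

end

open EllipticAnomaly EllipticAnomaly.GaugeAlg EllipticAnomaly.Kodaira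

namespace EllipticAnomaly

noncomputable section

/-! ### Sums over the weights of a character -/

section Characters

variable {h h' h'' : Type} [AddCommGroup h] [Module ℂ h] [AddCommGroup h'] [Module ℂ h']
  [AddCommGroup h''] [Module ℂ h'']

/-- The sum of a function over the weights of a character. -/
def weightSum (φ : Module.Dual ℂ h → ℂ) : Rep h →ₗ[ℚ] ℂ where
  toFun χ := χ.coeff.sum fun w c => (c : ℂ) * φ w
  map_add' χ χ' := by
    rw [AddMonoidAlgebra.coeff_add, Finsupp.sum_add_index'] <;> intros <;> push_cast <;> ring
  map_smul' a χ := by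
    rw [AddMonoidAlgebra.coeff_smul, Finsupp.sum_smul_index', RingHom.id_apply, Finsupp.smul_sum]
    · refine Finsupp.sum_congr fun w _ => ?_
      simp only [Algebra.smul_def, eq_ratCast, Rat.cast_id]; push_cast; ring
    · intros; simp

theorem weightSum_apply (φ : Module.Dual ℂ h → ℂ) (χ : Rep h) :
    weightSum φ χ = χ.coeff.sum fun w c => (c : ℂ) * φ w := rfl

@[simp]
theorem weightSum_single (φ : Module.Dual ℂ h → ℂ) (w : Module.Dual ℂ h) (c : ℚ) :
    weightSum φ (AddMonoidAlgebra.single w c) = c * φ w := by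
  rw [weightSum_apply, AddMonoidAlgebra.coeff_single, Finsupp.sum_single_index]
  simp

@[simp]
theorem weightSum_one (φ : Module.Dual ℂ h → ℂ) : weightSum φ 1 = φ 0 := by
  rw [AddMonoidAlgebra.one_def, weightSum_single]; simp

theorem Tr_eq_weightSum (k : ℕ) (χ : Rep h) (F : h) : Tr k χ F = weightSum (fun w => w F ^ k) χ :=
  rfl

theorem Tr_add (k : ℕ) (χ χ' : Rep h) (F : h) : Tr k (χ + χ') F = Tr k χ F + Tr k χ' F := by
  simp only [Tr_eq_weightSum, map_add]

theorem Tr_sub (k : ℕ) (χ χ' : Rep h) (F : h) : Tr k (χ - χ') F = Tr k χ F - Tr k χ' F := by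
  simp only [Tr_eq_weightSum, map_sub]

theorem Tr_zero (k : ℕ) (F : h) : Tr k (0 : Rep h) F = 0 := by
  simp only [Tr_eq_weightSum, map_zero]

theorem Tr_smul (k : ℕ) (a : ℚ) (χ : Rep h) (F : h) : Tr k (a • χ) F = a * Tr k χ F := by
  rw [Tr_eq_weightSum, map_smul, Algebra.smul_def, eq_ratCast, Tr_eq_weightSum]

theorem Tr_one {k : ℕ} (hk : k ≠ 0) (F : h) : Tr k (1 : Rep h) F = 0 := by
  simp [Tr_eq_weightSum, hk]

theorem Tr_single (k : ℕ) (w : Module.Dual ℂ h) (F : h) :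
    Tr k (AddMonoidAlgebra.single w 1) F = w F ^ k := by
  simp [Tr_eq_weightSum]

theorem Tr_sum {ι : Type*} (k : ℕ) (s : Finset ι) (χ : ι → Rep h) (F : h) :
    Tr k (∑ i ∈ s, χ i) F = ∑ i ∈ s, Tr k (χ i) F := by
  simp only [Tr_eq_weightSum, map_sum]

/-- Restriction along a linear map, as a ring homomorphism. -/
def pullHom (i : h →ₗ[ℂ] h') : Rep h' →+* Rep h :=
  AddMonoidAlgebra.mapDomainRingHom ℚ (Module.Dual.transpose (R := ℂ) i).toAddMonoidHom

theorem pull_eq (i : h →ₗ[ℂ] h') (χ : Rep h') : pull i χ = pullHom i χ := rfl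

theorem pull_add (i : h →ₗ[ℂ] h') (χ χ' : Rep h') : pull i (χ + χ') = pull i χ + pull i χ' :=
  map_add (pullHom i) χ χ'

theorem pull_sub (i : h →ₗ[ℂ] h') (χ χ' : Rep h') : pull i (χ - χ') = pull i χ - pull i χ' :=
  map_sub (pullHom i) χ χ'

theorem pull_mul (i : h →ₗ[ℂ] h') (χ χ' : Rep h') : pull i (χ * χ') = pull i χ * pull i χ' :=
  map_mul (pullHom i) χ χ'

theorem pull_one (i : h →ₗ[ℂ] h') : pull i (1 : Rep h') = 1 := map_one (pullHom i)

theorem pull_smul (i : h →ₗ[ℂ] h') (a : ℚ) (χ : Rep h') : pull i (a • χ) = a • pull i χ :=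
  map_rat_smul (pullHom i) a χ

theorem pull_sum {ι : Type*} (i : h →ₗ[ℂ] h') (s : Finset ι) (χ : ι → Rep h') :
    pull i (∑ j ∈ s, χ j) = ∑ j ∈ s, pull i (χ j) := map_sum (pullHom i) χ s

@[simp]
theorem pull_single (i : h →ₗ[ℂ] h') (w : Module.Dual ℂ h') (c : ℚ) :
    pull i (AddMonoidAlgebra.single w c) = AddMonoidAlgebra.single (w.comp i) c :=
  AddMonoidAlgebra.mapDomain_single

theorem pull_pull (i : h →ₗ[ℂ] h') (j : h' →ₗ[ℂ] h'') (χ : Rep h'') :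
    pull i (pull j χ) = pull (j.comp i) χ := by
  induction χ using AddMonoidAlgebra.induction_linear with
  | zero => simp [pull_eq]
  | add a b ha hb => simp only [pull_add, ha, hb]
  | single w c => simp [LinearMap.comp_assoc]

theorem weightSum_pull (φ : Module.Dual ℂ h → ℂ) (i : h →ₗ[ℂ] h') (χ : Rep h') :
    weightSum φ (pull i χ) = weightSum (fun w => φ (w.comp i)) χ := by
  induction χ using AddMonoidAlgebra.induction_linear with
  | zero => simp [pull_eq]
  | add a b ha hb => simp only [pull_add, map_add, ha, hb]
  | single w c => simp

theorem Tr_pull (k : ℕ) (i : h →ₗ[ℂ] h') (χ : Rep h') (F : h) :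
    Tr k (pull i χ) F = Tr k χ (i F) := by
  simp [Tr_eq_weightSum, weightSum_pull]

/-- Complex conjugation, as a ring homomorphism. -/
def conjHom : Rep h →+* Rep h :=
  AddMonoidAlgebra.mapDomainRingHom ℚ (negAddMonoidHom : Module.Dual ℂ h →+ Module.Dual ℂ h)

theorem conj_eq (χ : Rep h) : conj χ = conjHom χ := rfl

theorem conj_add (χ χ' : Rep h) : conj (χ + χ') = conj χ + conj χ' := map_add conjHom χ χ'

theorem conj_sub (χ χ' : Rep h) : conj (χ - χ') = conj χ - conj χ' := map_sub conjHom χ χ'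

theorem conj_mul (χ χ' : Rep h) : conj (χ * χ') = conj χ * conj χ' := map_mul conjHom χ χ'

theorem conj_one : conj (1 : Rep h) = 1 := map_one conjHom

theorem conj_smul (a : ℚ) (χ : Rep h) : conj (a • χ) = a • conj χ := map_rat_smul conjHom a χ

theorem conj_sum {ι : Type*} (s : Finset ι) (χ : ι → Rep h) :
    conj (∑ j ∈ s, χ j) = ∑ j ∈ s, conj (χ j) := map_sum conjHom χ s

@[simp]
theorem conj_single (w : Module.Dual ℂ h) (c : ℚ) :
    conj (AddMonoidAlgebra.single w c) = AddMonoidAlgebra.single (-w) c :=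
  AddMonoidAlgebra.mapDomain_single

theorem pull_conj (i : h →ₗ[ℂ] h') (χ : Rep h') : pull i (conj χ) = conj (pull i χ) := by
  induction χ using AddMonoidAlgebra.induction_linear with
  | zero => simp [pull_eq, conj_eq]
  | add a b ha hb => simp only [pull_add, conj_add, ha, hb]
  | single w c => simp [LinearMap.neg_comp]

theorem weightSum_eq_sum {φ ψ : Module.Dual ℂ h → ℂ} (H : ∀ w, φ w = ψ w) (χ : Rep h) :
    weightSum φ χ = weightSum ψ χ := by
  rw [show φ = ψ from funext H]

end Characters

/-! ### Linear forms and weights in coordinates -/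

theorem wt_apply (g : GaugeAlg) (v : Fin g.N → ℚ) (F : Cartan g) :
    wt g v F = ∑ i, (v i : ℂ) * (F : Fin g.N → ℂ) i := by
  simp [wt, LinearMap.sum_apply]

theorem wt_add (g : GaugeAlg) (v v' : Fin g.N → ℚ) : wt g (v + v') = wt g v + wt g v' := by
  ext F; simp [wt_apply, add_mul, Finset.sum_add_distrib]

theorem wt_neg (g : GaugeAlg) (v : Fin g.N → ℚ) : wt g (-v) = -wt g v := by
  ext F; simp [wt_apply]

theorem wt_sub (g : GaugeAlg) (v v' : Fin g.N → ℚ) : wt g (v - v') = wt g v - wt g v' := by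
  rw [sub_eq_add_neg, wt_add, wt_neg, sub_eq_add_neg]

theorem wt_zero (g : GaugeAlg) : wt g 0 = 0 := by
  ext F; simp [wt_apply]

theorem wt_sum (g : GaugeAlg) {ι : Type*} (s : Finset ι) (v : ι → Fin g.N → ℚ) :
    wt g (∑ j ∈ s, v j) = ∑ j ∈ s, wt g (v j) := by
  classical
  induction s using Finset.induction_on with
  | empty => simp [wt_zero]
  | insert a s ha ih => rw [Finset.sum_insert ha, Finset.sum_insert ha, wt_add, ih]

theorem ε_apply {n : ℕ} (i j : Fin n) : (ε i : Fin n → ℚ) j = if j = i then 1 else 0 := by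
  simp [ε, Pi.single_apply]

theorem wt_ε_apply (g : GaugeAlg) (i : Fin g.N) (F : Cartan g) :
    wt g (ε i) F = (F : Fin g.N → ℂ) i := by
  simp only [wt_apply, ε_apply]
  rw [Finset.sum_eq_single i] <;> simp +contextual

end

end EllipticAnomaly

namespace EllipticAnomaly

/-! ### Lists of half-integral weights -/

/-- The dot product of the first `n` entries. -/
def dotL (n : ℕ) (l c : List ℤ) : ℤ := ((List.range n).map fun j => l.getD j 0 * c.getD j 0).sum

/-- The values of a weight on a list of vectors. -/
def labels (n : ℕ) (cs : List (List ℤ)) (l : List ℤ) : List ℤ := cs.map (dotL n l)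

def addLabels : List ℤ → List ℤ → List ℤ
  | a :: l, b :: l' => (a + b) :: addLabels l l'
  | l, [] => l
  | [], l' => l'

/-- All sums of a label of the first and a label of the second list. -/
def tensorLabels (L L' : List (List ℤ)) : List (List ℤ) := L.flatMap fun l => L'.map (addLabels l)

def negLabels (L : List (List ℤ)) : List (List ℤ) := L.map fun l => l.map Neg.neg

/-- The vector with entries `a` and `b` at `i` and `j`. -/
def pairL (n : ℕ) (i j : Fin n) (a b : ℤ) : List ℤ :=
  List.ofFn fun k => (if k = i then a else 0) + if k = j then b else 0

def rootsAL (n : ℕ) : List (List ℤ) :=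
  (List.finRange n).flatMap fun i => ((List.finRange n).filter fun j => i ≠ j).map fun j =>
    pairL n i j 2 (-2)

def rootsDL (n : ℕ) : List (List ℤ) :=
  rootsAL n ++ (List.finRange n).flatMap fun i =>
    ((List.finRange n).filter fun j => i < j).flatMap fun j =>
      [pairL n i j 2 2, pairL n i j (-2) (-2)]

def axisL (n : ℕ) : List (List ℤ) :=
  (List.finRange n).flatMap fun i => [pairL n i i 2 0, pairL n i i (-2) 0]

/-- The spin vectors, with an even number of minus signs if `b` is `true`, and an odd number
otherwise. -/
def spinL : ℕ → Bool → List (List ℤ)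
  | 0, true => [[]]
  | 0, false => []
  | n + 1, b => (spinL n b).map (List.cons 1) ++ (spinL n (!b)).map (List.cons (-1))

def extL : ℕ → ℕ → List (List ℤ)
  | _, 0 => [[]]
  | 0, _ + 1 => []
  | m + 1, k + 1 => (extL m k).map (List.cons 2) ++ (extL m (k + 1)).map (List.cons 0)

def rootsE8L : List (List ℤ) := rootsDL 8 ++ spinL 8 true

def rootsE7L : List (List ℤ) := rootsE8L.filter fun l => l.getD 6 0 + l.getD 7 0 = 0

def rootsE6L : List (List ℤ) :=
  rootsE8L.filter fun l => l.getD 6 0 + l.getD 7 0 = 0 ∧ l.getD 5 0 - l.getD 6 0 = 0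

def rep27L : List (List ℤ) :=
  rootsE8L.filter fun l => l.getD 6 0 + l.getD 7 0 = 0 ∧ l.getD 5 0 - l.getD 6 0 = 2

def rep56L : List (List ℤ) := rootsE8L.filter fun l => l.getD 6 0 + l.getD 7 0 = 2

/-- Twice the coordinates of the image of a vector, for a map given by linear forms and vectors. -/
def imageL (n n' : ℕ) (rows ds : List (List ℤ)) (l : List ℤ) : List ℤ :=
  (List.range n').map fun j => (List.zipWith (fun r d => dotL n r l * d.getD j 0) rows ds).sum

noncomputable section

/-- The vector with twice the coordinates in the list. -/
def ofList (n : ℕ) (l : List ℤ) : Fin n → ℚ := fun i => (l.getD i 0 : ℚ) / 2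

theorem ofList_pairL {n : ℕ} (i j : Fin n) (a b : ℤ) :
    ofList n (pairL n i j a b) = ((a : ℚ) / 2) • ε i + ((b : ℚ) / 2) • ε j := by
  ext k
  have : (pairL n i j a b).getD k 0 = (if k = i then a else 0) + if k = j then b else 0 := by
    simp [pairL]
  simp only [ofList, this, Pi.add_apply, Pi.smul_apply, ε_apply, smul_eq_mul]
  split_ifs <;> push_cast <;> ring

/-- The vectors in the finite set are those given by the list. -/
def Enumerates {n : ℕ} (L : List (List ℤ)) (s : Finset (Fin n → ℚ)) : Prop :=
  ∀ v, v ∈ s ↔ ∃ l ∈ L, ofList n l = v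

theorem Enumerates.union {n : ℕ} {L L' : List (List ℤ)} {s s' : Finset (Fin n → ℚ)}
    (h : Enumerates L s) (h' : Enumerates L' s') : Enumerates (L ++ L') (s ∪ s') := by
  intro v
  rw [Finset.mem_union, h v, h' v]
  simp only [List.mem_append, or_and_right, exists_or]

theorem Enumerates.filter {n : ℕ} {L : List (List ℤ)} {s : Finset (Fin n → ℚ)}
    (h : Enumerates L s) (p : (Fin n → ℚ) → Prop) [DecidablePred p] (q : List ℤ → Prop)
    [DecidablePred q] (hpq : ∀ l, p (ofList n l) ↔ q l) :
    Enumerates (L.filter fun l => q l) (s.filter p) := by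
  intro v
  simp only [Finset.mem_filter, h v, List.mem_filter, decide_eq_true_eq]
  constructor
  · rintro ⟨⟨l, hl, rfl⟩, hv⟩; exact ⟨l, ⟨hl, (hpq l).1 hv⟩, rfl⟩
  · rintro ⟨l, ⟨hl, hq⟩, rfl⟩; exact ⟨⟨l, hl, rfl⟩, (hpq l).2 hq⟩

theorem enumerates_rootsA (n : ℕ) : Enumerates (rootsAL n) (rootsA n) := by
  intro v
  simp only [rootsA, rootsAL, Finset.mem_image, Finset.mem_offDiag, Finset.mem_univ, true_and,
    List.mem_flatMap, List.mem_map, List.mem_filter, List.mem_finRange, decide_eq_true_eq,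
    Prod.exists]
  constructor
  · rintro ⟨i, j, hij, rfl⟩
    refine ⟨_, ⟨i, j, hij, rfl⟩, ?_⟩
    rw [ofList_pairL]; norm_num; abel
  · rintro ⟨_, ⟨i, j, hij, rfl⟩, rfl⟩
    refine ⟨i, j, hij, ?_⟩
    rw [ofList_pairL]; norm_num; abel

theorem enumerates_rootsD (n : ℕ) : Enumerates (rootsDL n) (rootsD n) := by
  rw [rootsD, Finset.union_assoc]
  refine (enumerates_rootsA n).union fun v => ?_
  simp only [Finset.mem_union, Finset.mem_image, Finset.mem_offDiag, Finset.mem_univ, true_and,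
    List.mem_flatMap, List.mem_filter, List.mem_finRange, decide_eq_true_eq,
    Prod.exists, List.mem_cons, List.not_mem_nil, or_false]
  constructor
  · rintro (⟨i, j, hij, rfl⟩ | ⟨i, j, hij, rfl⟩)
    · rcases lt_or_gt_of_ne hij with h | h
      · exact ⟨_, ⟨i, j, h, .inl rfl⟩, by rw [ofList_pairL]; norm_num⟩
      · exact ⟨_, ⟨j, i, h, .inl rfl⟩, by rw [ofList_pairL]; norm_num; abel⟩
    · rcases lt_or_gt_of_ne hij with h | h
      · exact ⟨_, ⟨i, j, h, .inr rfl⟩, by rw [ofList_pairL]; norm_num; abel⟩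
      · exact ⟨_, ⟨j, i, h, .inr rfl⟩, by rw [ofList_pairL]; norm_num; abel⟩
  · rintro ⟨_, ⟨i, j, hij, rfl | rfl⟩, rfl⟩
    · exact .inl ⟨i, j, hij.ne, by rw [ofList_pairL]; norm_num⟩
    · exact .inr ⟨i, j, hij.ne, by rw [ofList_pairL]; norm_num; abel⟩

theorem enumerates_axis (n : ℕ) : Enumerates (axisL n) (axisVectors n 1) := by
  intro v
  simp only [axisVectors, axisL, Finset.mem_union, Finset.mem_image, Finset.mem_univ, true_and,
    List.mem_flatMap, List.mem_finRange, List.mem_cons, List.not_mem_nil, or_false]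
  constructor
  · rintro (⟨i, rfl⟩ | ⟨i, rfl⟩)
    · exact ⟨_, ⟨i, .inl rfl⟩, by rw [ofList_pairL]; norm_num⟩
    · exact ⟨_, ⟨i, .inr rfl⟩, by rw [ofList_pairL]; norm_num⟩
  · rintro ⟨_, ⟨i, rfl | rfl⟩, rfl⟩
    · exact .inl ⟨i, by rw [ofList_pairL]; norm_num⟩
    · exact .inr ⟨i, by rw [ofList_pairL]; norm_num⟩

theorem mem_spinL (n : ℕ) (p : Bool) (l : List ℤ) : l ∈ spinL n p ↔
    ∃ b : Fin n → Bool, (Even (Finset.univ.filter fun i => b i = true).card ↔ p = true) ∧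
      l = List.ofFn fun i => if b i then -1 else 1 := by
  induction n generalizing p l with
  | zero => cases p <;> simp [spinL]
  | succ n ih =>
    have key (c : Bool) (b : Fin n → Bool) :
        (Finset.univ.filter fun i => (Fin.cons c b : Fin (n + 1) → Bool) i = true).card =
          (if c then 1 else 0) + (Finset.univ.filter fun i => b i = true).card := by
      rw [Finset.card_filter, Fin.sum_univ_succ, Finset.card_filter]
      simp
    simp only [spinL, List.mem_append, List.mem_map, ih]
    constructor
    · rintro (⟨_, ⟨b, hb, rfl⟩, rfl⟩ | ⟨_, ⟨b, hb, rfl⟩, rfl⟩)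
      · refine ⟨Fin.cons false b, ?_, ?_⟩
        · rw [key]; simpa using hb
        · simp [List.ofFn_succ]
      · refine ⟨Fin.cons true b, ?_, ?_⟩
        · rw [key, add_comm]; cases p <;> simp_all [Nat.even_add_one]
        · simp [List.ofFn_succ]
    · rintro ⟨b, hb, rfl⟩
      obtain ⟨c, b, rfl⟩ : ∃ c b', b = Fin.cons c b' := ⟨b 0, Fin.tail b, (Fin.cons_self_tail b).symm⟩
      rw [key] at hb
      cases c
      · exact .inl ⟨_, ⟨b, by simpa using hb, rfl⟩, by simp [List.ofFn_succ]⟩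
      · refine .inr ⟨_, ⟨b, ?_, rfl⟩, by simp [List.ofFn_succ]⟩
        rw [add_comm] at hb; cases p <;> simp_all [Nat.even_add_one]

theorem ofList_spin {n : ℕ} (b : Fin n → Bool) :
    ofList n (List.ofFn fun i => if b i then -1 else 1) = spinVector b := by
  ext i
  simp only [ofList, spinVector]
  rw [List.getD_eq_getElem _ _ (by simp)]
  simp only [List.getElem_ofFn, Fin.eta]
  split_ifs <;> simp

theorem enumerates_evenSpin (n : ℕ) : Enumerates (spinL n true) (evenSpinVectors n) := by
  intro v
  simp only [evenSpinVectors, Finset.mem_image, Finset.mem_filter, Finset.mem_univ, true_and,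
    mem_spinL, iff_true]
  constructor
  · rintro ⟨b, hb, rfl⟩; exact ⟨_, ⟨b, hb, rfl⟩, ofList_spin b⟩
  · rintro ⟨_, ⟨b, hb, rfl⟩, rfl⟩; exact ⟨b, hb, (ofList_spin b).symm⟩

theorem spinVector_injective (n : ℕ) : Function.Injective (spinVector (n := n)) := by
  intro b b' h
  ext i
  have := congrFun h i
  simp only [spinVector] at this
  cases hb : b i <;> cases hb' : b' i <;> simp [hb, hb'] at this ⊢ <;> norm_num at this

theorem enumerates_oddSpin (n : ℕ) :
    Enumerates (spinL n false) (spinVectors n \ evenSpinVectors n) := by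
  intro v
  simp only [spinVectors, evenSpinVectors, Finset.mem_sdiff, Finset.mem_image, Finset.mem_filter,
    Finset.mem_univ, true_and, mem_spinL]
  constructor
  · rintro ⟨⟨b, rfl⟩, hb⟩
    exact ⟨_, ⟨b, by simpa using fun h => hb ⟨b, h, rfl⟩, rfl⟩, ofList_spin b⟩
  · rintro ⟨_, ⟨b, hb, rfl⟩, rfl⟩
    refine ⟨⟨b, (ofList_spin b).symm⟩, ?_⟩
    rintro ⟨b', hb', h⟩
    rw [ofList_spin] at h
    rw [spinVector_injective n h] at hb'
    simp [hb'] at hb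

theorem enumerates_spin (n : ℕ) :
    Enumerates (spinL n true ++ spinL n false) (spinVectors n) := by
  have : spinVectors n = evenSpinVectors n ∪ (spinVectors n \ evenSpinVectors n) := by
    refine (Finset.union_sdiff_of_subset ?_).symm
    intro v
    simp only [evenSpinVectors, spinVectors, Finset.mem_image, Finset.mem_filter]
    rintro ⟨b, -, rfl⟩; exact ⟨b, Finset.mem_univ _, rfl⟩
  rw [this]
  exact (enumerates_evenSpin n).union (enumerates_oddSpin n)

theorem enumerates_rootsE8 : Enumerates rootsE8L rootsE8 :=
  (enumerates_rootsD 8).union (enumerates_evenSpin 8)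

theorem ofList_dot_vecA1 (l : List ℤ) :
    ofList 8 l ⬝ᵥ vecA1 = ((l.getD 6 0 + l.getD 7 0 : ℤ) : ℚ) / 2 := by
  simp [vecA1, ε, ofList, dotProduct_add]; ring

theorem ofList_dot_vecA2 (l : List ℤ) :
    ofList 8 l ⬝ᵥ vecA2 = ((l.getD 5 0 - l.getD 6 0 : ℤ) : ℚ) / 2 := by
  simp [vecA2, ε, ofList, dotProduct_sub]; ring

theorem half_eq_zero_iff (a : ℤ) : (a : ℚ) / 2 = 0 ↔ a = 0 := by simp

theorem half_eq_one_iff (a : ℤ) : (a : ℚ) / 2 = 1 ↔ a = 2 := by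
  rw [div_eq_one_iff_eq two_ne_zero]; exact_mod_cast Iff.rfl

theorem enumerates_rootsE7 : Enumerates rootsE7L (GaugeAlg.roots E7) :=
  enumerates_rootsE8.filter _ _ fun l => by rw [ofList_dot_vecA1, half_eq_zero_iff]

theorem enumerates_rep56 : Enumerates rep56L (rootsE8.filter fun α => α ⬝ᵥ vecA1 = 1) :=
  enumerates_rootsE8.filter _ _ fun l => by rw [ofList_dot_vecA1, half_eq_one_iff]

theorem enumerates_rootsE6 : Enumerates rootsE6L (GaugeAlg.roots E6) :=
  enumerates_rootsE8.filter _ _ fun l => by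
    rw [ofList_dot_vecA1, ofList_dot_vecA2, half_eq_zero_iff, half_eq_zero_iff]

theorem enumerates_rep27 :
    Enumerates rep27L (rootsE8.filter fun α => α ⬝ᵥ vecA1 = 0 ∧ α ⬝ᵥ vecA2 = 1) :=
  enumerates_rootsE8.filter _ _ fun l => by
    rw [ofList_dot_vecA1, ofList_dot_vecA2, half_eq_zero_iff, half_eq_one_iff]

theorem ofList_injOn {n : ℕ} {l l' : List ℤ} (hl : l.length = n) (hl' : l'.length = n)
    (h : ofList n l = ofList n l') : l = l' := by
  refine List.ext_getElem (hl.trans hl'.symm) fun i hi hi' => ?_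
  have := congrFun h ⟨i, hl ▸ hi⟩
  simp only [ofList] at this
  rw [List.getD_eq_getElem _ _ hi, List.getD_eq_getElem _ _ hi'] at this
  have h2 : ((l[i] : ℤ) : ℚ) = (l'[i] : ℤ) := by linarith
  exact_mod_cast h2

/-- The list consists of distinct vectors with `n` entries. -/
def IsSimpleList (n : ℕ) (L : List (List ℤ)) : Prop := L.Nodup ∧ ∀ l ∈ L, l.length = n

instance (n : ℕ) (L : List (List ℤ)) : Decidable (IsSimpleList n L) :=
  inferInstanceAs (Decidable (_ ∧ _))

/-- The character whose weights are given by a list. -/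
def charL (g : GaugeAlg) (L : List (List ℤ)) : Rep (Cartan g) :=
  (L.map fun l => AddMonoidAlgebra.single (wt g (ofList g.N l)) 1).sum

theorem Enumerates.sum_eq {n : ℕ} {L : List (List ℤ)} {s : Finset (Fin n → ℚ)}
    (h : Enumerates L s) (hL : IsSimpleList n L) {M : Type*} [AddCommMonoid M]
    (f : (Fin n → ℚ) → M) : ∑ v ∈ s, f v = (L.map fun l => f (ofList n l)).sum := by
  classical
  have hnd : (L.map (ofList n)).Nodup :=
    hL.1.map_on fun l hl l' hl' h => ofList_injOn (hL.2 l hl) (hL.2 l' hl') h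
  have hs : s = (L.map (ofList n)).toFinset := by
    ext v; rw [h v]; simp
  rw [hs, List.sum_toFinset _ hnd, List.map_map]; rfl

theorem Enumerates.ofWeights_eq {g : GaugeAlg} {L : List (List ℤ)} {s : Finset (Fin g.N → ℚ)}
    (h : Enumerates L s) (hL : IsSimpleList g.N L) : ofWeights g s = charL g L :=
  h.sum_eq hL _

theorem charL_append (g : GaugeAlg) (L L' : List (List ℤ)) :
    charL g (L ++ L') = charL g L + charL g L' := by
  simp [charL]

theorem ofList_cons_zero (m : ℕ) (a : ℤ) (l : List ℤ) :
    ofList (m + 1) (a :: l) = Fin.cons ((a : ℚ) / 2) (ofList m l) := by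
  ext i
  refine Fin.cases ?_ (fun j => ?_) i <;> simp [ofList]

theorem sum_powersetCard_fin_succ {M : Type*} [AddCommMonoid M] (m k : ℕ)
    (f : Finset (Fin (m + 1)) → M) :
    ∑ s ∈ (Finset.univ : Finset (Fin (m + 1))).powersetCard (k + 1), f s =
      ∑ s ∈ (Finset.univ : Finset (Fin m)).powersetCard k,
        f (insert 0 (s.map (Fin.succEmb m))) +
      ∑ s ∈ (Finset.univ : Finset (Fin m)).powersetCard (k + 1), f (s.map (Fin.succEmb m)) := by
  classical
  have h0 (s : Finset (Fin m)) : (0 : Fin (m + 1)) ∉ s.map (Fin.succEmb m) := by simp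
  have hu : (Finset.univ : Finset (Fin (m + 1))) =
      insert 0 ((Finset.univ : Finset (Fin m)).map (Fin.succEmb m)) := by
    rw [Fin.univ_succ, Finset.cons_eq_insert]; rfl
  rw [hu, Finset.powersetCard_succ_insert (h0 _), Finset.sum_union, add_comm, Finset.sum_image]
  · simp only [Finset.powersetCard_map, Finset.sum_map]
    rfl
  · intro s hs s' hs' h
    have hs0 : (0 : Fin (m + 1)) ∉ s := fun h0' => by
      simpa using (Finset.mem_powersetCard.1 hs).1 h0'
    have hs0' : (0 : Fin (m + 1)) ∉ s' := fun h0' => by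
      simpa using (Finset.mem_powersetCard.1 hs').1 h0'
    rw [← Finset.erase_insert hs0, h, Finset.erase_insert hs0']
  · rw [Finset.disjoint_left]
    rintro s hs hs'
    obtain ⟨s', -, rfl⟩ := Finset.mem_image.1 hs'
    simpa using (Finset.mem_powersetCard.1 hs).1 (Finset.mem_insert_self 0 s')

theorem sum_map_succ_ε {m : ℕ} (s : Finset (Fin m)) :
    ∑ i ∈ s.map (Fin.succEmb m), (ε i : Fin (m + 1) → ℚ) = Fin.cons 0 (∑ i ∈ s, ε i) := by
  ext i
  rw [Finset.sum_apply, Finset.sum_map]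
  refine Fin.cases ?_ (fun j => ?_) i
  · simp [ε_apply, Fin.succ_ne_zero, eq_comm]
  · simp [ε_apply, Finset.sum_apply]

theorem sum_powersetCard_eq_extL {M : Type*} [AddCommMonoid M] (m k : ℕ) (f : (Fin m → ℚ) → M) :
    ∑ s ∈ (Finset.univ : Finset (Fin m)).powersetCard k, f (∑ i ∈ s, ε i) =
      ((extL m k).map fun l => f (ofList m l)).sum := by
  induction m generalizing k with
  | zero =>
    cases k with
    | zero => simp [extL]; congr 1; exact Subsingleton.elim _ _
    | succ k =>
      rw [Finset.powersetCard_eq_empty.2 (by simp)]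
      simp [extL]
  | succ m ih =>
    cases k with
    | zero =>
      simp only [Finset.powersetCard_zero, Finset.sum_singleton, Finset.sum_empty, extL,
        List.map_cons, List.map_nil, List.sum_cons, List.sum_nil, add_zero]
      congr 1; ext i; simp [ofList]
    | succ k =>
      rw [sum_powersetCard_fin_succ]
      have h1 (s : Finset (Fin m)) :
          ∑ i ∈ insert 0 (s.map (Fin.succEmb m)), (ε i : Fin (m + 1) → ℚ) =
            Fin.cons 1 (∑ i ∈ s, ε i) := by
        rw [Finset.sum_insert (by simp), sum_map_succ_ε]
        ext i
        refine Fin.cases ?_ (fun j => ?_) i <;> simp [ε_apply, Fin.succ_ne_zero]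
      simp only [h1, sum_map_succ_ε]
      rw [ih k fun v => f (Fin.cons 1 v), ih (k + 1) fun v => f (Fin.cons 0 v)]
      simp [extL, Function.comp_def, ofList_cons_zero]

theorem extA_eq_charL (m k : ℕ) : extA m k = charL (A m) (extL m k) :=
  sum_powersetCard_eq_extL m k fun v => AddMonoidAlgebra.single (wt (A m) v) 1

end

end EllipticAnomaly

namespace EllipticAnomaly

/-! ### Branching rules from lists of labels -/

/-- The labels of the `i`-th summand, from those of the summands. -/
def blockLabels {r : ℕ} (cs : Fin r → List (List ℤ)) (i : Fin r) : List (List ℤ) :=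
  (List.finRange r).flatMap fun j => if j = i then cs j else (cs j).map fun _ => []

noncomputable section

section Frames

variable {h : Type} [AddCommGroup h] [Module ℂ h]

/-- The linear form with four times the coefficients in the list. -/
def quarterForm (ys : List (Module.Dual ℂ h)) (l : List ℤ) : Module.Dual ℂ h :=
  (List.zipWith (fun y (a : ℤ) => ((a : ℂ) / 4) • y) ys l).sum

/-- The `j`-th coordinate of the combination of the vectors `d / 2`, for `d` in the list. -/
def frameVal (ys : List (Module.Dual ℂ h)) (ds : List (List ℤ)) (x : h) (j : ℕ) : ℂ :=
  (List.zipWith (fun y (d : List ℤ) => y x * ((d.getD j 0 : ℂ) / 2)) ys ds).sum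

/-- The character whose weights have the given labels. -/
def labelChar (ys : List (Module.Dual ℂ h)) (L : List (List ℤ)) : Rep h :=
  (L.map fun l => AddMonoidAlgebra.single (quarterForm ys l) 1).sum

theorem quarterForm_addLabels (ys : List (Module.Dual ℂ h)) (l l' : List ℤ) :
    quarterForm ys (addLabels l l') = quarterForm ys l + quarterForm ys l' := by
  induction ys generalizing l l' with
  | nil => simp [quarterForm]
  | cons y ys ih =>
    cases l with
    | nil => cases l' <;> simp [quarterForm, addLabels]
    | cons a l =>
      cases l' with
      | nil => simp [quarterForm, addLabels]
      | cons b l' =>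
        have := ih l l'
        simp only [quarterForm] at this
        simp only [quarterForm, addLabels, List.zipWith_cons_cons, List.sum_cons, this]
        push_cast; module

theorem quarterForm_neg (ys : List (Module.Dual ℂ h)) (l : List ℤ) :
    quarterForm ys (l.map Neg.neg) = -quarterForm ys l := by
  induction ys generalizing l with
  | nil => simp [quarterForm]
  | cons y ys ih =>
    cases l with
    | nil => simp [quarterForm]
    | cons a l =>
      have := ih l
      simp only [quarterForm] at this
      simp only [quarterForm, List.map_cons, List.zipWith_cons_cons, List.sum_cons, this]
      push_cast; module

theorem labelChar_append (ys : List (Module.Dual ℂ h)) (L L' : List (List ℤ)) :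
    labelChar ys (L ++ L') = labelChar ys L + labelChar ys L' := by
  simp [labelChar]

theorem labelChar_perm (ys : List (Module.Dual ℂ h)) {L L' : List (List ℤ)} (hp : L.Perm L') :
    labelChar ys L = labelChar ys L' :=
  (hp.map _).sum_eq

theorem labelChar_flatMap {ι : Type*} (ys : List (Module.Dual ℂ h)) (s : List ι)
    (L : ι → List (List ℤ)) :
    labelChar ys (s.flatMap L) = (s.map fun i => labelChar ys (L i)).sum := by
  induction s with
  | nil => simp [labelChar]
  | cons a s ih => simp [labelChar_append, ih]

theorem conj_labelChar (ys : List (Module.Dual ℂ h)) (L : List (List ℤ)) :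
    conj (labelChar ys L) = labelChar ys (negLabels L) := by
  induction L with
  | nil => simp [labelChar, negLabels, conj_eq]
  | cons a L ih =>
    simp only [labelChar, negLabels] at ih
    simp only [labelChar, negLabels, List.map_cons, List.sum_cons, conj_add, ih, conj_single,
      quarterForm_neg]

theorem labelChar_tensorLabels (ys : List (Module.Dual ℂ h)) (L L' : List (List ℤ)) :
    labelChar ys (tensorLabels L L') = labelChar ys L * labelChar ys L' := by
  rw [tensorLabels, labelChar_flatMap]
  conv_rhs => rw [labelChar, ← List.sum_map_mul_right]
  congr 1
  refine List.map_congr_left fun l _ => ?_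
  rw [labelChar, labelChar, List.map_map, ← List.sum_map_mul_left]
  congr 1
  refine List.map_congr_left fun l' _ => ?_
  simp [quarterForm_addLabels]

theorem cast_dotL (n : ℕ) (l d : List ℤ) :
    (dotL n l d : ℂ) = ∑ j : Fin n, (l.getD j 0 : ℂ) * (d.getD j 0 : ℂ) := by
  have : dotL n l d = ∑ j : Fin n, l.getD j 0 * d.getD j 0 := by
    rw [dotL, Fin.sum_univ_eq_sum_range (fun j => l.getD j 0 * d.getD j 0)]
    induction n with
    | zero => rfl
    | succ n ih => rw [List.range_succ, List.map_append, List.sum_append, ih,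
        Finset.sum_range_succ]; simp
  rw [this]; push_cast; rfl

theorem sum_mul_frameVal (n : ℕ) (l : List ℤ) (ys : List (Module.Dual ℂ h)) (ds : List (List ℤ))
    (x : h) : ∑ j : Fin n, ((l.getD j 0 : ℂ) / 2) * frameVal ys ds x j =
      quarterForm ys (labels n ds l) x := by
  induction ys generalizing ds with
  | nil => simp [frameVal, quarterForm]
  | cons y ys ih =>
    cases ds with
    | nil => simp [frameVal, quarterForm, labels]
    | cons d ds =>
      have := ih ds
      simp only [frameVal, quarterForm, labels] at this
      simp only [frameVal, quarterForm, labels, List.zipWith_cons_cons, List.map_cons,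
        List.sum_cons, mul_add, Finset.sum_add_distrib, this, LinearMap.add_apply,
        LinearMap.smul_apply, smul_eq_mul, cast_dotL, Finset.sum_div, Finset.sum_mul]
      congr 1
      exact Finset.sum_congr rfl fun j _ => by ring

/-- The map has the coordinates `frameVal`. -/
def IsFrame {g : GaugeAlg} (i : h →ₗ[ℂ] Cartan g) (ys : List (Module.Dual ℂ h))
    (ds : List (List ℤ)) : Prop :=
  ∀ x (j : Fin g.N), (i x : Fin g.N → ℂ) j = frameVal ys ds x j

theorem IsFrame.wt_comp {g : GaugeAlg} {i : h →ₗ[ℂ] Cartan g} {ys : List (Module.Dual ℂ h)}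
    {ds : List (List ℤ)} (hi : IsFrame i ys ds) (l : List ℤ) :
    (wt g (ofList g.N l)).comp i = quarterForm ys (labels g.N ds l) := by
  ext x
  rw [← sum_mul_frameVal, LinearMap.comp_apply, wt_apply]
  refine Finset.sum_congr rfl fun j _ => ?_
  rw [hi x j, ofList]; push_cast; rfl

theorem IsFrame.pull_charL {g : GaugeAlg} {i : h →ₗ[ℂ] Cartan g} {ys : List (Module.Dual ℂ h)}
    {ds : List (List ℤ)} (hi : IsFrame i ys ds) (L : List (List ℤ)) :
    pull i (charL g L) = labelChar ys (L.map (labels g.N ds)) := by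
  induction L with
  | nil => simp [charL, labelChar, pull_eq]
  | cons l L ih =>
    simp only [charL, labelChar] at ih
    simp only [charL, labelChar, List.map_cons, List.sum_cons, pull_add, pull_single, ih,
      hi.wt_comp]

theorem frameVal_append {ys ys' : List (Module.Dual ℂ h)} {ds ds' : List (List ℤ)}
    (hl : ys.length = ds.length) (x : h) (j : ℕ) :
    frameVal (ys ++ ys') (ds ++ ds') x j = frameVal ys ds x j + frameVal ys' ds' x j := by
  rw [frameVal, List.zipWith_append hl, List.sum_append]; rfl

theorem frameVal_flatMap {ι : Type*} (s : List ι) (ys : ι → List (Module.Dual ℂ h))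
    (ds : ι → List (List ℤ)) (hl : ∀ i, (ys i).length = (ds i).length) (x : h) (j : ℕ) :
    frameVal (s.flatMap ys) (s.flatMap ds) x j = (s.map fun i => frameVal (ys i) (ds i) x j).sum := by
  induction s with
  | nil => simp [frameVal]
  | cons a s ih => simp [frameVal_append (hl a), ih]

theorem frameVal_map_nil (ys : List (Module.Dual ℂ h)) (ds : List (List ℤ)) (x : h) (j : ℕ) :
    frameVal ys (ds.map fun _ => []) x j = 0 := by
  induction ys generalizing ds with
  | nil => simp [frameVal]
  | cons y ys ih =>
    cases ds with
    | nil => simp [frameVal]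
    | cons d ds =>
      have := ih ds
      simp only [frameVal] at this
      simp only [frameVal, List.map_cons, List.zipWith_cons_cons, List.sum_cons, this]
      simp

theorem frameVal_map_comp {h' : Type} [AddCommGroup h'] [Module ℂ h'] (p : h →ₗ[ℂ] h')
    (ys : List (Module.Dual ℂ h')) (ds : List (List ℤ)) (x : h) (j : ℕ) :
    frameVal (ys.map fun y => y.comp p) ds x j = frameVal ys ds (p x) j := by
  rw [frameVal, frameVal, List.zipWith_map_left]; rfl

end Frames

/-- The vector with the coordinates in the list. -/
def rowVec (n : ℕ) (R : List ℤ) : Fin n → ℚ := fun j => (R.getD j 0 : ℤ)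

/-- Linear forms on a Cartan subalgebra with integral coordinates. -/
def rowForms (g : GaugeAlg) (rows : List (List ℤ)) : List (Module.Dual ℂ (Cartan g)) :=
  rows.map fun R => wt g (rowVec g.N R)

section Sums

variable {r : ℕ} (T : Fin r → Kodaira)

/-- The linear forms on the summands, as forms on the sum. -/
def sumForms (rows : Fin r → List (List ℤ)) : List (Module.Dual ℂ (CoverSum T)) :=
  (List.finRange r).flatMap fun i => (rowForms (T i).cover (rows i)).map fun y =>
    y.comp (LinearMap.proj (R := ℂ) (φ := fun i => Cartan (T i).cover) i)

variable {T}

theorem isFrame_assemble {T' : Kodaira}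
    {ι : (i : Fin r) → Cartan (T i).cover →ₗ[ℂ] Cartan T'.cover} {rows ds : Fin r → List (List ℤ)}
    (hl : ∀ i, (rows i).length = (ds i).length)
    (hι : ∀ i, IsFrame (ι i) (rowForms (T i).cover (rows i)) (ds i)) :
    IsFrame (assemble ι) (sumForms T rows) ((List.finRange r).flatMap ds) := by
  intro x j
  rw [sumForms, frameVal_flatMap _ _ _ (by simpa [rowForms] using hl)]
  simp only [frameVal_map_comp, LinearMap.proj_apply]
  rw [← List.ofFn_eq_map, List.sum_ofFn]
  simp only [assemble, LinearMap.sum_apply, LinearMap.comp_apply, LinearMap.proj_apply,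
    AddSubmonoidClass.coe_finsetSum, Finset.sum_apply]
  exact Finset.sum_congr rfl fun i _ => hι i (x i) j

theorem isFrame_proj {rows cs : Fin r → List (List ℤ)}
    (hl : ∀ i, (rows i).length = (cs i).length)
    (hid : ∀ i, IsFrame (LinearMap.id : Cartan (T i).cover →ₗ[ℂ] _)
      (rowForms (T i).cover (rows i)) (cs i)) (i : Fin r) :
    IsFrame (LinearMap.proj (R := ℂ) (φ := fun i => Cartan (T i).cover) i) (sumForms T rows)
      (blockLabels cs i) := by
  intro x j
  rw [sumForms, blockLabels, frameVal_flatMap]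
  · simp only [frameVal_map_comp, LinearMap.proj_apply]
    rw [← List.ofFn_eq_map, List.sum_ofFn, Finset.sum_eq_single i]
    · rw [if_pos rfl]; exact hid i (x i) j
    · intro k _ hk
      rw [if_neg hk, frameVal_map_nil]
    · simp
  · intro k
    split_ifs <;> simp [rowForms, hl]

theorem on_eq_labelChar {rows cs : Fin r → List (List ℤ)}
    (hl : ∀ i, (rows i).length = (cs i).length)
    (hid : ∀ i, IsFrame (LinearMap.id : Cartan (T i).cover →ₗ[ℂ] _)
      (rowForms (T i).cover (rows i)) (cs i)) (i : Fin r) {χ : Rep (Cartan (T i).cover)}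
    {L : List (List ℤ)} (hχ : χ = charL (T i).cover L) :
    on T i χ = labelChar (sumForms T rows) (L.map (labels (T i).cover.N (blockLabels cs i))) := by
  rw [hχ, on, (isFrame_proj hl hid i).pull_charL]

theorem pull_eq_of_lists {T' : Kodaira}
    {ι : (i : Fin r) → Cartan (T i).cover →ₗ[ℂ] Cartan T'.cover}
    {rows cs ds L : Fin r → List (List ℤ)} {L' M : List (List ℤ)} {σ : Rep (CoverSum T)}
    (hc : ∀ i, (rows i).length = (cs i).length) (hd : ∀ i, (rows i).length = (ds i).length)
    (hid : ∀ i, IsFrame (LinearMap.id : Cartan (T i).cover →ₗ[ℂ] _)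
      (rowForms (T i).cover (rows i)) (cs i))
    (hι : ∀ i, IsFrame (ι i) (rowForms (T i).cover (rows i)) (ds i))
    (hL : ∀ i, Enumerates (L i) (T i).cover.roots) (hL' : Enumerates L' T'.cover.roots)
    (hs : ∀ i, IsSimpleList (T i).cover.N (L i)) (hs' : IsSimpleList T'.cover.N L')
    (hσ : σ = labelChar (sumForms T rows) M)
    (hp : (L'.map (labels T'.cover.N ((List.finRange r).flatMap ds))).Perm
      ((List.finRange r).flatMap (fun i => (L i).map (labels (T i).cover.N (blockLabels cs i))) ++
        M)) :
    pull (assemble ι) (ofWeights T'.cover T'.cover.roots) =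
      ∑ i, on T i (ofWeights (T i).cover (T i).cover.roots) + σ := by
  rw [hL'.ofWeights_eq hs', (isFrame_assemble hd hι).pull_charL, labelChar_perm _ hp,
    labelChar_append, labelChar_flatMap, ← List.ofFn_eq_map, List.sum_ofFn, hσ]
  congr 1
  refine Finset.sum_congr rfl fun i _ => ?_
  rw [on_eq_labelChar hc hid i ((hL i).ofWeights_eq (hs i))]

/-- The list enumerates the roots, which have norm `2`. -/
structure IsRootList (g : GaugeAlg) (L : List (List ℤ)) : Prop where
  enumerates : Enumerates L g.roots
  simple : IsSimpleList g.N L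
  norm : ∀ l ∈ L, dotL g.N l l = 8

theorem isCoroot_image {g g' : GaugeAlg} {i : Cartan g →ₗ[ℂ] Cartan g'}
    {rows ds L L' : List (List ℤ)} (hi : IsFrame i (rowForms g rows) ds)
    (hL : Enumerates L g.roots) (hL' : Enumerates L' g'.roots)
    (hn : ∀ l ∈ L, dotL g.N l l = 8) (hn' : ∀ l ∈ L', dotL g'.N l l = 8)
    (him : ∀ l ∈ L, imageL g.N g'.N rows ds l ∈ L'.map fun l => l.map (2 * ·))
    {x : Cartan g} (hx : IsCoroot x) : IsCoroot (i x) := by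
  have hnorm {n : ℕ} {l : List ℤ} (h : dotL n l l = 8) : ofList n l ⬝ᵥ ofList n l = 2 := by
    have h1 := cast_dotL n l l
    rw [h] at h1
    have h2 : ((∑ j : Fin n, (l.getD j 0 : ℚ) * (l.getD j 0 : ℚ) : ℚ) : ℂ) = ((8 : ℚ) : ℂ) := by
      push_cast at h1 ⊢; exact h1.symm
    have h3 := Rat.cast_injective h2
    simp only [dotProduct, ofList]
    calc _ = (∑ j : Fin n, (l.getD j 0 : ℚ) * (l.getD j 0 : ℚ)) / 4 := by
          rw [Finset.sum_div]; exact Finset.sum_congr rfl fun j _ => by ring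
      _ = 2 := by rw [h3]; norm_num
  obtain ⟨α, hα, hxα⟩ := hx
  obtain ⟨l, hl, rfl⟩ := (hL α).1 hα
  obtain ⟨l', hl', him'⟩ := List.mem_map.1 (him l hl)
  refine ⟨ofList g'.N l', (hL' _).2 ⟨l', hl', rfl⟩, fun j => ?_⟩
  rw [hnorm (hn l hl)] at hxα
  rw [hnorm (hn' l' hl'), hi x j]
  have h1 : (2 * l'.getD j 0 : ℤ) =
      (List.zipWith (fun r d => dotL g.N r l * d.getD j 0) rows ds).sum := by
    have := congrArg (fun l => l.getD (j : ℕ) 0) him'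
    have e := List.getD_map (l := l') (d := 0) (n := (j : ℕ)) (2 * ·)
    rw [mul_zero] at e
    rw [e] at this
    rw [this, imageL]
    simp
  have h2 : frameVal (rowForms g rows) ds x j =
      (((List.zipWith (fun r d => dotL g.N r l * d.getD j 0) rows ds).sum : ℤ) : ℂ) / 4 := by
    clear h1 hi him him'
    induction rows generalizing ds with
    | nil => simp [frameVal, rowForms]
    | cons R rows ih =>
      cases ds with
      | nil => simp [frameVal, rowForms]
      | cons d ds =>
        have := @ih ds
        simp only [frameVal, rowForms] at this
        simp only [frameVal, rowForms, List.map_cons, List.zipWith_cons_cons, List.sum_cons, this]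
        push_cast
        rw [wt_apply, add_div, cast_dotL]
        congr 1
        simp only [hxα]
        rw [Finset.sum_mul, Finset.sum_mul, Finset.sum_div]
        refine Finset.sum_congr rfl fun k _ => ?_
        simp only [ofList, rowVec]; push_cast; ring
  rw [h2, ← h1]
  simp only [ofList]; push_cast; ring

theorem branchingRule_of_pull_roots {T' : Kodaira}
    {ι : (i : Fin r) → Cartan (T i).cover →ₗ[ℂ] Cartan T'.cover} {ρ : Rep (CoverSum T)}
    (hc : ∀ i (x : Cartan (T i).cover), IsCoroot x → IsCoroot (ι i x))
    (h : pull (assemble ι) (ofWeights T'.cover T'.cover.roots) =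
      ∑ i, on T i (ofWeights (T i).cover (T i).cover.roots) + (ρ + conj ρ)) :
    BranchingRule T T' (assemble ι) ρ := by
  refine ⟨fun i x hx => ?_, ?_⟩
  · have : assemble ι (Pi.single i x) = ι i x := by
      simp only [assemble, LinearMap.sum_apply, LinearMap.comp_apply, LinearMap.proj_apply]
      rw [Finset.sum_eq_single i]
      · simp
      · intro j _ hj; simp [Pi.single_eq_of_ne hj]
      · simp
    rw [this]; exact hc i x hx
  · have h1 (i : Fin r) : on T i (adj (T i).cover) = ((T i).cover.rank : ℚ) • 1 +
        on T i (ofWeights (T i).cover (T i).cover.roots) := by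
      simp only [on, adj, pull_add, pull_smul, pull_one]
    simp only [h1, Finset.sum_add_distrib, ← Finset.sum_smul]
    rw [adj, pull_add, pull_smul, pull_one, h]
    module

theorem branchingRule_of_lists {T' : Kodaira}
    {ι : (i : Fin r) → Cartan (T i).cover →ₗ[ℂ] Cartan T'.cover}
    (rows cs ds L : Fin r → List (List ℤ)) (L' : List (List ℤ)) {M : List (List ℤ)}
    {ρ : Rep (CoverSum T)}
    (hid : ∀ i, IsFrame (LinearMap.id : Cartan (T i).cover →ₗ[ℂ] _)
      (rowForms (T i).cover (rows i)) (cs i))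
    (hι : ∀ i, IsFrame (ι i) (rowForms (T i).cover (rows i)) (ds i))
    (hL : ∀ i, IsRootList (T i).cover (L i)) (hL' : IsRootList T'.cover L')
    (hσ : ρ + conj ρ = labelChar (sumForms T rows) M)
    (hl : (∀ i, (rows i).length = (cs i).length) ∧ ∀ i, (rows i).length = (ds i).length)
    (hp : (L'.map (labels T'.cover.N ((List.finRange r).flatMap ds))).Perm
      ((List.finRange r).flatMap (fun i => (L i).map (labels (T i).cover.N (blockLabels cs i))) ++
        M))
    (hn : ∀ i, ∀ l ∈ L i, imageL (T i).cover.N T'.cover.N (rows i) (ds i) l ∈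
        L'.map fun l => l.map (2 * ·)) :
    BranchingRule T T' (assemble ι) ρ :=
  branchingRule_of_pull_roots
    (fun i _ hx => isCoroot_image (hι i) (hL i).1 hL'.1 (hL i).3 hL'.3 (hn i) hx)
    (pull_eq_of_lists hl.1 hl.2 hid hι (fun i => (hL i).1) hL'.1 (fun i => (hL i).2) hL'.2 hσ hp)

end Sums

end

end EllipticAnomaly

namespace EllipticAnomaly

/-! ### Coordinates on the Cartan subalgebras -/

def unitRows (n : ℕ) : List (List ℤ) := (List.range n).map fun i => List.replicate i 0 ++ [1]

def unitVecs (n : ℕ) : List (List ℤ) := (List.range n).map fun i => List.replicate i 0 ++ [2]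

/-- The partial sums of the coordinates. -/
def rowsA (m : ℕ) : List (List ℤ) := (List.range (m - 1)).map fun i => List.replicate (i + 1) 1

/-- The simple coroots of `A`. -/
def vecsA (m : ℕ) : List (List ℤ) := (List.range (m - 1)).map fun i => List.replicate i 0 ++ [2, -2]

def vecsE7 : List (List ℤ) := unitVecs 6 ++ [[0, 0, 0, 0, 0, 0, 2, -2]]

def vecsE6 : List (List ℤ) := unitVecs 5 ++ [[0, 0, 0, 0, 0, 2, 2, -2]]

/-- Twice the simple coroots of `E₈`. -/
def simpleL : List (List ℤ) :=
  [[1, -1, -1, -1, -1, -1, -1, 1], [2, 2, 0, 0, 0, 0, 0, 0], [-2, 2, 0, 0, 0, 0, 0, 0],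
    [0, -2, 2, 0, 0, 0, 0, 0], [0, 0, -2, 2, 0, 0, 0, 0], [0, 0, 0, -2, 2, 0, 0, 0],
    [0, 0, 0, 0, -2, 2, 0, 0], [0, 0, 0, 0, 0, -2, 2, 0]]

noncomputable section

theorem simple_eq (l j : Fin 8) : simple l j = (((simpleL.getD l []).getD j 0 : ℤ) : ℂ) / 2 := by
  fin_cases l <;> fin_cases j <;> simp [simple, simpleL]

theorem frameVal_map_range {h : Type} [AddCommGroup h] [Module ℂ h] (n : ℕ)
    (y : ℕ → Module.Dual ℂ h) (d : ℕ → List ℤ) (x : h) (j : ℕ) :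
    frameVal ((List.range n).map y) ((List.range n).map d) x j =
      ∑ i ∈ Finset.range n, y i x * (((d i).getD j 0 : ℂ) / 2) := by
  induction n with
  | zero => simp [frameVal]
  | succ n ih =>
    rw [List.range_succ, List.map_append, List.map_append, frameVal_append (by simp), ih,
      Finset.sum_range_succ]
    simp [frameVal]

theorem list_eq_map_range (ds : List (List ℤ)) :
    ds = (List.range ds.length).map fun i => ds.getD i [] := by
  refine List.ext_getElem (by simp) fun i hi _ => ?_
  simp [List.getElem?_eq_getElem hi]

theorem getD_replicate_one (l j : ℕ) :
    (List.replicate l (1 : ℤ)).getD j 0 = if j < l then 1 else 0 := by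
  rw [List.getD_eq_getElem?_getD, List.getElem?_replicate]; split_ifs <;> rfl

theorem getD_unit (i j : ℕ) (a : ℤ) :
    (List.replicate i 0 ++ [a]).getD j 0 = if j = i then a else 0 := by
  rcases lt_trichotomy j i with h | h | h
  · rw [List.getD_append _ _ _ _ (by simpa using h), if_neg h.ne]
    simp [h]
  · subst h; simp
  · rw [List.getD_eq_default _ _ (by simpa using h), if_neg h.ne']

theorem wt_row_unit (g : GaugeAlg) (i : ℕ) (hi : i < g.N) (x : Cartan g) :
    wt g (rowVec g.N (List.replicate i 0 ++ [1])) x = (x : Fin g.N → ℂ) ⟨i, hi⟩ := by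
  rw [wt_apply, Finset.sum_eq_single ⟨i, hi⟩]
  · simp only [rowVec, getD_unit]; simp
  · intro j _ hj
    have : (j : ℕ) ≠ i := fun h => hj (Fin.ext h)
    simp only [rowVec, getD_unit]; simp [this]
  · simp

theorem isFrame_chain (m : ℕ) {g : GaugeAlg} (c : Fin (m - 1) → Cartan g) (ds : List (List ℤ))
    (hl : ds.length = m - 1)
    (hc : ∀ l j, (c l : Fin g.N → ℂ) j = (((ds.getD l []).getD j 0 : ℤ) : ℂ) / 2) :
    IsFrame (chain m c) (rowForms (A m) (rowsA m)) ds := by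
  intro x j
  rw [list_eq_map_range ds, hl, rowForms, rowsA, List.map_map, frameVal_map_range]
  rw [← Fin.sum_univ_eq_sum_range (fun i => ((fun R : List ℤ => wt (A m) (rowVec m R))
    ∘ fun i => List.replicate (i + 1) 1) i x * ((((ds.getD i []).getD j 0 : ℤ) : ℂ) / 2))
    (m - 1)]
  simp only [chain, LinearMap.sum_apply, LinearMap.smulRight_apply, Submodule.coe_sum,
    Submodule.coe_smul, Finset.sum_apply, Pi.smul_apply, smul_eq_mul, hc]
  refine Finset.sum_congr rfl fun l _ => ?_
  congr 1
  rw [Function.comp_apply, wt_apply]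
  simp only [rowVec, getD_replicate_one, Finset.sum_filter]
  refine Finset.sum_congr rfl fun i _ => ?_
  by_cases h : (i : ℕ) ≤ l <;> simp [h]

theorem frameVal_unit (g : GaugeAlg) (n : ℕ) (hn : n ≤ g.N) (x : Cartan g) (j : ℕ) :
    frameVal (rowForms g (unitRows n)) (unitVecs n) x j =
      if h : j < n then (x : Fin g.N → ℂ) ⟨j, h.trans_le hn⟩ else 0 := by
  rw [rowForms, unitRows, unitVecs, List.map_map, frameVal_map_range]
  split_ifs with h
  · rw [Finset.sum_eq_single j]
    · rw [Function.comp_apply, wt_row_unit g j (h.trans_le hn), getD_unit]; simp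
    · intro k _ hk
      rw [getD_unit, if_neg hk.symm]; simp
    · intro h'; exact absurd (Finset.mem_range.2 h) h'
  · refine Finset.sum_eq_zero fun k hk => ?_
    rw [getD_unit, if_neg (by have := Finset.mem_range.1 hk; omega)]; simp

theorem pad_apply (a b : ℕ) (x : Fin a → ℂ) (j : Fin b) :
    pad a b x j = if h : (j : ℕ) < a then x ⟨j, h⟩ else 0 := by
  simp only [pad, LinearMap.pi_apply]
  split_ifs <;> rfl

theorem isFrame_unit {g g' : GaugeAlg} (i : Cartan g →ₗ[ℂ] Cartan g')
    (hi : ∀ x (j : Fin g'.N), (i x : Fin g'.N → ℂ) j = pad g.N g'.N x j) :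
    IsFrame i (rowForms g (unitRows g.N)) (unitVecs g.N) := by
  intro x j
  rw [frameVal_unit g g.N le_rfl, hi, pad_apply]

theorem frameVal_eq_zero {h : Type} [AddCommGroup h] [Module ℂ h] (ys : List (Module.Dual ℂ h))
    (ds : List (List ℤ)) (x : h) (j : ℕ) (hj : ∀ d ∈ ds, d.length ≤ j) :
    frameVal ys ds x j = 0 := by
  induction ys generalizing ds with
  | nil => simp [frameVal]
  | cons y ys ih =>
    cases ds with
    | nil => simp [frameVal]
    | cons d ds =>
      have := ih ds fun d hd => hj d (List.mem_cons_of_mem _ hd)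
      simp only [frameVal] at this
      simp only [frameVal, List.zipWith_cons_cons, List.sum_cons, this,
        List.getD_eq_default _ _ (hj d List.mem_cons_self)]
      simp

theorem IsFrame.pad {g g' : GaugeAlg} {i : Cartan g →ₗ[ℂ] Cartan g'}
    {ys : List (Module.Dual ℂ (Cartan g))} {ds : List (List ℤ)}
    (hid : IsFrame (LinearMap.id : Cartan g →ₗ[ℂ] _) ys ds)
    (hi : ∀ x (j : Fin g'.N), (i x : Fin g'.N → ℂ) j = EllipticAnomaly.pad g.N g'.N x j)
    (hds : ∀ d ∈ ds, d.length ≤ g.N) : IsFrame i ys ds := by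
  intro x j
  rw [hi, pad_apply]
  split_ifs with h
  · exact hid x ⟨j, h⟩
  · exact (frameVal_eq_zero _ _ _ _ fun d hd => (hds d hd).trans (not_lt.1 h)).symm

theorem isFrame_idD (n : ℕ) :
    IsFrame (LinearMap.id : Cartan (D n) →ₗ[ℂ] _) (rowForms (D n) (unitRows n)) (unitVecs n) :=
  isFrame_unit (g := D n) (g' := D n) _ fun x j => by rw [pad_apply, dif_pos j.2]; rfl

theorem sum_range_partial (x : ℕ → ℂ) (m : ℕ) (hx : ∑ i ∈ Finset.range (m + 1), x i = 0) (j : ℕ)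
    (hj : j < m + 1) : ∑ l ∈ Finset.range m, (∑ i ∈ Finset.range (l + 1), x i) *
      ((if j = l then 1 else 0) - if j = l + 1 then 1 else 0) = x j := by
  simp only [mul_sub, Finset.sum_sub_distrib, mul_ite, mul_one, mul_zero]
  have h1 : ∑ l ∈ Finset.range m, (if j = l then ∑ i ∈ Finset.range (l + 1), x i else 0) =
      ∑ i ∈ Finset.range (j + 1), x i := by
    rw [Finset.sum_ite_eq]
    split_ifs with h
    · rfl
    · have : j = m := by rw [Finset.mem_range] at h; omega
      rw [this, hx]
  rw [h1]
  cases j with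
  | zero => simp
  | succ j =>
    have : ∀ l, (j + 1 = l + 1) = (j = l) := fun l => by simp
    simp only [this]
    rw [Finset.sum_ite_eq, if_pos (by rw [Finset.mem_range]; omega),
      Finset.sum_range_succ _ (j + 1)]
    ring

theorem getD_simpleRoot (i j : ℕ) : (List.replicate i (0 : ℤ) ++ [2, -2]).getD j 0 =
    (if j = i then 2 else 0) - if j = i + 1 then 2 else 0 := by
  rcases lt_or_ge j i with h | h
  · rw [List.getD_append _ _ _ _ (by simpa using h), if_neg h.ne, if_neg (by omega)]
    simp [h]
  · obtain ⟨k, rfl⟩ := Nat.exists_eq_add_of_le h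
    rw [List.getD_append_right _ _ _ _ (by simp)]
    rcases k with _ | _ | k <;> simp

theorem sum_eq_zero_of_mem_cartanA {m : ℕ} (x : Cartan (A m)) :
    ∑ i, (x : Fin m → ℂ) i = 0 := by
  have := LinearMap.mem_ker.1 x.2
  simpa using this

theorem isFrame_idA (m : ℕ) (hm : 1 ≤ m) :
    IsFrame (LinearMap.id : Cartan (A m) →ₗ[ℂ] _) (rowForms (A m) (rowsA m)) (vecsA m) := by
  obtain ⟨m, rfl⟩ := Nat.exists_eq_add_of_le' hm
  intro x j
  let y : ℕ → ℂ := fun i => if h : i < m + 1 then (x : Fin (m + 1) → ℂ) ⟨i, h⟩ else 0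
  have hxy (i : Fin (m + 1)) : (x : Fin (m + 1) → ℂ) i = y i := by
    have hi : (i : ℕ) < m + 1 := i.2
    simp only [y, dif_pos hi]
  have hy : ∑ i ∈ Finset.range (m + 1), y i = 0 := by
    rw [Finset.sum_range, ← sum_eq_zero_of_mem_cartanA x]
    exact Finset.sum_congr rfl fun i _ => (hxy i).symm
  rw [rowForms, rowsA, vecsA, List.map_map, frameVal_map_range, LinearMap.id_apply, hxy,
    ← sum_range_partial y m hy j j.2]
  refine Finset.sum_congr rfl fun l hl => ?_
  rw [getD_simpleRoot]
  congr 1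
  · rw [Function.comp_apply, wt_apply]
    simp only [rowVec, getD_replicate_one]
    have : ∑ i : Fin (m + 1), (((if (i : ℕ) < l + 1 then (1 : ℤ) else 0 : ℤ) : ℚ) : ℂ) *
        (x : Fin (m + 1) → ℂ) i =
        ∑ i ∈ Finset.range (m + 1), if i < l + 1 then y i else 0 := by
      rw [Finset.sum_range]
      refine Finset.sum_congr rfl fun i _ => ?_
      rw [hxy]; split_ifs <;> simp
    rw [this, ← Finset.sum_filter]
    refine Finset.sum_congr ?_ fun _ _ => rfl
    ext i; simp only [Finset.mem_range, Finset.mem_filter] at *; omega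
  · push_cast; split_ifs <;> norm_num

theorem cartanE7_eq (x : Cartan E7) : (x : Fin 8 → ℂ) 7 = -(x : Fin 8 → ℂ) 6 := by
  have := LinearMap.mem_ker.1 x.2
  simp at this
  linear_combination this

theorem cartanE6_eq (x : Cartan E6) : (x : Fin 8 → ℂ) 7 = -(x : Fin 8 → ℂ) 5 ∧
    (x : Fin 8 → ℂ) 6 = (x : Fin 8 → ℂ) 5 := by
  have h1 := LinearMap.mem_ker.1 x.2.1
  have h2 := LinearMap.mem_ker.1 x.2.2
  simp at h1 h2
  exact ⟨by linear_combination h1 + h2, by linear_combination -h2⟩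

theorem frameVal_E7 (x : Cartan E7) (j : Fin 8) :
    frameVal (rowForms E7 (unitRows 7)) vecsE7 x j = (x : Fin 8 → ℂ) j := by
  have h1 : unitRows 7 = unitRows 6 ++ [List.replicate 6 0 ++ [1]] := rfl
  rw [h1, rowForms, List.map_append, vecsE7, frameVal_append (by simp [unitRows, unitVecs]),
    ← rowForms, frameVal_unit E7 6 (by decide)]
  simp only [List.map_cons, List.map_nil, frameVal, List.zipWith_cons_cons, List.zipWith_nil_left,
    List.sum_cons, List.sum_nil, wt_row_unit E7 6 (by decide)]
  have := cartanE7_eq x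
  fin_cases j <;> simp <;> first | rfl | exact this.symm

theorem frameVal_E6 (x : Cartan E6) (j : Fin 8) :
    frameVal (rowForms E6 (unitRows 6)) vecsE6 x j = (x : Fin 8 → ℂ) j := by
  have h1 : unitRows 6 = unitRows 5 ++ [List.replicate 5 0 ++ [1]] := rfl
  rw [h1, rowForms, List.map_append, vecsE6, frameVal_append (by simp [unitRows, unitVecs]),
    ← rowForms, frameVal_unit E6 5 (by decide)]
  simp only [List.map_cons, List.map_nil, frameVal, List.zipWith_cons_cons, List.zipWith_nil_left,
    List.sum_cons, List.sum_nil, wt_row_unit E6 5 (by decide)]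
  obtain ⟨h7, h6⟩ := cartanE6_eq x
  fin_cases j <;> simp <;> first | rfl | exact h6.symm | exact h7.symm

theorem isRootList_A (m : ℕ)
    (h : IsSimpleList m (rootsAL m) ∧ ∀ l ∈ rootsAL m, dotL m l l = 8) :
    IsRootList (A m) (rootsAL m) :=
  ⟨enumerates_rootsA m, h.1, h.2⟩

theorem isRootList_D (m : ℕ)
    (h : IsSimpleList m (rootsDL m) ∧ ∀ l ∈ rootsDL m, dotL m l l = 8) :
    IsRootList (D m) (rootsDL m) :=
  ⟨enumerates_rootsD m, h.1, h.2⟩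

theorem isRootList_E8 : IsRootList E8 rootsE8L :=
  ⟨enumerates_rootsE8, by decide +kernel, by decide +kernel⟩

theorem IsSimpleList.filter {n : ℕ} {L : List (List ℤ)} (h : IsSimpleList n L)
    (p : List ℤ → Bool) : IsSimpleList n (L.filter p) :=
  ⟨h.1.filter p, fun l hl => h.2 l (List.mem_filter.1 hl).1⟩

theorem isRootList_E7 : IsRootList E7 rootsE7L :=
  ⟨enumerates_rootsE7, isRootList_E8.2.filter _,
    fun l hl => isRootList_E8.3 l (List.mem_filter.1 hl).1⟩

theorem isRootList_E6 : IsRootList E6 rootsE6L :=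
  ⟨enumerates_rootsE6, isRootList_E8.2.filter _,
    fun l hl => isRootList_E8.3 l (List.mem_filter.1 hl).1⟩

theorem rep27_eq_charL : rep27 = charL E6 rep27L :=
  enumerates_rep27.ofWeights_eq (g := E6) (isRootList_E8.2.filter _)

theorem rep56_eq_charL : rep56 = charL E7 rep56L :=
  enumerates_rep56.ofWeights_eq (g := E7) (isRootList_E8.2.filter _)

theorem charL_one (g : GaugeAlg) : (1 : Rep (Cartan g)) = charL g [[]] := by
  have : ofList g.N [] = 0 := by ext; simp [ofList]
  simp [charL, this, wt_zero, AddMonoidAlgebra.one_def]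

theorem charL_add {g : GaugeAlg} {χ χ' : Rep (Cartan g)} {L L' : List (List ℤ)}
    (h : χ = charL g L) (h' : χ' = charL g L') : χ + χ' = charL g (L ++ L') := by
  rw [charL_append, h, h']

theorem add_conj_labelChar {h : Type} [AddCommGroup h] [Module ℂ h] {ys : List (Module.Dual ℂ h)}
    {ρ : Rep h} {L : List (List ℤ)} (hρ : ρ = labelChar ys L) :
    ρ + conj ρ = labelChar ys (L ++ negLabels L) := by
  rw [labelChar_append, ← conj_labelChar, ← hρ]

/-- The branching rule for a single summand, whose representation is given by a list. -/
theorem branchingRule_single {T T' : Kodaira} {ι : Cartan T.cover →ₗ[ℂ] Cartan T'.cover}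
    (rows cs ds L : List (List ℤ)) (L' : List (List ℤ)) (M : List (List ℤ))
    {χ : Rep (Cartan T.cover)}
    (hid : IsFrame (LinearMap.id : Cartan T.cover →ₗ[ℂ] _) (rowForms T.cover rows) cs)
    (hι : IsFrame ι (rowForms T.cover rows) ds)
    (hL : IsRootList T.cover L) (hL' : IsRootList T'.cover L')
    (hχ : χ = charL T.cover M)
    (hl : rows.length = cs.length ∧ rows.length = ds.length)
    (hp : (L'.map (labels T'.cover.N ds)).Perm (L.map (labels T.cover.N cs) ++
      (M.map (labels T.cover.N cs) ++ negLabels (M.map (labels T.cover.N cs)))))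
    (hn : ∀ l ∈ L, imageL T.cover.N T'.cover.N rows ds l ∈ L'.map fun l => l.map (2 * ·)) :
    BranchingRule (fun _ : Fin 1 => T) T' (assemble fun _ => ι) (on (fun _ : Fin 1 => T) 0 χ) := by
  have h1 (f : Fin 1 → List (List ℤ)) : (List.finRange 1).flatMap f = f 0 :=
    List.append_nil _
  refine branchingRule_of_lists (fun _ => rows) (fun _ => cs) (fun _ => ds) (fun _ => L) L'
    (fun _ => hid) (fun _ => hι) (fun _ => hL) hL'
    (add_conj_labelChar (on_eq_labelChar (fun _ => hl.1) (fun _ => hid) 0 hχ))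
    ⟨fun _ => hl.1, fun _ => hl.2⟩ ?_ fun _ => hn
  rw [h1, h1, blockLabels, h1, if_pos rfl]
  exact hp

end

end EllipticAnomaly

namespace EllipticAnomaly

noncomputable section

/-! ### The branching rules for the weighted homogeneous families -/

theorem isFrame_embAA (m : ℕ) (hm : 1 ≤ m) :
    IsFrame (embAA m) (rowForms (A m) (rowsA m)) (vecsA m) :=
  (isFrame_idA m hm).pad (fun _ _ => rfl) fun d hd => by
    obtain ⟨i, hi, rfl⟩ := List.mem_map.1 hd
    have := List.mem_range.1 hi
    simp only [List.length_append, List.length_replicate, List.length_cons, List.length_nil]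
    change _ ≤ m; omega

theorem isFrame_embAD (m n : ℕ) (hm : 1 ≤ m) :
    IsFrame (embAD m n) (rowForms (A m) (rowsA m)) (vecsA m) :=
  (isFrame_idA m hm).pad (fun _ _ => rfl) fun d hd => by
    obtain ⟨i, hi, rfl⟩ := List.mem_map.1 hd
    have := List.mem_range.1 hi
    simp only [List.length_append, List.length_replicate, List.length_cons, List.length_nil]
    change _ ≤ m; omega

theorem branching_A2_A3 : BranchingRule (fun _ : Fin 1 => III) IV (assemble fun _ => embAA 2)
    (on (fun _ : Fin 1 => III) 0 (fundA 2)) :=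
  branchingRule_single (T := III) (T' := IV) (rowsA 2) (vecsA 2) (vecsA 2) (rootsAL 2) (rootsAL 3)
    (extL 2 1) (isFrame_idA 2 (by norm_num)) (isFrame_embAA 2 (by norm_num)) (isRootList_A 2 (by decide +kernel))
    (isRootList_A 3 (by decide +kernel)) (extA_eq_charL 2 1) (by decide +kernel) (by decide +kernel)
    (by decide +kernel)

theorem branching_A3_D4 : BranchingRule (fun _ : Fin 1 => IV) (Istar 0)
    (assemble fun _ => embAD 3 4) (on (fun _ : Fin 1 => IV) 0 ((3 : ℚ) • fundA 3)) :=
  branchingRule_single (T := IV) (T' := Istar 0) (rowsA 3) (vecsA 3) (vecsA 3) (rootsAL 3)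
    (rootsDL 4) (extL 3 1 ++ (extL 3 1 ++ extL 3 1)) (isFrame_idA 3 (by norm_num))
    (isFrame_embAD 3 4 (by norm_num)) (isRootList_A 3 (by decide +kernel)) (isRootList_D 4 (by decide +kernel))
    (by
      rw [← charL_add (extA_eq_charL 3 1) (charL_add (extA_eq_charL 3 1) (extA_eq_charL 3 1))]
      rw [fundA]; module)
    (by decide +kernel) (by decide +kernel) (by decide +kernel)

theorem simple_isFrame {m : ℕ} {g : GaugeAlg} (hg : g.N = 8) (c : Fin (m - 1) → Cartan g)
    (f : Fin (m - 1) → Fin 8) (hc : ∀ l j, (c l : Fin g.N → ℂ) j = simple (f l) (Fin.cast hg j)) :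
    IsFrame (chain m c) (rowForms (A m) (rowsA m))
      ((List.finRange (m - 1)).map fun l => simpleL.getD (f l) []) :=
  isFrame_chain m c _ (by simp) fun l j => by
    have e : ((List.finRange (m - 1)).map fun l => simpleL.getD (f l) []).getD l [] =
        simpleL.getD (f l) [] := by
      rw [List.getD_eq_getElem _ _ (by simp)]; simp
    rw [hc, simple_eq, e]; rfl

theorem branching_A6_E6 : BranchingRule (fun _ : Fin 1 => I 6) IVstar
    (assemble fun _ => chain 6 ![simpleE6 0, simpleE6 2, simpleE6 3, simpleE6 4, simpleE6 5])
    (on (fun _ : Fin 1 => I 6) 0 (1 + extA 6 3)) :=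
  branchingRule_single (T := I 6) (T' := IVstar) (rowsA 6) (vecsA 6) _ (rootsAL 6) rootsE6L
    ([[]] ++ extL 6 3) (isFrame_idA 6 (by norm_num))
    (simple_isFrame (m := 6) (g := E6) rfl _ ![0, 2, 3, 4, 5] fun l _ => by fin_cases l <;> rfl)
    (isRootList_A 6 (by decide +kernel)) isRootList_E6
    (charL_add (charL_one (A 6)) (extA_eq_charL 6 3))
    (by decide +kernel) (by decide +kernel) (by decide +kernel)

theorem branching_A7_E7 : BranchingRule (fun _ : Fin 1 => I 7) IIIstar
    (assemble fun _ =>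
      chain 7 ![simpleE7 0, simpleE7 2, simpleE7 3, simpleE7 4, simpleE7 5, simpleE7 6])
    (on (fun _ : Fin 1 => I 7) 0 (fundA 7 + extA 7 3)) :=
  branchingRule_single (T := I 7) (T' := IIIstar) (rowsA 7) (vecsA 7) _ (rootsAL 7) rootsE7L
    (extL 7 1 ++ extL 7 3) (isFrame_idA 7 (by norm_num))
    (simple_isFrame (m := 7) (g := E7) rfl _ ![0, 2, 3, 4, 5, 6] fun l _ => by fin_cases l <;> rfl)
    (isRootList_A 7 (by decide +kernel)) isRootList_E7
    (charL_add (extA_eq_charL 7 1) (extA_eq_charL 7 3))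
    (by decide +kernel) (by decide +kernel) (by decide +kernel)

theorem branching_A8_E8 : BranchingRule (fun _ : Fin 1 => I 8) IIstar
    (assemble fun _ => embA7E8)
    (on (fun _ : Fin 1 => I 8) 0 (fundA 8 + extA 8 2 + extA 8 3)) :=
  branchingRule_single (T := I 8) (T' := IIstar) (rowsA 8) (vecsA 8) _ (rootsAL 8) rootsE8L
    (extL 8 1 ++ extL 8 2 ++ extL 8 3) (isFrame_idA 8 (by norm_num))
    (simple_isFrame (m := 8) (g := E8) rfl _ ![0, 2, 3, 4, 5, 6, 7]
      fun l _ => by fin_cases l <;> rfl)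
    (isRootList_A 8 (by decide +kernel)) isRootList_E8
    (charL_add (charL_add (extA_eq_charL 8 1) (extA_eq_charL 8 2)) (extA_eq_charL 8 3))
    (by decide +kernel) (by decide +kernel) (by decide +kernel)

end

end EllipticAnomaly

namespace EllipticAnomaly

noncomputable section

theorem branching_A8_D8_E8 : BranchingRule (fun _ : Fin 1 => I 8) IIstar
    (assemble fun _ => embA7E8') (on (fun _ : Fin 1 => I 8) 0
      (1 + (2 : ℚ) • extA 8 2 + (1 / 2 : ℚ) • extA 8 4)) := by
  have hl : (rowsA 8).length = (vecsA 8).length := rfl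
  have hid := isFrame_idA 8 (by norm_num)
  have h0 := on_eq_labelChar (T := fun _ : Fin 1 => I 8) (fun _ => hl) (fun _ => hid) 0
    (charL_one (A 8))
  have h2 := on_eq_labelChar (T := fun _ : Fin 1 => I 8) (fun _ => hl) (fun _ => hid) 0
    (extA_eq_charL 8 2)
  have h4 := on_eq_labelChar (T := fun _ : Fin 1 => I 8) (fun _ => hl) (fun _ => hid) 0
    (extA_eq_charL 8 4)
  have h4' : conj (on (fun _ : Fin 1 => I 8) 0 (extA 8 4)) =
      on (fun _ : Fin 1 => I 8) 0 (extA 8 4) := by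
    rw [h4, conj_labelChar]
    exact labelChar_perm _ (by decide +kernel)
  let Y : List (List ℤ) → List (List ℤ) :=
    List.map (labels 8 (blockLabels (fun _ : Fin 1 => vecsA 8) 0))
  have hσ : on (fun _ : Fin 1 => I 8) 0 (1 + (2 : ℚ) • extA 8 2 + (1 / 2 : ℚ) • extA 8 4) +
      conj (on (fun _ : Fin 1 => I 8) 0 (1 + (2 : ℚ) • extA 8 2 + (1 / 2 : ℚ) • extA 8 4)) =
      labelChar (sumForms (fun _ : Fin 1 => I 8) fun _ => rowsA 8)
        (Y [[]] ++ negLabels (Y [[]]) ++ (Y (extL 8 2) ++ Y (extL 8 2)) ++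
          (negLabels (Y (extL 8 2)) ++ negLabels (Y (extL 8 2))) ++ Y (extL 8 4)) := by
    have e : on (fun _ : Fin 1 => I 8) 0 (1 + (2 : ℚ) • extA 8 2 + (1 / 2 : ℚ) • extA 8 4) =
        on (fun _ : Fin 1 => I 8) 0 1 + (2 : ℚ) • on (fun _ : Fin 1 => I 8) 0 (extA 8 2) +
          (1 / 2 : ℚ) • on (fun _ : Fin 1 => I 8) 0 (extA 8 4) := by
      simp only [on, pull_add, pull_smul]
    rw [e, conj_add, conj_add, conj_smul, conj_smul, h4']
    trans on (fun _ : Fin 1 => I 8) 0 1 + conj (on (fun _ : Fin 1 => I 8) 0 1) +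
      (on (fun _ : Fin 1 => I 8) 0 (extA 8 2) + on (fun _ : Fin 1 => I 8) 0 (extA 8 2)) +
      (conj (on (fun _ : Fin 1 => I 8) 0 (extA 8 2)) +
        conj (on (fun _ : Fin 1 => I 8) 0 (extA 8 2))) + on (fun _ : Fin 1 => I 8) 0 (extA 8 4)
    · module
    · simp only [labelChar_append]
      rw [h0, h2, h4, conj_labelChar, conj_labelChar]
  exact branchingRule_of_lists (T := fun _ : Fin 1 => I 8) (T' := IIstar) (fun _ => rowsA 8)
    (fun _ => vecsA 8) (fun _ => vecsA 8) (fun _ => rootsAL 8) rootsE8L (fun _ => hid)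
    (fun _ => hid) (fun _ => isRootList_A 8 (by decide +kernel)) isRootList_E8 hσ
    (by decide +kernel) (by decide +kernel) (by decide +kernel)

theorem spinD_eq_charL {n : ℕ} (h : IsSimpleList n (spinL n true)) :
    spinD n = charL (D n) (spinL n true) :=
  (enumerates_evenSpin n).ofWeights_eq (g := D n) h

theorem spinD'_eq_charL {n : ℕ} (h : IsSimpleList n (spinL n false)) :
    spinD' n = charL (D n) (spinL n false) :=
  (enumerates_oddSpin n).ofWeights_eq (g := D n) h

theorem vectD_eq_charL {n : ℕ} (h : IsSimpleList n (axisL n)) : vectD n = charL (D n) (axisL n) :=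
  (enumerates_axis n).ofWeights_eq (g := D n) h

theorem isFrame_idE6 :
    IsFrame (LinearMap.id : Cartan E6 →ₗ[ℂ] _) (rowForms E6 (unitRows 6)) vecsE6 :=
  fun x j => (frameVal_E6 x j).symm

theorem isFrame_idE7 :
    IsFrame (LinearMap.id : Cartan E7 →ₗ[ℂ] _) (rowForms E7 (unitRows 7)) vecsE7 :=
  fun x j => (frameVal_E7 x j).symm

theorem branching_D5_E6 : BranchingRule (fun _ : Fin 1 => Istar 1) IVstar
    (assemble fun _ => embD5E6) (on (fun _ : Fin 1 => Istar 1) 0 (spinD 5)) :=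
  branchingRule_single (T := Istar 1) (T' := IVstar) (unitRows 5) (unitVecs 5) (unitVecs 5)
    (rootsDL 5) rootsE6L (spinL 5 true) (isFrame_idD 5)
    (isFrame_unit (g := D 5) (g' := E6) _ fun _ _ => rfl)
    (isRootList_D 5 (by decide +kernel)) isRootList_E6 (spinD_eq_charL (by decide +kernel))
    (by decide +kernel) (by decide +kernel) (by decide +kernel)

theorem branching_D6_E7 : BranchingRule (fun _ : Fin 1 => Istar 2) IIIstar
    (assemble fun _ => embDE7 6 le_rfl) (on (fun _ : Fin 1 => Istar 2) 0 (1 + spinD' 6)) :=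
  branchingRule_single (T := Istar 2) (T' := IIIstar) (unitRows 6) (unitVecs 6) (unitVecs 6)
    (rootsDL 6) rootsE7L ([[]] ++ spinL 6 false) (isFrame_idD 6)
    (isFrame_unit (g := D 6) (g' := E7) _ fun _ _ => rfl)
    (isRootList_D 6 (by decide +kernel)) isRootList_E7
    (charL_add (charL_one (D 6)) (spinD'_eq_charL (by decide +kernel)))
    (by decide +kernel) (by decide +kernel) (by decide +kernel)

theorem branching_D7_E8 : BranchingRule (fun _ : Fin 1 => Istar 3) IIstar
    (assemble fun _ => embD7E8) (on (fun _ : Fin 1 => Istar 3) 0 (vectD 7 + spinD 7)) :=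
  branchingRule_single (T := Istar 3) (T' := IIstar) (unitRows 7) (unitVecs 7) (unitVecs 7)
    (rootsDL 7) rootsE8L (axisL 7 ++ spinL 7 true) (isFrame_idD 7)
    (isFrame_unit (g := D 7) (g' := E8) _ fun _ _ => rfl)
    (isRootList_D 7 (by decide +kernel)) isRootList_E8
    (charL_add (vectD_eq_charL (by decide +kernel)) (spinD_eq_charL (by decide +kernel)))
    (by decide +kernel) (by decide +kernel) (by decide +kernel)

theorem branching_E6_E7 : BranchingRule (fun _ : Fin 1 => IVstar) IIIstar
    (assemble fun _ => embE6E7) (on (fun _ : Fin 1 => IVstar) 0 rep27) :=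
  branchingRule_single (T := IVstar) (T' := IIIstar) (unitRows 6) vecsE6 vecsE6
    rootsE6L rootsE7L rep27L isFrame_idE6 isFrame_idE6
    isRootList_E6 isRootList_E7 rep27_eq_charL
    (by decide +kernel) (by decide +kernel) (by decide +kernel)

theorem branching_E7_E8 : BranchingRule (fun _ : Fin 1 => IIIstar) IIstar
    (assemble fun _ => embE7E8) (on (fun _ : Fin 1 => IIIstar) 0 (1 + rep56)) :=
  branchingRule_single (T := IIIstar) (T' := IIstar) (unitRows 7) vecsE7 vecsE7
    rootsE7L rootsE8L ([[]] ++ rep56L) isFrame_idE7 isFrame_idE7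
    isRootList_E7 isRootList_E8 (charL_add (charL_one E7) rep56_eq_charL)
    (by decide +kernel) (by decide +kernel) (by decide +kernel)

end

end EllipticAnomaly

namespace EllipticAnomaly

noncomputable section

theorem labelChar_add {h : Type} [AddCommGroup h] [Module ℂ h] {ys : List (Module.Dual ℂ h)}
    {ρ ρ' : Rep h} {L L' : List (List ℤ)} (hρ : ρ = labelChar ys L) (hρ' : ρ' = labelChar ys L') :
    ρ + ρ' = labelChar ys (L ++ L') := by
  rw [labelChar_append, hρ, hρ']

theorem labelChar_mul {h : Type} [AddCommGroup h] [Module ℂ h] {ys : List (Module.Dual ℂ h)}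
    {ρ ρ' : Rep h} {L L' : List (List ℤ)} (hρ : ρ = labelChar ys L) (hρ' : ρ' = labelChar ys L') :
    ρ * ρ' = labelChar ys (tensorLabels L L') := by
  rw [labelChar_tensorLabels, hρ, hρ']

theorem isFrame_coroot78 : IsFrame (chain 2 ![coroot78]) (rowForms (A 2) (rowsA 2))
    [[0, 0, 0, 0, 0, 0, 2, -2]] :=
  isFrame_chain 2 (g := E7) _ _ rfl fun l j => by
    fin_cases l; fin_cases j <;> simp [coroot78]

theorem branching_A2_A5_E6 : BranchingRule ![I 2, I 5] IVstar
    (assemble fun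
      | 0 => chain 2 ![simpleE6 0]
      | 1 => chain 5 ![simpleE6 1, simpleE6 3, simpleE6 4, simpleE6 5])
    (on ![I 2, I 5] 1 (fundA 5) + on ![I 2, I 5] 0 (fundA 2) * on ![I 2, I 5] 1 (extA 5 2)) := by
  have hl : ∀ i : Fin 2, ((![rowsA 2, rowsA 5] : Fin 2 → List (List ℤ)) i).length =
      ((![vecsA 2, vecsA 5] : Fin 2 → List (List ℤ)) i).length := by decide
  have hid : ∀ i : Fin 2, IsFrame (LinearMap.id : Cartan ((![I 2, I 5] : Fin 2 → Kodaira) i).cover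
      →ₗ[ℂ] _) (rowForms _ ((![rowsA 2, rowsA 5] : Fin 2 → List (List ℤ)) i))
      ((![vecsA 2, vecsA 5] : Fin 2 → List (List ℤ)) i) := fun
    | 0 => isFrame_idA 2 (by norm_num)
    | 1 => isFrame_idA 5 (by norm_num)
  exact branchingRule_of_lists (T := ![I 2, I 5]) (T' := IVstar) ![rowsA 2, rowsA 5]
    ![vecsA 2, vecsA 5]
    ![[simpleL.getD 0 []], ([1, 3, 4, 5] : List ℕ).map fun i => simpleL.getD i []]
    ![rootsAL 2, rootsAL 5] rootsE6L hid
    (fun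
      | 0 => simple_isFrame (m := 2) (g := E6) rfl _ ![0] fun l _ => by fin_cases l; rfl
      | 1 => simple_isFrame (m := 5) (g := E6) rfl _ ![1, 3, 4, 5] fun l _ => by
          fin_cases l <;> rfl)
    (fun
      | 0 => isRootList_A 2 (by decide +kernel)
      | 1 => isRootList_A 5 (by decide +kernel))
    isRootList_E6
    (add_conj_labelChar (labelChar_add (on_eq_labelChar hl hid 1 (extA_eq_charL 5 1))
      (labelChar_mul (on_eq_labelChar hl hid 0 (extA_eq_charL 2 1))
        (on_eq_labelChar hl hid 1 (extA_eq_charL 5 2)))))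
    (by decide +kernel) (by decide +kernel) (by decide +kernel)

theorem branching_A2_D5_E7 : BranchingRule ![I 2, Istar 1] IIIstar
    (assemble fun
      | 0 => chain 2 ![coroot78]
      | 1 => embDE7 5 (by norm_num))
    (on ![I 2, Istar 1] 1 (vectD 5) +
      on ![I 2, Istar 1] 0 (fundA 2) * on ![I 2, Istar 1] 1 (spinD 5)) := by
  have hl : ∀ i : Fin 2, ((![rowsA 2, unitRows 5] : Fin 2 → List (List ℤ)) i).length =
      ((![vecsA 2, unitVecs 5] : Fin 2 → List (List ℤ)) i).length := by decide
  have hid : ∀ i : Fin 2, IsFrame (LinearMap.id :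
      Cartan ((![I 2, Istar 1] : Fin 2 → Kodaira) i).cover
      →ₗ[ℂ] _) (rowForms _ ((![rowsA 2, unitRows 5] : Fin 2 → List (List ℤ)) i))
      ((![vecsA 2, unitVecs 5] : Fin 2 → List (List ℤ)) i) := fun
    | 0 => isFrame_idA 2 (by norm_num)
    | 1 => isFrame_idD 5
  exact branchingRule_of_lists (T := ![I 2, Istar 1]) (T' := IIIstar) ![rowsA 2, unitRows 5]
    ![vecsA 2, unitVecs 5] ![[[0, 0, 0, 0, 0, 0, 2, -2]], unitVecs 5]
    ![rootsAL 2, rootsDL 5] rootsE7L hid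
    (fun
      | 0 => isFrame_coroot78
      | 1 => isFrame_unit (g := D 5) (g' := E7) _ fun _ _ => rfl)
    (fun
      | 0 => isRootList_A 2 (by decide +kernel)
      | 1 => isRootList_D 5 (by decide +kernel))
    isRootList_E7
    (add_conj_labelChar (labelChar_add
      (on_eq_labelChar hl hid 1 (vectD_eq_charL (by decide +kernel)))
      (labelChar_mul (on_eq_labelChar hl hid 0 (extA_eq_charL 2 1))
        (on_eq_labelChar hl hid 1 (spinD_eq_charL (by decide +kernel))))))
    (by decide +kernel) (by decide +kernel) (by decide +kernel)

theorem branching_A2_E6_E8 : BranchingRule ![I 2, IVstar] IIstar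
    (assemble fun
      | 0 => chain 2 ![simpleE8 7]
      | 1 => embE6E8)
    (on ![I 2, IVstar] 1 rep27 + on ![I 2, IVstar] 0 (fundA 2) +
      on ![I 2, IVstar] 0 (fundA 2) * on ![I 2, IVstar] 1 rep27) := by
  have hl : ∀ i : Fin 2, ((![rowsA 2, unitRows 6] : Fin 2 → List (List ℤ)) i).length =
      ((![vecsA 2, vecsE6] : Fin 2 → List (List ℤ)) i).length := by decide
  have hid : ∀ i : Fin 2, IsFrame (LinearMap.id :
      Cartan ((![I 2, IVstar] : Fin 2 → Kodaira) i).cover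
      →ₗ[ℂ] _) (rowForms _ ((![rowsA 2, unitRows 6] : Fin 2 → List (List ℤ)) i))
      ((![vecsA 2, vecsE6] : Fin 2 → List (List ℤ)) i) := fun
    | 0 => isFrame_idA 2 (by norm_num)
    | 1 => isFrame_idE6
  exact branchingRule_of_lists (T := ![I 2, IVstar]) (T' := IIstar) ![rowsA 2, unitRows 6]
    ![vecsA 2, vecsE6] ![[simpleL.getD 7 []], vecsE6]
    ![rootsAL 2, rootsE6L] rootsE8L hid
    (fun
      | 0 => simple_isFrame (m := 2) (g := E8) rfl _ ![7] fun l _ => by fin_cases l; rfl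
      | 1 => isFrame_idE6)
    (fun
      | 0 => isRootList_A 2 (by decide +kernel)
      | 1 => isRootList_E6)
    isRootList_E8
    (add_conj_labelChar (labelChar_add (labelChar_add (on_eq_labelChar hl hid 1 rep27_eq_charL)
        (on_eq_labelChar hl hid 0 (extA_eq_charL 2 1)))
      (labelChar_mul (on_eq_labelChar hl hid 0 (extA_eq_charL 2 1))
        (on_eq_labelChar hl hid 1 rep27_eq_charL))))
    (by decide +kernel) (by decide +kernel) (by decide +kernel)

theorem branching_A3_A5_E7 : BranchingRule ![I 3, I 5] IIIstar
    (assemble fun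
      | 0 => chain 3 ![simpleE7 6, simpleE7 5]
      | 1 => chain 5 ![simpleE7 0, simpleE7 2, simpleE7 3, simpleE7 1])
    (on ![I 3, I 5] 1 (fundA 5) + on ![I 3, I 5] 0 (fundA 3) * on ![I 3, I 5] 1 (fundA 5) +
      on ![I 3, I 5] 0 (fundA 3) * on ![I 3, I 5] 1 (extA 5 2)) := by
  have hl : ∀ i : Fin 2, ((![rowsA 3, rowsA 5] : Fin 2 → List (List ℤ)) i).length =
      ((![vecsA 3, vecsA 5] : Fin 2 → List (List ℤ)) i).length := by decide
  have hid : ∀ i : Fin 2, IsFrame (LinearMap.id : Cartan ((![I 3, I 5] : Fin 2 → Kodaira) i).cover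
      →ₗ[ℂ] _) (rowForms _ ((![rowsA 3, rowsA 5] : Fin 2 → List (List ℤ)) i))
      ((![vecsA 3, vecsA 5] : Fin 2 → List (List ℤ)) i) := fun
    | 0 => isFrame_idA 3 (by norm_num)
    | 1 => isFrame_idA 5 (by norm_num)
  exact branchingRule_of_lists (T := ![I 3, I 5]) (T' := IIIstar) ![rowsA 3, rowsA 5]
    ![vecsA 3, vecsA 5]
    ![([6, 5] : List ℕ).map fun i => simpleL.getD i [],
      ([0, 2, 3, 1] : List ℕ).map fun i => simpleL.getD i []]
    ![rootsAL 3, rootsAL 5] rootsE7L hid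
    (fun
      | 0 => simple_isFrame (m := 3) (g := E7) rfl _ ![6, 5] fun l _ => by fin_cases l <;> rfl
      | 1 => simple_isFrame (m := 5) (g := E7) rfl _ ![0, 2, 3, 1] fun l _ => by
          fin_cases l <;> rfl)
    (fun
      | 0 => isRootList_A 3 (by decide +kernel)
      | 1 => isRootList_A 5 (by decide +kernel))
    isRootList_E7
    (add_conj_labelChar (labelChar_add (labelChar_add
        (on_eq_labelChar hl hid 1 (extA_eq_charL 5 1))
        (labelChar_mul (on_eq_labelChar hl hid 0 (extA_eq_charL 3 1))
          (on_eq_labelChar hl hid 1 (extA_eq_charL 5 1))))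
      (labelChar_mul (on_eq_labelChar hl hid 0 (extA_eq_charL 3 1))
        (on_eq_labelChar hl hid 1 (extA_eq_charL 5 2)))))
    (by decide +kernel) (by decide +kernel) (by decide +kernel)

theorem branching_A2_A3_A3_E6 : BranchingRule ![I 2, I 3, I 3] IVstar
    (assemble fun
      | 0 => chain 2 ![simpleE6 1]
      | 1 => chain 3 ![simpleE6 2, simpleE6 0]
      | 2 => chain 3 ![simpleE6 4, simpleE6 5])
    (on ![I 2, I 3, I 3] 1 (fundA 3) * on ![I 2, I 3, I 3] 2 (fundA 3) +
      on ![I 2, I 3, I 3] 0 (fundA 2) +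
      on ![I 2, I 3, I 3] 0 (fundA 2) * on ![I 2, I 3, I 3] 1 (fundA 3) *
        on ![I 2, I 3, I 3] 2 (fundA 3)) := by
  have hl : ∀ i : Fin 3, ((![rowsA 2, rowsA 3, rowsA 3] : Fin 3 → List (List ℤ)) i).length =
      ((![vecsA 2, vecsA 3, vecsA 3] : Fin 3 → List (List ℤ)) i).length := by decide
  have hid : ∀ i : Fin 3, IsFrame (LinearMap.id :
      Cartan ((![I 2, I 3, I 3] : Fin 3 → Kodaira) i).cover
      →ₗ[ℂ] _) (rowForms _ ((![rowsA 2, rowsA 3, rowsA 3] : Fin 3 → List (List ℤ)) i))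
      ((![vecsA 2, vecsA 3, vecsA 3] : Fin 3 → List (List ℤ)) i) := fun
    | 0 => isFrame_idA 2 (by norm_num)
    | 1 => isFrame_idA 3 (by norm_num)
    | 2 => isFrame_idA 3 (by norm_num)
  have h0 := on_eq_labelChar hl hid 0 (extA_eq_charL 2 1)
  have h1 := on_eq_labelChar hl hid 1 (extA_eq_charL 3 1)
  have h2 := on_eq_labelChar hl hid 2 (extA_eq_charL 3 1)
  exact branchingRule_of_lists (T := ![I 2, I 3, I 3]) (T' := IVstar) ![rowsA 2, rowsA 3, rowsA 3]
    ![vecsA 2, vecsA 3, vecsA 3]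
    ![[simpleL.getD 1 []], ([2, 0] : List ℕ).map fun i => simpleL.getD i [],
      ([4, 5] : List ℕ).map fun i => simpleL.getD i []]
    ![rootsAL 2, rootsAL 3, rootsAL 3] rootsE6L hid
    (fun
      | 0 => simple_isFrame (m := 2) (g := E6) rfl _ ![1] fun l _ => by fin_cases l; rfl
      | 1 => simple_isFrame (m := 3) (g := E6) rfl _ ![2, 0] fun l _ => by fin_cases l <;> rfl
      | 2 => simple_isFrame (m := 3) (g := E6) rfl _ ![4, 5] fun l _ => by fin_cases l <;> rfl)
    (fun
      | 0 => isRootList_A 2 (by decide +kernel)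
      | 1 => isRootList_A 3 (by decide +kernel)
      | 2 => isRootList_A 3 (by decide +kernel))
    isRootList_E6
    (add_conj_labelChar (labelChar_add (labelChar_add (labelChar_mul h1 h2) h0)
      (labelChar_mul (labelChar_mul h0 h1) h2)))
    (by decide +kernel) (by decide +kernel) (by decide +kernel)

end

end EllipticAnomaly

namespace EllipticAnomaly

noncomputable section

/-! ### Sums over roots of classical type -/

theorem sum_powersetCard_succ_insert {ι M : Type*} [DecidableEq ι] [AddCommMonoid M] {a : ι}
    {S : Finset ι} (ha : a ∉ S) (k : ℕ) (f : Finset ι → M) :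
    ∑ s ∈ (insert a S).powersetCard (k + 1), f s =
      ∑ s ∈ S.powersetCard (k + 1), f s + ∑ s ∈ S.powersetCard k, f (insert a s) := by
  rw [Finset.powersetCard_succ_insert ha, Finset.sum_union, Finset.sum_image]
  · intro s hs s' hs' h
    have hs0 : a ∉ s := fun h0' => ha ((Finset.mem_powersetCard.1 hs).1 h0')
    have hs0' : a ∉ s' := fun h0' => ha ((Finset.mem_powersetCard.1 hs').1 h0')
    rw [← Finset.erase_insert hs0, h, Finset.erase_insert hs0']
  · rw [Finset.disjoint_left]
    rintro s hs hs'
    obtain ⟨s', -, rfl⟩ := Finset.mem_image.1 hs'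
    exact ha ((Finset.mem_powersetCard.1 hs).1 (Finset.mem_insert_self a s'))

theorem sum_powersetCard_one {ι M : Type*} [AddCommMonoid M] (S : Finset ι)
    (f : Finset ι → M) : ∑ s ∈ S.powersetCard 1, f s = ∑ i ∈ S, f {i} := by
  rw [Finset.powersetCard_one, Finset.sum_map]; rfl

theorem sum_sum_add {ι V M : Type*} [AddCommMonoid V] [AddCommMonoid M]
    (S : Finset ι) (w : ι → V) (F : V → M) :
    ∑ i ∈ S, ∑ j ∈ S, F (w i + w j) =
      ∑ i ∈ S, F (w i + w i) + 2 • ∑ s ∈ S.powersetCard 2, F (∑ i ∈ s, w i) := by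
  classical
  induction S using Finset.induction_on with
  | empty => rw [Finset.powersetCard_eq_empty.2 (by simp)]; simp
  | insert a S ha ih =>
    simp only [Finset.sum_insert ha, Finset.sum_add_distrib, ih]
    rw [sum_powersetCard_succ_insert ha, sum_powersetCard_one]
    have h1 : ∑ i ∈ S, F (∑ k ∈ insert a {i}, w k) = ∑ i ∈ S, F (w a + w i) :=
      Finset.sum_congr rfl fun i hi => by
        rw [Finset.sum_pair (by rintro rfl; exact ha hi)]
    have h2 : ∑ i ∈ S, F (w i + w a) = ∑ i ∈ S, F (w a + w i) :=
      Finset.sum_congr rfl fun i _ => by rw [add_comm]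
    rw [h1, h2]
    abel

theorem sum_offDiag_eq {ι M : Type*} [DecidableEq ι] [AddCommGroup M] (S : Finset ι)
    (f : ι → ι → M) :
    ∑ p ∈ S.offDiag, f p.1 p.2 = ∑ i ∈ S, ∑ j ∈ S, f i j - ∑ i ∈ S, f i i := by
  rw [← Finset.sum_product', ← Finset.diag_union_offDiag,
    Finset.sum_union (Finset.disjoint_diag_offDiag S), Finset.sum_diag]
  abel

theorem sum_rootsA {M : Type*} [AddCommMonoid M] (n : ℕ) (f : (Fin n → ℚ) → M) :
    ∑ v ∈ rootsA n, f v = ∑ p ∈ (Finset.univ : Finset (Fin n)).offDiag, f (ε p.1 - ε p.2) := by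
  rw [rootsA, Finset.sum_image]
  rintro ⟨i, j⟩ hp ⟨k, l⟩ hq h
  have hij : i ≠ j := by simpa using hp
  have hkl : k ≠ l := by simpa using hq
  have h1 := congrFun h i
  have h2 := congrFun h j
  simp only [Pi.sub_apply, ε_apply] at h1 h2
  have e1 : i = k := by
    by_contra hne
    simp only [hij, hne, if_true, if_false] at h1
    split_ifs at h1 <;> norm_num at h1
  have e2 : j = l := by
    by_contra hne
    simp only [hij.symm, hne, if_true, if_false] at h2
    split_ifs at h2 <;> norm_num at h2
  rw [e1, e2]

theorem sum_ε_apply {n : ℕ} (s : Finset (Fin n)) (i : Fin n) :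
    (∑ j ∈ s, (ε j : Fin n → ℚ)) i = if i ∈ s then 1 else 0 := by
  simp [ε_apply]

theorem image_offDiag_add (n : ℕ) :
    ((Finset.univ : Finset (Fin n)).offDiag.image fun p => (ε p.1 + ε p.2 : Fin n → ℚ)) =
      ((Finset.univ : Finset (Fin n)).powersetCard 2).image fun s => ∑ i ∈ s, ε i := by
  ext v
  simp only [Finset.mem_image, Finset.mem_offDiag, Finset.mem_powersetCard, Finset.mem_univ,
    true_and, Finset.subset_univ, Prod.exists]
  constructor
  · rintro ⟨i, j, hij, rfl⟩
    exact ⟨{i, j}, Finset.card_pair hij, Finset.sum_pair hij⟩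
  · rintro ⟨s, hs, rfl⟩
    obtain ⟨i, j, hij, rfl⟩ := Finset.card_eq_two.1 hs
    exact ⟨i, j, hij, (Finset.sum_pair hij).symm⟩

theorem sum_ε_injective (n : ℕ) :
    Function.Injective fun s : Finset (Fin n) => ∑ i ∈ s, (ε i : Fin n → ℚ) := by
  intro s s' h
  ext i
  have := congrFun h i
  simp only [sum_ε_apply] at this
  by_cases h1 : i ∈ s <;> by_cases h2 : i ∈ s' <;> simp_all

theorem sum_rootsD {M : Type*} [AddCommMonoid M] (n : ℕ) (f : (Fin n → ℚ) → M) :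
    ∑ v ∈ rootsD n, f v = ∑ p ∈ (Finset.univ : Finset (Fin n)).offDiag, f (ε p.1 - ε p.2) +
      ∑ s ∈ (Finset.univ : Finset (Fin n)).powersetCard 2, f (∑ i ∈ s, ε i) +
      ∑ s ∈ (Finset.univ : Finset (Fin n)).powersetCard 2, f (-∑ i ∈ s, ε i) := by
  have hneg : ((Finset.univ : Finset (Fin n)).offDiag.image
      fun p => (-ε p.1 - ε p.2 : Fin n → ℚ)) =
      ((Finset.univ : Finset (Fin n)).powersetCard 2).image fun s => -∑ i ∈ s, ε i := by
    have := congrArg (Finset.image fun v : Fin n → ℚ => -v) (image_offDiag_add n)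
    rw [Finset.image_image, Finset.image_image] at this
    rw [← Function.comp_def, ← this]
    congr 1; ext p; simp; ring
  have hA (i j : Fin n) : ∑ k, (ε i - ε j : Fin n → ℚ) k = 0 := by
    simp [ε_apply, Finset.sum_sub_distrib]
  have hP (s : Finset (Fin n)) (hs : s ∈ Finset.univ.powersetCard 2) :
      ∑ k, (∑ i ∈ s, ε i : Fin n → ℚ) k = 2 := by
    simp only [sum_ε_apply]
    simp [(Finset.mem_powersetCard.1 hs).2]
  rw [rootsD, image_offDiag_add, hneg, Finset.sum_union, Finset.sum_union,
    Finset.sum_image (sum_ε_injective n).injOn,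
    Finset.sum_image (g := fun s : Finset (Fin n) => -∑ i ∈ s, (ε i : Fin n → ℚ))
      (neg_injective.comp (sum_ε_injective n)).injOn]
  · congr 2
    exact sum_rootsA n f
  · rw [Finset.disjoint_left]
    rintro v hv hv'
    obtain ⟨p, -, rfl⟩ := Finset.mem_image.1 hv
    obtain ⟨s, hs, h⟩ := Finset.mem_image.1 hv'
    have := hP s hs
    rw [h, hA] at this; norm_num at this
  · rw [Finset.disjoint_left]
    rintro v hv hv'
    obtain ⟨s', hs', h'⟩ := Finset.mem_image.1 hv'
    have e' : ∑ k, v k = -2 := by rw [← h', ← hP s' hs']; simp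
    rcases Finset.mem_union.1 hv with hv | hv
    · obtain ⟨p, -, rfl⟩ := Finset.mem_image.1 hv
      rw [hA] at e'; norm_num at e'
    · obtain ⟨s, hs, rfl⟩ := Finset.mem_image.1 hv
      rw [hP s hs] at e'; norm_num at e'

/-- The character with weights `ε i`. -/
def epsD (n : ℕ) : Rep (Cartan (D n)) := ∑ i, AddMonoidAlgebra.single (wt (D n) (ε i)) 1

/-- The character with weights `εᵢ + εⱼ`, for `i < j`. -/
def extD (n : ℕ) : Rep (Cartan (D n)) :=
  ∑ s ∈ (Finset.univ : Finset (Fin n)).powersetCard 2,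
    AddMonoidAlgebra.single (wt (D n) (∑ i ∈ s, ε i)) 1

theorem fundA_eq (m : ℕ) :
    fundA m = ∑ i : Fin m, AddMonoidAlgebra.single (wt (A m) (ε i)) 1 := by
  simp [fundA, extA, sum_powersetCard_one]

section

variable {h : Type} [AddCommGroup h] [Module ℂ h]

theorem sum_single_mul_conj {ι : Type*} (S : Finset ι) (w : ι → Module.Dual ℂ h) :
    (∑ i ∈ S, AddMonoidAlgebra.single (w i) (1 : ℚ)) *
      conj (∑ i ∈ S, AddMonoidAlgebra.single (w i) 1) =
      ∑ i ∈ S, ∑ j ∈ S, AddMonoidAlgebra.single (w i - w j) 1 := by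
  rw [conj_sum, Finset.sum_mul_sum]
  simp [sub_eq_add_neg]

theorem sum_single_sq {ι : Type*} (S : Finset ι) (w : ι → Module.Dual ℂ h) :
    (∑ i ∈ S, AddMonoidAlgebra.single (w i) (1 : ℚ)) ^ 2 =
      ∑ i ∈ S, AddMonoidAlgebra.single (w i + w i) 1 +
        2 • ∑ s ∈ S.powersetCard 2, AddMonoidAlgebra.single (∑ i ∈ s, w i) 1 := by
  rw [← sum_sum_add S w fun v => AddMonoidAlgebra.single v (1 : ℚ), sq, Finset.sum_mul_sum]
  simp

end

theorem ofWeights_rootsA (m : ℕ) :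
    ofWeights (A m) (GaugeAlg.roots (A m)) = fundA m * conj (fundA m) - (m : ℚ) • 1 := by
  have : ofWeights (A m) (GaugeAlg.roots (A m)) = _ :=
    sum_rootsA m fun v => AddMonoidAlgebra.single (wt (A m) v) 1
  rw [this, fundA_eq, sum_single_mul_conj,
    sum_offDiag_eq _ fun i j => AddMonoidAlgebra.single (wt (A m) (ε i - ε j)) (1 : ℚ)]
  congr 1
  · simp only [wt_sub (A m)]
  · simp only [sub_self, wt_zero (A m), Finset.sum_const, Finset.card_univ, Fintype.card_fin,
      ← AddMonoidAlgebra.one_def]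
    rw [← Nat.cast_smul_eq_nsmul ℚ]

theorem ofWeights_rootsD (n : ℕ) :
    ofWeights (D n) (GaugeAlg.roots (D n)) =
      epsD n * conj (epsD n) - (n : ℚ) • 1 + (extD n + conj (extD n)) := by
  have : ofWeights (D n) (GaugeAlg.roots (D n)) = _ :=
    sum_rootsD n fun v => AddMonoidAlgebra.single (wt (D n) v) 1
  rw [this, epsD, sum_single_mul_conj,
    sum_offDiag_eq _ fun i j => AddMonoidAlgebra.single (wt (D n) (ε i - ε j)) (1 : ℚ), add_assoc]
  congr 2
  · simp only [wt_sub (D n)]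
  · simp only [sub_self, wt_zero (D n), Finset.sum_const, Finset.card_univ, Fintype.card_fin,
      ← AddMonoidAlgebra.one_def]
    rw [← Nat.cast_smul_eq_nsmul ℚ]
  · simp only [extD, conj_sum, conj_single, wt_neg (D n)]

/-- The second Adams operation on characters with weights `w i`. -/
theorem two_smul_extA (m : ℕ) : (2 : ℚ) • extA m 2 = fundA m ^ 2 -
    ∑ i : Fin m, AddMonoidAlgebra.single (wt (A m) (ε i) + wt (A m) (ε i)) 1 := by
  rw [fundA_eq, sum_single_sq, extA, add_sub_cancel_left, ← Nat.cast_smul_eq_nsmul ℚ]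
  simp only [wt_sum (A m)]
  norm_num

theorem two_smul_extD (n : ℕ) : (2 : ℚ) • extD n = epsD n ^ 2 -
    ∑ i : Fin n, AddMonoidAlgebra.single (wt (D n) (ε i) + wt (D n) (ε i)) 1 := by
  rw [epsD, sum_single_sq, extD, add_sub_cancel_left, ← Nat.cast_smul_eq_nsmul ℚ]
  simp only [wt_sum (D n)]
  norm_num

theorem vectD_eq (n : ℕ) : vectD n = epsD n + conj (epsD n) := by
  rw [vectD, ofWeights, axisVectors, Finset.sum_union, Finset.sum_image, Finset.sum_image, epsD,
    conj_sum]
  · simp [wt_neg (D n)]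
  · intro i _ j _ h
    by_contra hne
    have := congrFun h i
    simp [ε_apply, hne] at this
  · intro i _ j _ h
    by_contra hne
    have := congrFun h i
    simp [ε_apply, hne] at this
  · rw [Finset.disjoint_left]
    rintro v hv hv'
    obtain ⟨i, -, rfl⟩ := Finset.mem_image.1 hv
    obtain ⟨j, -, h⟩ := Finset.mem_image.1 hv'
    have := congrFun h i
    simp only [Pi.smul_apply, ε_apply, smul_eq_mul] at this
    split_ifs at this <;> norm_num at this

end

end EllipticAnomaly

namespace EllipticAnomaly

noncomputable section

/-! ### Branching rules of classical type -/

theorem branchingRule_one {T T' : Kodaira} {ι : Cartan T.cover →ₗ[ℂ] Cartan T'.cover}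
    {χ : Rep (Cartan T.cover)} (hc : ∀ x : Cartan T.cover, IsCoroot x → IsCoroot (ι x))
    (h : pull ι (ofWeights T'.cover T'.cover.roots) =
      ofWeights T.cover T.cover.roots + (χ + conj χ)) :
    BranchingRule (fun _ : Fin 1 => T) T' (assemble fun _ => ι) (on (fun _ : Fin 1 => T) 0 χ) := by
  refine branchingRule_of_pull_roots (fun _ => hc) ?_
  have h1 : assemble (T := fun _ : Fin 1 => T) (T' := T') (fun _ => ι) =
      ι.comp (LinearMap.proj (R := ℂ) (φ := fun _ : Fin 1 => Cartan T.cover) 0) := by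
    simp [assemble]
  rw [h1, ← pull_pull, h, pull_add, pull_add, pull_conj]
  simp [on]

theorem dotProduct_rootsD {n : ℕ} {α : Fin n → ℚ} (h : α ∈ rootsD n) : α ⬝ᵥ α = 2 := by
  simp only [rootsD, Finset.mem_union, Finset.mem_image, Finset.mem_offDiag, Finset.mem_univ,
    true_and, Prod.exists] at h
  rcases h with (⟨i, j, hij, rfl⟩ | ⟨i, j, hij, rfl⟩) | ⟨i, j, hij, rfl⟩ <;>
  · simp [ε, add_dotProduct, sub_dotProduct, neg_dotProduct, hij, hij.symm]
    norm_num

theorem rootsA_subset_rootsD (n : ℕ) : rootsA n ⊆ rootsD n := fun _ hv =>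
  Finset.mem_union_left _ (Finset.mem_union_left _ hv)

/-- Padding by zeros, or truncation, on weights. -/
def padWeight {m : ℕ} (n : ℕ) (v : Fin m → ℚ) : Fin n → ℚ :=
  fun i => if h : (i : ℕ) < m then v ⟨i, h⟩ else 0

theorem padWeight_ε {m n : ℕ} (hmn : m ≤ n) (i : Fin m) :
    padWeight n (ε i) = ε (Fin.castLE hmn i) := by
  ext k
  simp only [padWeight, ε_apply, Fin.ext_iff, Fin.val_castLE]
  split_ifs <;> first | rfl | omega

theorem padWeight_add {m n : ℕ} (v v' : Fin m → ℚ) :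
    padWeight n (v + v') = padWeight n v + padWeight n v' := by
  ext k; simp only [padWeight, Pi.add_apply]; split_ifs <;> simp

theorem padWeight_neg {m n : ℕ} (v : Fin m → ℚ) : padWeight n (-v) = -padWeight n v := by
  ext k; simp only [padWeight, Pi.neg_apply]; split_ifs <;> simp

theorem padWeight_mem_rootsA {m n : ℕ} (hmn : m ≤ n) {α : Fin m → ℚ} (h : α ∈ rootsA m) :
    padWeight n α ∈ rootsA n := by
  simp only [rootsA, Finset.mem_image, Finset.mem_offDiag, Finset.mem_univ, true_and,
    Prod.exists] at h ⊢
  obtain ⟨i, j, hij, rfl⟩ := h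
  refine ⟨Fin.castLE hmn i, Fin.castLE hmn j, fun e => hij (Fin.castLE_injective hmn e), ?_⟩
  rw [sub_eq_add_neg, sub_eq_add_neg, padWeight_add, padWeight_neg, padWeight_ε hmn,
    padWeight_ε hmn]

theorem padWeight_mem_rootsD {m n : ℕ} (hmn : m ≤ n) {α : Fin m → ℚ} (h : α ∈ rootsD m) :
    padWeight n α ∈ rootsD n := by
  simp only [rootsD, Finset.mem_union, Finset.mem_image, Finset.mem_offDiag, Finset.mem_univ,
    true_and, Prod.exists] at h ⊢
  have hne {i j : Fin m} (hij : i ≠ j) : Fin.castLE hmn i ≠ Fin.castLE hmn j :=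
    fun e => hij (Fin.castLE_injective hmn e)
  rcases h with (⟨i, j, hij, rfl⟩ | ⟨i, j, hij, rfl⟩) | ⟨i, j, hij, rfl⟩
  · exact .inl (.inl ⟨_, _, hne hij, by
      rw [sub_eq_add_neg, sub_eq_add_neg, padWeight_add, padWeight_neg, padWeight_ε hmn,
        padWeight_ε hmn]⟩)
  · exact .inl (.inr ⟨_, _, hne hij, by rw [padWeight_add, padWeight_ε hmn, padWeight_ε hmn]⟩)
  · exact .inr ⟨_, _, hne hij, by
      rw [sub_eq_add_neg, sub_eq_add_neg, padWeight_add, padWeight_neg, padWeight_neg,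
        padWeight_ε hmn, padWeight_ε hmn]⟩

theorem isCoroot_pad {g g' : GaugeAlg} {p : Cartan g →ₗ[ℂ] Cartan g'}
    (hp : ∀ x (j : Fin g'.N), (p x : Fin g'.N → ℂ) j = pad g.N g'.N x j)
    (hg : ∀ α ∈ g.roots, α ⬝ᵥ α = 2) (hg' : ∀ α ∈ g'.roots, α ⬝ᵥ α = 2)
    (hr : ∀ α ∈ g.roots, padWeight g'.N α ∈ g'.roots) {x : Cartan g} (hx : IsCoroot x) :
    IsCoroot (p x) := by
  obtain ⟨α, hα, hxα⟩ := hx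
  refine ⟨_, hr α hα, fun j => ?_⟩
  rw [hp, pad_apply, hg' _ (hr α hα), padWeight]
  rw [hg α hα] at hxα
  split_ifs with h
  · exact hxα _
  · simp

theorem sum_eq_of_le {V M : Type*} [AddCommMonoid V] [AddCommMonoid M] {m n : ℕ}
    (w : Fin n → V) (w' : Fin m → V) (F : V → M)
    (hw : ∀ i : Fin n, w i = if h : (i : ℕ) < m then w' ⟨i, h⟩ else 0) :
    (n = m → ∑ i, F (w i) = ∑ i, F (w' i)) ∧ (n = m + 1 → ∑ i, F (w i) = ∑ i, F (w' i) + F 0) := by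
  constructor
  · rintro rfl
    exact Finset.sum_congr rfl fun i _ => by rw [hw, dif_pos i.2]
  · rintro rfl
    rw [Fin.sum_univ_castSucc]
    congr 1
    · exact Finset.sum_congr rfl fun i _ => by rw [hw, dif_pos (by simp)]; rfl
    · rw [hw, dif_neg (by simp)]

theorem wt_ε_comp_pad {g g' : GaugeAlg} {p : Cartan g →ₗ[ℂ] Cartan g'}
    (hp : ∀ x (j : Fin g'.N), (p x : Fin g'.N → ℂ) j = pad g.N g'.N x j) (i : Fin g'.N) :
    (wt g' (ε i)).comp p = if h : (i : ℕ) < g.N then wt g (ε ⟨i, h⟩) else 0 := by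
  ext x
  rw [LinearMap.comp_apply, wt_ε_apply, hp, pad_apply]
  split_ifs
  · rw [wt_ε_apply]
  · rfl

theorem two_smul_left_cancel {h : Type} [AddCommGroup h] [Module ℂ h] {χ χ' : Rep h}
    (e : (2 : ℚ) • χ = (2 : ℚ) • χ') : χ = χ' := by
  have := congrArg (fun y => (1 / 2 : ℚ) • y) e
  simpa [smul_smul] using this

theorem branching_A_succ (m : ℕ) : BranchingRule (fun _ : Fin 1 => I m) (I (m + 1))
    (assemble fun _ => embAA m) (on (fun _ : Fin 1 => I m) 0 (fundA m)) := by
  refine branchingRule_one (T := I m) (T' := I (m + 1)) (fun x hx => isCoroot_pad (g := A m)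
    (g' := A (m + 1)) (fun _ _ => rfl) (fun α h => dotProduct_rootsD (rootsA_subset_rootsD _ h))
    (fun α h => dotProduct_rootsD (rootsA_subset_rootsD _ h))
    (fun α h => padWeight_mem_rootsA (Nat.le_succ m) h) hx) ?_
  have e : pull (embAA m) (fundA (m + 1)) = fundA m + 1 := by
    rw [fundA_eq, fundA_eq, pull_sum]
    simp only [pull_single]
    rw [(sum_eq_of_le _ (fun i => wt (A m) (ε i)) (fun w => AddMonoidAlgebra.single w (1 : ℚ))
      (wt_ε_comp_pad (g := A m) (g' := A (m + 1)) (p := embAA m) fun _ _ => rfl)).2 rfl,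
      AddMonoidAlgebra.one_def]
  change pull (embAA m) (ofWeights (A (m + 1)) (GaugeAlg.roots (A (m + 1)))) =
    ofWeights (A m) (GaugeAlg.roots (A m)) + (fundA m + conj (fundA m))
  rw [ofWeights_rootsA, ofWeights_rootsA, pull_sub, pull_mul, pull_conj, pull_smul, pull_one, e,
    conj_add, conj_one]
  have : (((m + 1 : ℕ) : ℚ) • (1 : Rep (Cartan (A m)))) = (m : ℚ) • 1 + 1 := by
    push_cast; module
  rw [this]
  ring

section

variable {m n : ℕ} {g : GaugeAlg} (p : Cartan g →ₗ[ℂ] Cartan (D n))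
  (hp : ∀ x (j : Fin n), (p x : Fin n → ℂ) j = pad g.N n x j)

theorem pull_epsD (hp : ∀ x (j : Fin n), (p x : Fin n → ℂ) j = pad g.N n x j) :
    (n = g.N → pull p (epsD n) = ∑ i, AddMonoidAlgebra.single (wt g (ε i)) 1) ∧
    (n = g.N + 1 → pull p (epsD n) = ∑ i, AddMonoidAlgebra.single (wt g (ε i)) 1 + 1) := by
  rw [epsD, pull_sum]
  simp only [pull_single]
  exact sum_eq_of_le _ (fun i => wt g (ε i)) (fun w => AddMonoidAlgebra.single w (1 : ℚ))
      (wt_ε_comp_pad (g' := D n) hp)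

theorem pull_extD (hp : ∀ x (j : Fin n), (p x : Fin n → ℂ) j = pad g.N n x j)
    {χ Λ : Rep (Cartan g)} (hχ : χ = ∑ i, AddMonoidAlgebra.single (wt g (ε i)) 1)
    (hΛ : (2 : ℚ) • Λ = χ ^ 2 - ∑ i, AddMonoidAlgebra.single (wt g (ε i) + wt g (ε i)) 1) :
    (n = g.N → pull p (extD n) = Λ) ∧ (n = g.N + 1 → pull p (extD n) = Λ + χ) := by
  have h1 := pull_epsD p hp
  have h2 : pull p (∑ i : Fin n, AddMonoidAlgebra.single (wt (D n) (ε i) + wt (D n) (ε i)) 1) =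
      ∑ i : Fin n, AddMonoidAlgebra.single
        ((wt (D n) (ε i)).comp p + (wt (D n) (ε i)).comp p) 1 := by
    rw [pull_sum]; simp [LinearMap.add_comp]
  have h3 := sum_eq_of_le (fun i : Fin n => (wt (D n) (ε i)).comp p) (fun i => wt g (ε i))
    (fun w => AddMonoidAlgebra.single (w + w) (1 : ℚ)) (wt_ε_comp_pad (g' := D n) hp)
  have h4 : (2 : ℚ) • pull p (extD n) = pull p (epsD n) ^ 2 - ∑ i : Fin n,
      AddMonoidAlgebra.single ((wt (D n) (ε i)).comp p + (wt (D n) (ε i)).comp p) 1 := by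
    rw [← pull_smul, two_smul_extD, pull_sub, h2, sq, sq, pull_mul]
  constructor
  · intro hn
    apply two_smul_left_cancel
    rw [h4, h1.1 hn, h3.1 hn, hΛ, hχ]
  · intro hn
    apply two_smul_left_cancel
    rw [h4, h1.2 hn, h3.2 hn, smul_add, hΛ, ← hχ, add_zero, ← AddMonoidAlgebra.one_def,
      show (2 : ℚ) • χ = 2 * χ by rw [two_mul, two_smul]]
    ring

end

theorem fundA_eq_sum (m : ℕ) :
    fundA m = ∑ i : Fin (A m).N, AddMonoidAlgebra.single (wt (A m) (ε i)) 1 := fundA_eq m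

theorem branching_A_D (m j : ℕ) (h : j + 4 = m) : BranchingRule (fun _ : Fin 1 => I m) (Istar j)
    (assemble fun _ => embAD m (j + 4)) (on (fun _ : Fin 1 => I m) 0 (extA m 2)) := by
  refine branchingRule_one (T := I m) (T' := Istar j) (fun x hx => isCoroot_pad (g := A m)
    (g' := D (j + 4)) (fun _ _ => rfl) (fun α h => dotProduct_rootsD (rootsA_subset_rootsD _ h))
    (fun α h => dotProduct_rootsD h)
    (fun α ha => padWeight_mem_rootsD h.ge (rootsA_subset_rootsD _ ha)) hx) ?_
  have e1 := (pull_epsD (g := A m) (embAD m (j + 4)) fun _ _ => rfl).1 h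
  have e2 := (pull_extD (g := A m) (embAD m (j + 4)) (fun _ _ => rfl) (fundA_eq m)
    (two_smul_extA m)).1 h
  rw [← fundA_eq_sum] at e1
  change pull (embAD m (j + 4)) (ofWeights (D (j + 4)) (GaugeAlg.roots (D (j + 4)))) =
    ofWeights (A m) (GaugeAlg.roots (A m)) + (extA m 2 + conj (extA m 2))
  rw [ofWeights_rootsA, ofWeights_rootsD, pull_add, pull_add, pull_sub, pull_mul, pull_conj,
    pull_conj, pull_smul, pull_one, e1, e2, h]

theorem branching_A_D_succ (m j : ℕ) (h : j + 4 = m + 1) :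
    BranchingRule (fun _ : Fin 1 => I m) (Istar j) (assemble fun _ => embAD m (j + 4))
      (on (fun _ : Fin 1 => I m) 0 ((2 : ℚ) • fundA m + extA m 2)) := by
  refine branchingRule_one (T := I m) (T' := Istar j) (fun x hx => isCoroot_pad (g := A m)
    (g' := D (j + 4)) (fun _ _ => rfl) (fun α h => dotProduct_rootsD (rootsA_subset_rootsD _ h))
    (fun α h => dotProduct_rootsD h)
    (fun α ha => padWeight_mem_rootsD (show m ≤ j + 4 by omega) (rootsA_subset_rootsD _ ha)) hx) ?_
  have e1 := (pull_epsD (g := A m) (embAD m (j + 4)) fun _ _ => rfl).2 h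
  have e2 := (pull_extD (g := A m) (embAD m (j + 4)) (fun _ _ => rfl) (fundA_eq m)
    (two_smul_extA m)).2 h
  rw [← fundA_eq_sum] at e1
  change pull (embAD m (j + 4)) (ofWeights (D (j + 4)) (GaugeAlg.roots (D (j + 4)))) =
    ofWeights (A m) (GaugeAlg.roots (A m)) + ((2 : ℚ) • fundA m + extA m 2 +
      conj ((2 : ℚ) • fundA m + extA m 2))
  rw [ofWeights_rootsA, ofWeights_rootsD, pull_add, pull_add, pull_sub, pull_mul, pull_conj,
    pull_conj, pull_smul, pull_one, e1, e2, h]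
  have e : (((m + 1 : ℕ) : ℚ) • (1 : Rep (Cartan (A m)))) = (m : ℚ) • 1 + 1 := by
    push_cast; module
  rw [e, conj_add, conj_add, conj_add, conj_one, conj_smul, two_smul, two_smul]
  ring

theorem branching_D_succ (j j' : ℕ) (h : j' = j + 1) :
    BranchingRule (fun _ : Fin 1 => Istar j) (Istar j')
      (assemble fun _ => embDD (j + 4) (j' + 4))
      (on (fun _ : Fin 1 => Istar j) 0 (vectD (j + 4))) := by
  refine branchingRule_one (T := Istar j) (T' := Istar j') (fun x hx => isCoroot_pad
    (g := D (j + 4)) (g' := D (j' + 4)) (fun _ _ => rfl) (fun α h => dotProduct_rootsD h)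
    (fun α h => dotProduct_rootsD h)
    (fun α ha => padWeight_mem_rootsD (show j + 4 ≤ j' + 4 by omega) ha) hx) ?_
  have e1 := (pull_epsD (g := D (j + 4)) (embDD (j + 4) (j' + 4)) fun _ _ => rfl).2 (by simp [h])
  have e2 := (pull_extD (g := D (j + 4)) (embDD (j + 4) (j' + 4)) (fun _ _ => rfl) rfl
    (two_smul_extD (j + 4))).2 (by simp [h])
  change _ = epsD (j + 4) + 1 at e1
  change _ = extD (j + 4) + epsD (j + 4) at e2
  change pull (embDD (j + 4) (j' + 4)) (ofWeights (D (j' + 4)) (GaugeAlg.roots (D (j' + 4)))) =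
    ofWeights (D (j + 4)) (GaugeAlg.roots (D (j + 4))) + (vectD (j + 4) + conj (vectD (j + 4)))
  have hconj : conj (conj (epsD (j + 4))) = epsD (j + 4) := by
    rw [epsD, conj_sum, conj_sum]; simp
  rw [ofWeights_rootsD, ofWeights_rootsD, pull_add, pull_add, pull_sub, pull_mul, pull_conj,
    pull_conj, pull_smul, pull_one, e1, e2, h, vectD_eq]
  have e : (((j + 1 + 4 : ℕ) : ℚ) • (1 : Rep (Cartan (D (j + 4))))) =
      ((j + 4 : ℕ) : ℚ) • 1 + 1 := by
    push_cast; module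
  rw [e, conj_add, conj_add, conj_add, conj_one, hconj]
  ring

end

end EllipticAnomaly

namespace EllipticAnomaly
noncomputable section

/-! ### Restriction of the Tate representations to the smaller gauge algebras -/

/-- The weights of the standard representation of `𝔰𝔭(n)`. -/
def signedε {n : ℕ} (p : Fin n × Bool) : Fin n → ℚ := if p.2 then -ε p.1 else ε p.1

theorem fundC_eq (n : ℕ) :
    fundC n = ∑ p : Fin n × Bool, AddMonoidAlgebra.single (wt (C n) (signedε p)) 1 := by
  simp [fundC, extC, sum_powersetCard_one, signedε]

theorem two_smul_extC (n : ℕ) : (2 : ℚ) • extC n 2 = fundC n ^ 2 -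
    ∑ p : Fin n × Bool,
      AddMonoidAlgebra.single (wt (C n) (signedε p) + wt (C n) (signedε p)) 1 := by
  rw [fundC_eq, sum_single_sq, add_sub_cancel_left, extC]
  simp only [wt_sum (C n)]
  rfl

theorem extC_zero (n : ℕ) : extC n 0 = 1 := by
  simp [extC, wt_zero, AddMonoidAlgebra.one_def]

/-- The position of the weights of `𝔰𝔭([m/2])` among those of `𝔰𝔲(m)`. -/
def mirrorPosition (m : ℕ) : Fin (m / 2) × Bool → Fin m
  | (i, false) => ⟨i, by omega⟩
  | (i, true) => (⟨i, by omega⟩ : Fin m).rev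

theorem mirrorPosition_val (m : ℕ) (i : Fin (m / 2)) :
    (mirrorPosition m (i, false) : ℕ) = i ∧ (mirrorPosition m (i, true) : ℕ) = m - (i + 1) :=
  ⟨rfl, Fin.val_rev _⟩

def mirrorIndex (m : ℕ) : Fin (m / 2) × Bool ↪ Fin m where
  toFun := mirrorPosition m
  inj' := by
    rintro ⟨i, b⟩ ⟨j, c⟩ h
    rw [Fin.ext_iff] at h
    have h1 := mirrorPosition_val m i
    have h2 := mirrorPosition_val m j
    cases b <;> cases c <;> simp only [h1, h2] at h <;>
      simp only [Prod.mk.injEq, and_true, Fin.ext_iff, reduceCtorEq, and_false] <;> omega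

theorem wt_comp_foldA (m : ℕ) (p : Fin (m / 2) × Bool) :
    (wt (A m) (ε (mirrorIndex m p))).comp (foldA m) = wt (C (m / 2)) (signedε p) := by
  ext x
  obtain ⟨i, b⟩ := p
  rw [LinearMap.comp_apply, wt_ε_apply (A m)]
  cases b
  · change mirror m x.1 ⟨i, _⟩ = wt (C (m / 2)) (ε i) x
    rw [wt_ε_apply (C (m / 2))]
    simp [mirror]
  · change mirror m x.1 (Fin.rev ⟨i, _⟩) = wt (C (m / 2)) (-ε i) x
    rw [wt_neg (C (m / 2)), LinearMap.neg_apply, wt_ε_apply (C (m / 2)), mirror_rev]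
    simp [mirror]

theorem middle_notMem {m : ℕ} (hm : m % 2 = 1) (h : m / 2 < m) :
    (⟨m / 2, h⟩ : Fin m) ∉ (Finset.univ : Finset (Fin (m / 2) × Bool)).map (mirrorIndex m) := by
  simp only [Finset.mem_map, Finset.mem_univ, true_and, not_exists]
  rintro ⟨i, b⟩ h
  have hi := i.2
  have h1 := mirrorPosition_val m i
  replace h : (mirrorPosition m (i, b) : ℕ) = m / 2 := congrArg Fin.val h
  cases b <;> simp only [h1] at h <;> omega

theorem mirrorIndex_range_even {m : ℕ} (hm : m % 2 = 0) :
    (Finset.univ : Finset (Fin (m / 2) × Bool)).map (mirrorIndex m) = Finset.univ := by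
  refine Finset.eq_univ_of_card _ ?_
  simp
  omega

theorem mirrorIndex_range_odd {m : ℕ} (hm : m % 2 = 1) :
    (Finset.univ : Finset (Fin m)) = insert ⟨m / 2, by omega⟩
      ((Finset.univ : Finset (Fin (m / 2) × Bool)).map (mirrorIndex m)) := by
  symm
  refine Finset.eq_univ_of_card _ ?_
  rw [Finset.card_insert_of_notMem]
  · simp
    omega
  · exact middle_notMem hm _

theorem wt_comp_foldA_middle {m : ℕ} (hm : m % 2 = 1) :
    (wt (A m) (ε (⟨m / 2, by omega⟩ : Fin m))).comp (foldA m) = 0 := by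
  ext x
  rw [LinearMap.comp_apply, wt_ε_apply (A m)]
  change mirror m x.1 _ = _
  have : ¬ (m - (m / 2 + 1) < m / 2) := by omega
  simp [mirror, Fin.val_rev, this]

theorem sum_comp_foldA_odd {M : Type*} [AddCommMonoid M] {m : ℕ} (hm : m % 2 = 1)
    (f : Module.Dual ℂ (Cartan (C (m / 2))) → M) :
    ∑ i : Fin m, f ((wt (A m) (ε i)).comp (foldA m)) = f 0 + ∑ p, f (wt (C (m / 2)) (signedε p)) := by
  rw [mirrorIndex_range_odd hm, Finset.sum_insert, Finset.sum_map]
  · exact congrArg₂ _ (congrArg f (wt_comp_foldA_middle hm))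
      (Finset.sum_congr rfl fun p _ => congrArg f (wt_comp_foldA m p))
  · exact middle_notMem hm _

theorem pull_extA_foldA {m : ℕ} (hm : m % 2 = 0) (k : ℕ) :
    pull (foldA m) (extA m k) = extC (m / 2) k := by
  rw [extA, pull_sum, ← mirrorIndex_range_even hm, Finset.powersetCard_map, Finset.sum_map, extC]
  refine Finset.sum_congr rfl fun s _ => ?_
  rw [pull_single, wt_sum (A m), wt_sum (C (m / 2))]
  congr 1
  change (∑ j ∈ s.map (mirrorIndex m), wt (A m) (ε j)).comp (foldA m) = _
  rw [Finset.sum_map]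
  ext1 x
  simp only [LinearMap.comp_apply, LinearMap.sum_apply]
  refine Finset.sum_congr rfl fun p _ => ?_
  exact LinearMap.congr_fun (wt_comp_foldA m p) x

theorem pull_fundA_even {m : ℕ} (hm : m % 2 = 0) :
    pull (foldA m) (fundA m) = fundC (m / 2) := pull_extA_foldA hm 1

theorem pull_fundA_odd {m : ℕ} (hm : m % 2 = 1) :
    pull (foldA m) (fundA m) = fundC (m / 2) + 1 := by
  rw [fundA_eq, fundC_eq, pull_sum]
  simp only [pull_single]
  rw [sum_comp_foldA_odd hm fun w => (AddMonoidAlgebra.single w 1 : Rep (Cartan (C (m / 2)))),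
    add_comm, AddMonoidAlgebra.one_def]

theorem pull_extA_two_odd {m : ℕ} (hm : m % 2 = 1) :
    pull (foldA m) (extA m 2) = extC (m / 2) 2 + fundC (m / 2) := by
  have h := congrArg (pull (foldA m)) (two_smul_extA m)
  have h2 := two_smul_extC (m / 2)
  rw [pull_sub, pow_two, pull_mul, pull_fundA_odd hm, pull_sum, pull_smul] at h
  simp only [pull_single, LinearMap.add_comp] at h
  rw [sum_comp_foldA_odd hm fun w => (AddMonoidAlgebra.single (w + w) 1 :
    Rep (Cartan (C (m / 2))))] at h
  rw [add_zero, ← AddMonoidAlgebra.one_def] at h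
  have h3 : (2 : ℚ) • pull (foldA m) (extA m 2) =
      (2 : ℚ) • (extC (m / 2) 2 + fundC (m / 2)) := by
    rw [h, smul_add, h2, two_smul ℚ (fundC _)]
    ring
  exact smul_right_injective _ (two_ne_zero : (2 : ℚ) ≠ 0) h3

theorem extC_one_two : extC 1 2 = 1 := by
  have h : (Finset.univ : Finset (Fin 1 × Bool)).powersetCard 2 = {Finset.univ} := by decide
  rw [extC, h, Finset.sum_singleton]
  simp [Fintype.sum_prod_type, wt_zero, AddMonoidAlgebra.one_def]

theorem sum_axisVectors_smul {M : Type*} [AddCommMonoid M] (n : ℕ) {c : ℚ} (hc : 0 < c)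
    (f : (Fin n → ℚ) → M) :
    ∑ v ∈ axisVectors n c, f v = ∑ i : Fin n, (f (c • ε i) + f ((-c) • ε i)) := by
  have hinj (c : ℚ) (hc : c ≠ 0) : Function.Injective fun i : Fin n => c • (ε i : Fin n → ℚ) := by
    intro i j h
    by_contra hne
    have := congrFun h i
    simp [ε_apply, hc, hne] at this
  rw [axisVectors, Finset.sum_union, Finset.sum_image (hinj _ hc.ne').injOn,
    Finset.sum_image (hinj _ (neg_ne_zero.2 hc.ne')).injOn, Finset.sum_add_distrib]
  simp only [Finset.disjoint_left, Finset.mem_image, Finset.mem_univ, true_and]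
  rintro _ ⟨i, rfl⟩ ⟨j, h⟩
  have := congrFun h i
  simp only [Pi.smul_apply, ε_apply, smul_eq_mul] at this
  split_ifs at this <;> linarith

theorem sum_axisVectors {M : Type*} [AddCommMonoid M] (n : ℕ) (f : (Fin n → ℚ) → M) :
    ∑ v ∈ axisVectors n 1, f v = ∑ i : Fin n, (f (ε i) + f (-ε i)) := by
  simpa using sum_axisVectors_smul n one_pos f

theorem wt_comp_foldD (j : ℕ) (v : Fin (j + 4) → ℚ) :
    (wt (D (j + 4)) v).comp (foldD j) = wt (B (j + 3)) (fun i => v i.castSucc) := by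
  ext x
  rw [LinearMap.comp_apply, wt_apply, wt_apply]
  change ∑ i : Fin (j + 3 + 1), (v i : ℂ) * pad (j + 3) (j + 4) x.1 i = _
  rw [Fin.sum_univ_castSucc]
  simp [pad]

theorem pull_vectD (j : ℕ) : pull (foldD j) (vectD (j + 4)) = vectB (j + 3) + 1 := by
  have h1 (i : Fin (j + 3)) : (fun k : Fin (j + 3) => (ε i.castSucc : Fin (j + 4) → ℚ) k.castSucc) =
      ε i := by ext k; simp [ε_apply]
  have h2 : (fun k : Fin (j + 3) => (ε (Fin.last (j + 3)) : Fin (j + 4) → ℚ) k.castSucc) = 0 := by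
    ext k; simp [ε_apply, Fin.ext_iff]; omega
  have h3 (v : Fin (j + 4) → ℚ) : (fun k : Fin (j + 3) => (-v) k.castSucc) =
    -fun k : Fin (j + 3) => v k.castSucc := rfl
  rw [vectD, ofWeights, sum_axisVectors, pull_sum, vectB, ofWeights, sum_axisVectors]
  simp only [pull_add, pull_single]
  have key (v : Fin (j + 4) → ℚ) : (AddMonoidAlgebra.single ((wt (D (j + 4)) v).comp (foldD j)) 1 :
      Rep (Cartan (B (j + 3)))) =
      AddMonoidAlgebra.single (wt (B (j + 3)) fun i => v i.castSucc) 1 :=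
    congrArg (fun w => AddMonoidAlgebra.single w 1) (wt_comp_foldD j v)
  rw [Finset.sum_congr rfl fun i _ => congrArg₂ (· + ·) (key (ε i)) (key (-ε i))]
  change ∑ i : Fin (j + 3 + 1), _ = _
  rw [Fin.sum_univ_castSucc]
  simp only [h3, h1, h2, neg_zero, wt_zero, ← AddMonoidAlgebra.one_def]
  abel

theorem isFrame_idB (n : ℕ) :
    IsFrame (LinearMap.id : Cartan (B n) →ₗ[ℂ] _) (rowForms (B n) (unitRows n)) (unitVecs n) :=
  isFrame_unit (g := B n) (g' := B n) _ fun x j => by rw [pad_apply, dif_pos j.2]; rfl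

theorem pull_id {h : Type} [AddCommGroup h] [Module ℂ h] (χ : Rep h) :
    pull LinearMap.id χ = χ := by
  induction χ using AddMonoidAlgebra.induction_linear with
  | zero => rw [pull_eq, map_zero]
  | add f g hf hg => rw [pull_add, hf, hg]
  | single w c => rw [pull_single, LinearMap.comp_id]

theorem pull_spinD_of_perm {j : ℕ} (h : IsSimpleList (j + 4) (spinL (j + 4) true))
    (h' : IsSimpleList (j + 3) (spinL (j + 3) true ++ spinL (j + 3) false))
    (hp : ((spinL (j + 4) true).map (labels (j + 4) (unitVecs (j + 3)))).Perm
      ((spinL (j + 3) true ++ spinL (j + 3) false).map (labels (j + 3) (unitVecs (j + 3))))) :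
    pull (foldD j) (spinD (j + 4)) = spinB (j + 3) := by
  have e : spinB (j + 3) = charL (B (j + 3)) (spinL (j + 3) true ++ spinL (j + 3) false) :=
    (enumerates_spin (j + 3)).ofWeights_eq (g := B (j + 3)) h'
  rw [spinD_eq_charL h, (isFrame_unit (g := B (j + 3)) (g' := D (j + 4)) (foldD j)
    fun _ _ => rfl).pull_charL, labelChar_perm _ hp, e, ← (isFrame_idB (j + 3)).pull_charL, pull_id]

theorem pull_rep27 : pull foldE rep27 = rep26 + 1 := by
  have hid : IsFrame (LinearMap.id : Cartan F4 →ₗ[ℂ] _) (rowForms F4 (unitRows 4)) (unitVecs 4) :=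
    isFrame_unit (g := F4) (g' := F4) _ fun x j => by rw [pad_apply, dif_pos j.2]; rfl
  have e : ofWeights F4 (axisVectors 4 1 ∪ spinVectors 4) =
      charL F4 (axisL 4 ++ (spinL 4 true ++ spinL 4 false)) :=
    ((enumerates_axis 4).union (enumerates_spin 4)).ofWeights_eq (g := F4) (by decide +kernel)
  have e2 : rep26 + 1 =
      charL F4 (axisL 4 ++ (spinL 4 true ++ spinL 4 false) ++ [[]] ++ [[]] ++ [[]]) := by
    rw [← charL_add (charL_add (charL_add e (charL_one F4)) (charL_one F4)) (charL_one F4), rep26]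
    module
  rw [e2, rep27_eq_charL, (isFrame_unit (g := F4) (g' := E6) foldE fun _ _ => rfl).pull_charL,
    ← pull_id (charL F4 _), hid.pull_charL]
  exact labelChar_perm _ (by decide +kernel)

theorem pull_rhoSqrtBeta (T : Kodaira) (s : Bool) (hT : s = false → T.HasMonodromyCover) :
    ∃ c : ℚ, pull (foldMap T s) (rhoSqrtBeta T true) = rhoSqrtBeta T s + c • 1 := by
  cases s with
  | true =>
    refine ⟨0, ?_⟩
    have : foldMap T true = LinearMap.id := by cases T <;> rfl
    rw [this]
    simpa using pull_id _
  | false =>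
    cases T with
    | I m =>
      have hm : 3 ≤ m := hT rfl
      change ∃ c : ℚ, pull (foldA m) (if m ≤ 2 then 0 else if m = 3 then fundA m else extA m 2) =
        (if m % 2 = 0 then extIrrC (m / 2) 2 else extIrrC (m / 2) 2 + fundC (m / 2)) + c • 1
      rw [if_neg (by omega)]
      by_cases h3 : m = 3
      · subst h3
        refine ⟨1, ?_⟩
        have : extIrrC (3 / 2) 2 = 0 := by
          change extC 1 2 - extC 1 0 = 0
          rw [extC_one_two, extC_zero, sub_self]
        rw [if_pos rfl, if_neg (by norm_num), pull_fundA_odd (by norm_num), this, zero_add, one_smul]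
      · refine ⟨1, ?_⟩
        have : extIrrC (m / 2) 2 = extC (m / 2) 2 - 1 := by rw [extIrrC, extC_zero]
        rw [if_neg h3]
        split_ifs with h
        · rw [pull_extA_foldA h, this, one_smul]
          ring
        · rw [pull_extA_two_odd (by omega), this, one_smul]
          ring
    | IV =>
      refine ⟨3, ?_⟩
      change pull (foldA 3) ((3 : ℚ) • fundA 3) = (3 : ℚ) • fundC 1 + _
      rw [pull_smul, pull_fundA_odd (by norm_num), smul_add]
    | Istar j => exact ⟨1, by rw [one_smul]; exact pull_vectD j⟩
    | IVstar => exact ⟨1, by rw [one_smul]; exact pull_rep27⟩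
    | III => exact (hT rfl).elim
    | IIIstar => exact (hT rfl).elim
    | IIstar => exact (hT rfl).elim

theorem pull_rhoGamma (T : Kodaira) (s : Bool) (hT : s = false → T.HasMonodromyCover) :
    ∃ c : ℚ, pull (foldMap T s) (rhoGamma T true) = rhoGamma T s + c • 1 := by
  cases s with
  | true =>
    refine ⟨0, ?_⟩
    have : foldMap T true = LinearMap.id := by cases T <;> rfl
    rw [this]
    simpa using pull_id _
  | false =>
    have h0 {h h' : Type} [AddCommGroup h] [Module ℂ h] [AddCommGroup h'] [Module ℂ h']
        (i : h →ₗ[ℂ] h') : pull i 0 = 0 + (0 : ℚ) • 1 := by rw [pull_eq, map_zero]; simp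
    cases T with
    | I m =>
      change ∃ c : ℚ, pull (foldA m) (fundA m) = fundC (m / 2) + c • 1
      rcases Nat.mod_two_eq_zero_or_one m with h | h
      · exact ⟨0, by rw [pull_fundA_even h]; simp⟩
      · exact ⟨1, by rw [pull_fundA_odd h, one_smul]⟩
    | IV => exact ⟨0, h0 _⟩
    | Istar j =>
      match j with
      | 0 => exact (Nat.not_succ_le_zero _ (hT rfl)).elim
      | 1 =>
        refine ⟨0, ?_⟩
        change pull (foldD 1) (spinD 5) = spinB 4 + _
        rw [pull_spinD_of_perm (by decide +kernel) (by decide +kernel) (by decide +kernel)]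
        simp
      | 2 =>
        refine ⟨0, ?_⟩
        change pull (foldD 2) ((1 / 2 : ℚ) • spinD 6) = (1 / 2 : ℚ) • spinB 5 + _
        rw [pull_smul,
          pull_spinD_of_perm (by decide +kernel) (by decide +kernel) (by decide +kernel)]
        simp
      | 3 =>
        refine ⟨1, ?_⟩
        change pull (foldD 3) ((1 / 4 : ℚ) • spinD 7 + vectD 7) =
          (1 / 4 : ℚ) • spinB 6 + vectB 6 + _
        rw [pull_add, pull_smul, pull_vectD 3,
          pull_spinD_of_perm (by decide +kernel) (by decide +kernel) (by decide +kernel)]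
        simp [add_assoc]
      | j + 4 => exact ⟨0, h0 _⟩
    | IVstar => exact ⟨0, h0 _⟩
    | III => exact (hT rfl).elim
    | IIIstar => exact (hT rfl).elim
    | IIstar => exact (hT rfl).elim

theorem Tr_pull_add_smul_one {h h' : Type} [AddCommGroup h] [Module ℂ h] [AddCommGroup h']
    [Module ℂ h'] {i : h →ₗ[ℂ] h'} {χ' : Rep h'} {χ : Rep h} {c : ℚ}
    (e : pull i χ' = χ + c • 1) {k : ℕ} (hk : k ≠ 0) (F : h) : Tr k χ F = Tr k χ' (i F) := by
  rw [← Tr_pull, e, Tr_add, Tr_smul, Tr_one hk, mul_zero, add_zero]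

theorem Tr_tateRep (T : Kodaira) (s : Bool) (hT : s = false → T.HasMonodromyCover)
    (β γ : Option Mero) {k : ℕ} (hk : k ≠ 0) (F : Cartan (T.gauge s)) :
    Tr k (tateRep T s β γ) F = (ord β : ℂ) / 2 * Tr k (rhoSqrtBeta T true) (foldMap T s F) +
      ord γ * Tr k (rhoGamma T true) (foldMap T s F) := by
  obtain ⟨_, hβ⟩ := pull_rhoSqrtBeta T s hT
  obtain ⟨_, hγ⟩ := pull_rhoGamma T s hT
  rw [tateRep, Tr_add, Tr_smul, Tr_smul, Tr_pull_add_smul_one hβ hk, Tr_pull_add_smul_one hγ hk]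
  push_cast
  ring

theorem normTr_gauge (T : Kodaira) (s : Bool) (hT : s = false → T.HasMonodromyCover)
    (F : Cartan (T.gauge s)) : normTr (T.gauge s) F = normTr T.cover (foldMap T s F) := by
  cases s with
  | true =>
    have : foldMap T true = LinearMap.id := by cases T <;> rfl
    rw [this]
    rfl
  | false =>
    cases T with
    | I m =>
      change Tr 2 (fundC (m / 2)) F = Tr 2 (fundA m) (foldA m F)
      rcases Nat.mod_two_eq_zero_or_one m with h | h
      · rw [← pull_fundA_even h, Tr_pull]
      · exact Tr_pull_add_smul_one (c := 1) (by rw [pull_fundA_odd h, one_smul]) two_ne_zero F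
    | IV =>
      exact Tr_pull_add_smul_one (i := foldA 3) (χ := fundC 1) (c := 1)
        (by rw [pull_fundA_odd (by norm_num), one_smul]) two_ne_zero F
    | Istar j =>
      change 1 / 2 * Tr 2 (vectB (j + 3)) F = 1 / 2 * Tr 2 (vectD (j + 4)) (foldD j F)
      rw [Tr_pull_add_smul_one (i := foldD j) (c := 1) (by rw [pull_vectD j, one_smul]) two_ne_zero]
    | IVstar =>
      change 1 / 6 * Tr 2 rep26 F = 1 / 6 * Tr 2 rep27 (foldE F)
      rw [Tr_pull_add_smul_one (i := foldE) (c := 1) (by rw [pull_rep27, one_smul]) two_ne_zero]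
    | III => exact (hT rfl).elim
    | IIIstar => exact (hT rfl).elim
    | IIstar => exact (hT rfl).elim

/-! ### Traces of products, exterior powers and spin representations -/

section

variable {h : Type} [AddCommGroup h] [Module ℂ h]

theorem Tr_mul (k : ℕ) (χ χ' : Rep h) (F : h) : Tr k (χ * χ') F =
    ∑ j ∈ Finset.range (k + 1), Tr j χ F * Tr (k - j) χ' F * (k.choose j : ℂ) := by
  induction χ using AddMonoidAlgebra.induction_linear with
  | zero => simp [Tr_zero]
  | add f g hf hg => simp only [add_mul, Tr_add, hf, hg, Finset.sum_add_distrib]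
  | single w c =>
    induction χ' using AddMonoidAlgebra.induction_linear with
    | zero => simp [Tr_zero]
    | add f g hf hg => simp only [mul_add, add_mul, Tr_add, hf, hg, Finset.sum_add_distrib]
    | single w' c' =>
      rw [AddMonoidAlgebra.single_mul_single]
      simp only [Tr_eq_weightSum, weightSum_single]
      rw [LinearMap.add_apply, add_pow, Finset.mul_sum]
      refine Finset.sum_congr rfl fun j _ => ?_
      push_cast
      ring

theorem Tr_prod_eq_zero {ι : Type*} (s : Finset ι) (χ : ι → Rep h) (F : h)
    (h0 : ∀ i ∈ s, Tr 0 (χ i) F = 0) {k : ℕ} (hk : k < s.card) : Tr k (∏ i ∈ s, χ i) F = 0 := by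
  classical
  induction s using Finset.induction_on generalizing k with
  | empty => simp at hk
  | insert a s ha ih =>
    rw [Finset.card_insert_of_notMem ha] at hk
    rw [Finset.prod_insert ha, Tr_mul]
    refine Finset.sum_eq_zero fun j hj => ?_
    rcases Nat.eq_zero_or_pos j with rfl | hj'
    · rw [h0 a (Finset.mem_insert_self _ _), zero_mul, zero_mul]
    · have := Finset.mem_range.1 hj
      rw [ih (fun i hi => h0 i (Finset.mem_insert_of_mem hi)) (by omega), mul_zero, zero_mul]

/-- The sum of the `k`-th multiples of the weights. -/
def adams {ι : Type*} [Fintype ι] (w : ι → Module.Dual ℂ h) (k : ℕ) : Rep h :=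
  ∑ i, AddMonoidAlgebra.single (k • w i) 1

theorem Tr_adams {ι : Type*} [Fintype ι] (w : ι → Module.Dual ℂ h) (k j : ℕ) (F : h) :
    Tr j (adams w k) F = k ^ j * ∑ i, w i F ^ j := by
  rw [adams, Tr_sum, Finset.mul_sum]
  refine Finset.sum_congr rfl fun i _ => ?_
  rw [Tr_single, LinearMap.smul_apply, nsmul_eq_mul, mul_pow]

end

/-- The weights of the standard representation of `𝔰𝔲(m)`. -/
def epsA (m : ℕ) (i : Fin m) : Module.Dual ℂ (Cartan (A m)) := wt (A m) (ε i)

theorem epsA_apply (m : ℕ) (i : Fin m) (F : Cartan (A m)) : epsA m i F = (F : Fin m → ℂ) i :=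
  wt_ε_apply (A m) i F

theorem extA_eq_aeval (m k : ℕ) : extA m k = MvPolynomial.aeval
    (fun i : Fin m => (AddMonoidAlgebra.single (epsA m i) 1 : Rep (Cartan (A m))))
    (MvPolynomial.esymm (Fin m) ℚ k) := by
  rw [MvPolynomial.aeval_esymm_eq_multiset_esymm, Finset.esymm_map_val, extA]
  refine Finset.sum_congr rfl fun s _ => ?_
  rw [AddMonoidAlgebra.prod_single, wt_sum (A m)]
  simp [epsA]

theorem adams_eq_aeval (m k : ℕ) : adams (epsA m) k = MvPolynomial.aeval
    (fun i : Fin m => (AddMonoidAlgebra.single (epsA m i) 1 : Rep (Cartan (A m))))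
    (MvPolynomial.psum (Fin m) ℚ k) := by
  simp [adams, MvPolynomial.psum, AddMonoidAlgebra.single_pow]

theorem newton_extA (m k : ℕ) : (k : Rep (Cartan (A m))) * extA m k =
    (-1) ^ (k + 1) * ∑ a ∈ Finset.HasAntidiagonal.antidiagonal k with a.1 < k,
      (-1) ^ a.1 * extA m a.1 * adams (epsA m) a.2 := by
  have := congrArg (MvPolynomial.aeval (fun i : Fin m =>
    (AddMonoidAlgebra.single (epsA m i) 1 : Rep (Cartan (A m)))))
      (MvPolynomial.mul_esymm_eq_sum (Fin m) ℚ k)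
  rw [map_mul, map_mul, map_sum, map_pow, map_neg, map_one, map_natCast, ← extA_eq_aeval] at this
  rw [this]
  refine congrArg _ (Finset.sum_congr rfl fun a _ => ?_)
  rw [map_mul, map_mul, map_pow, map_neg, map_one, extA_eq_aeval, adams_eq_aeval]

section

variable {h : Type} [AddCommGroup h] [Module ℂ h] {e ψ : ℕ → Rep h} {F : h} {p : ℕ → ℂ}

/-- Newton's identities. -/
def IsNewton (e ψ : ℕ → Rep h) : Prop := ∀ k : ℕ, (k : Rep h) * e k =
  (-1) ^ (k + 1) * ∑ a ∈ Finset.HasAntidiagonal.antidiagonal k with a.1 < k,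
    (-1) ^ a.1 * e a.1 * ψ a.2

theorem IsNewton.low_degree (hN : IsNewton e ψ) (h0 : e 0 = 1) :
    e 1 = ψ 1 ∧ (2 : ℚ) • e 2 = e 1 * ψ 1 - ψ 2 ∧
    (3 : ℚ) • e 3 = e 2 * ψ 1 - e 1 * ψ 2 + ψ 3 ∧
    (4 : ℚ) • e 4 = e 3 * ψ 1 - e 2 * ψ 2 + e 1 * ψ 3 - ψ 4 := by
  have h1 := hN 1
  have h2 := hN 2
  have h3 := hN 3
  have h4 := hN 4
  have e1 : (Finset.HasAntidiagonal.antidiagonal 1).filter (fun a : ℕ × ℕ => a.1 < 1) =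
    {(0, 1)} := by decide
  have e2 : (Finset.HasAntidiagonal.antidiagonal 2).filter (fun a : ℕ × ℕ => a.1 < 2) =
    {(0, 2), (1, 1)} := by decide
  have e3 : (Finset.HasAntidiagonal.antidiagonal 3).filter (fun a : ℕ × ℕ => a.1 < 3) =
    {(0, 3), (1, 2), (2, 1)} := by decide
  have e4 : (Finset.HasAntidiagonal.antidiagonal 4).filter (fun a : ℕ × ℕ => a.1 < 4) =
    {(0, 4), (1, 3), (2, 2), (3, 1)} := by decide
  rw [e1, Finset.sum_singleton] at h1
  rw [e2, Finset.sum_pair (by decide)] at h2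
  rw [e3, Finset.sum_insert (by decide), Finset.sum_pair (by decide)] at h3
  rw [e4, Finset.sum_insert (by decide), Finset.sum_insert (by decide),
    Finset.sum_pair (by decide)] at h4
  simp only [h0] at h1 h2 h3 h4
  refine ⟨by simpa using h1, ?_, ?_, ?_⟩
  · rw [← Nat.cast_ofNat, Nat.cast_smul_eq_nsmul, nsmul_eq_mul, h2]
    ring
  · rw [← Nat.cast_ofNat, Nat.cast_smul_eq_nsmul, nsmul_eq_mul, h3]
    ring
  · rw [← Nat.cast_ofNat, Nat.cast_smul_eq_nsmul, nsmul_eq_mul, h4]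
    ring

theorem IsNewton.Tr_two (hN : IsNewton e ψ) (h0 : e 0 = 1)
    (hψ : ∀ k j, Tr j (ψ k) F = k ^ j * p j) (hp : p 1 = 0) :
    Tr 0 (e 2) F = p 0 * (p 0 - 1) / 2 ∧ Tr 1 (e 2) F = 0 ∧
    Tr 2 (e 2) F = (p 0 - 2) * p 2 ∧ Tr 3 (e 2) F = (p 0 - 4) * p 3 ∧
    Tr 4 (e 2) F = (p 0 - 8) * p 4 + 3 * p 2 ^ 2 := by
  obtain ⟨h1, h2, -, -⟩ := hN.low_degree h0
  have H (k : ℕ) := congrArg (fun χ => Tr k χ F) h2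
  simp only [h1, Tr_smul, Tr_sub, Tr_mul, hψ] at H
  have t0 := H 0
  have t1 := H 1
  have t2 := H 2
  have t3 := H 3
  have t4 := H 4
  simp [Finset.sum_range_succ, hp, Nat.choose] at t0 t1 t2 t3 t4
  refine ⟨?_, ?_, ?_, ?_, ?_⟩
  · linear_combination t0 / 2
  · exact t1
  · linear_combination t2 / 2
  · linear_combination t3 / 2
  · linear_combination t4 / 2

theorem IsNewton.Tr_three (hN : IsNewton e ψ) (h0 : e 0 = 1)
    (hψ : ∀ k j, Tr j (ψ k) F = k ^ j * p j) (hp : p 1 = 0) :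
    Tr 0 (e 3) F = p 0 * (p 0 - 1) * (p 0 - 2) / 6 ∧ Tr 1 (e 3) F = 0 ∧
    Tr 2 (e 3) F = (p 0 - 2) * (p 0 - 3) / 2 * p 2 ∧
    Tr 3 (e 3) F = (p 0 - 3) * (p 0 - 6) / 2 * p 3 ∧
    Tr 4 (e 3) F = (p 0 ^ 2 - 17 * p 0 + 54) / 2 * p 4 + (3 * p 0 - 12) * p 2 ^ 2 := by
  obtain ⟨h1, -, h3, -⟩ := hN.low_degree h0
  obtain ⟨a0, a1, a2, a3, a4⟩ := hN.Tr_two h0 hψ hp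
  have H (k : ℕ) := congrArg (fun χ => Tr k χ F) h3
  simp only [h1, Tr_smul, Tr_add, Tr_sub, Tr_mul, hψ] at H
  have t0 := H 0
  have t1 := H 1
  have t2 := H 2
  have t3 := H 3
  have t4 := H 4
  simp [Finset.sum_range_succ, hp, Nat.choose, a0, a1, a2, a3, a4] at t0 t1 t2 t3 t4
  refine ⟨?_, ?_, ?_, ?_, ?_⟩
  · linear_combination t0 / 3
  · exact t1
  · linear_combination t2 / 3
  · linear_combination t3 / 3
  · linear_combination t4 / 3

theorem IsNewton.Tr_four (hN : IsNewton e ψ) (h0 : e 0 = 1)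
    (hψ : ∀ k j, Tr j (ψ k) F = k ^ j * p j) (hp : p 1 = 0) :
    Tr 2 (e 4) F = (p 0 - 2) * (p 0 - 3) * (p 0 - 4) / 6 * p 2 ∧
    Tr 4 (e 4) F = (p 0 - 4) * (p 0 ^ 2 - 23 * p 0 + 96) / 6 * p 4 +
      3 * (p 0 - 4) * (p 0 - 5) / 2 * p 2 ^ 2 := by
  obtain ⟨h1, -, -, h4⟩ := hN.low_degree h0
  obtain ⟨a0, a1, a2, a3, a4⟩ := hN.Tr_two h0 hψ hp
  obtain ⟨b0, b1, b2, b3, b4⟩ := hN.Tr_three h0 hψ hp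
  have H (k : ℕ) := congrArg (fun χ => Tr k χ F) h4
  simp only [h1, Tr_smul, Tr_add, Tr_sub, Tr_mul, hψ] at H
  have t2 := H 2
  have t4 := H 4
  simp [Finset.sum_range_succ, hp, Nat.choose, a0, a1, a2, a3, a4, b0, b1, b2, b3, b4] at t2 t4
  refine ⟨?_, ?_⟩
  · linear_combination t2 / 4
  · linear_combination t4 / 4

end

theorem isNewton_extA (m : ℕ) : IsNewton (extA m) (adams (epsA m)) := newton_extA m

theorem extA_zero (m : ℕ) : extA m 0 = 1 := by simp [extA, wt_zero, AddMonoidAlgebra.one_def]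

/-- The power sums of the eigenvalues. -/
def powA {m : ℕ} (F : Cartan (A m)) (k : ℕ) : ℂ := ∑ i, (F : Fin m → ℂ) i ^ k

variable {m : ℕ} (F : Cartan (A m))

theorem Tr_fundA (k : ℕ) : Tr k (fundA m) F = powA F k := by
  rw [fundA_eq, Tr_sum]
  exact Finset.sum_congr rfl fun i _ => by rw [Tr_single, wt_ε_apply (A m)]

theorem powA_zero : powA F 0 = m := by simp [powA]

theorem powA_one : powA F 1 = 0 := by
  simpa [powA] using sum_eq_zero_of_mem_cartanA F

theorem Tr_adams_epsA (k j : ℕ) : Tr j (adams (epsA m) k) F = k ^ j * powA F j := by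
  rw [Tr_adams, powA]
  exact congrArg _ (Finset.sum_congr rfl fun i _ => by rw [epsA_apply])

theorem Tr_extA_two : Tr 2 (extA m 2) F = (m - 2) * Tr 2 (fundA m) F ∧
    Tr 4 (extA m 2) F = (m - 8) * Tr 4 (fundA m) F + 3 * Tr 2 (fundA m) F ^ 2 := by
  have := (isNewton_extA m).Tr_two (extA_zero m) (Tr_adams_epsA F) (powA_one F)
  rw [powA_zero] at this
  rw [Tr_fundA, Tr_fundA]
  exact ⟨this.2.2.1, this.2.2.2.2⟩

theorem Tr_extA_three : Tr 2 (extA m 3) F = (m - 2) * (m - 3) / 2 * Tr 2 (fundA m) F ∧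
    Tr 4 (extA m 3) F = (m ^ 2 - 17 * m + 54) / 2 * Tr 4 (fundA m) F +
      (3 * m - 12) * Tr 2 (fundA m) F ^ 2 := by
  have := (isNewton_extA m).Tr_three (extA_zero m) (Tr_adams_epsA F) (powA_one F)
  rw [powA_zero] at this
  rw [Tr_fundA, Tr_fundA]
  exact ⟨this.2.2.1, this.2.2.2.2⟩

theorem Tr_extA_four : Tr 2 (extA m 4) F = (m - 2) * (m - 3) * (m - 4) / 6 * Tr 2 (fundA m) F ∧
    Tr 4 (extA m 4) F = (m - 4) * (m ^ 2 - 23 * m + 96) / 6 * Tr 4 (fundA m) F +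
      3 * (m - 4) * (m - 5) / 2 * Tr 2 (fundA m) F ^ 2 := by
  have := (isNewton_extA m).Tr_four (extA_zero m) (Tr_adams_epsA F) (powA_one F)
  rw [powA_zero] at this
  rw [Tr_fundA, Tr_fundA]
  exact this

/-- `½ εᵢ`, up to sign. -/
def halfε (n : ℕ) (i : Fin n) (b : Bool) : Module.Dual ℂ (Cartan (D n)) :=
  wt (D n) ((if b then -1 / 2 else 1 / 2 : ℚ) • ε i)

theorem wt_spinVector (n : ℕ) (b : Fin n → Bool) :
    wt (D n) (spinVector b) = ∑ i, halfε n i (b i) := by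
  have : spinVector b = ∑ i, (if b i then -1 / 2 else 1 / 2 : ℚ) • ε i := by
    ext j
    simp only [Finset.sum_apply, Pi.smul_apply, ε_apply, smul_eq_mul, mul_ite, mul_one, mul_zero,
      Finset.sum_ite_eq, Finset.mem_univ, if_true]
    rfl
  rw [this, wt_sum (D n)]
  rfl

theorem halfε_apply (n : ℕ) (i : Fin n) (b : Bool) (F : Cartan (D n)) :
    halfε n i b F = (if b then -1 / 2 else 1 / 2) * (F : Fin n → ℂ) i := by
  rw [halfε, wt_apply]
  change ∑ j : Fin n, (((_ : ℚ) : ℂ)) * _ = _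
  rw [Finset.sum_eq_single i]
  · cases b <;> simp [ε_apply]
  · intro j _ hj
    simp [ε_apply, hj]
  · simp

theorem spinD_eq_sum (n : ℕ) : spinD n = ∑ b : Fin n → Bool,
    if Even (Finset.univ.filter fun i => b i = true).card then
      AddMonoidAlgebra.single (wt (D n) (spinVector b)) 1 else 0 := by
  rw [spinD, ofWeights, evenSpinVectors, Finset.sum_image fun _ _ _ _ h => spinVector_injective n h,
    Finset.sum_filter]

theorem spinD_add_spinD' (n : ℕ) : spinD n + spinD' n = ∑ b : Fin n → Bool,
    AddMonoidAlgebra.single (wt (D n) (spinVector b)) 1 := by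
  have hsub : evenSpinVectors n ⊆ spinVectors n :=
    Finset.image_subset_image (Finset.filter_subset _ _)
  rw [spinD, spinD', ofWeights, ofWeights, add_comm, Finset.sum_sdiff hsub, spinVectors,
    Finset.sum_image fun _ _ _ _ h => spinVector_injective n h]

theorem spinD_add (n : ℕ) : spinD n + spinD' n =
    ∏ i : Fin n, ∑ b : Bool, AddMonoidAlgebra.single (halfε n i b) 1 := by
  rw [spinD_add_spinD', Finset.prod_univ_sum, Fintype.piFinset_univ]
  refine Finset.sum_congr rfl fun b _ => ?_
  rw [AddMonoidAlgebra.prod_single, wt_spinVector]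
  simp

theorem spinD_sub (n : ℕ) : spinD n - spinD' n =
    ∏ i : Fin n, ∑ b : Bool, AddMonoidAlgebra.single (halfε n i b) (if b then -1 else 1) := by
  have e : spinD n - spinD' n = spinD n + spinD n - (spinD n + spinD' n) := by ring
  rw [e, spinD_add_spinD', Finset.prod_univ_sum, Fintype.piFinset_univ, spinD_eq_sum,
    ← Finset.sum_add_distrib, ← Finset.sum_sub_distrib]
  refine Finset.sum_congr rfl fun b _ => ?_
  rw [AddMonoidAlgebra.prod_single, wt_spinVector, Finset.prod_ite, Finset.prod_const,
    Finset.prod_const_one, mul_one]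
  split_ifs with h
  · rw [h.neg_one_pow, add_sub_cancel_right]
  · rw [(Nat.not_even_iff_odd.1 h).neg_one_pow, add_zero, zero_sub, AddMonoidAlgebra.single_neg]

theorem Tr_spinD_eq {n k : ℕ} (hk : k < n) (F : Cartan (D n)) :
    Tr k (spinD n) F = Tr k (spinD' n) F := by
  rw [← sub_eq_zero, ← Tr_sub, spinD_sub]
  refine Tr_prod_eq_zero _ _ _ (fun i _ => ?_) (by simpa using hk)
  rw [Tr_sum]
  simp [Tr_eq_weightSum, weightSum_single]

theorem Tr_prod_two {h ι : Type} [AddCommGroup h] [Module ℂ h] (s : Finset ι) (χ : ι → Rep h)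
    (F : h) (x : ι → ℂ) (h0 : ∀ i, Tr 0 (χ i) F = 2) (h1 : ∀ i, Tr 1 (χ i) F = 0)
    (h2 : ∀ i, Tr 2 (χ i) F = x i ^ 2 / 2) :
    Tr 0 (∏ i ∈ s, χ i) F = 2 ^ s.card ∧
      Tr 2 (∏ i ∈ s, χ i) F = 2 ^ s.card / 4 * ∑ i ∈ s, x i ^ 2 := by
  classical
  induction s using Finset.induction_on with
  | empty => simp [Tr_eq_weightSum, weightSum_one]
  | insert a s ha ih =>
    rw [Finset.prod_insert ha, Finset.card_insert_of_notMem ha, Finset.sum_insert ha, Tr_mul,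
      Tr_mul]
    simp only [Finset.sum_range_succ, Finset.sum_range_zero, Nat.sub_zero, Nat.sub_self, ih, h0, h1,
      h2]
    constructor
    · simp [pow_succ']
    · simp
      ring

theorem Tr_two_spinD {n : ℕ} (hn : 2 < n) (F : Cartan (D n)) :
    Tr 2 (spinD n) F = 2 ^ n / 8 * ∑ i, (F : Fin n → ℂ) i ^ 2 := by
  have h := congrArg (fun χ => Tr 2 χ F) (spinD_add n)
  simp only [Tr_add] at h
  rw [← Tr_spinD_eq hn, (Tr_prod_two Finset.univ _ F (fun i => (F : Fin n → ℂ) i) ?_ ?_ ?_).2,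
    Finset.card_univ, Fintype.card_fin] at h
  · linear_combination h / 2
  all_goals
    intro i
    rw [Tr_sum, Fintype.sum_bool, Tr_single, Tr_single, halfε_apply, halfε_apply, if_pos rfl,
      if_neg Bool.false_ne_true]
    ring

theorem normTr_D (n : ℕ) (F : Cartan (D n)) :
    normTr (D n) F = ∑ i, (F : Fin n → ℂ) i ^ 2 := by
  change 1 / 2 * Tr 2 (vectD n) F = _
  have e (v : Fin n → ℚ) : Tr 2 (AddMonoidAlgebra.single (wt (D n) v) 1 : Rep (Cartan (D n))) F =
    wt (D n) v F ^ 2 := Tr_single _ _ _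
  rw [vectD, ofWeights, sum_axisVectors, Tr_sum, Finset.mul_sum]
  refine Finset.sum_congr rfl fun i _ => ?_
  rw [Tr_add, e, e, wt_neg (D n), LinearMap.neg_apply, wt_ε_apply (D n)]
  ring

/-! ### Reduction of anomaly cancellation to the covering algebras -/

section

variable {r : ℕ} {T : Fin r → Kodaira}

/-- The cancellation of anomalies for the covering algebras, `b` and `c` being the orders of `β` and
`γ`, and `n` the intersection multiplicity of any two components. -/
structure IsBalanced (T : Fin r → Kodaira) (k : ℚ) (ρ : Rep (CoverSum T)) (b c : Fin r → ℤ)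
    (n : ℕ) : Prop where
  tr : ∀ i (F : Cartan (T i).cover) (l : ℕ), l = 2 ∨ l = 4 →
    ((k⁻¹ : ℚ) : ℂ) * Tr l ρ (Pi.single i F) =
      (b i : ℂ) / 2 * Tr l (rhoSqrtBeta (T i) true) F + c i * Tr l (rhoGamma (T i) true) F
  mult : ∀ i j, i < j → ∀ (F : Cartan (T i).cover) (G : Cartan (T j).cover),
    ((k⁻¹ : ℚ) : ℂ) * weightSum (fun w => w (Pi.single i F) ^ 2 * w (Pi.single j G) ^ 2) ρ =
      n * normTr _ F * normTr _ G

/-- The inclusion of the gauge algebras in the covering algebras. -/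
def foldSum (T : Fin r → Kodaira) (s : Fin r → Bool) : CartanSum T s →ₗ[ℂ] CoverSum T :=
  LinearMap.pi fun i => (foldMap (T i) (s i)).comp
    (LinearMap.proj (R := ℂ) (φ := fun i => Cartan ((T i).gauge (s i))) i)

theorem foldSum_single (s : Fin r → Bool) (i : Fin r) (F : Cartan ((T i).gauge (s i))) :
    foldSum T s (Pi.single i F) = Pi.single i (foldMap (T i) (s i) F) := by
  ext1 j
  change foldMap (T j) (s j) (Pi.single (M := fun i => Cartan ((T i).gauge (s i))) i F j) = _
  rcases eq_or_ne j i with rfl | h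
  · rw [Pi.single_eq_same, Pi.single_eq_same]
  · rw [Pi.single_eq_of_ne h, Pi.single_eq_of_ne h, map_zero]

theorem Tr_restrictTo_matter (s : Fin r → Bool) (k : ℚ) (ρ : Rep (CoverSum T)) (i : Fin r) (l : ℕ)
    (F : Cartan ((T i).gauge (s i))) : Tr l (restrictTo T s i (matter T s k ρ)) F =
      ((k⁻¹ : ℚ) : ℂ) * Tr l ρ (Pi.single i (foldMap (T i) (s i) F)) := by
  rw [restrictTo, Tr_pull, matter, Tr_smul, Tr_pull]
  exact congrArg (fun x => ((k⁻¹ : ℚ) : ℂ) * Tr l ρ x) (foldSum_single s i F)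

theorem weightSum_matter (s : Fin r → Bool) (k : ℚ) (ρ : Rep (CoverSum T)) (i j : Fin r)
    (F : Cartan ((T i).gauge (s i))) (G : Cartan ((T j).gauge (s j))) :
    weightSum (fun w => w (Pi.single i F) ^ 2 * w (Pi.single j G) ^ 2) (matter T s k ρ) =
      ((k⁻¹ : ℚ) : ℂ) * weightSum (fun w => w (Pi.single i (foldMap (T i) (s i) F)) ^ 2 *
        w (Pi.single j (foldMap (T j) (s j) G)) ^ 2) ρ := by
  rw [matter, map_rat_smul, weightSum_pull, Rat.smul_def]
  congr 1
  refine weightSum_eq_sum (fun w => ?_) _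
  rw [← foldSum_single, ← foldSum_single]
  rfl

theorem IsBalanced.mult_of_ne {k : ℚ} {ρ : Rep (CoverSum T)} {b c : Fin r → ℤ}
    {n : ℕ} (h : IsBalanced T k ρ b c n) {i j : Fin r} (hij : i ≠ j) (F : Cartan (T i).cover)
    (G : Cartan (T j).cover) :
    ((k⁻¹ : ℚ) : ℂ) * weightSum (fun w => w (Pi.single i F) ^ 2 * w (Pi.single j G) ^ 2) ρ =
      n * normTr _ F * normTr _ G := by
  rcases lt_or_gt_of_ne hij with hlt | hlt
  · exact h.mult i j hlt F G
  · have e : weightSum (fun w => w (Pi.single i F) ^ 2 * w (Pi.single j G) ^ 2) ρ =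
        weightSum (fun w => w (Pi.single j G) ^ 2 * w (Pi.single i F) ^ 2) ρ :=
      weightSum_eq_sum (fun w => mul_comm _ _) ρ
    rw [e, h.mult j i hlt G F]
    ring

theorem IsBalanced.localAnomalyCancellation {k : ℚ} {ρ : Rep (CoverSum T)} {b c : Fin r → ℤ}
    {n : ℕ} (h : IsBalanced T k ρ b c n) {e : ℕ} {φ : Fin r → Base}
    {β γ : Fin r → Option Mero} (hβ : ∀ i, ord (β i) = e * b i) (hγ : ∀ i, ord (γ i) = e * c i)
    (hφ : ∀ i j, i ≠ j → intersectionMult (φ i) (φ j) = e * n) (s : Fin r → Bool)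
    (hs : IsAdmissible T β s) : LocalAnomalyCancellation T s φ β γ (matter T s (k / e) ρ) := by
  have hk : (((k / e)⁻¹ : ℚ) : ℂ) = e * ((k⁻¹ : ℚ) : ℂ) := by
    rw [inv_div, div_eq_mul_inv]
    push_cast
    ring
  have htr (i : Fin r) (l : ℕ) (hl : l = 2 ∨ l = 4) (F : Cartan ((T i).gauge (s i))) :
      Tr l (restrictTo T s i (matter T s (k / e) ρ)) F =
        Tr l (tateRep (T i) (s i) (β i) (γ i)) F := by
    rw [Tr_restrictTo_matter, hk, mul_assoc, h.tr _ _ _ hl, Tr_tateRep _ _ (hs i).1 _ _ (by omega),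
      hβ, hγ]
    push_cast
    ring
  refine ⟨fun i F => ⟨htr i 2 (.inl rfl) F, htr i 4 (.inr rfl) F⟩, fun i j hij F G => ?_⟩
  have e1 : ((matter T s (k / e) ρ).coeff.sum fun w c =>
      (c : ℂ) * (w (Pi.single i F)) ^ 2 * (w (Pi.single j G)) ^ 2) =
      weightSum (fun w => w (Pi.single i F) ^ 2 * w (Pi.single j G) ^ 2)
        (matter T s (k / e) ρ) := by
    rw [weightSum_apply]
    simp only [mul_assoc]
  rw [e1, weightSum_matter, hk, hφ i j hij, normTr_gauge _ _ (hs i).1, normTr_gauge _ _ (hs j).1]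
  rw [mul_assoc, h.mult_of_ne hij]
  push_cast
  ring

/-! ### Representations of a direct sum -/

theorem pull_zero_ofWeights {h : Type} [AddCommGroup h] [Module ℂ h] (g : GaugeAlg)
    (s : Finset (Fin g.N → ℚ)) :
    pull (0 : h →ₗ[ℂ] Cartan g) (ofWeights g s) = (s.card : ℚ) • 1 := by
  rw [ofWeights, pull_sum]
  simp only [pull_single, LinearMap.comp_zero, ← AddMonoidAlgebra.one_def, Finset.sum_const]
  rw [Nat.cast_smul_eq_nsmul]

theorem pull_zero_extA {h : Type} [AddCommGroup h] [Module ℂ h] (m k : ℕ) :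
    pull (0 : h →ₗ[ℂ] Cartan (A m)) (extA m k) = (m.choose k : ℚ) • 1 := by
  rw [extA, pull_sum]
  simp only [pull_single, LinearMap.comp_zero, ← AddMonoidAlgebra.one_def, Finset.sum_const]
  rw [Nat.cast_smul_eq_nsmul, Finset.card_powersetCard, Finset.card_univ, Fintype.card_fin]

theorem pull_on {h : Type} [AddCommGroup h] [Module ℂ h] (f : h →ₗ[ℂ] CoverSum T) (i : Fin r)
    (χ : Rep (Cartan (T i).cover)) : pull f (on T i χ) =
      pull ((LinearMap.proj (R := ℂ) (φ := fun i => Cartan (T i).cover) i).comp f) χ :=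
  pull_pull _ _ _

theorem pull_single_on_same (i : Fin r) (χ : Rep (Cartan (T i).cover)) :
    pull (LinearMap.single ℂ (fun i => Cartan (T i).cover) i) (on T i χ) = χ := by
  rw [pull_on, LinearMap.proj_comp_single_same, pull_id]

theorem pull_single_on_ne {i j : Fin r} (h : j ≠ i) (χ : Rep (Cartan (T j).cover)) :
    pull (LinearMap.single ℂ (fun i => Cartan (T i).cover) i) (on T j χ) = pull 0 χ := by
  rw [pull_on, LinearMap.proj_comp_single_ne _ _ _ _ h]

theorem Tr_pi_single (l : ℕ) (ρ : Rep (CoverSum T)) (i : Fin r) (F : Cartan (T i).cover) :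
    Tr l ρ (Pi.single i F) =
      Tr l (pull (LinearMap.single ℂ (fun i => Cartan (T i).cover) i) ρ) F := by
  rw [Tr_pull]
  rfl

/-- The inclusion of the sum of two summands. -/
def pairMap (T : Fin r → Kodaira) (i j : Fin r) :
    (Cartan (T i).cover × Cartan (T j).cover) →ₗ[ℂ] CoverSum T :=
  (LinearMap.single ℂ (fun i => Cartan (T i).cover) i).coprod
    (LinearMap.single ℂ (fun i => Cartan (T i).cover) j)

theorem weightSum_pi_single (ρ : Rep (CoverSum T)) (i j : Fin r) (F : Cartan (T i).cover)
    (G : Cartan (T j).cover) :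
    weightSum (fun w => w (Pi.single i F) ^ 2 * w (Pi.single j G) ^ 2) ρ =
      weightSum (fun w => w (F, 0) ^ 2 * w (0, G) ^ 2) (pull (pairMap T i j) ρ) := by
  rw [weightSum_pull]
  refine weightSum_eq_sum (fun w => ?_) _
  simp [pairMap]

theorem pull_pairMap_fst {i j : Fin r} (h : i ≠ j) (χ : Rep (Cartan (T i).cover)) :
    pull (pairMap T i j) (on T i χ) = pull (LinearMap.fst ℂ _ _) χ := by
  rw [pull_on]
  congr 1
  ext1 <;> ext x <;> simp [pairMap, h]

theorem pull_pairMap_snd {i j : Fin r} (h : i ≠ j) (χ : Rep (Cartan (T j).cover)) :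
    pull (pairMap T i j) (on T j χ) = pull (LinearMap.snd ℂ _ _) χ := by
  rw [pull_on]
  congr 1
  ext1 <;> ext x <;> simp [pairMap, h.symm]

theorem pull_pairMap_other {i j k : Fin r} (hi : k ≠ i) (hj : k ≠ j)
    (χ : Rep (Cartan (T k).cover)) : pull (pairMap T i j) (on T k χ) = pull 0 χ := by
  rw [pull_on]
  congr 1
  ext1 <;> ext x <;> simp [pairMap, hi, hj]

section

variable {h h' : Type} [AddCommGroup h] [Module ℂ h] [AddCommGroup h'] [Module ℂ h']

/-- The functional `Tr_σ F² Tr_τ G²` on the representations of a direct sum. -/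
def pairTr (F : h) (G : h') : Rep (h × h') →ₗ[ℚ] ℂ :=
  weightSum fun w => w (F, 0) ^ 2 * w (0, G) ^ 2

theorem pairTr_fst (F : h) (G : h') (χ : Rep h) : pairTr F G (pull (LinearMap.fst ℂ h h') χ) = 0 := by
  rw [pairTr, weightSum_pull, weightSum_eq_sum (ψ := fun w => 0) (by simp), weightSum_apply]
  simp

theorem pairTr_snd (F : h) (G : h') (χ : Rep h') :
    pairTr F G (pull (LinearMap.snd ℂ h h') χ) = 0 := by
  rw [pairTr, weightSum_pull, weightSum_eq_sum (ψ := fun w => 0) (by simp), weightSum_apply]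
  simp

theorem pairTr_mul (F : h) (G : h') (χ : Rep h) (χ' : Rep h') :
    pairTr F G (pull (LinearMap.fst ℂ h h') χ * pull (LinearMap.snd ℂ h h') χ') =
      Tr 2 χ F * Tr 2 χ' G := by
  induction χ using AddMonoidAlgebra.induction_linear with
  | zero => rw [pull_eq, map_zero, zero_mul, map_zero, Tr_zero, zero_mul]
  | add f g hf hg => rw [pull_add, add_mul, map_add, hf, hg, Tr_add, add_mul]
  | single w c =>
    induction χ' using AddMonoidAlgebra.induction_linear with
    | zero => rw [pull_eq, pull_eq, map_zero, mul_zero, map_zero, Tr_zero, mul_zero]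
    | add f g hf hg => rw [pull_add, mul_add, map_add, hf, hg, Tr_add, mul_add]
    | single w' c' =>
      rw [pull_single, pull_single, AddMonoidAlgebra.single_mul_single, pairTr, weightSum_single,
        Tr_eq_weightSum, Tr_eq_weightSum, weightSum_single, weightSum_single]
      simp
      ring

end

end

/-! ### Balance of traces -/

theorem isBalanced_one {T : Kodaira} {k : ℚ} {ρ : Rep (Cartan T.cover)} (b c : ℤ)
    (h : ∀ (F : Cartan T.cover) (l : ℕ), l = 2 ∨ l = 4 → ((k⁻¹ : ℚ) : ℂ) * Tr l ρ F =
      (b : ℂ) / 2 * Tr l (rhoSqrtBeta T true) F + c * Tr l (rhoGamma T true) F) :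
    IsBalanced (fun _ : Fin 1 => T) k (on (fun _ : Fin 1 => T) 0 ρ) (fun _ => b) (fun _ => c) 0 where
  tr i F l hl := by
    obtain rfl : i = 0 := Subsingleton.elim _ _
    rw [Tr_pi_single, pull_single_on_same, h F l hl]
  mult i j hij := absurd hij (by simp [Subsingleton.elim i j])

theorem rhoSqrtBeta_I {m : ℕ} (hm : 4 ≤ m) : rhoSqrtBeta (I m) true = extA m 2 := by
  change (if m ≤ 2 then 0 else if m = 3 then fundA m else extA m 2) = _
  rw [if_neg (by omega), if_neg (by omega)]

/-- A balance that holds already for the characters, up to trivial summands. -/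
theorem isBalanced_of_eq {T : Kodaira} {k : ℚ} {ρ : Rep (Cartan T.cover)} (b c : ℤ) (a : ℚ)
    (h : k⁻¹ • ρ = ((b : ℚ) / 2) • rhoSqrtBeta T true + (c : ℚ) • rhoGamma T true + a • 1) :
    IsBalanced (fun _ : Fin 1 => T) k (on (fun _ : Fin 1 => T) 0 ρ) (fun _ => b) (fun _ => c) 0 :=
  isBalanced_one b c fun F l hl => by
    rw [← Tr_smul, h, Tr_add, Tr_add, Tr_smul, Tr_smul, Tr_smul, Tr_one (by omega)]
    push_cast
    ring

theorem balanced_I_fund (m : ℕ) : IsBalanced (fun _ : Fin 1 => I m) 1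
    (on (fun _ : Fin 1 => I m) 0 (fundA m)) (fun _ => 0) (fun _ => 1) 0 :=
  isBalanced_of_eq (T := I m) 0 1 0 (by
    change _ = _ + ((1 : ℤ) : ℚ) • fundA m + _
    simp)

theorem balanced_I_half_extA {m : ℕ} (hm : 4 ≤ m) : IsBalanced (fun _ : Fin 1 => I m) 2
    (on (fun _ : Fin 1 => I m) 0 (extA m 2)) (fun _ => 1) (fun _ => 0) 0 :=
  isBalanced_of_eq (T := I m) 1 0 0 (by
    rw [rhoSqrtBeta_I hm]
    norm_num)

theorem balanced_I_fund_extA {m : ℕ} (hm : 4 ≤ m) : IsBalanced (fun _ : Fin 1 => I m) 2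
    (on (fun _ : Fin 1 => I m) 0 ((2 : ℚ) • fundA m + extA m 2)) (fun _ => 1) (fun _ => 1) 0 :=
  isBalanced_of_eq (T := I m) 1 1 0 (by
    rw [rhoSqrtBeta_I hm]
    change _ = _ + ((1 : ℤ) : ℚ) • fundA m + _
    push_cast
    module)

theorem balanced_I_extA {m : ℕ} (hm : 4 ≤ m) : IsBalanced (fun _ : Fin 1 => I m) 1
    (on (fun _ : Fin 1 => I m) 0 (extA m 2)) (fun _ => 2) (fun _ => 0) 0 :=
  isBalanced_of_eq (T := I m) 2 0 0 (by
    rw [rhoSqrtBeta_I hm]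
    norm_num)

theorem balanced_Istar_vect (j : ℕ) : IsBalanced (fun _ : Fin 1 => Istar j) 2
    (on (fun _ : Fin 1 => Istar j) 0 (vectD (j + 4))) (fun _ => 1) (fun _ => 0) 0 :=
  isBalanced_of_eq (T := Istar j) 1 0 0 (by
    change _ = _ • vectD (j + 4) + _ + _
    norm_num)

theorem balanced_III : IsBalanced (fun _ : Fin 1 => III) (1 / 2)
    (on (fun _ : Fin 1 => III) 0 (fundA 2)) (fun _ => 0) (fun _ => 1) 0 :=
  isBalanced_of_eq (T := III) 0 1 0 (by
    change _ = _ + ((1 : ℤ) : ℚ) • (2 : ℚ) • fundA 2 + _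
    norm_num)

theorem balanced_IV : IsBalanced (fun _ : Fin 1 => IV) 2
    (on (fun _ : Fin 1 => IV) 0 ((3 : ℚ) • fundA 3)) (fun _ => 1) (fun _ => 0) 0 :=
  isBalanced_of_eq (T := IV) 1 0 0 (by
    change _ = _ • (3 : ℚ) • fundA 3 + _ + _
    norm_num)

theorem balanced_I6 : IsBalanced (fun _ : Fin 1 => I 6) 2
    (on (fun _ : Fin 1 => I 6) 0 (1 + extA 6 3)) (fun _ => 2) (fun _ => -1) 0 :=
  isBalanced_one (T := I 6) 2 (-1) fun F l hl => by
    rw [rhoSqrtBeta_I (by norm_num)]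
    change _ = _ + _ * Tr l (fundA 6) F
    obtain ⟨h2, h2'⟩ := Tr_extA_two F
    obtain ⟨h3, h3'⟩ := Tr_extA_three F
    rw [Tr_add, Tr_one (by omega)]
    rcases hl with rfl | rfl
    · rw [h2, h3]; push_cast; ring
    · rw [h2', h3']; push_cast; ring

theorem balanced_I7 : IsBalanced (fun _ : Fin 1 => I 7) 2
    (on (fun _ : Fin 1 => I 7) 0 (fundA 7 + extA 7 3)) (fun _ => 3) (fun _ => -2) 0 :=
  isBalanced_one (T := I 7) 3 (-2) fun F l hl => by
    rw [rhoSqrtBeta_I (by norm_num)]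
    change _ = _ + _ * Tr l (fundA 7) F
    obtain ⟨h2, h2'⟩ := Tr_extA_two F
    obtain ⟨h3, h3'⟩ := Tr_extA_three F
    rw [Tr_add]
    rcases hl with rfl | rfl
    · rw [h2, h3]; push_cast; ring
    · rw [h2', h3']; push_cast; ring

theorem balanced_I8 : IsBalanced (fun _ : Fin 1 => I 8) 2
    (on (fun _ : Fin 1 => I 8) 0 (fundA 8 + extA 8 2 + extA 8 3)) (fun _ => 5) (fun _ => -4) 0 :=
  isBalanced_one (T := I 8) 5 (-4) fun F l hl => by
    rw [rhoSqrtBeta_I (by norm_num)]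
    change _ = _ + _ * Tr l (fundA 8) F
    obtain ⟨h2, h2'⟩ := Tr_extA_two F
    obtain ⟨h3, h3'⟩ := Tr_extA_three F
    rw [Tr_add, Tr_add]
    rcases hl with rfl | rfl
    · rw [h2, h3]; push_cast; ring
    · rw [h2', h3']; push_cast; ring

theorem balanced_I8' : IsBalanced (fun _ : Fin 1 => I 8) 2 (on (fun _ : Fin 1 => I 8) 0
    (1 + (2 : ℚ) • extA 8 2 + (1 / 2 : ℚ) • extA 8 4)) (fun _ => 5) (fun _ => -4) 0 :=
  isBalanced_one (T := I 8) 5 (-4) fun F l hl => by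
    rw [rhoSqrtBeta_I (by norm_num)]
    change _ = _ + _ * Tr l (fundA 8) F
    obtain ⟨h2, h2'⟩ := Tr_extA_two F
    obtain ⟨h4, h4'⟩ := Tr_extA_four F
    rw [Tr_add, Tr_add, Tr_one (by omega), Tr_smul, Tr_smul]
    rcases hl with rfl | rfl
    · rw [h2, h4]; push_cast; ring
    · rw [h2', h4']; push_cast; ring

theorem balanced_Istar1 : IsBalanced (fun _ : Fin 1 => Istar 1) 1
    (on (fun _ : Fin 1 => Istar 1) 0 (spinD 5)) (fun _ => 0) (fun _ => 1) 0 :=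
  isBalanced_of_eq (T := Istar 1) 0 1 0 (by
    change _ = _ + ((1 : ℤ) : ℚ) • spinD 5 + _
    norm_num)

theorem balanced_Istar2 : IsBalanced (fun _ : Fin 1 => Istar 2) 2
    (on (fun _ : Fin 1 => Istar 2) 0 (1 + spinD' 6)) (fun _ => 0) (fun _ => 1) 0 :=
  isBalanced_one (T := Istar 2) 0 1 fun F l hl => by
    change _ = _ + _ * Tr l ((1 / 2 : ℚ) • spinD 6) F
    rw [Tr_smul, Tr_spinD_eq (by omega), Tr_add, Tr_one (by omega)]
    push_cast
    ring

theorem balanced_Istar3 : IsBalanced (fun _ : Fin 1 => Istar 3) 2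
    (on (fun _ : Fin 1 => Istar 3) 0 (vectD 7 + spinD 7)) (fun _ => -3) (fun _ => 2) 0 :=
  isBalanced_of_eq (T := Istar 3) (-3) 2 0 (by
    change _ = _ • vectD 7 + ((2 : ℤ) : ℚ) • ((1 / 4 : ℚ) • spinD 7 + vectD 7) + _
    push_cast
    module)

theorem balanced_IVstar : IsBalanced (fun _ : Fin 1 => IVstar) 2
    (on (fun _ : Fin 1 => IVstar) 0 rep27) (fun _ => 1) (fun _ => 0) 0 :=
  isBalanced_of_eq (T := IVstar) 1 0 0 (by
    change _ = _ • rep27 + _ + _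
    norm_num)

theorem balanced_IIIstar : IsBalanced (fun _ : Fin 1 => IIIstar) 2
    (on (fun _ : Fin 1 => IIIstar) 0 (1 + rep56)) (fun _ => 0) (fun _ => 1) 0 :=
  isBalanced_of_eq (T := IIIstar) 0 1 (1 / 2) (by
    change _ = _ + ((1 : ℤ) : ℚ) • (1 / 2 : ℚ) • rep56 + _
    push_cast
    module)

/-! ### Several components -/

theorem card_evenSpinVectors_five : (evenSpinVectors 5).card = 16 := by
  rw [evenSpinVectors, Finset.card_image_of_injective _ (spinVector_injective 5)]
  decide

theorem card_axisVectors (n : ℕ) : (axisVectors n 1).card = 2 * n := by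
  rw [Finset.card_eq_sum_ones, sum_axisVectors]
  simp [mul_comm]

theorem pull_zero_rep27 {h : Type} [AddCommGroup h] [Module ℂ h] :
    pull (0 : h →ₗ[ℂ] Cartan E6) rep27 = (27 : ℚ) • 1 := by
  have : (rootsE8.filter fun α => α ⬝ᵥ vecA1 = 0 ∧ α ⬝ᵥ vecA2 = 1).card = 27 := by
    rw [Finset.card_eq_sum_ones, enumerates_rep27.sum_eq (isRootList_E8.2.filter _)]
    decide +kernel
  rw [rep27, pull_zero_ofWeights, this]
  norm_num

theorem isBalanced_two {T : Fin 2 → Kodaira} {k : ℚ} {χ : Rep (Cartan (T 0).cover)}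
    {χ' : Rep (Cartan (T 1).cover)} {σ : Rep (Cartan (T 0).cover)} {τ : Rep (Cartan (T 1).cover)}
    {b b' c c' : ℤ} {n : ℕ} {d d' e e' : ℚ}
    (hχ : pull (0 : Cartan (T 1).cover →ₗ[ℂ] _) χ = e • 1)
    (hχ' : pull (0 : Cartan (T 0).cover →ₗ[ℂ] _) χ' = e' • 1)
    (hσ : pull (0 : Cartan (T 1).cover →ₗ[ℂ] _) σ = d • 1)
    (hτ : pull (0 : Cartan (T 0).cover →ₗ[ℂ] _) τ = d' • 1)
    (h0 : ∀ (F : Cartan (T 0).cover) (l : ℕ), l = 2 ∨ l = 4 →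
      ((k⁻¹ : ℚ) : ℂ) * (Tr l χ F + d' * Tr l σ F) =
        (b : ℂ) / 2 * Tr l (rhoSqrtBeta (T 0) true) F + c * Tr l (rhoGamma (T 0) true) F)
    (h1 : ∀ (F : Cartan (T 1).cover) (l : ℕ), l = 2 ∨ l = 4 →
      ((k⁻¹ : ℚ) : ℂ) * (Tr l χ' F + d * Tr l τ F) =
        (b' : ℂ) / 2 * Tr l (rhoSqrtBeta (T 1) true) F + c' * Tr l (rhoGamma (T 1) true) F)
    (h01 : ∀ (F : Cartan (T 0).cover) (G : Cartan (T 1).cover),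
      ((k⁻¹ : ℚ) : ℂ) * (Tr 2 σ F * Tr 2 τ G) = n * normTr _ F * normTr _ G) :
    IsBalanced T k (on T 1 χ' + on T 0 χ + on T 0 σ * on T 1 τ) ![b, b'] ![c, c'] n where
  tr i F l hl := by
    have hl0 : l ≠ 0 := by omega
    rw [Tr_pi_single]
    fin_cases i
    · change Cartan (T 0).cover at F
      change _ * Tr l (pull (LinearMap.single ℂ (fun i => Cartan (T i).cover) 0) _) F =
        (b : ℂ) / 2 * Tr l (rhoSqrtBeta (T 0) true) F + c * Tr l (rhoGamma (T 0) true) F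
      rw [pull_add, pull_add, pull_mul, pull_single_on_same, pull_single_on_same,
        pull_single_on_ne (by decide), pull_single_on_ne (by decide), hχ', hτ, mul_smul_comm,
        mul_one, Tr_add, Tr_add, Tr_smul, Tr_smul, Tr_one hl0, ← h0 F l hl]
      ring
    · change Cartan (T 1).cover at F
      change _ * Tr l (pull (LinearMap.single ℂ (fun i => Cartan (T i).cover) 1) _) F =
        (b' : ℂ) / 2 * Tr l (rhoSqrtBeta (T 1) true) F + c' * Tr l (rhoGamma (T 1) true) F
      rw [pull_add, pull_add, pull_mul, pull_single_on_same, pull_single_on_same,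
        pull_single_on_ne (by decide), pull_single_on_ne (by decide), hχ, hσ, smul_mul_assoc,
        one_mul, Tr_add, Tr_add, Tr_smul, Tr_smul, Tr_one hl0, ← h1 F l hl]
      ring
  mult i j hij := by
    obtain ⟨rfl, rfl⟩ : i = 0 ∧ j = 1 := by omega
    intro F G
    have h : (0 : Fin 2) ≠ 1 := by decide
    rw [weightSum_pi_single, pull_add, pull_add, pull_mul, pull_pairMap_fst h, pull_pairMap_fst h,
      pull_pairMap_snd h, pull_pairMap_snd h, ← h01]
    change _ * pairTr F G _ = _
    rw [map_add, map_add, pairTr_fst, pairTr_snd, pairTr_mul]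
    ring

theorem pull_zero_zero {h h' : Type} [AddCommGroup h] [Module ℂ h] [AddCommGroup h'] [Module ℂ h'] :
    pull (0 : h →ₗ[ℂ] h') 0 = (0 : ℚ) • 1 := by
  rw [pull_eq, map_zero, zero_smul]

theorem isBalanced_two' {T : Fin 2 → Kodaira} {k : ℚ} {χ' : Rep (Cartan (T 1).cover)}
    {σ : Rep (Cartan (T 0).cover)} {τ : Rep (Cartan (T 1).cover)}
    {b b' c c' : ℤ} {n : ℕ} {d d' e' : ℚ}
    (hχ' : pull (0 : Cartan (T 0).cover →ₗ[ℂ] _) χ' = e' • 1)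
    (hσ : pull (0 : Cartan (T 1).cover →ₗ[ℂ] _) σ = d • 1)
    (hτ : pull (0 : Cartan (T 0).cover →ₗ[ℂ] _) τ = d' • 1)
    (h0 : ∀ (F : Cartan (T 0).cover) (l : ℕ), l = 2 ∨ l = 4 →
      ((k⁻¹ : ℚ) : ℂ) * (d' * Tr l σ F) =
        (b : ℂ) / 2 * Tr l (rhoSqrtBeta (T 0) true) F + c * Tr l (rhoGamma (T 0) true) F)
    (h1 : ∀ (F : Cartan (T 1).cover) (l : ℕ), l = 2 ∨ l = 4 →
      ((k⁻¹ : ℚ) : ℂ) * (Tr l χ' F + d * Tr l τ F) =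
        (b' : ℂ) / 2 * Tr l (rhoSqrtBeta (T 1) true) F + c' * Tr l (rhoGamma (T 1) true) F)
    (h01 : ∀ (F : Cartan (T 0).cover) (G : Cartan (T 1).cover),
      ((k⁻¹ : ℚ) : ℂ) * (Tr 2 σ F * Tr 2 τ G) = n * normTr _ F * normTr _ G) :
    IsBalanced T k (on T 1 χ' + on T 0 σ * on T 1 τ) ![b, b'] ![c, c'] n := by
  have h := isBalanced_two (χ := 0) pull_zero_zero hχ' hσ hτ
    (fun F l hl => by rw [Tr_zero, zero_add, h0 F l hl]) h1 h01
  have e : on T 0 0 = 0 := by rw [on, pull_eq, map_zero]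
  rwa [e, add_zero] at h

theorem isBalanced_three {T : Fin 3 → Kodaira} {k : ℚ} {σ₀ : Rep (Cartan (T 0).cover)}
    {σ₁ : Rep (Cartan (T 1).cover)} {σ₂ : Rep (Cartan (T 2).cover)}
    {b₀ b₁ b₂ c₀ c₁ c₂ : ℤ} {n : ℕ} {d₀ d₁ d₂ : ℚ}
    (hd₀ : ∀ {h : Type} [AddCommGroup h] [Module ℂ h], pull (0 : h →ₗ[ℂ] _) σ₀ = d₀ • 1)
    (hd₁ : ∀ {h : Type} [AddCommGroup h] [Module ℂ h], pull (0 : h →ₗ[ℂ] _) σ₁ = d₁ • 1)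
    (hd₂ : ∀ {h : Type} [AddCommGroup h] [Module ℂ h], pull (0 : h →ₗ[ℂ] _) σ₂ = d₂ • 1)
    (h0 : ∀ (F : Cartan (T 0).cover) (l : ℕ), l = 2 ∨ l = 4 →
      ((k⁻¹ : ℚ) : ℂ) * ((1 + d₁ * d₂) * Tr l σ₀ F) =
        (b₀ : ℂ) / 2 * Tr l (rhoSqrtBeta (T 0) true) F + c₀ * Tr l (rhoGamma (T 0) true) F)
    (h1 : ∀ (F : Cartan (T 1).cover) (l : ℕ), l = 2 ∨ l = 4 →
      ((k⁻¹ : ℚ) : ℂ) * ((d₂ + d₀ * d₂) * Tr l σ₁ F) =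
        (b₁ : ℂ) / 2 * Tr l (rhoSqrtBeta (T 1) true) F + c₁ * Tr l (rhoGamma (T 1) true) F)
    (h2 : ∀ (F : Cartan (T 2).cover) (l : ℕ), l = 2 ∨ l = 4 →
      ((k⁻¹ : ℚ) : ℂ) * ((d₁ + d₀ * d₁) * Tr l σ₂ F) =
        (b₂ : ℂ) / 2 * Tr l (rhoSqrtBeta (T 2) true) F + c₂ * Tr l (rhoGamma (T 2) true) F)
    (h01 : ∀ (F : Cartan (T 0).cover) (G : Cartan (T 1).cover),
      ((k⁻¹ : ℚ) : ℂ) * (d₂ * (Tr 2 σ₀ F * Tr 2 σ₁ G)) = n * normTr _ F * normTr _ G)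
    (h02 : ∀ (F : Cartan (T 0).cover) (G : Cartan (T 2).cover),
      ((k⁻¹ : ℚ) : ℂ) * (d₁ * (Tr 2 σ₀ F * Tr 2 σ₂ G)) = n * normTr _ F * normTr _ G)
    (h12 : ∀ (F : Cartan (T 1).cover) (G : Cartan (T 2).cover),
      ((k⁻¹ : ℚ) : ℂ) * ((1 + d₀) * (Tr 2 σ₁ F * Tr 2 σ₂ G)) = n * normTr _ F * normTr _ G) :
    IsBalanced T k (on T 1 σ₁ * on T 2 σ₂ + on T 0 σ₀ + on T 0 σ₀ * on T 1 σ₁ * on T 2 σ₂)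
      ![b₀, b₁, b₂] ![c₀, c₁, c₂] n where
  tr i F l hl := by
    have hl0 : l ≠ 0 := by omega
    rw [Tr_pi_single]
    fin_cases i
    · change Cartan (T 0).cover at F
      change _ * Tr l (pull (LinearMap.single ℂ (fun i => Cartan (T i).cover) 0) _) F =
        (b₀ : ℂ) / 2 * Tr l (rhoSqrtBeta (T 0) true) F + c₀ * Tr l (rhoGamma (T 0) true) F
      simp only [pull_add, pull_mul]
      rw [pull_single_on_same, pull_single_on_ne (by decide), pull_single_on_ne (by decide),
        hd₁, hd₂, ← h0 F l hl]
      simp only [mul_smul_comm, mul_one, Tr_add, Tr_smul, Tr_one hl0]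
      ring
    · change Cartan (T 1).cover at F
      change _ * Tr l (pull (LinearMap.single ℂ (fun i => Cartan (T i).cover) 1) _) F =
        (b₁ : ℂ) / 2 * Tr l (rhoSqrtBeta (T 1) true) F + c₁ * Tr l (rhoGamma (T 1) true) F
      simp only [pull_add, pull_mul]
      rw [pull_single_on_same, pull_single_on_ne (by decide), pull_single_on_ne (by decide),
        hd₀, hd₂, ← h1 F l hl]
      simp only [smul_mul_assoc, mul_smul_comm, one_mul, mul_one, Tr_add, Tr_smul, Tr_one hl0]
      ring
    · change Cartan (T 2).cover at F
      change _ * Tr l (pull (LinearMap.single ℂ (fun i => Cartan (T i).cover) 2) _) F =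
        (b₂ : ℂ) / 2 * Tr l (rhoSqrtBeta (T 2) true) F + c₂ * Tr l (rhoGamma (T 2) true) F
      simp only [pull_add, pull_mul]
      rw [pull_single_on_same, pull_single_on_ne (by decide), pull_single_on_ne (by decide),
        hd₀, hd₁, ← h2 F l hl]
      simp only [smul_mul_assoc, mul_smul_comm, one_mul, mul_one, Tr_add, Tr_smul, Tr_one hl0]
      ring
  mult i j hij := by
    obtain ⟨rfl, rfl⟩ | ⟨rfl, rfl⟩ | ⟨rfl, rfl⟩ : (i = 0 ∧ j = 1) ∨ (i = 0 ∧ j = 2) ∨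
      (i = 1 ∧ j = 2) := by omega
    · intro F G
      have h : (0 : Fin 3) ≠ 1 := by decide
      rw [weightSum_pi_single, ← h01]
      simp only [pull_add, pull_mul]
      rw [pull_pairMap_fst h, pull_pairMap_snd h, pull_pairMap_other (by decide) (by decide), hd₂]
      change _ * pairTr F G _ = _
      simp only [mul_smul_comm, mul_one, map_add, map_rat_smul, pairTr_fst, pairTr_snd, pairTr_mul,
        Rat.smul_def]
      ring
    · intro F G
      have h : (0 : Fin 3) ≠ 2 := by decide
      rw [weightSum_pi_single, ← h02]
      simp only [pull_add, pull_mul]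
      rw [pull_pairMap_fst h, pull_pairMap_snd h, pull_pairMap_other (by decide) (by decide), hd₁]
      change _ * pairTr F G _ = _
      simp only [mul_smul_comm, smul_mul_assoc, one_mul, mul_one, map_add, map_rat_smul, pairTr_fst,
        pairTr_snd, pairTr_mul, Rat.smul_def]
      ring
    · intro F G
      have h : (1 : Fin 3) ≠ 2 := by decide
      rw [weightSum_pi_single, ← h12]
      simp only [pull_add, pull_mul]
      rw [pull_pairMap_fst h, pull_pairMap_snd h, pull_pairMap_other (by decide) (by decide), hd₀]
      change _ * pairTr F G _ = _
      have e : pairTr F G (1 : Rep (Cartan (T 1).cover × Cartan (T 2).cover)) = 0 := by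
        simp [pairTr, weightSum_one]
      simp only [smul_mul_assoc, one_mul, map_add, map_rat_smul, pairTr_mul, Rat.smul_def, e]
      ring

theorem IsBalanced.expand {T : Fin 2 → Kodaira} {k : ℚ} {χ : Rep (CoverSum T)}
    {σ : Rep (Cartan (T 0).cover)} {τ τ' : Rep (Cartan (T 1).cover)} {b c : Fin 2 → ℤ} {n : ℕ}
    (h : IsBalanced T k (χ + on T 0 σ * on T 1 (τ + τ')) b c n) :
    IsBalanced T k (χ + on T 0 σ * on T 1 τ + on T 0 σ * on T 1 τ') b c n := by
  rwa [add_assoc, ← mul_add, on, on, on, ← pull_add]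

theorem balanced_I2_I5 : IsBalanced ![I 2, I 5] 1
    (on ![I 2, I 5] 1 (fundA 5) + on ![I 2, I 5] 0 (fundA 2) * on ![I 2, I 5] 1 (extA 5 2))
    ![0, 4] ![10, 1] 3 := by
  refine isBalanced_two' (T := ![I 2, I 5]) (k := 1)
    (χ' := fundA 5) (σ := fundA 2) (τ := extA 5 2) (b := 0) (b' := 4) (c := 10) (c' := 1) (n := 3)
    (pull_zero_extA 5 1) (pull_zero_extA 2 1) (pull_zero_extA 5 2) ?_ ?_ ?_
  · intro F l hl
    change Cartan (A 2) at F
    change _ * (_ * Tr l (fundA 2) F) = _ / 2 * _ + _ * Tr l (fundA 2) F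
    norm_num [Nat.choose]
  · intro F l hl
    change Cartan (A 5) at F
    change _ * (Tr l (fundA 5) F + _ * Tr l (extA 5 2) F) =
      _ / 2 * Tr l (extA 5 2) F + _ * Tr l (fundA 5) F
    norm_num [Nat.choose]
    ring
  · intro F G
    change Cartan (A 2) at F
    change Cartan (A 5) at G
    change _ * (Tr 2 (fundA 2) F * Tr 2 (extA 5 2) G) = _ * Tr 2 (fundA 2) F * Tr 2 (fundA 5) G
    rw [(Tr_extA_two G).1]
    push_cast
    ring

theorem balanced_I2_Istar1 : IsBalanced ![I 2, Istar 1] 2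
    (on ![I 2, Istar 1] 1 (vectD 5) + on ![I 2, Istar 1] 0 (fundA 2) * on ![I 2, Istar 1] 1 (spinD 5))
    ![0, 1] ![8, 1] 2 := by
  have hv : pull (0 : Cartan (A 2) →ₗ[ℂ] Cartan (D 5)) (vectD 5) = (10 : ℚ) • 1 := by
    rw [vectD, pull_zero_ofWeights, card_axisVectors]
    norm_num
  have hs : pull (0 : Cartan (A 2) →ₗ[ℂ] Cartan (D 5)) (spinD 5) = (16 : ℚ) • 1 := by
    rw [spinD, pull_zero_ofWeights, card_evenSpinVectors_five]
    norm_num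
  refine isBalanced_two' (T := ![I 2, Istar 1]) (k := 2)
    (χ' := vectD 5) (σ := fundA 2) (τ := spinD 5) (b := 0) (b' := 1) (c := 8) (c' := 1) (n := 2)
    hv (pull_zero_extA 2 1) hs ?_ ?_ ?_
  · intro F l hl
    change Cartan (A 2) at F
    change _ * (_ * Tr l (fundA 2) F) = _ / 2 * _ + _ * Tr l (fundA 2) F
    push_cast
    ring
  · intro F l hl
    change Cartan (D 5) at F
    change _ * (Tr l (vectD 5) F + _ * Tr l (spinD 5) F) =
      _ / 2 * Tr l (vectD 5) F + _ * Tr l (spinD 5) F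
    norm_num [Nat.choose]
    ring
  · intro F G
    change Cartan (A 2) at F
    change Cartan (D 5) at G
    change _ * (Tr 2 (fundA 2) F * Tr 2 (spinD 5) G) = _ * Tr 2 (fundA 2) F * normTr (D 5) G
    rw [Tr_two_spinD (by norm_num), normTr_D]
    push_cast
    ring

theorem balanced_I2_IVstar : IsBalanced ![I 2, IVstar] 2
    (on ![I 2, IVstar] 1 rep27 + on ![I 2, IVstar] 0 (fundA 2) +
      on ![I 2, IVstar] 0 (fundA 2) * on ![I 2, IVstar] 1 rep27) ![0, 3] ![14, 0] 3 := by
  refine isBalanced_two (T := ![I 2, IVstar]) (k := 2) (χ := fundA 2)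
    (χ' := rep27) (σ := fundA 2) (τ := rep27) (b := 0) (b' := 3) (c := 14) (c' := 0) (n := 3)
    (pull_zero_extA 2 1) pull_zero_rep27 (pull_zero_extA 2 1) pull_zero_rep27 ?_ ?_ ?_
  · intro F l hl
    change Cartan (A 2) at F
    change _ * (Tr l (fundA 2) F + _ * Tr l (fundA 2) F) = _ / 2 * _ + _ * Tr l (fundA 2) F
    push_cast
    ring
  · intro F l hl
    change Cartan E6 at F
    change _ * (Tr l rep27 F + _ * Tr l rep27 F) = _ / 2 * Tr l rep27 F + _ * _
    norm_num [Nat.choose]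
    ring
  · intro F G
    change Cartan (A 2) at F
    change Cartan E6 at G
    change _ * (Tr 2 (fundA 2) F * Tr 2 rep27 G) = _ * Tr 2 (fundA 2) F * (1 / 6 * Tr 2 rep27 G)
    push_cast
    ring

theorem balanced_I3_I5 : IsBalanced ![I 3, I 5] 2
    (on ![I 3, I 5] 1 (fundA 5) + on ![I 3, I 5] 0 (fundA 3) * on ![I 3, I 5] 1 (fundA 5) +
      on ![I 3, I 5] 0 (fundA 3) * on ![I 3, I 5] 1 (extA 5 2)) ![3, 3] ![6, 2] 2 := by
  have hτ : pull (0 : Cartan (A 3) →ₗ[ℂ] Cartan (A 5)) (fundA 5 + extA 5 2) = (15 : ℚ) • 1 := by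
    rw [pull_add, fundA, pull_zero_extA, pull_zero_extA, ← add_smul]
    norm_num [Nat.choose]
  refine IsBalanced.expand (T := ![I 3, I 5]) (isBalanced_two' (T := ![I 3, I 5]) (k := 2)
    (χ' := fundA 5) (σ := fundA 3) (τ := fundA 5 + extA 5 2) (b := 3) (b' := 3) (c := 6) (c' := 2)
    (n := 2) (pull_zero_extA 5 1) (pull_zero_extA 3 1) hτ ?_ ?_ ?_)
  · intro F l hl
    change Cartan (A 3) at F
    change _ * (_ * Tr l (fundA 3) F) =
      _ / 2 * Tr l (fundA 3) F + _ * Tr l (fundA 3) F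
    push_cast
    ring
  · intro F l hl
    change Cartan (A 5) at F
    change _ * (Tr l (fundA 5) F + _ * Tr l (fundA 5 + extA 5 2) F) =
      _ / 2 * Tr l (extA 5 2) F + _ * Tr l (fundA 5) F
    rw [Tr_add]
    norm_num [Nat.choose]
    ring
  · intro F G
    change Cartan (A 3) at F
    change Cartan (A 5) at G
    change _ * (Tr 2 (fundA 3) F * Tr 2 (fundA 5 + extA 5 2) G) =
      _ * Tr 2 (fundA 3) F * Tr 2 (fundA 5) G
    rw [Tr_add, (Tr_extA_two G).1]
    push_cast
    ring

theorem balanced_I2_I3_I3 : IsBalanced ![I 2, I 3, I 3] 1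
    (on ![I 2, I 3, I 3] 1 (fundA 3) * on ![I 2, I 3, I 3] 2 (fundA 3) +
      on ![I 2, I 3, I 3] 0 (fundA 2) + on ![I 2, I 3, I 3] 0 (fundA 2) *
        on ![I 2, I 3, I 3] 1 (fundA 3) * on ![I 2, I 3, I 3] 2 (fundA 3))
    ![0, 4, 4] ![10, 7, 7] 3 := by
  have p3 {h : Type} [AddCommGroup h] [Module ℂ h] :
      pull (0 : h →ₗ[ℂ] Cartan (A 3)) (fundA 3) = (3 : ℚ) • 1 := pull_zero_extA 3 1
  have p2 {h : Type} [AddCommGroup h] [Module ℂ h] :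
      pull (0 : h →ₗ[ℂ] Cartan (A 2)) (fundA 2) = (2 : ℚ) • 1 := pull_zero_extA 2 1
  refine isBalanced_three (T := ![I 2, I 3, I 3]) (σ₀ := fundA 2) (σ₁ := fundA 3) (σ₂ := fundA 3)
    p2 p3 p3 ?_ ?_ ?_ ?_ ?_ ?_
  · intro F l _
    change Cartan (A 2) at F
    change _ * (_ * Tr l (fundA 2) F) = _ / 2 * _ + _ * Tr l (fundA 2) F
    push_cast
    ring
  · intro F l _
    change Cartan (A 3) at F
    change _ * (_ * Tr l (fundA 3) F) = _ / 2 * Tr l (fundA 3) F + _ * Tr l (fundA 3) F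
    push_cast
    ring
  · intro F l _
    change Cartan (A 3) at F
    change _ * (_ * Tr l (fundA 3) F) = _ / 2 * Tr l (fundA 3) F + _ * Tr l (fundA 3) F
    push_cast
    ring
  · intro F G
    change Cartan (A 2) at F
    change Cartan (A 3) at G
    change _ * (_ * (Tr 2 (fundA 2) F * Tr 2 (fundA 3) G)) =
      _ * Tr 2 (fundA 2) F * Tr 2 (fundA 3) G
    push_cast
    ring
  · intro F G
    change Cartan (A 2) at F
    change Cartan (A 3) at G
    change _ * (_ * (Tr 2 (fundA 2) F * Tr 2 (fundA 3) G)) =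
      _ * Tr 2 (fundA 2) F * Tr 2 (fundA 3) G
    push_cast
    ring
  · intro F G
    change Cartan (A 3) at F
    change Cartan (A 3) at G
    change _ * (_ * (Tr 2 (fundA 3) F * Tr 2 (fundA 3) G)) =
      _ * Tr 2 (fundA 3) F * Tr 2 (fundA 3) G
    push_cast
    ring

/-! ### Curves and restrictions -/

instance : CharZero Germ := charZero_of_injective_algebraMap (algebraMap ℂ Germ).injective

instance : CharZero Mero :=
  charZero_of_injective_ringHom (f := (HahnSeries.C : ℂ →+* Mero)) HahnSeries.C_injective

theorem curve_zero : curve 0 = z := by simp [curve, lift]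

theorem curve_ne_zero (φ : Base) : curve φ ≠ 0 := by
  intro h
  have := congrArg (PowerSeries.coeff 1) h
  simp [curve, z, lift] at this

theorem eq_zero_of_curve_dvd_lift {φ a : Base} (hφ : PowerSeries.constantCoeff φ = 0)
    (h : curve φ ∣ lift a) : a = 0 := by
  obtain ⟨Q, hQ⟩ := h
  have h0 : a = -φ * PowerSeries.coeff 0 Q := by
    have := congrArg (PowerSeries.coeff 0) hQ
    simpa [curve, z, lift] using this
  have hs (n : ℕ) : PowerSeries.coeff n Q = φ * PowerSeries.coeff (n + 1) Q := by
    have := congrArg (PowerSeries.coeff (n + 1)) hQ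
    rw [curve, z, lift, lift, sub_mul, map_sub, PowerSeries.coeff_succ_X_mul,
      PowerSeries.coeff_C_mul, PowerSeries.coeff_C, if_neg n.succ_ne_zero] at this
    exact (sub_eq_zero.1 this.symm)
  have hp (n : ℕ) : PowerSeries.coeff 0 Q = φ ^ n * PowerSeries.coeff n Q := by
    induction n with
    | zero => simp
    | succ n ih => rw [ih, hs n, pow_succ, mul_assoc]
  ext n
  have hX : (PowerSeries.X : Base) ∣ φ := PowerSeries.X_dvd_iff.2 hφ
  have : (PowerSeries.X : Base) ^ (n + 1) ∣ a := by
    rw [h0, hp (n + 1)]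
    exact Dvd.dvd.mul_left ((pow_dvd_pow_of_dvd hX _).mul_right _) _
  simpa using PowerSeries.X_pow_dvd_iff.1 this n (Nat.lt_succ_self n)

theorem RestrictsTo.le_emultiplicity {φ : Base} {k : ℕ} {F : Germ} {a : Base}
    (h : RestrictsTo φ k F a) : k ≤ emultiplicity (curve φ) F := by
  obtain ⟨H, rfl, -⟩ := h
  exact le_emultiplicity_of_pow_dvd (dvd_mul_right _ _)

theorem RestrictsTo.emultiplicity_eq {φ : Base} (hφ : PowerSeries.constantCoeff φ = 0) {k : ℕ}
    {F : Germ} {a : Base} (h : RestrictsTo φ k F a) (ha : a ≠ 0) :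
    emultiplicity (curve φ) F = k := by
  obtain ⟨H, rfl, hH⟩ := h
  rw [emultiplicity_eq_coe]
  refine ⟨dvd_mul_right _ _, fun hd => ha ?_⟩
  rw [pow_succ, mul_dvd_mul_iff_left (pow_ne_zero _ (curve_ne_zero φ))] at hd
  exact eq_zero_of_curve_dvd_lift hφ ((dvd_sub_right hd).1 hH)

theorem RestrictsTo.of_mul {φ : Base} {k : ℕ} {F : Germ} {a : Base} {n : ℂ} (hn : n ≠ 0)
    (h : RestrictsTo φ k (n • F) a) : RestrictsTo φ k F (n⁻¹ • a) := by
  obtain ⟨H, hF, Q, hQ⟩ := h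
  refine ⟨n⁻¹ • H, ?_, n⁻¹ • Q, ?_⟩
  · rw [mul_smul_comm, ← hF, inv_smul_smul₀ hn]
  · have : lift (n⁻¹ • a) = n⁻¹ • lift a := by
      ext i j
      simp only [lift, PowerSeries.coeff_C, PowerSeries.coeff_smul]
      split_ifs <;> simp
    rw [this, ← smul_sub, hQ, mul_smul_comm]

/-- `z` may be replaced by `φ` in the computation of a restriction. -/
theorem curve_dvd_of {φ : Base} {H : Germ} {a : Base}
    (h : ∀ (Q : Type) [CommRing Q] (q : Germ →+* Q), q z = q (lift φ) → q H = q (lift a)) :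
    curve φ ∣ H - lift a := by
  rw [← Ideal.mem_span_singleton, ← Ideal.Quotient.eq]
  refine h _ (Ideal.Quotient.mk (Ideal.span {curve φ})) ?_
  rw [Ideal.Quotient.eq, Ideal.mem_span_singleton, curve]

/-! ### The Weierstrass equation -/

theorem three_smul_f (W : Weierstrass) : (3 : ℂ) • W.f = 3 * W.v - W.u ^ 2 := by
  rw [Weierstrass.f, smul_sub, smul_smul, Algebra.smul_def (3 : ℂ), map_ofNat]
  norm_num

theorem twentyseven_smul_g (W : Weierstrass) :
    (27 : ℂ) • W.g = 2 * W.u ^ 3 - 9 * W.u * W.v + 27 * W.w := by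
  rw [Weierstrass.g, smul_add, smul_sub, smul_smul, smul_smul]
  norm_num [Algebra.smul_def, map_ofNat (algebraMap ℂ Germ)]
  ring

theorem disc_eq (W : Weierstrass) : W.disc = 4 * W.u ^ 3 * W.w - W.u ^ 2 * W.v ^ 2 -
    18 * W.u * W.v * W.w + 4 * W.v ^ 3 + 27 * W.w ^ 2 := by
  have hf := three_smul_f W
  have hg := twentyseven_smul_g W
  rw [Algebra.smul_def, map_ofNat] at hf hg
  have h27 : (27 : Germ) ≠ 0 := by norm_num
  apply mul_left_cancel₀ h27
  rw [Weierstrass.disc]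
  linear_combination 4 * (9 * W.f ^ 2 + 3 * W.f * (3 * W.v - W.u ^ 2) +
    (3 * W.v - W.u ^ 2) ^ 2) * hf + (27 * W.g + (2 * W.u ^ 3 - 9 * W.u * W.v + 27 * W.w)) * hg

/-- Types for which `f`, resp. `g`, has exactly the minimal order of vanishing. -/
def Kodaira.fExact : Kodaira → Prop
  | I m => m ≠ 0 | III => True | Istar j => j ≠ 0 | IIIstar => True | _ => False

def Kodaira.gExact : Kodaira → Prop
  | I m => m ≠ 0 | IV => True | Istar j => j ≠ 0 | IVstar => True | IIstar => True | _ => False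

theorem Kodaira.hasOrders_of {T : Kodaira} {a b d : ℕ∞} (ha : (T.fOrd : ℕ∞) ≤ a)
    (ha' : T.fExact → a = T.fOrd) (hb : (T.gOrd : ℕ∞) ≤ b) (hb' : T.gExact → b = T.gOrd)
    (hd : d = T.discOrd) : T.HasOrders a b d := by
  cases T with
  | I m =>
    rcases eq_or_ne m 0 with rfl | hm
    · simpa [HasOrders, discOrd] using hd
    · simp only [HasOrders, if_neg hm]
      exact ⟨ha' hm, hb' hm, hd⟩
  | III => exact ⟨ha' trivial, hb, hd⟩
  | IV => exact ⟨ha, hb' trivial, hd⟩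
  | Istar j =>
    rcases eq_or_ne j 0 with rfl | hj
    · exact ⟨ha, hb, hd⟩
    · simp only [HasOrders, if_neg hj]
      exact ⟨ha' hj, hb' hj, hd⟩
  | IVstar => exact ⟨ha, hb' trivial, hd⟩
  | IIIstar => exact ⟨ha' trivial, hb, hd⟩
  | IIstar => exact ⟨ha, hb' trivial, hd⟩

theorem mero_smul_inv (n : ℕ) [NeZero n] (a : Base) :
    mero ((n : ℂ)⁻¹ • a) = mero a / n := by
  have hn : (n : ℂ) ≠ 0 := Nat.cast_ne_zero.2 (NeZero.ne n)
  have hn' : (n : Mero) ≠ 0 := Nat.cast_ne_zero.2 (NeZero.ne n)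
  rw [eq_div_iff hn', mero, mero, ← map_natCast (HahnSeries.ofPowerSeries ℤ ℂ) n, ← map_mul,
    mul_comm, ← nsmul_eq_mul, ← Nat.cast_smul_eq_nsmul ℂ, smul_inv_smul₀ hn]

/-- A component of the discriminant with its type and its Tate invariants. -/
def IsComponent (W : Weierstrass) (φ : Base) (T : Kodaira) (β γ : Option Mero) : Prop :=
  PowerSeries.constantCoeff φ = 0 ∧ HasKodairaType W φ T ∧ HasTateInvariants W φ T β γ

theorem isComponent_of {W : Weierstrass} {φ : Base} {T : Kodaira} {β γ : Option Mero}
    (hφ : PowerSeries.constantCoeff φ = 0) {f g δ : Base}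
    (hf : RestrictsTo φ T.fOrd (3 * W.v - W.u ^ 2) f)
    (hg : RestrictsTo φ T.gOrd (2 * W.u ^ 3 - 9 * W.u * W.v + 27 * W.w) g)
    (hδ : RestrictsTo φ T.discOrd W.disc δ)
    (hf0 : T.fExact → f ≠ 0) (hg0 : T.gExact → g ≠ 0) (hδ0 : δ ≠ 0)
    (hβ : β = betaOf T (mero f / 3) (mero g / 27) (mero δ))
    (hγ : γ = gammaOf T (mero f / 3) (mero g / 27) (mero δ)) : IsComponent W φ T β γ := by
  rw [← three_smul_f] at hf
  rw [← twentyseven_smul_g] at hg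
  replace hf := hf.of_mul (by norm_num)
  replace hg := hg.of_mul (by norm_num)
  have h3 := mero_smul_inv 3 f
  have h27 := mero_smul_inv 27 g
  rw [Nat.cast_ofNat, Nat.cast_ofNat] at h3 h27
  refine ⟨hφ, hasOrders_of hf.le_emultiplicity (fun h => hf.emultiplicity_eq hφ ?_)
    hg.le_emultiplicity (fun h => hg.emultiplicity_eq hφ ?_) (hδ.emultiplicity_eq hφ hδ0), _, _, _,
    hf, hg, hδ, by rw [h3, h27, hβ], by rw [h3, h27, hγ]⟩
  · exact smul_ne_zero (by norm_num) (hf0 h)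
  · exact smul_ne_zero (by norm_num) (hg0 h)

/-! ### Orders -/

theorem mero_injective : Function.Injective mero := HahnSeries.ofPowerSeries_injective

theorem order_mero_unit {u : Base} (hu : IsUnit u) : HahnSeries.order (mero u) = 0 := by
  have hne : (mero u).coeff 0 ≠ 0 := by
    have : (mero u).coeff ((0 : ℕ) : ℤ) = PowerSeries.coeff 0 u :=
      HahnSeries.ofPowerSeries_apply_coeff u 0
    rw [Nat.cast_zero] at this
    rw [this, PowerSeries.coeff_zero_eq_constantCoeff]
    exact (PowerSeries.isUnit_iff_constantCoeff.1 hu).ne_zero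
  have h0 : mero u ≠ 0 := fun h => hne (by rw [h]; rfl)
  refine le_antisymm (HahnSeries.order_le_of_coeff_ne_zero hne) ?_
  rw [HahnSeries.le_order_iff_forall h0]
  intro j hj
  rw [mero, HahnSeries.ofPowerSeries_apply, HahnSeries.embDomain_of_notMem_range]
  rintro ⟨n, rfl⟩
  simp at hj
  omega

theorem order_mero_X_pow (n : ℕ) : HahnSeries.order (mero (PowerSeries.X ^ n)) = n := by
  rw [mero, HahnSeries.ofPowerSeries_X_pow, HahnSeries.order_single one_ne_zero]

theorem order_mero_mul {u : Base} (hu : IsUnit u) (n : ℕ) :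
    HahnSeries.order (mero (u * PowerSeries.X ^ n)) = n := by
  have h1 : mero u ≠ 0 := fun h => hu.ne_zero (mero_injective (by rw [h, mero, map_zero]))
  have h2 : mero (PowerSeries.X ^ n) ≠ 0 :=
    fun h => pow_ne_zero n PowerSeries.X_ne_zero (mero_injective (by rw [h, mero, map_zero]))
  rw [mero, map_mul]
  change HahnSeries.order (mero u * mero (PowerSeries.X ^ n)) = n
  rw [HahnSeries.order_mul h1 h2, order_mero_unit hu, order_mero_X_pow, zero_add]

theorem order_mul_zpow {c : ℂ} (hc : c ≠ 0) (e : ℕ) (k : ℤ) :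
    HahnSeries.order (HahnSeries.C c * mero (PowerSeries.X ^ e) ^ k : Mero) = e * k := by
  have h : mero (PowerSeries.X ^ e) ^ k = (HahnSeries.single (e * k : ℤ) 1 : Mero) := by
    have h1 (n : ℤ) := RatFunc.single_zpow (F := ℂ) n
    rw [mero, HahnSeries.ofPowerSeries_X_pow, h1 (e * k), h1 e, ← zpow_mul]
  rw [h, HahnSeries.C_apply, HahnSeries.single_mul_single, HahnSeries.order_single (by simpa)]
  simp

/-! ### Restriction to disks -/

theorem coeff_onDisk (c : ℂ) (F : Germ) (n : ℕ) : PowerSeries.coeff n (onDisk c F) =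
    ∑ p ∈ Finset.HasAntidiagonal.antidiagonal n,
      PowerSeries.coeff p.2 (PowerSeries.coeff p.1 F) * c ^ p.2 := by
  rw [onDisk, PowerSeries.coeff_mk, Finset.Nat.antidiagonal_eq_map', Finset.sum_map]
  rfl

theorem onDisk_add (c : ℂ) (F G : Germ) : onDisk c (F + G) = onDisk c F + onDisk c G := by
  ext n
  simp only [coeff_onDisk, map_add, add_mul, Finset.sum_add_distrib]

theorem onDisk_mul (c : ℂ) (F G : Germ) : onDisk c (F * G) = onDisk c F * onDisk c G := by
  ext n
  rw [PowerSeries.coeff_mul, coeff_onDisk]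
  simp only [coeff_onDisk, PowerSeries.coeff_mul, map_sum, Finset.sum_mul, Finset.mul_sum]
  simp only [Finset.sum_sigma']
  refine Finset.sum_bij'
    (fun x _ => ⟨(x.2.1.1 + x.2.2.1, x.2.1.2 + x.2.2.2), (x.2.1.2, x.2.2.2), (x.2.1.1, x.2.2.1)⟩)
    (fun x _ => ⟨(x.2.2.1 + x.2.1.1, x.2.2.2 + x.2.1.2), (x.2.2.1, x.2.1.1), (x.2.2.2, x.2.1.2)⟩)
    ?_ ?_ ?_ ?_ ?_
  · rintro ⟨⟨a, b⟩, ⟨a1, a2⟩, ⟨b1, b2⟩⟩ h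
    simp only [Finset.mem_sigma, Finset.HasAntidiagonal.mem_antidiagonal] at h ⊢
    exact ⟨by omega, trivial, trivial⟩
  · rintro ⟨⟨a, b⟩, ⟨a1, a2⟩, ⟨b1, b2⟩⟩ h
    simp only [Finset.mem_sigma, Finset.HasAntidiagonal.mem_antidiagonal] at h ⊢
    exact ⟨by omega, trivial, trivial⟩
  · rintro ⟨⟨a, b⟩, ⟨a1, a2⟩, ⟨b1, b2⟩⟩ h
    simp only [Finset.mem_sigma, Finset.HasAntidiagonal.mem_antidiagonal] at h ⊢
    obtain ⟨h1, h2, h3⟩ := h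
    subst h2 h3
    rfl
  · rintro ⟨⟨a, b⟩, ⟨a1, a2⟩, ⟨b1, b2⟩⟩ h
    simp only [Finset.mem_sigma, Finset.HasAntidiagonal.mem_antidiagonal] at h ⊢
    obtain ⟨h1, h2, h3⟩ := h
    subst h2 h3
    rfl
  · rintro ⟨⟨a, b⟩, ⟨a1, a2⟩, ⟨b1, b2⟩⟩ h
    simp only [Finset.mem_sigma, Finset.HasAntidiagonal.mem_antidiagonal] at h ⊢
    rw [← h.2.2, pow_add]
    ring

theorem onDisk_lift_C (c r : ℂ) : onDisk c (lift (PowerSeries.C r)) = PowerSeries.C r := by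
  ext n
  rw [coeff_onDisk, Finset.sum_eq_single (0, n)]
  · simp only [lift, PowerSeries.coeff_C]
    rcases eq_or_ne n 0 with rfl | hn
    · simp
    · simp [PowerSeries.coeff_C, hn]
  · rintro ⟨i, j⟩ h hne
    have hi : i ≠ 0 := by
      rintro rfl
      apply hne
      simpa using h
    simp [lift, PowerSeries.coeff_C, hi]
  · simp

/-- Restriction to the disk `t = c z`, as a ring homomorphism. -/
def onDiskHom (c : ℂ) : Germ →+* PowerSeries ℂ where
  toFun := onDisk c
  map_one' := by simpa [lift] using onDisk_lift_C c 1
  map_mul' := onDisk_mul c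
  map_zero' := by simpa [lift] using onDisk_lift_C c 0
  map_add' := onDisk_add c

theorem onDiskHom_apply (c : ℂ) (F : Germ) : onDiskHom c F = onDisk c F := rfl

theorem onDiskHom_lift_C (c r : ℂ) : onDiskHom c (lift (PowerSeries.C r)) = PowerSeries.C r :=
  onDisk_lift_C c r

theorem smul_eq_lift (r : ℂ) (F : Germ) : r • F = lift (PowerSeries.C r) * F := by
  ext i j
  simp [lift, PowerSeries.coeff_C_mul]

theorem onDiskHom_z (c : ℂ) : onDiskHom c z = PowerSeries.X := by
  ext n
  rw [onDiskHom_apply, coeff_onDisk, PowerSeries.coeff_X]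
  split_ifs with h
  · subst h
    simp [Finset.Nat.antidiagonal_succ, z, PowerSeries.coeff_X]
  · refine Finset.sum_eq_zero ?_
    rintro ⟨i, j⟩ hij
    rw [Finset.HasAntidiagonal.mem_antidiagonal] at hij
    simp only [z, PowerSeries.coeff_X]
    split_ifs with hi
    · have hj : j ≠ 0 := by omega
      simp [PowerSeries.coeff_one, hj]
    · simp

theorem onDiskHom_lift_X (c : ℂ) :
    onDiskHom c (lift PowerSeries.X) = PowerSeries.C c * PowerSeries.X := by
  ext n
  rw [onDiskHom_apply, coeff_onDisk, PowerSeries.coeff_C_mul, PowerSeries.coeff_X]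
  split_ifs with h
  · subst h
    simp [Finset.Nat.antidiagonal_succ, lift, PowerSeries.coeff_C]
  · rw [mul_zero]
    refine Finset.sum_eq_zero ?_
    rintro ⟨i, j⟩ hij
    rw [Finset.HasAntidiagonal.mem_antidiagonal] at hij
    simp only [lift, PowerSeries.coeff_C]
    split_ifs with hi
    · have hj : j ≠ 1 := by omega
      simp [PowerSeries.coeff_X, hj]
    · simp

theorem constantCoeff_onDiskHom (c : ℂ) (F : Germ) :
    PowerSeries.constantCoeff (onDiskHom c F) =
      PowerSeries.constantCoeff (PowerSeries.constantCoeff F) := by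
  have h := coeff_onDisk c F 0
  rw [Finset.Nat.antidiagonal_zero, Finset.sum_singleton, pow_zero, mul_one,
    PowerSeries.coeff_zero_eq_constantCoeff_apply, PowerSeries.coeff_zero_eq_constantCoeff_apply,
    PowerSeries.coeff_zero_eq_constantCoeff_apply] at h
  exact h

theorem emultiplicity_X_eq {F H : PowerSeries ℂ} {k : ℕ} (h : F = PowerSeries.X ^ k * H)
    (hH : PowerSeries.constantCoeff H ≠ 0) : emultiplicity PowerSeries.X F = k := by
  rw [emultiplicity_eq_coe, h]
  refine ⟨dvd_mul_right _ _, fun hd => hH ?_⟩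
  rw [pow_succ, mul_dvd_mul_iff_left (pow_ne_zero _ PowerSeries.X_ne_zero)] at hd
  exact PowerSeries.X_dvd_iff.1 hd

theorem emultiplicity_ofNat_mul {n : ℕ} (hn : n ≠ 0) (F : PowerSeries ℂ) :
    emultiplicity PowerSeries.X ((n : PowerSeries ℂ) * F) = emultiplicity PowerSeries.X F := by
  have hu : IsUnit (n : PowerSeries ℂ) := by
    rw [PowerSeries.isUnit_iff_constantCoeff, map_natCast]
    exact (Nat.cast_ne_zero.2 hn).isUnit
  obtain ⟨u, hu⟩ := hu
  rw [← hu]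
  exact emultiplicity_eq_of_associated_right (associated_unit_mul_left _ _ u.isUnit)

theorem hasTypeOnDisk_of {W : Weierstrass} {c : ℂ} {T : Kodaira} {f g δ : PowerSeries ℂ}
    (hf : onDiskHom c (3 * W.v - W.u ^ 2) = PowerSeries.X ^ T.fOrd * f)
    (hg : onDiskHom c (2 * W.u ^ 3 - 9 * W.u * W.v + 27 * W.w) = PowerSeries.X ^ T.gOrd * g)
    (hδ : onDiskHom c W.disc = PowerSeries.X ^ T.discOrd * δ)
    (hf0 : T.fExact → PowerSeries.constantCoeff f ≠ 0)
    (hg0 : T.gExact → PowerSeries.constantCoeff g ≠ 0)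
    (hδ0 : PowerSeries.constantCoeff δ ≠ 0) : HasTypeOnDisk W c T := by
  have ef : emultiplicity PowerSeries.X (onDisk c W.f) =
      emultiplicity PowerSeries.X (onDiskHom c (3 * W.v - W.u ^ 2)) := by
    rw [← three_smul_f, Algebra.smul_def, map_ofNat, map_mul, map_ofNat]
    exact (emultiplicity_ofNat_mul (n := 3) (by norm_num) _).symm
  have eg : emultiplicity PowerSeries.X (onDisk c W.g) = emultiplicity PowerSeries.X
      (onDiskHom c (2 * W.u ^ 3 - 9 * W.u * W.v + 27 * W.w)) := by
    rw [← twentyseven_smul_g, Algebra.smul_def, map_ofNat, map_mul, map_ofNat]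
    exact (emultiplicity_ofNat_mul (n := 27) (by norm_num) _).symm
  rw [HasTypeOnDisk, ef, eg]
  refine hasOrders_of ?_ (fun h => ?_) ?_ (fun h => ?_) ?_
  · exact le_emultiplicity_of_pow_dvd (hf ▸ dvd_mul_right _ _)
  · exact emultiplicity_X_eq hf (hf0 h)
  · exact le_emultiplicity_of_pow_dvd (hg ▸ dvd_mul_right _ _)
  · exact emultiplicity_X_eq hg (hg0 h)
  · exact emultiplicity_X_eq hδ hδ0

/-! ### Weighted homogeneity -/

/-- `F` is weighted homogeneous of weight `n`, for weights `b`, `d` of `z`, `t`. -/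
def IsHomog (b d : ℕ) (F : Germ) (n : ℕ) : Prop :=
  ∀ i j : ℕ, PowerSeries.coeff j (PowerSeries.coeff i F) ≠ 0 → b * i + d * j = n

variable {b d n m : ℕ} {F G : Germ}

theorem IsHomog.congr (h : IsHomog b d F n) (hn : n = m) : IsHomog b d F m := hn ▸ h

theorem isHomog_zero : IsHomog b d 0 n := fun i j h => absurd (by simp) h

theorem isHomog_lift_C (r : ℂ) : IsHomog b d (lift (PowerSeries.C r)) 0 := by
  intro i j h
  simp only [lift, PowerSeries.coeff_C] at h
  have hi : i = 0 := by
    by_contra hi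
    simp [hi] at h
  have hj : j = 0 := by
    by_contra hj
    simp [hi, hj, PowerSeries.coeff_C] at h
  simp [hi, hj]

theorem isHomog_ofNat (k : ℕ) [k.AtLeastTwo] : IsHomog b d (OfNat.ofNat k) 0 := by
  have := isHomog_lift_C (b := b) (d := d) (OfNat.ofNat k)
  rwa [lift, map_ofNat, map_ofNat] at this

theorem isHomog_z : IsHomog b d z b := by
  intro i j h
  simp only [z, PowerSeries.coeff_X] at h
  have hi : i = 1 := by
    by_contra hi
    simp [hi] at h
  have hj : j = 0 := by
    by_contra hj
    simp [hi, hj, PowerSeries.coeff_one] at h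
  simp [hi, hj]

theorem isHomog_t : IsHomog b d (lift PowerSeries.X) d := by
  intro i j h
  simp only [lift, PowerSeries.coeff_C] at h
  have hi : i = 0 := by
    by_contra hi
    simp [hi] at h
  have hj : j = 1 := by
    by_contra hj
    simp [hi, hj, PowerSeries.coeff_X] at h
  simp [hi, hj]

theorem IsHomog.add (hF : IsHomog b d F n) (hG : IsHomog b d G n) : IsHomog b d (F + G) n := by
  intro i j h
  by_cases hf : PowerSeries.coeff j (PowerSeries.coeff i F) = 0
  · exact hG i j fun hg => h (by simp [hf, hg])
  · exact hF i j hf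

theorem IsHomog.neg (hF : IsHomog b d F n) : IsHomog b d (-F) n :=
  fun i j h => hF i j fun hf => h (by simp [hf])

theorem IsHomog.sub (hF : IsHomog b d F n) (hG : IsHomog b d G n) : IsHomog b d (F - G) n :=
  sub_eq_add_neg F G ▸ hF.add hG.neg

theorem IsHomog.mul (hF : IsHomog b d F n) (hG : IsHomog b d G m) :
    IsHomog b d (F * G) (n + m) := by
  intro i j h
  rw [PowerSeries.coeff_mul, map_sum] at h
  obtain ⟨p, hp, h⟩ := Finset.exists_ne_zero_of_sum_ne_zero h
  rw [PowerSeries.coeff_mul] at h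
  obtain ⟨q, hq, h⟩ := Finset.exists_ne_zero_of_sum_ne_zero h
  rw [Finset.HasAntidiagonal.mem_antidiagonal] at hp hq
  rw [← hF _ _ (left_ne_zero_of_mul h), ← hG _ _ (right_ne_zero_of_mul h), ← hp, ← hq]
  ring

theorem IsHomog.pow (hF : IsHomog b d F n) (k : ℕ) : IsHomog b d (F ^ k) (k * n) := by
  induction k with
  | zero =>
    have := isHomog_lift_C (b := b) (d := d) 1
    simpa [lift] using this
  | succ k ih => exact pow_succ F k ▸ (ih.mul hF).congr (by ring)

theorem IsHomog.smul (hF : IsHomog b d F n) (r : ℂ) : IsHomog b d (r • F) n := by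
  rw [smul_eq_lift]
  exact ((isHomog_lift_C r).mul hF).congr (zero_add n)

theorem isHomogeneous_of {u v w : Germ} {a : ℕ} (hu : IsHomog b d u a) (hv : IsHomog b d v (2 * a))
    (hw : IsHomog b d w (3 * a)) : IsHomogeneous ⟨u, v, w⟩ a b d :=
  fun i j => ⟨hu i j, hv i j, hw i j⟩

/-! ### Intersection multiplicities -/

theorem mem_span_curves {φ ψ a u : Base} {N : ℕ} (hφ : φ = a * PowerSeries.X ^ N) (hu : IsUnit u)
    (h : φ - ψ = u * PowerSeries.X ^ N) (F : Germ) :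
    F ∈ Ideal.span ({curve φ, curve ψ} : Set Germ) ↔
      PowerSeries.X ^ N ∣ PowerSeries.constantCoeff F := by
  constructor
  · intro hF
    have hle : Ideal.span ({curve φ, curve ψ} : Set Germ) ≤
        (Ideal.span {(PowerSeries.X : Base) ^ N}).comap PowerSeries.constantCoeff := by
      rw [Ideal.span_le]
      have hψ : ψ = (a - u) * PowerSeries.X ^ N := by linear_combination hφ - h
      rintro _ (rfl | rfl)
      · simp only [SetLike.mem_coe, Ideal.mem_comap, Ideal.mem_span_singleton]
        rw [hφ]
        simp [curve, z, lift]
      · simp only [SetLike.mem_coe, Ideal.mem_comap, Ideal.mem_span_singleton]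
        rw [hψ]
        simp [curve, z, lift]
    simpa [Ideal.mem_comap, Ideal.mem_span_singleton] using hle hF
  · rintro ⟨b, hb⟩
    set I := Ideal.span ({curve φ, curve ψ} : Set Germ)
    have h1 : curve φ ∈ I := Ideal.subset_span (by simp)
    have h2 : curve ψ ∈ I := Ideal.subset_span (by simp)
    obtain ⟨v, hv⟩ := hu.exists_left_inv
    have hX : lift (PowerSeries.X ^ N) ∈ I := by
      have : lift (PowerSeries.X ^ N) = lift v * (curve ψ - curve φ) := by
        have : curve ψ - curve φ = lift (φ - ψ) := by simp [curve, lift]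
        rw [this, h]
        simp only [lift, ← map_mul, ← mul_assoc, hv, one_mul]
      exact this ▸ I.mul_mem_left _ (I.sub_mem h2 h1)
    have hz : z ∈ I := by
      have : z = curve φ + lift a * lift (PowerSeries.X ^ N) := by
        rw [curve, hφ]
        simp [lift]
      exact this ▸ I.add_mem h1 (I.mul_mem_left _ hX)
    rw [PowerSeries.eq_X_mul_shift_add_const F, hb, map_mul]
    exact I.add_mem (I.mul_mem_right _ hz) (I.mul_mem_right _ hX)

theorem intersectionMult_eq {φ ψ a u : Base} {N : ℕ} (hφ : φ = a * PowerSeries.X ^ N)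
    (hu : IsUnit u) (h : φ - ψ = u * PowerSeries.X ^ N) : intersectionMult φ ψ = N := by
  set I := Ideal.span ({curve φ, curve ψ} : Set Germ) with hI
  let L : Germ →ₗ[ℂ] (Fin N → ℂ) :=
    { toFun := fun F j => PowerSeries.coeff j (PowerSeries.constantCoeff F)
      map_add' := fun F G => by ext j; simp
      map_smul' := fun r F => by
        ext j
        rw [smul_eq_lift]
        simp [lift] }
  have hL (F : Germ) (j : Fin N) :
      L F j = PowerSeries.coeff j (PowerSeries.constantCoeff F) := rfl
  have hker : LinearMap.ker L = I.restrictScalars ℂ := by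
    ext F
    rw [LinearMap.mem_ker, Submodule.restrictScalars_mem, mem_span_curves hφ hu h,
      PowerSeries.X_pow_dvd_iff]
    exact ⟨fun hF j hj => (hL F ⟨j, hj⟩).symm.trans (congrFun hF _), fun hF => funext fun j =>
      (hL F j).trans (hF j j.2)⟩
  have hsurj : Function.Surjective L := by
    intro x
    refine ⟨lift (PowerSeries.mk fun j => if hj : j < N then x ⟨j, hj⟩ else 0), ?_⟩
    ext j
    rw [hL]
    simp [lift]
  rw [intersectionMult, ← (Submodule.Quotient.restrictScalarsEquiv ℂ I).finrank_eq,
    ← (Submodule.quotEquivOfEq _ _ hker).finrank_eq,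
    (L.quotKerEquivOfSurjective hsurj).finrank_eq, Module.finrank_fin_fun]

/-! ### Other components of the discriminant -/

theorem isUnit_germ_iff {F : Germ} :
    IsUnit F ↔ PowerSeries.constantCoeff (PowerSeries.constantCoeff F) ≠ 0 := by
  rw [PowerSeries.isUnit_iff_constantCoeff, PowerSeries.isUnit_iff_constantCoeff, isUnit_iff_ne_zero]

theorem associated_of_dvd_curve {φ : Base} {p : Germ} (hp : Prime p) (h : p ∣ curve φ) : Associated p (curve φ) := by
  obtain ⟨q, hq⟩ := h
  have h1 := congrArg (fun F => PowerSeries.constantCoeff (PowerSeries.coeff 1 F)) hq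
  have hp' : ¬ PowerSeries.constantCoeff (PowerSeries.constantCoeff p) ≠ 0 :=
    fun h => hp.not_isUnit (isUnit_germ_iff.2 h)
  rw [not_not] at hp'
  simp [curve, z, lift, PowerSeries.coeff_mul, Finset.Nat.antidiagonal_succ, hp'] at h1
  have hq' : IsUnit q := isUnit_germ_iff.2 fun h => by simp [h] at h1
  exact hq ▸ associated_mul_unit_right p q hq'

theorem noOtherGauge_of {r : ℕ} {W : Weierstrass} {φ : Fin r → Base} {m : Fin r → ℕ} {R : Germ}
    (hW : W.disc = (∏ i, curve (φ i) ^ m i) * R)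
    (hR : ∀ p, Prime p → p ^ 2 ∣ R →
      (∃ i, p ∣ curve (φ i)) ∨ (p ∣ W.f ∧ p ∣ W.g ∧ ¬ p ^ 2 ∣ W.g)) : NoOtherGauge W φ := by
  intro p hp _
  by_cases h : ∃ i, p ∣ curve (φ i)
  · obtain ⟨i, hi⟩ := h
    exact Or.inl ⟨i, associated_of_dvd_curve hp hi⟩
  · refine Or.inr ?_
    by_cases h2 : p ^ 2 ∣ W.disc
    · rw [hW] at h2
      have hprod : ¬ p ∣ ∏ i, curve (φ i) ^ m i := fun hd => by
        obtain ⟨i, -, hi⟩ := (Prime.dvd_finsetProd_iff hp _).1 hd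
        exact h ⟨i, hp.dvd_of_dvd_pow hi⟩
      rcases hR p hp (hp.pow_dvd_of_dvd_mul_left 2 hprod h2) with h3 | h3
      · exact absurd h3 h
      · exact Or.inr h3
    · exact Or.inl h2

/-- The derivative with respect to the variable of a power series. -/
def deriv₁ {R : Type*} [CommRing R] (F : PowerSeries R) : PowerSeries R :=
  PowerSeries.derivative R F

section Derivative

variable {R : Type*} [CommRing R]

theorem deriv₁_add (F G : PowerSeries R) : deriv₁ (F + G) = deriv₁ F + deriv₁ G :=
  map_add (PowerSeries.derivative R) F G

theorem deriv₁_mul (F G : PowerSeries R) : deriv₁ (F * G) = F * deriv₁ G + G * deriv₁ F :=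
  Derivation.leibniz (PowerSeries.derivative R) F G

theorem deriv₁_C (a : R) : deriv₁ (PowerSeries.C a) = 0 := PowerSeries.derivative_C

theorem deriv₁_X : deriv₁ (PowerSeries.X : PowerSeries R) = 1 := PowerSeries.derivative_X

end Derivative

theorem dvd_deriv₁_of_sq_dvd {p F : Germ} (h : p ^ 2 ∣ F) :
    p ∣ deriv₁ F := by
  obtain ⟨Q, rfl⟩ := h
  rw [pow_two, deriv₁_mul, deriv₁_mul]
  exact ⟨p * deriv₁ Q + Q * (2 * deriv₁ p), by ring⟩

theorem not_sq_dvd_of_isUnit {p R : Germ} (hp : Prime p) (hR : IsUnit R) : ¬ p ^ 2 ∣ R :=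
  fun h => hp.not_isUnit (isUnit_of_dvd_unit ((dvd_pow_self p two_ne_zero).trans h) hR)

theorem not_sq_dvd_linear {p : Germ} (hp : Prime p) {a : Base} (ha : IsUnit a) (b : Base) :
    ¬ p ^ 2 ∣ lift a * z + lift b := by
  intro h
  have := dvd_deriv₁_of_sq_dvd h
  rw [deriv₁_add, deriv₁_mul, lift, lift,
    deriv₁_C, deriv₁_C, z, deriv₁_X] at this
  simp only [mul_one, mul_zero, add_zero] at this
  exact hp.not_isUnit (isUnit_of_dvd_unit this (ha.map PowerSeries.C))

theorem dvd_z_of_sq_dvd_quadratic {p : Germ} (hp : Prime p) {a b c u : Base} {n : ℕ} (ha : IsUnit a)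
    (hu : IsUnit u) (h4 : 4 * a * c - (PowerSeries.X * b) ^ 2 = u * PowerSeries.X ^ n)
    (h : p ^ 2 ∣ lift a * z ^ 2 + lift (PowerSeries.X * b) * z + lift c) : p ∣ z := by
  have h1 : p ∣ 2 * lift a * z + lift (PowerSeries.X * b) := by
    have := dvd_deriv₁_of_sq_dvd h
    rw [pow_two, deriv₁_add, deriv₁_add,
      deriv₁_mul, deriv₁_mul, deriv₁_mul,
      lift, lift, lift, deriv₁_C, deriv₁_C,
      deriv₁_C, z, deriv₁_X] at this
    refine this.trans (dvd_of_eq ?_)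
    simp only [lift, z]
    ring
  have h2 : p ∣ lift (u * PowerSeries.X ^ n) := by
    have : lift (u * PowerSeries.X ^ n) =
        4 * lift a * (lift a * z ^ 2 + lift (PowerSeries.X * b) * z + lift c) -
        (2 * lift a * z + lift (PowerSeries.X * b)) *
          (2 * lift a * z + lift (PowerSeries.X * b)) := by
      rw [← h4]
      simp only [lift, map_sub, map_mul, map_pow, map_ofNat]
      ring
    rw [this]
    exact dvd_sub (((dvd_pow_self p two_ne_zero).trans h).mul_left _) (h1.mul_right _)
  have h3 : p ∣ lift PowerSeries.X := by
    rw [lift, map_mul, map_pow] at h2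
    rcases hp.dvd_or_dvd h2 with h2 | h2
    · exact absurd (isUnit_of_dvd_unit h2 (hu.map PowerSeries.C)) hp.not_isUnit
    · exact hp.dvd_of_dvd_pow h2
  have h5 : p ∣ 2 * lift a * z := by
    have := dvd_sub h1 (h3.mul_right (lift b))
    rwa [lift, lift, lift, lift, map_mul, add_sub_cancel_right] at this
  rcases hp.dvd_or_dvd h5 with h5 | h5
  · have h2u : IsUnit (2 : Germ) := isUnit_germ_iff.2 (by
      rw [map_ofNat, map_ofNat]
      exact two_ne_zero)
    exact absurd (isUnit_of_dvd_unit h5 (h2u.mul (ha.map PowerSeries.C))) hp.not_isUnit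
  · exact h5

/-- Constants as meromorphic functions. -/
def meroC : ℂ →+* Mero := HahnSeries.C

theorem ord_some_eq {e : ℕ} {b : Mero} {c : ℂ} {k : ℤ} (hc : c ≠ 0)
    (h : b = meroC c * mero (PowerSeries.X ^ e) ^ k) : ord (some b) = e * k := by
  rw [h]
  exact order_mul_zpow hc e k

theorem ord_none_eq (e : ℕ) : ord none = e * 0 := by simp [ord]

instance : CharZero Base :=
  charZero_of_injective_ringHom (f := (PowerSeries.C : ℂ →+* Base)) PowerSeries.C_injective

variable {r : ℕ} {T : Fin r → Kodaira}

theorem anomaliesCancel_of {W : Weierstrass} {φ : Fin r → Base} {β γ : Fin r → Option Mero}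
    {k : ℚ} {ρ : Rep (CoverSum T)} {b c : Fin r → ℤ} {n : ℕ} (hbal : IsBalanced T k ρ b c n) {e : ℕ}
    (hβ : ∀ i, ord (β i) = e * b i) (hγ : ∀ i, ord (γ i) = e * c i)
    (hφ : ∀ i j, i ≠ j → intersectionMult (φ i) (φ j) = e * n)
    (hcomp : ∀ i, IsComponent W (φ i) (T i) (β i) (γ i)) :
    AnomaliesCancel T W φ β γ (k / e) ρ :=
  ⟨fun i => (hcomp i).1, fun i => (hcomp i).2.1, fun i => (hcomp i).2.2,
    fun s hs => hbal.localAnomalyCancellation hβ hγ hφ s hs⟩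

theorem verified_of {T' : Kodaira} {W : Germ → Weierstrass} {Δ : Germ → Germ}
    {φ : Base → Fin r → Base} {n : ℕ} {β γ : Mero → Fin r → Option Mero}
    {a b d : ℕ} {k : ℚ} {ι : CoverSum T →ₗ[ℂ] Cartan T'.cover} {ρ : Rep (CoverSum T)}
    {B C : Fin r → ℤ} (hdisc : ∀ t, (W t).disc = Δ t) (h0 : HasTypeOnDisk (W (lift PowerSeries.X)) 0 T')
    (hdisk : HasSpecialType (W (lift PowerSeries.X)) T')
    (hhom : IsHomogeneous (W (lift PowerSeries.X)) a b d) (hk : k * (3 * a) = T'.coxeter * d)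
    (hbr : BranchingRule T T' ι ρ) (hbal : IsBalanced T k ρ B C n)
    (hβ : ∀ (e : ℕ) (i : Fin r), ord (β (mero (PowerSeries.X ^ e)) i) = e * B i)
    (hγ : ∀ (e : ℕ) (i : Fin r), ord (γ (mero (PowerSeries.X ^ e)) i) = e * C i)
    (hφ : ∀ (e : ℕ) (i j : Fin r), i ≠ j →
      intersectionMult (φ (PowerSeries.X ^ e) i) (φ (PowerSeries.X ^ e) j) = e * n)
    (hother : ∀ e : ℕ, 1 ≤ e →
      NoOtherGauge (W (lift (PowerSeries.X ^ e))) (φ (PowerSeries.X ^ e)))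
    (hcomp : ∀ t : Base, PowerSeries.constantCoeff t = 0 → t ≠ 0 → ∀ i,
      IsComponent (W (lift t)) (φ t i) (T i) (β (mero t) i) (γ (mero t) i)) :
    Verified T T' W Δ φ n β γ a b d k ι ρ :=
  ⟨h0, hdisk, hhom, hk, hbr, fun e he => ⟨hdisc _, hother e he, hφ e,
    anomaliesCancel_of hbal (hβ e) (hγ e) (hφ e) (hcomp _
      (by simp [Nat.one_le_iff_ne_zero.1 he]) (pow_ne_zero e PowerSeries.X_ne_zero))⟩⟩

theorem hasSpecialType_of_forall {W : Weierstrass} {T' : Kodaira}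
    (h : ∀ c, HasTypeOnDisk W c T') : HasSpecialType W T' := by
  simp [HasSpecialType, h]

theorem RestrictsTo.of_eq {φ a : Base} {k : ℕ} {F : Germ} (H : Germ) (hF : F = curve φ ^ k * H)
    (h : ∀ (Q : Type) [CommRing Q] (q : Germ →+* Q), q z = q (lift φ) → q H = q (lift a)) :
    RestrictsTo φ k F a :=
  ⟨H, hF, curve_dvd_of h⟩

theorem verifiedOne_of {T T' : Kodaira} {W : Germ → Weierstrass} {Δ : Germ → Germ}
    {β γ : Mero → Option Mero} {a b d : ℕ} {k : ℚ} {ι : Cartan T.cover →ₗ[ℂ] Cartan T'.cover}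
    {ρ : Rep (Cartan T.cover)} {B C : ℤ} (hdisc : ∀ t, (W t).disc = Δ t)
    (h0 : HasTypeOnDisk (W (lift PowerSeries.X)) 0 T')
    (hdisk : HasSpecialType (W (lift PowerSeries.X)) T')
    (hhom : IsHomogeneous (W (lift PowerSeries.X)) a b d) (hk : k * (3 * a) = T'.coxeter * d)
    (hbr : BranchingRule (fun _ : Fin 1 => T) T' (assemble fun _ => ι) (on (fun _ : Fin 1 => T) 0 ρ))
    (hbal : IsBalanced (fun _ : Fin 1 => T) k (on (fun _ : Fin 1 => T) 0 ρ) (fun _ => B)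
      (fun _ => C) 0)
    (hβ : ∀ e : ℕ, ord (β (mero (PowerSeries.X ^ e))) = e * B)
    (hγ : ∀ e : ℕ, ord (γ (mero (PowerSeries.X ^ e))) = e * C)
    {m : ℕ} (R : Germ → Germ) (hm : ∀ t, Δ t = z ^ m * R t)
    (hR : ∀ e : ℕ, 1 ≤ e → ∀ p, Prime p → p ^ 2 ∣ R (lift (PowerSeries.X ^ e)) →
      p ∣ z ∨ (p ∣ (W (lift (PowerSeries.X ^ e))).f ∧ p ∣ (W (lift (PowerSeries.X ^ e))).g ∧
        ¬ p ^ 2 ∣ (W (lift (PowerSeries.X ^ e))).g))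
    {f g δ : Base → Base}
    (hf : ∀ t, RestrictsTo 0 T.fOrd (3 * (W (lift t)).v - (W (lift t)).u ^ 2) (f t))
    (hg : ∀ t, RestrictsTo 0 T.gOrd (2 * (W (lift t)).u ^ 3 -
      9 * (W (lift t)).u * (W (lift t)).v + 27 * (W (lift t)).w) (g t))
    (hδ : ∀ t, RestrictsTo 0 T.discOrd (Δ (lift t)) (δ t))
    (hne : ∀ t ≠ 0, (T.fExact → f t ≠ 0) ∧ (T.gExact → g t ≠ 0) ∧ δ t ≠ 0)
    (hinv : ∀ t ≠ 0,
      β (mero t) = betaOf T (mero (f t) / 3) (mero (g t) / 27) (mero (δ t)) ∧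
      γ (mero t) = gammaOf T (mero (f t) / 3) (mero (g t) / 27) (mero (δ t))) :
    VerifiedOne T T' W Δ β γ a b d k ι ρ := by
  refine verified_of hdisc h0 hdisk hhom hk hbr hbal (fun e _ => hβ e) (fun e _ => hγ e)
    (fun e i j hij => absurd (Subsingleton.elim i j) hij) (fun e he => ?_) (fun t ht ht0 i => ?_)
  · refine noOtherGauge_of (m := fun _ => m) (R := R (lift (PowerSeries.X ^ e))) ?_ ?_
    · rw [hdisc, hm, Fin.prod_univ_one, curve_zero]
    · intro p hp h
      exact (hR e he p hp h).imp_left fun h => ⟨0, by rwa [curve_zero]⟩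
  · obtain ⟨h1, h2, h3⟩ := hne t ht0
    exact isComponent_of (map_zero _) (hf t) (hg t) (by rw [hdisc]; exact hδ t) h1 h2 h3
      (hinv t ht0).1 (hinv t ht0).2

set_option linter.unusedSimpArgs false

/-! ### Families with one component -/

theorem verified_III_IV : VerifiedOne III IV (fun t => ⟨0, 2 * t * z, z ^ 2⟩)
      (fun t => z ^ 3 * (27 * z + 32 * t ^ 3))
      (fun _ => none) (fun t => some (2 * t)) 2 3 1 (1 / 2) (embAA 2) (fundA 2) := by
  have hd (c : ℂ) : HasTypeOnDisk ⟨0, 2 * lift PowerSeries.X * z, z ^ 2⟩ c IV := by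
    refine hasTypeOnDisk_of (f := 6 * PowerSeries.C c) (g := 27) (δ := 32 * PowerSeries.X ^ 2 *
        PowerSeries.C c ^ 3 + 27) ?_ ?_ ?_ ?_ ?_ ?_
    iterate 3
      · simp only [fOrd, gOrd, discOrd, disc_eq, map_add, map_sub, map_mul, map_pow, map_neg,
          map_ofNat, map_zero, onDiskHom_z, onDiskHom_lift_X]
        ring
    all_goals simp [fExact, gExact, map_ofNat]
  refine verifiedOne_of (fun t => ?_) (hd 0) (hasSpecialType_of_forall hd) ?_ ?_ branching_A2_A3
    balanced_III (fun e => ?_) (fun e => ?_) (m := 3) (fun t => 27 * z + 32 * t ^ 3) (fun t => ?_)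
    ?_ (f := fun t => 6 * t) (g := fun t => 27) (δ := fun t => 32 * t ^ 3) (fun t => .of_eq (6 *
    lift t) ?_ fun Q _ q hq => ?_) (fun t => .of_eq (27) ?_ fun Q _ q hq => ?_) (fun t => .of_eq
    (27 * z + 32 * lift t ^ 3) ?_ fun Q _ q hq => ?_) (fun t ht => ?_) (fun t ht => ?_)
  · rw [disc_eq]
    ring
  · exact isHomogeneous_of isHomog_zero ((((isHomog_ofNat 2).mul isHomog_t).mul isHomog_z : IsHomog
        3 1 _ 4).congr rfl) ((isHomog_z.pow 2 : IsHomog 3 1 _ 6).congr rfl)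
  · norm_num [coxeter]
  · exact ord_none_eq e
  · exact ord_some_eq (c := 2) (k := 1) (by norm_num) (by simp [map_ofNat])
  · ring
  · intro e he p hp h
    refine absurd ?_ (not_sq_dvd_linear hp (a := 27) ?_ (32 * (PowerSeries.X ^ e) ^ 3))
    · convert h using 1
      simp only [lift, map_add, map_sub, map_mul, map_pow, map_neg, map_ofNat]
    · exact PowerSeries.isUnit_iff_constantCoeff.2 (by simp [map_ofNat])
  iterate 3
    · simp only [fOrd, gOrd, discOrd, curve, lift, map_zero]
      ring
    · simp only [lift, map_add, map_sub, map_mul, map_pow, map_neg, map_ofNat, map_zero, map_one]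
          at hq ⊢
      try simp only [hq]
      try ring
  · simp [fExact, gExact, ht]
  · have hx : mero t ≠ 0 := fun h => ht (mero_injective (h.trans (map_zero _).symm))
    refine ⟨?_, ?_⟩
    all_goals
      simp only [betaOf, gammaOf, mero, map_add, map_sub, map_mul, map_pow, map_neg, map_ofNat,
        map_one, map_zero, ↓reduceIte, Nat.reduceMod, Nat.reduceLeDiff, OfNat.ofNat_ne_zero,
        OfNat.ofNat_ne_one, one_ne_zero, Nat.zero_ne_one, Option.some.injEq] at hx ⊢
      try field_simp
      try norm_num
      try ring

theorem verified_I6_IVstar : VerifiedOne (I 6) IVstar (fun t => ⟨t ^ 2, 2 * t * z ^ 2, z ^ 4⟩)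
      (fun t => z ^ 6 * (27 * z ^ 2 - 4 * t ^ 3))
      (fun t => some (t ^ 2)) (fun t => some (-4 * t⁻¹)) 4 3 2 2
      (chain 6 ![simpleE6 0, simpleE6 2, simpleE6 3, simpleE6 4, simpleE6 5])
      (1 + extA 6 3) := by
  have hd (c : ℂ) : HasTypeOnDisk ⟨lift PowerSeries.X ^ 2, 2 * lift PowerSeries.X * z ^ 2, z ^ 4⟩ c
      IVstar := by
    refine hasTypeOnDisk_of (f := -PowerSeries.X * PowerSeries.C c ^ 4 + 6 * PowerSeries.C c) (g :=
        2 * PowerSeries.X ^ 2 * PowerSeries.C c ^ 6 - 18 * PowerSeries.X * PowerSeries.C c ^ 3 +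
        27) (δ := -4 * PowerSeries.X * PowerSeries.C c ^ 3 + 27) ?_ ?_ ?_ ?_ ?_ ?_
    iterate 3
      · simp only [fOrd, gOrd, discOrd, disc_eq, map_add, map_sub, map_mul, map_pow, map_neg,
          map_ofNat, map_zero, onDiskHom_z, onDiskHom_lift_X]
        ring
    all_goals simp [fExact, gExact, map_ofNat]
  refine verifiedOne_of (fun t => ?_) (hd 0) (hasSpecialType_of_forall hd) ?_ ?_ branching_A6_E6
    balanced_I6 (fun e => ?_) (fun e => ?_) (m := 6) (fun t => 27 * z ^ 2 - 4 * t ^ 3) (fun t =>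
    ?_) ?_ (f := fun t => -t ^ 4) (g := fun t => 2 * t ^ 6) (δ := fun t => -4 * t ^ 3) (fun t =>
    .of_eq (6 * z ^ 2 * lift t - lift t ^ 4) ?_ fun Q _ q hq => ?_) (fun t => .of_eq (27 * z ^ 4 -
    18 * z ^ 2 * lift t ^ 3 + 2 * lift t ^ 6) ?_ fun Q _ q hq => ?_) (fun t => .of_eq (27 * z ^ 2 -
    4 * lift t ^ 3) ?_ fun Q _ q hq => ?_) (fun t ht => ?_) (fun t ht => ?_)
  · rw [disc_eq]
    ring
  · exact isHomogeneous_of ((isHomog_t.pow 2 : IsHomog 3 2 _ 4).congr rfl) ((((isHomog_ofNat 2).mul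
        isHomog_t).mul (isHomog_z.pow 2) : IsHomog 3 2 _ 8).congr rfl) ((isHomog_z.pow 4 : IsHomog
        3 2 _ 12).congr rfl)
  · norm_num [coxeter]
  · exact ord_some_eq (c := 1) (k := 2) (by norm_num) (by simp [map_ofNat])
  · exact ord_some_eq (c := -4) (k := -1) (by norm_num) (by simp [map_ofNat])
  · ring
  · intro e he p hp h
    refine Or.inl (dvd_z_of_sq_dvd_quadratic hp (a := 27) (b := 0) (c := -4 * (PowerSeries.X ^ e) ^
        3) (u := -432) (n := e * 3) ?_ ?_ ?_ ?_)
    · exact PowerSeries.isUnit_iff_constantCoeff.2 (by simp [map_ofNat])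
    · exact PowerSeries.isUnit_iff_constantCoeff.2 (by simp [map_ofNat])
    · ring
    · convert h using 1
      simp only [lift, map_add, map_sub, map_mul, map_pow, map_neg, map_ofNat, map_zero]
      ring
  iterate 3
    · simp only [fOrd, gOrd, discOrd, curve, lift, map_zero]
      ring
    · simp only [lift, map_add, map_sub, map_mul, map_pow, map_neg, map_ofNat, map_zero, map_one]
          at hq ⊢
      try simp only [hq]
      try ring
  · simp [fExact, gExact, ht]
  · have hx : mero t ≠ 0 := fun h => ht (mero_injective (h.trans (map_zero _).symm))
    refine ⟨?_, ?_⟩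
    all_goals
      simp only [betaOf, gammaOf, mero, map_add, map_sub, map_mul, map_pow, map_neg, map_ofNat,
        map_one, map_zero, ↓reduceIte, Nat.reduceMod, Nat.reduceLeDiff, OfNat.ofNat_ne_zero,
        OfNat.ofNat_ne_one, one_ne_zero, Nat.zero_ne_one, Option.some.injEq] at hx ⊢
      try field_simp
      try norm_num
      try ring

theorem verified_I7_IIIstar : VerifiedOne (I 7) IIIstar
      (fun t => ⟨-4 * t * z + 16 * t ^ 3, z ^ 3 - 8 * t ^ 2 * z ^ 2, t * z ^ 4⟩)
      (fun t => z ^ 7 * (4 * z ^ 2 - 13 * t ^ 2 * z + 32 * t ^ 4))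
      (fun t => some (16 * t ^ 3)) (fun t => some (1 / 8 * (t ^ 2)⁻¹)) 6 4 2 2
      (chain 7 ![simpleE7 0, simpleE7 2, simpleE7 3, simpleE7 4, simpleE7 5, simpleE7 6])
      (fundA 7 + extA 7 3) := by
  have hd (c : ℂ) : HasTypeOnDisk ⟨-4 * lift PowerSeries.X * z + 16 * lift PowerSeries.X ^ 3, z ^ 3
      - 8 * lift PowerSeries.X ^ 2 * z ^ 2, lift PowerSeries.X * z ^ 4⟩ c IIIstar := by
    refine hasTypeOnDisk_of (f := -256 * PowerSeries.X ^ 3 * PowerSeries.C c ^ 6 + 128 *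
        PowerSeries.X ^ 2 * PowerSeries.C c ^ 4 - 40 * PowerSeries.X * PowerSeries.C c ^ 2 + 3) (g
        := 8192 * PowerSeries.X ^ 4 * PowerSeries.C c ^ 9 - 6144 * PowerSeries.X ^ 3 *
        PowerSeries.C c ^ 7 + 2688 * PowerSeries.X ^ 2 * PowerSeries.C c ^ 5 - 560 * PowerSeries.X
        * PowerSeries.C c ^ 3 + 63 * PowerSeries.C c) (δ := 32 * PowerSeries.X ^ 2 * PowerSeries.C
        c ^ 4 - 13 * PowerSeries.X * PowerSeries.C c ^ 2 + 4) ?_ ?_ ?_ ?_ ?_ ?_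
    iterate 3
      · simp only [fOrd, gOrd, discOrd, disc_eq, map_add, map_sub, map_mul, map_pow, map_neg,
          map_ofNat, map_zero, onDiskHom_z, onDiskHom_lift_X]
        ring
    all_goals simp [fExact, gExact, map_ofNat]
  refine verifiedOne_of (fun t => ?_) (hd 0) (hasSpecialType_of_forall hd) ?_ ?_ branching_A7_E7
    balanced_I7 (fun e => ?_) (fun e => ?_) (m := 7) (fun t => 4 * z ^ 2 - 13 * z * t ^ 2 + 32 * t
    ^ 4) (fun t => ?_) ?_ (f := fun t => -256 * t ^ 6) (g := fun t => 8192 * t ^ 9) (δ := fun t =>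
    32 * t ^ 4) (fun t => .of_eq (3 * z ^ 3 - 40 * z ^ 2 * lift t ^ 2 + 128 * z * lift t ^ 4 - 256
    * lift t ^ 6) ?_ fun Q _ q hq => ?_) (fun t => .of_eq (63 * z ^ 4 * lift t - 560 * z ^ 3 * lift
    t ^ 3 + 2688 * z ^ 2 * lift t ^ 5 - 6144 * z * lift t ^ 7 + 8192 * lift t ^ 9) ?_ fun Q _ q hq
    => ?_) (fun t => .of_eq (4 * z ^ 2 - 13 * z * lift t ^ 2 + 32 * lift t ^ 4) ?_ fun Q _ q hq =>
    ?_) (fun t ht => ?_) (fun t ht => ?_)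
  · rw [disc_eq]
    ring
  · exact isHomogeneous_of (((((((isHomog_ofNat 4).neg).mul isHomog_t).mul isHomog_z).congr (m :=
        6) rfl).add (((isHomog_ofNat 16).mul (isHomog_t.pow 3)).congr rfl) : IsHomog 4 2 _ 6).congr
        rfl) ((((isHomog_z.pow 3).congr (m := 12) rfl).sub ((((isHomog_ofNat 8).mul (isHomog_t.pow
        2)).mul (isHomog_z.pow 2)).congr rfl) : IsHomog 4 2 _ 12).congr rfl) (((isHomog_t).mul
        (isHomog_z.pow 4) : IsHomog 4 2 _ 18).congr rfl)
  · norm_num [coxeter]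
  · exact ord_some_eq (c := 16) (k := 3) (by norm_num) (by simp [map_ofNat])
  · exact ord_some_eq (c := 1 / 8) (k := -2) (by norm_num) (by simp [map_ofNat])
  · ring
  · intro e he p hp h
    obtain ⟨e, rfl⟩ := Nat.exists_eq_add_of_le' he
    refine Or.inl (dvd_z_of_sq_dvd_quadratic hp (a := 4) (b := (-13 * (PowerSeries.X ^ (e + 1))) *
        PowerSeries.X ^ e) (c := 32 * (PowerSeries.X ^ (e + 1)) ^ 4) (u := 343) (n := (e + 1) * 4)
        ?_ ?_ ?_ ?_)
    · exact PowerSeries.isUnit_iff_constantCoeff.2 (by simp [map_ofNat])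
    · exact PowerSeries.isUnit_iff_constantCoeff.2 (by simp [map_ofNat])
    · ring
    · convert h using 1
      simp only [lift, map_add, map_sub, map_mul, map_pow, map_neg, map_ofNat, map_zero]
      ring
  iterate 3
    · simp only [fOrd, gOrd, discOrd, curve, lift, map_zero]
      ring
    · simp only [lift, map_add, map_sub, map_mul, map_pow, map_neg, map_ofNat, map_zero, map_one]
          at hq ⊢
      try simp only [hq]
      try ring
  · simp [fExact, gExact, ht]
  · have hx : mero t ≠ 0 := fun h => ht (mero_injective (h.trans (map_zero _).symm))
    refine ⟨?_, ?_⟩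
    all_goals
      simp only [betaOf, gammaOf, mero, map_add, map_sub, map_mul, map_pow, map_neg, map_ofNat,
        map_one, map_zero, ↓reduceIte, Nat.reduceMod, Nat.reduceLeDiff, OfNat.ofNat_ne_zero,
        OfNat.ofNat_ne_one, one_ne_zero, Nat.zero_ne_one, Option.some.injEq] at hx ⊢
      try field_simp
      try norm_num
      try ring

theorem verified_I8_IIstar_of {ι : Cartan (A 8) →ₗ[ℂ] Cartan E8} {ρ : Rep (Cartan (A 8))}
    (hbr : BranchingRule (fun _ : Fin 1 => I 8) IIstar (assemble fun _ => ι)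
      (on (fun _ : Fin 1 => I 8) 0 ρ))
    (hbal : IsBalanced (fun _ : Fin 1 => I 8) 2 (on (fun _ : Fin 1 => I 8) 0 ρ) (fun _ => 5)
      (fun _ => -4) 0) :
    VerifiedOne (I 8) IIstar
      (fun t => ⟨3 * t ^ 2 * z + t ^ 5, -(4 * t * z ^ 3 + 2 * t ^ 4 * z ^ 2), z ^ 5 + t ^ 3 * z ^
          4⟩)
      (fun t => z ^ 8 * (27 * z ^ 2 + 14 * t ^ 3 * z + 3 * t ^ 6)) (fun t => some (t ^ 5))
      (fun t => some (3 * (t ^ 4)⁻¹)) 10 6 2 2 ι ρ := by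
  have hd (c : ℂ) : HasTypeOnDisk ⟨3 * lift PowerSeries.X ^ 2 * z + lift PowerSeries.X ^ 5, -(4 *
      lift PowerSeries.X * z ^ 3 + 2 * lift PowerSeries.X ^ 4 * z ^ 2), z ^ 5 + lift PowerSeries.X
      ^ 3 * z ^ 4⟩ c IIstar := by
    refine hasTypeOnDisk_of (f := -PowerSeries.X ^ 6 * PowerSeries.C c ^ 10 - 6 * PowerSeries.X ^ 4
        * PowerSeries.C c ^ 7 - 15 * PowerSeries.X ^ 2 * PowerSeries.C c ^ 4 - 12 * PowerSeries.C
        c) (g := 2 * PowerSeries.X ^ 10 * PowerSeries.C c ^ 15 + 18 * PowerSeries.X ^ 8 *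
        PowerSeries.C c ^ 12 + 72 * PowerSeries.X ^ 6 * PowerSeries.C c ^ 9 + 144 * PowerSeries.X ^
        4 * PowerSeries.C c ^ 6 + 135 * PowerSeries.X ^ 2 * PowerSeries.C c ^ 3 + 27) (δ := 3 *
        PowerSeries.X ^ 4 * PowerSeries.C c ^ 6 + 14 * PowerSeries.X ^ 2 * PowerSeries.C c ^ 3 +
        27) ?_ ?_ ?_ ?_ ?_ ?_
    iterate 3
      · simp only [fOrd, gOrd, discOrd, disc_eq, map_add, map_sub, map_mul, map_pow, map_neg,
          map_ofNat, map_zero, onDiskHom_z, onDiskHom_lift_X]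
        ring
    all_goals simp [fExact, gExact, map_ofNat]
  refine verifiedOne_of (fun t => ?_) (hd 0) (hasSpecialType_of_forall hd) ?_ ?_ hbr hbal (fun e =>
    ?_) (fun e => ?_) (m := 8) (fun t => 27 * z ^ 2 + 14 * z * t ^ 3 + 3 * t ^ 6) (fun t => ?_) ?_
    (f := fun t => -t ^ 10) (g := fun t => 2 * t ^ 15) (δ := fun t => 3 * t ^ 6) (fun t => .of_eq
    (-12 * z ^ 3 * lift t - 15 * z ^ 2 * lift t ^ 4 - 6 * z * lift t ^ 7 - lift t ^ 10) ?_ fun Q _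
    q hq => ?_) (fun t => .of_eq (27 * z ^ 5 + 135 * z ^ 4 * lift t ^ 3 + 144 * z ^ 3 * lift t ^ 6
    + 72 * z ^ 2 * lift t ^ 9 + 18 * z * lift t ^ 12 + 2 * lift t ^ 15) ?_ fun Q _ q hq => ?_) (fun
    t => .of_eq (27 * z ^ 2 + 14 * z * lift t ^ 3 + 3 * lift t ^ 6) ?_ fun Q _ q hq => ?_) (fun t
    ht => ?_) (fun t ht => ?_)
  · rw [disc_eq]
    ring
  · exact isHomogeneous_of ((((((isHomog_ofNat 3).mul (isHomog_t.pow 2)).mul isHomog_z).congr (m :=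
        10) rfl).add ((isHomog_t.pow 5).congr rfl) : IsHomog 6 2 _ 10).congr rfl)
        (((((((isHomog_ofNat 4).mul isHomog_t).mul (isHomog_z.pow 3)).congr (m := 20) rfl).add
        ((((isHomog_ofNat 2).mul (isHomog_t.pow 4)).mul (isHomog_z.pow 2)).congr rfl)).neg :
        IsHomog 6 2 _ 20).congr rfl) ((((isHomog_z.pow 5).congr (m := 30) rfl).add (((isHomog_t.pow
        3).mul (isHomog_z.pow 4)).congr rfl) : IsHomog 6 2 _ 30).congr rfl)
  · norm_num [coxeter]
  · exact ord_some_eq (c := 1) (k := 5) (by norm_num) (by simp [map_ofNat])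
  · exact ord_some_eq (c := 3) (k := -4) (by norm_num) (by simp [map_ofNat])
  · ring
  · intro e he p hp h
    obtain ⟨e, rfl⟩ := Nat.exists_eq_add_of_le' he
    refine Or.inl (dvd_z_of_sq_dvd_quadratic hp (a := 27) (b := (14 * (PowerSeries.X ^ (e + 1)) ^
        2) * PowerSeries.X ^ e) (c := 3 * (PowerSeries.X ^ (e + 1)) ^ 6) (u := 128) (n := (e + 1) *
        6) ?_ ?_ ?_ ?_)
    · exact PowerSeries.isUnit_iff_constantCoeff.2 (by simp [map_ofNat])
    · exact PowerSeries.isUnit_iff_constantCoeff.2 (by simp [map_ofNat])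
    · ring
    · convert h using 1
      simp only [lift, map_add, map_sub, map_mul, map_pow, map_neg, map_ofNat, map_zero]
      ring
  iterate 3
    · simp only [fOrd, gOrd, discOrd, curve, lift, map_zero]
      ring
    · simp only [lift, map_add, map_sub, map_mul, map_pow, map_neg, map_ofNat, map_zero, map_one]
          at hq ⊢
      try simp only [hq]
      try ring
  · simp [fExact, gExact, ht]
  · have hx : mero t ≠ 0 := fun h => ht (mero_injective (h.trans (map_zero _).symm))
    refine ⟨?_, ?_⟩
    all_goals
      simp only [betaOf, gammaOf, mero, map_add, map_sub, map_mul, map_pow, map_neg, map_ofNat,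
        map_one, map_zero, ↓reduceIte, Nat.reduceMod, Nat.reduceLeDiff, OfNat.ofNat_ne_zero,
        OfNat.ofNat_ne_one, one_ne_zero, Nat.zero_ne_one, Option.some.injEq] at hx ⊢
      try field_simp
      try norm_num
      try ring

theorem verified_Istar1_IVstar : VerifiedOne (Istar 1) IVstar (fun t => ⟨t * z, 0, z ^ 4⟩)
      (fun t => z ^ 7 * (27 * z + 4 * t ^ 3))
      (fun _ => some 4) (fun t => some t) 4 3 1 1 embD5E6 (spinD 5) := by
  have hd (c : ℂ) : HasTypeOnDisk ⟨lift PowerSeries.X * z, 0, z ^ 4⟩ c IVstar := by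
    refine hasTypeOnDisk_of (f := -PowerSeries.X * PowerSeries.C c ^ 2) (g := 2 * PowerSeries.X ^ 2
        * PowerSeries.C c ^ 3 + 27) (δ := 4 * PowerSeries.X ^ 2 * PowerSeries.C c ^ 3 + 27) ?_ ?_
        ?_ ?_ ?_ ?_
    iterate 3
      · simp only [fOrd, gOrd, discOrd, disc_eq, map_add, map_sub, map_mul, map_pow, map_neg,
          map_ofNat, map_zero, onDiskHom_z, onDiskHom_lift_X]
        ring
    all_goals simp [fExact, gExact, map_ofNat]
  refine verifiedOne_of (fun t => ?_) (hd 0) (hasSpecialType_of_forall hd) ?_ ?_ branching_D5_E6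
    balanced_Istar1 (fun e => ?_) (fun e => ?_) (m := 7) (fun t => 27 * z + 4 * t ^ 3) (fun t =>
    ?_) ?_ (f := fun t => -t ^ 2) (g := fun t => 2 * t ^ 3) (δ := fun t => 4 * t ^ 3) (fun t =>
    .of_eq (-lift t ^ 2) ?_ fun Q _ q hq => ?_) (fun t => .of_eq (27 * z + 2 * lift t ^ 3) ?_ fun Q
    _ q hq => ?_) (fun t => .of_eq (27 * z + 4 * lift t ^ 3) ?_ fun Q _ q hq => ?_) (fun t ht =>
    ?_) (fun t ht => ?_)
  · rw [disc_eq]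
    ring
  · exact isHomogeneous_of (((isHomog_t).mul isHomog_z : IsHomog 3 1 _ 4).congr rfl) isHomog_zero
        ((isHomog_z.pow 4 : IsHomog 3 1 _ 12).congr rfl)
  · norm_num [coxeter]
  · exact ord_some_eq (c := 4) (k := 0) (by norm_num) (by simp [map_ofNat])
  · exact ord_some_eq (c := 1) (k := 1) (by norm_num) (by simp [map_ofNat])
  · ring
  · intro e he p hp h
    refine absurd ?_ (not_sq_dvd_linear hp (a := 27) ?_ (4 * (PowerSeries.X ^ e) ^ 3))
    · convert h using 1
      simp only [lift, map_add, map_sub, map_mul, map_pow, map_neg, map_ofNat]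
    · exact PowerSeries.isUnit_iff_constantCoeff.2 (by simp [map_ofNat])
  iterate 3
    · simp only [fOrd, gOrd, discOrd, curve, lift, map_zero]
      ring
    · simp only [lift, map_add, map_sub, map_mul, map_pow, map_neg, map_ofNat, map_zero, map_one]
          at hq ⊢
      try simp only [hq]
      try ring
  · simp [fExact, gExact, ht]
  · have hx : mero t ≠ 0 := fun h => ht (mero_injective (h.trans (map_zero _).symm))
    refine ⟨?_, ?_⟩
    all_goals
      simp only [betaOf, gammaOf, mero, map_add, map_sub, map_mul, map_pow, map_neg, map_ofNat,
        map_one, map_zero, ↓reduceIte, Nat.reduceMod, Nat.reduceLeDiff, OfNat.ofNat_ne_zero,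
        OfNat.ofNat_ne_one, one_ne_zero, Nat.zero_ne_one, Option.some.injEq] at hx ⊢
      try field_simp
      try norm_num
      try ring

theorem verified_Istar2_IIIstar : VerifiedOne (Istar 2) IIIstar (fun t => ⟨t * z, z ^ 3, 0⟩)
      (fun t => z ^ 8 * (4 * z - t ^ 2))
      (fun _ => some 1) (fun t => some t) 6 4 2 2 (embDE7 6 le_rfl) (1 + spinD' 6) := by
  have hd (c : ℂ) : HasTypeOnDisk ⟨lift PowerSeries.X * z, z ^ 3, 0⟩ c IIIstar := by
    refine hasTypeOnDisk_of (f := -PowerSeries.X * PowerSeries.C c ^ 2 + 3) (g := 2 * PowerSeries.X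
        * PowerSeries.C c ^ 3 - 9 * PowerSeries.C c) (δ := -PowerSeries.X * PowerSeries.C c ^ 2 +
        4) ?_ ?_ ?_ ?_ ?_ ?_
    iterate 3
      · simp only [fOrd, gOrd, discOrd, disc_eq, map_add, map_sub, map_mul, map_pow, map_neg,
          map_ofNat, map_zero, onDiskHom_z, onDiskHom_lift_X]
        ring
    all_goals simp [fExact, gExact, map_ofNat]
  refine verifiedOne_of (fun t => ?_) (hd 0) (hasSpecialType_of_forall hd) ?_ ?_ branching_D6_E7
    balanced_Istar2 (fun e => ?_) (fun e => ?_) (m := 8) (fun t => 4 * z - t ^ 2) (fun t => ?_) ?_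
    (f := fun t => -t ^ 2) (g := fun t => 2 * t ^ 3) (δ := fun t => -t ^ 2) (fun t => .of_eq (3 * z
    - lift t ^ 2) ?_ fun Q _ q hq => ?_) (fun t => .of_eq (-9 * z * lift t + 2 * lift t ^ 3) ?_ fun
    Q _ q hq => ?_) (fun t => .of_eq (4 * z - lift t ^ 2) ?_ fun Q _ q hq => ?_) (fun t ht => ?_)
    (fun t ht => ?_)
  · rw [disc_eq]
    ring
  · exact isHomogeneous_of (((isHomog_t).mul isHomog_z : IsHomog 4 2 _ 6).congr rfl)
        ((isHomog_z.pow 3 : IsHomog 4 2 _ 12).congr rfl) isHomog_zero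
  · norm_num [coxeter]
  · exact ord_some_eq (c := 1) (k := 0) (by norm_num) (by simp [map_ofNat])
  · exact ord_some_eq (c := 1) (k := 1) (by norm_num) (by simp [map_ofNat])
  · ring
  · intro e he p hp h
    refine absurd ?_ (not_sq_dvd_linear hp (a := 4) ?_ (-(PowerSeries.X ^ e) ^ 2))
    · convert h using 1
      simp only [lift, map_add, map_sub, map_mul, map_pow, map_neg, map_ofNat]
      ring
    · exact PowerSeries.isUnit_iff_constantCoeff.2 (by simp [map_ofNat])
  iterate 3
    · simp only [fOrd, gOrd, discOrd, curve, lift, map_zero]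
      ring
    · simp only [lift, map_add, map_sub, map_mul, map_pow, map_neg, map_ofNat, map_zero, map_one]
          at hq ⊢
      try simp only [hq]
      try ring
  · simp [fExact, gExact, ht]
  · have hx : mero t ≠ 0 := fun h => ht (mero_injective (h.trans (map_zero _).symm))
    refine ⟨?_, ?_⟩
    all_goals
      simp only [betaOf, gammaOf, mero, map_add, map_sub, map_mul, map_pow, map_neg, map_ofNat,
        map_one, map_zero, ↓reduceIte, Nat.reduceMod, Nat.reduceLeDiff, OfNat.ofNat_ne_zero,
        OfNat.ofNat_ne_one, one_ne_zero, Nat.zero_ne_one, Option.some.injEq] at hx ⊢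
      try field_simp
      try norm_num
      try ring

theorem verified_Istar3_IIstar : VerifiedOne (Istar 3) IIstar (fun t => ⟨t ^ 2 * z, 2 * t * z ^ 3,
    z ^ 5⟩)
      (fun t => z ^ 9 * (27 * z - 4 * t ^ 3))
      (fun t => some (-4 * (t ^ 3)⁻¹)) (fun t => some (t ^ 2)) 10 6 2 2 embD7E8
      (vectD 7 + spinD 7) := by
  have hd (c : ℂ) : HasTypeOnDisk ⟨lift PowerSeries.X ^ 2 * z, 2 * lift PowerSeries.X * z ^ 3, z ^
      5⟩ c IIstar := by
    refine hasTypeOnDisk_of (f := -PowerSeries.X ^ 2 * PowerSeries.C c ^ 4 + 6 * PowerSeries.C c)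
        (g := 2 * PowerSeries.X ^ 4 * PowerSeries.C c ^ 6 - 18 * PowerSeries.X ^ 2 * PowerSeries.C
        c ^ 3 + 27) (δ := -4 * PowerSeries.X ^ 2 * PowerSeries.C c ^ 3 + 27) ?_ ?_ ?_ ?_ ?_ ?_
    iterate 3
      · simp only [fOrd, gOrd, discOrd, disc_eq, map_add, map_sub, map_mul, map_pow, map_neg,
          map_ofNat, map_zero, onDiskHom_z, onDiskHom_lift_X]
        ring
    all_goals simp [fExact, gExact, map_ofNat]
  refine verifiedOne_of (fun t => ?_) (hd 0) (hasSpecialType_of_forall hd) ?_ ?_ branching_D7_E8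
    balanced_Istar3 (fun e => ?_) (fun e => ?_) (m := 9) (fun t => 27 * z - 4 * t ^ 3) (fun t =>
    ?_) ?_ (f := fun t => -t ^ 4) (g := fun t => 2 * t ^ 6) (δ := fun t => -4 * t ^ 3) (fun t =>
    .of_eq (6 * z * lift t - lift t ^ 4) ?_ fun Q _ q hq => ?_) (fun t => .of_eq (27 * z ^ 2 - 18 *
    z * lift t ^ 3 + 2 * lift t ^ 6) ?_ fun Q _ q hq => ?_) (fun t => .of_eq (27 * z - 4 * lift t ^
    3) ?_ fun Q _ q hq => ?_) (fun t ht => ?_) (fun t ht => ?_)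
  · rw [disc_eq]
    ring
  · exact isHomogeneous_of (((isHomog_t.pow 2).mul isHomog_z : IsHomog 6 2 _ 10).congr rfl)
        ((((isHomog_ofNat 2).mul isHomog_t).mul (isHomog_z.pow 3) : IsHomog 6 2 _ 20).congr rfl)
        ((isHomog_z.pow 5 : IsHomog 6 2 _ 30).congr rfl)
  · norm_num [coxeter]
  · exact ord_some_eq (c := -4) (k := -3) (by norm_num) (by simp [map_ofNat])
  · exact ord_some_eq (c := 1) (k := 2) (by norm_num) (by simp [map_ofNat])
  · ring
  · intro e he p hp h
    refine absurd ?_ (not_sq_dvd_linear hp (a := 27) ?_ (-4 * (PowerSeries.X ^ e) ^ 3))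
    · convert h using 1
      simp only [lift, map_add, map_sub, map_mul, map_pow, map_neg, map_ofNat]
      ring
    · exact PowerSeries.isUnit_iff_constantCoeff.2 (by simp [map_ofNat])
  iterate 3
    · simp only [fOrd, gOrd, discOrd, curve, lift, map_zero]
      ring
    · simp only [lift, map_add, map_sub, map_mul, map_pow, map_neg, map_ofNat, map_zero, map_one]
          at hq ⊢
      try simp only [hq]
      try ring
  · simp [fExact, gExact, ht]
  · have hx : mero t ≠ 0 := fun h => ht (mero_injective (h.trans (map_zero _).symm))
    refine ⟨?_, ?_⟩
    all_goals
      simp only [betaOf, gammaOf, mero, map_add, map_sub, map_mul, map_pow, map_neg, map_ofNat,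
        map_one, map_zero, ↓reduceIte, Nat.reduceMod, Nat.reduceLeDiff, OfNat.ofNat_ne_zero,
        OfNat.ofNat_ne_one, one_ne_zero, Nat.zero_ne_one, Option.some.injEq] at hx ⊢
      try field_simp
      try norm_num
      try ring

theorem verified_IVstar_IIIstar : VerifiedOne IVstar IIIstar (fun t => ⟨0, z ^ 3, t * z ^ 4⟩)
      (fun t => z ^ 8 * (4 * z + 27 * t ^ 2))
      (fun t => some t) (fun _ => none) 6 4 2 2 embE6E7 rep27 := by
  have hd (c : ℂ) : HasTypeOnDisk ⟨0, z ^ 3, lift PowerSeries.X * z ^ 4⟩ c IIIstar := by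
    refine hasTypeOnDisk_of (f := 3) (g := 27 * PowerSeries.C c) (δ := 27 * PowerSeries.X *
        PowerSeries.C c ^ 2 + 4) ?_ ?_ ?_ ?_ ?_ ?_
    iterate 3
      · simp only [fOrd, gOrd, discOrd, disc_eq, map_add, map_sub, map_mul, map_pow, map_neg,
          map_ofNat, map_zero, onDiskHom_z, onDiskHom_lift_X]
        ring
    all_goals simp [fExact, gExact, map_ofNat]
  refine verifiedOne_of (fun t => ?_) (hd 0) (hasSpecialType_of_forall hd) ?_ ?_ branching_E6_E7
    balanced_IVstar (fun e => ?_) (fun e => ?_) (m := 8) (fun t => 4 * z + 27 * t ^ 2) (fun t =>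
    ?_) ?_ (f := fun t => 3) (g := fun t => 27 * t) (δ := fun t => 27 * t ^ 2) (fun t => .of_eq (3)
    ?_ fun Q _ q hq => ?_) (fun t => .of_eq (27 * lift t) ?_ fun Q _ q hq => ?_) (fun t => .of_eq
    (4 * z + 27 * lift t ^ 2) ?_ fun Q _ q hq => ?_) (fun t ht => ?_) (fun t ht => ?_)
  · rw [disc_eq]
    ring
  · exact isHomogeneous_of isHomog_zero ((isHomog_z.pow 3 : IsHomog 4 2 _ 12).congr rfl)
        (((isHomog_t).mul (isHomog_z.pow 4) : IsHomog 4 2 _ 18).congr rfl)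
  · norm_num [coxeter]
  · exact ord_some_eq (c := 1) (k := 1) (by norm_num) (by simp [map_ofNat])
  · exact ord_none_eq e
  · ring
  · intro e he p hp h
    refine absurd ?_ (not_sq_dvd_linear hp (a := 4) ?_ (27 * (PowerSeries.X ^ e) ^ 2))
    · convert h using 1
      simp only [lift, map_add, map_sub, map_mul, map_pow, map_neg, map_ofNat]
    · exact PowerSeries.isUnit_iff_constantCoeff.2 (by simp [map_ofNat])
  iterate 3
    · simp only [fOrd, gOrd, discOrd, curve, lift, map_zero]
      ring
    · simp only [lift, map_add, map_sub, map_mul, map_pow, map_neg, map_ofNat, map_zero, map_one]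
          at hq ⊢
      try simp only [hq]
      try ring
  · simp [fExact, gExact, ht]
  · have hx : mero t ≠ 0 := fun h => ht (mero_injective (h.trans (map_zero _).symm))
    refine ⟨?_, ?_⟩
    all_goals
      simp only [betaOf, gammaOf, mero, map_add, map_sub, map_mul, map_pow, map_neg, map_ofNat,
        map_one, map_zero, ↓reduceIte, Nat.reduceMod, Nat.reduceLeDiff, OfNat.ofNat_ne_zero,
        OfNat.ofNat_ne_one, one_ne_zero, Nat.zero_ne_one, Option.some.injEq] at hx ⊢
      try field_simp
      try norm_num
      try ring

theorem verified_IIIstar_IIstar : VerifiedOne IIIstar IIstar (fun t => ⟨0, t * z ^ 3, z ^ 5⟩)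
      (fun t => z ^ 9 * (27 * z + 4 * t ^ 3))
      (fun _ => none) (fun t => some t) 10 6 2 2 embE7E8 (1 + rep56) := by
  have hd (c : ℂ) : HasTypeOnDisk ⟨0, lift PowerSeries.X * z ^ 3, z ^ 5⟩ c IIstar := by
    refine hasTypeOnDisk_of (f := 3 * PowerSeries.C c) (g := 27) (δ := 4 * PowerSeries.X ^ 2 *
        PowerSeries.C c ^ 3 + 27) ?_ ?_ ?_ ?_ ?_ ?_
    iterate 3
      · simp only [fOrd, gOrd, discOrd, disc_eq, map_add, map_sub, map_mul, map_pow, map_neg,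
          map_ofNat, map_zero, onDiskHom_z, onDiskHom_lift_X]
        ring
    all_goals simp [fExact, gExact, map_ofNat]
  refine verifiedOne_of (fun t => ?_) (hd 0) (hasSpecialType_of_forall hd) ?_ ?_ branching_E7_E8
    balanced_IIIstar (fun e => ?_) (fun e => ?_) (m := 9) (fun t => 27 * z + 4 * t ^ 3) (fun t =>
    ?_) ?_ (f := fun t => 3 * t) (g := fun t => 27) (δ := fun t => 4 * t ^ 3) (fun t => .of_eq (3 *
    lift t) ?_ fun Q _ q hq => ?_) (fun t => .of_eq (27) ?_ fun Q _ q hq => ?_) (fun t => .of_eq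
    (27 * z + 4 * lift t ^ 3) ?_ fun Q _ q hq => ?_) (fun t ht => ?_) (fun t ht => ?_)
  · rw [disc_eq]
    ring
  · exact isHomogeneous_of isHomog_zero (((isHomog_t).mul (isHomog_z.pow 3) : IsHomog 6 2 _
        20).congr rfl) ((isHomog_z.pow 5 : IsHomog 6 2 _ 30).congr rfl)
  · norm_num [coxeter]
  · exact ord_none_eq e
  · exact ord_some_eq (c := 1) (k := 1) (by norm_num) (by simp [map_ofNat])
  · ring
  · intro e he p hp h
    refine absurd ?_ (not_sq_dvd_linear hp (a := 27) ?_ (4 * (PowerSeries.X ^ e) ^ 3))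
    · convert h using 1
      simp only [lift, map_add, map_sub, map_mul, map_pow, map_neg, map_ofNat]
    · exact PowerSeries.isUnit_iff_constantCoeff.2 (by simp [map_ofNat])
  iterate 3
    · simp only [fOrd, gOrd, discOrd, curve, lift, map_zero]
      ring
    · simp only [lift, map_add, map_sub, map_mul, map_pow, map_neg, map_ofNat, map_zero, map_one]
          at hq ⊢
      try simp only [hq]
      try ring
  · simp [fExact, gExact, ht]
  · have hx : mero t ≠ 0 := fun h => ht (mero_injective (h.trans (map_zero _).symm))
    refine ⟨?_, ?_⟩
    all_goals
      simp only [betaOf, gammaOf, mero, map_add, map_sub, map_mul, map_pow, map_neg, map_ofNat,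
        map_one, map_zero, ↓reduceIte, Nat.reduceMod, Nat.reduceLeDiff, OfNat.ofNat_ne_zero,
        OfNat.ofNat_ne_one, one_ne_zero, Nat.zero_ne_one, Option.some.injEq] at hx ⊢
      try field_simp
      try norm_num
      try ring

set_option linter.unusedSimpArgs false

/-! ### Families with several components -/

theorem intersectionMult_of_monomials {r : ℕ} {φ : Base → Fin r → Base} {A : Fin r → ℂ} {n : ℕ}
    (hφ : ∀ (e : ℕ) (i : Fin r),
      φ (PowerSeries.X ^ e) i = PowerSeries.C (A i) * (PowerSeries.X ^ e) ^ n)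
    (hA : Function.Injective A) (e : ℕ) (i j : Fin r) (hij : i ≠ j) :
    intersectionMult (φ (PowerSeries.X ^ e) i) (φ (PowerSeries.X ^ e) j) = e * n := by
  refine intersectionMult_eq (a := PowerSeries.C (A i)) (u := PowerSeries.C (A i - A j)) ?_ ?_ ?_
  · rw [hφ, pow_mul]
  · exact (sub_ne_zero.2 (hA.ne hij)).isUnit.map PowerSeries.C
  · rw [hφ, hφ, pow_mul, map_sub]
    ring

theorem hasTypeOnDisk_I2_I5_IVstar (c : ℂ) : HasTypeOnDisk ⟨4 * lift PowerSeries.X * z + lift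
    PowerSeries.X ^ 4, 2 * lift PowerSeries.X ^ 2 * z ^ 2, z ^ 4⟩ c IVstar := by
  refine hasTypeOnDisk_of (f := -PowerSeries.X ^ 5 * PowerSeries.C c ^ 8 - 8 * PowerSeries.X ^ 3 *
      PowerSeries.C c ^ 5 - 10 * PowerSeries.X * PowerSeries.C c ^ 2) (g := 2 * PowerSeries.X ^ 8 *
      PowerSeries.C c ^ 12 + 24 * PowerSeries.X ^ 6 * PowerSeries.C c ^ 9 + 78 * PowerSeries.X ^ 4
      * PowerSeries.C c ^ 6 + 56 * PowerSeries.X ^ 2 * PowerSeries.C c ^ 3 + 27) (δ := 16 *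
      PowerSeries.X ^ 6 * PowerSeries.C c ^ 9 + 124 * PowerSeries.X ^ 4 * PowerSeries.C c ^ 6 + 112
      * PowerSeries.X ^ 2 * PowerSeries.C c ^ 3 + 27) ?_ ?_ ?_ ?_ ?_ ?_
  iterate 3
    · simp only [fOrd, gOrd, discOrd, disc_eq, map_add, map_sub, map_mul, map_pow, map_neg,
        map_ofNat, map_zero, onDiskHom_z, onDiskHom_lift_X]
      ring
  all_goals simp [fExact, gExact, map_ofNat]

theorem isComponent_I2_I5_IVstar_0 {t : Base} (ht0 : PowerSeries.constantCoeff t = 0) (ht : t ≠ 0)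
    : IsComponent ⟨4 * lift t * z + lift t ^ 4, 2 * lift t ^ 2 * z ^ 2, z ^ 4⟩ (-2 * t ^ 3) (I 2)
    none (some (64 * mero t ^ 10)) := by
  have hx : mero t ≠ 0 := fun h => ht (mero_injective (h.trans (map_zero _).symm))
  refine isComponent_of (f := -25 * t ^ 8) (g := 250 * t ^ 12) (δ := 1600 * t ^ 18) (by simp [ht0])
    (.of_eq (-10 * z ^ 2 * lift t ^ 2 - 8 * z * lift t ^ 5 - lift t ^ 8) ?_ fun Q _ q hq => ?_)
    (.of_eq (27 * z ^ 4 + 56 * z ^ 3 * lift t ^ 3 + 78 * z ^ 2 * lift t ^ 6 + 24 * z * lift t ^ 9 +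
    2 * lift t ^ 12) ?_ fun Q _ q hq => ?_) (.of_eq (27 * z ^ 6 + 4 * z ^ 5 * lift t ^ 3) ?_ fun Q
    _ q hq => ?_) (by simp [fExact, ht]) (by simp [gExact, ht]) (by simp [ht]) ?_ ?_
  iterate 3
    · simp only [fOrd, gOrd, discOrd, disc_eq, curve, lift, map_add, map_sub, map_mul, map_pow,
      map_neg, map_ofNat, map_zero, map_one]
      ring
    · simp only [lift, map_add, map_sub, map_mul, map_pow, map_neg, map_ofNat, map_zero, map_one]
          at hq ⊢
      try simp only [hq]
      try ring
  all_goals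
    simp only [betaOf, gammaOf, mero, map_add, map_sub, map_mul, map_pow, map_neg, map_ofNat,
      map_one, map_zero, ↓reduceIte, Nat.reduceMod, Nat.reduceLeDiff, OfNat.ofNat_ne_zero,
      OfNat.ofNat_ne_one, one_ne_zero, Nat.zero_ne_one, Option.some.injEq] at hx ⊢
    try field_simp
    try norm_num
    try ring

theorem isComponent_I2_I5_IVstar_1 {t : Base} (ht : t ≠ 0) : IsComponent ⟨4 * lift t * z + lift t ^
    4, 2 * lift t ^ 2 * z ^ 2, z ^ 4⟩ (0) (I 5) (some (mero t ^ 4)) (some (16 * mero t)) := by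
  have hx : mero t ≠ 0 := fun h => ht (mero_injective (h.trans (map_zero _).symm))
  refine isComponent_of (f := -t ^ 8) (g := 2 * t ^ 12) (δ := 16 * t ^ 9) (by simp) (.of_eq (-10 *
    z ^ 2 * lift t ^ 2 - 8 * z * lift t ^ 5 - lift t ^ 8) ?_ fun Q _ q hq => ?_) (.of_eq (27 * z ^
    4 + 56 * z ^ 3 * lift t ^ 3 + 78 * z ^ 2 * lift t ^ 6 + 24 * z * lift t ^ 9 + 2 * lift t ^ 12)
    ?_ fun Q _ q hq => ?_) (.of_eq (27 * z ^ 3 + 112 * z ^ 2 * lift t ^ 3 + 124 * z * lift t ^ 6 +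
    16 * lift t ^ 9) ?_ fun Q _ q hq => ?_) (by simp [fExact, ht]) (by simp [gExact, ht]) (by simp
    [ht]) ?_ ?_
  iterate 3
    · simp only [fOrd, gOrd, discOrd, disc_eq, curve, lift, map_add, map_sub, map_mul, map_pow,
      map_neg, map_ofNat, map_zero, map_one]
      ring
    · simp only [lift, map_add, map_sub, map_mul, map_pow, map_neg, map_ofNat, map_zero, map_one]
          at hq ⊢
      try simp only [hq]
      try ring
  all_goals
    simp only [betaOf, gammaOf, mero, map_add, map_sub, map_mul, map_pow, map_neg, map_ofNat,
      map_one, map_zero, ↓reduceIte, Nat.reduceMod, Nat.reduceLeDiff, OfNat.ofNat_ne_zero,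
      OfNat.ofNat_ne_one, one_ne_zero, Nat.zero_ne_one, Option.some.injEq] at hx ⊢
    try field_simp
    try norm_num
    try ring

theorem verified_I2_I5_IVstar : Verified ![I 2, I 5] IVstar (fun t => ⟨4 * t * z + t ^ 4, 2 * t ^ 2
    * z ^ 2, z ^ 4⟩)
        (fun t => (z + 2 * t ^ 3) ^ 2 * z ^ 5 * (27 * z + 4 * t ^ 3))
        (fun t => ![-2 * t ^ 3, 0]) 3
        (fun t => ![none, some (t ^ 4)]) (fun t => ![some (64 * t ^ 10), some (16 * t)])
        4 3 1 1
        (assemble fun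
          | 0 => chain 2 ![simpleE6 0]
          | 1 => chain 5 ![simpleE6 1, simpleE6 3, simpleE6 4, simpleE6 5])
        (on ![I 2, I 5] 1 (fundA 5) + on ![I 2, I 5] 0 (fundA 2) * on ![I 2, I 5] 1 (extA 5 2)) :=
            by
  refine verified_of (fun t => ?_) (hasTypeOnDisk_I2_I5_IVstar 0) (hasSpecialType_of_forall
      hasTypeOnDisk_I2_I5_IVstar) ?_ ?_ branching_A2_A5_E6 balanced_I2_I5 (fun e => ?_) (fun e =>
      ?_) ?_ (fun e he => ?_) (fun t ht0 ht => ?_)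
  · rw [disc_eq]
    ring
  · exact isHomogeneous_of ((((((isHomog_ofNat 4).mul isHomog_t).mul isHomog_z).congr (m := 4)
        rfl).add ((isHomog_t.pow 4).congr rfl) : IsHomog 3 1 _ 4).congr rfl) ((((isHomog_ofNat
        2).mul (isHomog_t.pow 2)).mul (isHomog_z.pow 2) : IsHomog 3 1 _ 8).congr rfl)
        ((isHomog_z.pow 4 : IsHomog 3 1 _ 12).congr rfl)
  · norm_num [coxeter]
  · refine Fin.forall_fin_two.2 ⟨?_, ?_⟩
    · exact ord_none_eq e
    · exact ord_some_eq (c := 1) (k := 4) (by norm_num) (by simp [map_ofNat])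
  · refine Fin.forall_fin_two.2 ⟨?_, ?_⟩
    · exact ord_some_eq (c := 64) (k := 10) (by norm_num) (by simp [map_ofNat])
    · exact ord_some_eq (c := 16) (k := 1) (by norm_num) (by simp [map_ofNat])
  · refine intersectionMult_of_monomials (φ := fun t => ![-2 * t ^ 3, 0]) (A := ![-2, 0]) (fun e =>
        ?_) ?_
    · refine Fin.forall_fin_two.2 ⟨?_, ?_⟩
      · simp [map_ofNat]
      · simp [map_ofNat]
    · intro i j
      fin_cases i <;> fin_cases j <;> norm_num
  · refine noOtherGauge_of (m := ![2, 5]) (R := 27 * z + 4 * lift (PowerSeries.X ^ e) ^ 3) ?_ fun p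
        hp h => ?_
    · rw [disc_eq, Fin.prod_univ_two]
      simp [curve, lift, map_ofNat]
      ring
    · refine absurd ?_ (not_sq_dvd_linear hp (a := 27) ?_ (4 * (PowerSeries.X ^ e) ^ 3))
      · convert h using 1
        simp only [lift, map_add, map_sub, map_mul, map_pow, map_neg, map_ofNat]
      · exact PowerSeries.isUnit_iff_constantCoeff.2 (by simp [map_ofNat])
  · refine Fin.forall_fin_two.2 ⟨?_, ?_⟩
    · exact isComponent_I2_I5_IVstar_0 ht0 ht
    · exact isComponent_I2_I5_IVstar_1 ht

theorem hasTypeOnDisk_I2_Istar1_IIIstar (c : ℂ) : HasTypeOnDisk ⟨lift PowerSeries.X * z, z ^ 3,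
    lift PowerSeries.X * z ^ 4⟩ c IIIstar := by
  refine hasTypeOnDisk_of (f := -PowerSeries.X * PowerSeries.C c ^ 2 + 3) (g := 2 * PowerSeries.X *
      PowerSeries.C c ^ 3 + 18 * PowerSeries.C c) (δ := 4 * PowerSeries.X ^ 2 * PowerSeries.C c ^ 4
      + 8 * PowerSeries.X * PowerSeries.C c ^ 2 + 4) ?_ ?_ ?_ ?_ ?_ ?_
  iterate 3
    · simp only [fOrd, gOrd, discOrd, disc_eq, map_add, map_sub, map_mul, map_pow, map_neg,
        map_ofNat, map_zero, onDiskHom_z, onDiskHom_lift_X]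
      ring
  all_goals simp [fExact, gExact, map_ofNat]

theorem isComponent_I2_Istar1_IIIstar_0 {t : Base} (ht0 : PowerSeries.constantCoeff t = 0) (ht : t
    ≠ 0) : IsComponent ⟨lift t * z, z ^ 3, lift t * z ^ 4⟩ (-t ^ 2) (I 2) none (some (-mero t ^ 8))
    := by
  have hx : mero t ≠ 0 := fun h => ht (mero_injective (h.trans (map_zero _).symm))
  refine isComponent_of (f := -4 * t ^ 6) (g := 16 * t ^ 9) (δ := -4 * t ^ 14) (by simp [ht0])
    (.of_eq (3 * z ^ 3 - z ^ 2 * lift t ^ 2) ?_ fun Q _ q hq => ?_) (.of_eq (18 * z ^ 4 * lift t +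
    2 * z ^ 3 * lift t ^ 3) ?_ fun Q _ q hq => ?_) (.of_eq (4 * z ^ 7) ?_ fun Q _ q hq => ?_) (by
    simp [fExact, ht]) (by simp [gExact, ht]) (by simp [ht]) ?_ ?_
  iterate 3
    · simp only [fOrd, gOrd, discOrd, disc_eq, curve, lift, map_add, map_sub, map_mul, map_pow,
      map_neg, map_ofNat, map_zero, map_one]
      ring
    · simp only [lift, map_add, map_sub, map_mul, map_pow, map_neg, map_ofNat, map_zero, map_one]
          at hq ⊢
      try simp only [hq]
      try ring
  all_goals
    simp only [betaOf, gammaOf, mero, map_add, map_sub, map_mul, map_pow, map_neg, map_ofNat,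
      map_one, map_zero, ↓reduceIte, Nat.reduceMod, Nat.reduceLeDiff, OfNat.ofNat_ne_zero,
      OfNat.ofNat_ne_one, one_ne_zero, Nat.zero_ne_one, Option.some.injEq] at hx ⊢
    try field_simp
    try norm_num
    try ring

theorem isComponent_I2_Istar1_IIIstar_1 {t : Base} (ht : t ≠ 0) : IsComponent ⟨lift t * z, z ^ 3,
    lift t * z ^ 4⟩ (0) (Istar 1) (some (4 * mero t)) (some (mero t)) := by
  have hx : mero t ≠ 0 := fun h => ht (mero_injective (h.trans (map_zero _).symm))
  refine isComponent_of (f := -t ^ 2) (g := 2 * t ^ 3) (δ := 4 * t ^ 4) (by simp) (.of_eq (3 * z -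
    lift t ^ 2) ?_ fun Q _ q hq => ?_) (.of_eq (18 * z * lift t + 2 * lift t ^ 3) ?_ fun Q _ q hq
    => ?_) (.of_eq (4 * z ^ 2 + 8 * z * lift t ^ 2 + 4 * lift t ^ 4) ?_ fun Q _ q hq => ?_) (by
    simp [fExact, ht]) (by simp [gExact, ht]) (by simp [ht]) ?_ ?_
  iterate 3
    · simp only [fOrd, gOrd, discOrd, disc_eq, curve, lift, map_add, map_sub, map_mul, map_pow,
      map_neg, map_ofNat, map_zero, map_one]
      ring
    · simp only [lift, map_add, map_sub, map_mul, map_pow, map_neg, map_ofNat, map_zero, map_one]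
          at hq ⊢
      try simp only [hq]
      try ring
  all_goals
    simp only [betaOf, gammaOf, mero, map_add, map_sub, map_mul, map_pow, map_neg, map_ofNat,
      map_one, map_zero, ↓reduceIte, Nat.reduceMod, Nat.reduceLeDiff, OfNat.ofNat_ne_zero,
      OfNat.ofNat_ne_one, one_ne_zero, Nat.zero_ne_one, Option.some.injEq] at hx ⊢
    try field_simp
    try norm_num
    try ring

theorem verified_I2_Istar1_IIIstar : Verified ![I 2, Istar 1] IIIstar (fun t => ⟨t * z, z ^ 3, t *
    z ^ 4⟩)
        (fun t => 4 * (z + t ^ 2) ^ 2 * z ^ 7)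
        (fun t => ![-t ^ 2, 0]) 2
        (fun t => ![none, some (4 * t)]) (fun t => ![some (-t ^ 8), some t])
        6 4 2 2
        (assemble fun
          | 0 => chain 2 ![coroot78]
          | 1 => embDE7 5 (by norm_num))
        (on ![I 2, Istar 1] 1 (vectD 5) + on ![I 2, Istar 1] 0 (fundA 2) * on ![I 2, Istar 1] 1
            (spinD 5)) := by
  refine verified_of (fun t => ?_) (hasTypeOnDisk_I2_Istar1_IIIstar 0) (hasSpecialType_of_forall
      hasTypeOnDisk_I2_Istar1_IIIstar) ?_ ?_ branching_A2_D5_E7 balanced_I2_Istar1 (fun e => ?_)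
      (fun e => ?_) ?_ (fun e he => ?_) (fun t ht0 ht => ?_)
  · rw [disc_eq]
    ring
  · exact isHomogeneous_of (((isHomog_t).mul isHomog_z : IsHomog 4 2 _ 6).congr rfl)
        ((isHomog_z.pow 3 : IsHomog 4 2 _ 12).congr rfl) (((isHomog_t).mul (isHomog_z.pow 4) :
        IsHomog 4 2 _ 18).congr rfl)
  · norm_num [coxeter]
  · refine Fin.forall_fin_two.2 ⟨?_, ?_⟩
    · exact ord_none_eq e
    · exact ord_some_eq (c := 4) (k := 1) (by norm_num) (by simp [map_ofNat])
  · refine Fin.forall_fin_two.2 ⟨?_, ?_⟩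
    · exact ord_some_eq (c := -1) (k := 8) (by norm_num) (by simp; ring)
    · exact ord_some_eq (c := 1) (k := 1) (by norm_num) (by simp [map_ofNat])
  · refine intersectionMult_of_monomials (φ := fun t => ![-t ^ 2, 0]) (A := ![-1, 0]) (fun e => ?_)
        ?_
    · refine Fin.forall_fin_two.2 ⟨?_, ?_⟩
      · simp [map_ofNat]
      · simp [map_ofNat]
    · intro i j
      fin_cases i <;> fin_cases j <;> norm_num
  · refine noOtherGauge_of (m := ![2, 7]) (R := 4) ?_ fun p hp h => ?_
    · rw [disc_eq, Fin.prod_univ_two]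
      simp [curve, lift, map_ofNat]
      ring
    · exact absurd h (not_sq_dvd_of_isUnit hp (isUnit_germ_iff.2 (by simp [map_ofNat])))
  · refine Fin.forall_fin_two.2 ⟨?_, ?_⟩
    · exact isComponent_I2_Istar1_IIIstar_0 ht0 ht
    · exact isComponent_I2_Istar1_IIIstar_1 ht

theorem hasTypeOnDisk_I2_IVstar_IIstar (c : ℂ) : HasTypeOnDisk ⟨0, -3 * lift PowerSeries.X * z ^ 3,
    z ^ 5 + lift PowerSeries.X ^ 3 * z ^ 4⟩ c IIstar := by
  refine hasTypeOnDisk_of (f := -9 * PowerSeries.C c) (g := 27 * PowerSeries.X ^ 2 * PowerSeries.C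
      c ^ 3 + 27) (δ := 27 * PowerSeries.X ^ 4 * PowerSeries.C c ^ 6 - 54 * PowerSeries.X ^ 2 *
      PowerSeries.C c ^ 3 + 27) ?_ ?_ ?_ ?_ ?_ ?_
  iterate 3
    · simp only [fOrd, gOrd, discOrd, disc_eq, map_add, map_sub, map_mul, map_pow, map_neg,
        map_ofNat, map_zero, onDiskHom_z, onDiskHom_lift_X]
      ring
  all_goals simp [fExact, gExact, map_ofNat]

theorem isComponent_I2_IVstar_IIstar_0 {t : Base} (ht0 : PowerSeries.constantCoeff t = 0) (ht : t ≠
    0) : IsComponent ⟨0, -3 * lift t * z ^ 3, z ^ 5 + lift t ^ 3 * z ^ 4⟩ (t ^ 3) (I 2) none (some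
    (3 * mero t ^ 14)) := by
  have hx : mero t ≠ 0 := fun h => ht (mero_injective (h.trans (map_zero _).symm))
  refine isComponent_of (f := -9 * t ^ 10) (g := 54 * t ^ 15) (δ := 27 * t ^ 24) (by simp [ht0])
    (.of_eq (-9 * z ^ 3 * lift t) ?_ fun Q _ q hq => ?_) (.of_eq (27 * z ^ 5 + 27 * z ^ 4 * lift t
    ^ 3) ?_ fun Q _ q hq => ?_) (.of_eq (27 * z ^ 8) ?_ fun Q _ q hq => ?_) (by simp [fExact, ht])
    (by simp [gExact, ht]) (by simp [ht]) ?_ ?_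
  iterate 3
    · simp only [fOrd, gOrd, discOrd, disc_eq, curve, lift, map_add, map_sub, map_mul, map_pow,
      map_neg, map_ofNat, map_zero, map_one]
      ring
    · simp only [lift, map_add, map_sub, map_mul, map_pow, map_neg, map_ofNat, map_zero, map_one]
          at hq ⊢
      try simp only [hq]
      try ring
  all_goals
    simp only [betaOf, gammaOf, mero, map_add, map_sub, map_mul, map_pow, map_neg, map_ofNat,
      map_one, map_zero, ↓reduceIte, Nat.reduceMod, Nat.reduceLeDiff, OfNat.ofNat_ne_zero,
      OfNat.ofNat_ne_one, one_ne_zero, Nat.zero_ne_one, Option.some.injEq] at hx ⊢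
    try field_simp
    try norm_num
    try ring

theorem isComponent_I2_IVstar_IIstar_1 {t : Base} (ht : t ≠ 0) : IsComponent ⟨0, -3 * lift t * z ^
    3, z ^ 5 + lift t ^ 3 * z ^ 4⟩ (0) (IVstar) (some (mero t ^ 3)) none := by
  have hx : mero t ≠ 0 := fun h => ht (mero_injective (h.trans (map_zero _).symm))
  refine isComponent_of (f := -9 * t) (g := 27 * t ^ 3) (δ := 27 * t ^ 6) (by simp) (.of_eq (-9 *
    lift t) ?_ fun Q _ q hq => ?_) (.of_eq (27 * z + 27 * lift t ^ 3) ?_ fun Q _ q hq => ?_)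
    (.of_eq (27 * z ^ 2 - 54 * z * lift t ^ 3 + 27 * lift t ^ 6) ?_ fun Q _ q hq => ?_) (by simp
    [fExact, ht]) (by simp [gExact, ht]) (by simp [ht]) ?_ ?_
  iterate 3
    · simp only [fOrd, gOrd, discOrd, disc_eq, curve, lift, map_add, map_sub, map_mul, map_pow,
      map_neg, map_ofNat, map_zero, map_one]
      ring
    · simp only [lift, map_add, map_sub, map_mul, map_pow, map_neg, map_ofNat, map_zero, map_one]
          at hq ⊢
      try simp only [hq]
      try ring
  all_goals
    simp only [betaOf, gammaOf, mero, map_add, map_sub, map_mul, map_pow, map_neg, map_ofNat,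
      map_one, map_zero, ↓reduceIte, Nat.reduceMod, Nat.reduceLeDiff, OfNat.ofNat_ne_zero,
      OfNat.ofNat_ne_one, one_ne_zero, Nat.zero_ne_one, Option.some.injEq] at hx ⊢
    try field_simp
    try norm_num
    try ring

theorem verified_I2_IVstar_IIstar : Verified ![I 2, IVstar] IIstar (fun t => ⟨0, -3 * t * z ^ 3, z
    ^ 5 + t ^ 3 * z ^ 4⟩)
        (fun t => 27 * (z - t ^ 3) ^ 2 * z ^ 8)
        (fun t => ![t ^ 3, 0]) 3
        (fun t => ![none, some (t ^ 3)]) (fun t => ![some (3 * t ^ 14), none])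
        10 6 2 2
        (assemble fun
          | 0 => chain 2 ![simpleE8 7]
          | 1 => embE6E8)
        (on ![I 2, IVstar] 1 rep27 + on ![I 2, IVstar] 0 (fundA 2) + on ![I 2, IVstar] 0 (fundA 2)
            * on ![I 2, IVstar] 1 rep27) := by
  refine verified_of (fun t => ?_) (hasTypeOnDisk_I2_IVstar_IIstar 0) (hasSpecialType_of_forall
      hasTypeOnDisk_I2_IVstar_IIstar) ?_ ?_ branching_A2_E6_E8 balanced_I2_IVstar (fun e => ?_)
      (fun e => ?_) ?_ (fun e he => ?_) (fun t ht0 ht => ?_)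
  · rw [disc_eq]
    ring
  · exact isHomogeneous_of isHomog_zero (((((isHomog_ofNat 3).neg).mul isHomog_t).mul
        (isHomog_z.pow 3) : IsHomog 6 2 _ 20).congr rfl) ((((isHomog_z.pow 5).congr (m := 30)
        rfl).add (((isHomog_t.pow 3).mul (isHomog_z.pow 4)).congr rfl) : IsHomog 6 2 _ 30).congr
        rfl)
  · norm_num [coxeter]
  · refine Fin.forall_fin_two.2 ⟨?_, ?_⟩
    · exact ord_none_eq e
    · exact ord_some_eq (c := 1) (k := 3) (by norm_num) (by simp [map_ofNat])
  · refine Fin.forall_fin_two.2 ⟨?_, ?_⟩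
    · exact ord_some_eq (c := 3) (k := 14) (by norm_num) (by simp [map_ofNat])
    · exact ord_none_eq e
  · refine intersectionMult_of_monomials (φ := fun t => ![t ^ 3, 0]) (A := ![1, 0]) (fun e => ?_)
        ?_
    · refine Fin.forall_fin_two.2 ⟨?_, ?_⟩
      · simp [map_ofNat]
      · simp [map_ofNat]
    · intro i j
      fin_cases i <;> fin_cases j <;> norm_num
  · refine noOtherGauge_of (m := ![2, 8]) (R := 27) ?_ fun p hp h => ?_
    · rw [disc_eq, Fin.prod_univ_two]
      simp [curve, lift, map_ofNat]
      ring
    · exact absurd h (not_sq_dvd_of_isUnit hp (isUnit_germ_iff.2 (by simp [map_ofNat])))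
  · refine Fin.forall_fin_two.2 ⟨?_, ?_⟩
    · exact isComponent_I2_IVstar_IIstar_0 ht0 ht
    · exact isComponent_I2_IVstar_IIstar_1 ht

theorem hasTypeOnDisk_I3_I5_IIIstar (c : ℂ) : HasTypeOnDisk ⟨400 * lift PowerSeries.X ^ 3 - 15 *
    lift PowerSeries.X * z, 480 * lift PowerSeries.X ^ 4 * z - 45 * lift PowerSeries.X ^ 2 * z ^ 2
    + z ^ 3, 144 * lift PowerSeries.X ^ 5 * z ^ 2 - 5 * lift PowerSeries.X ^ 3 * z ^ 3⟩ c IIIstar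
    := by
  refine hasTypeOnDisk_of (f := -160000 * PowerSeries.X ^ 3 * PowerSeries.C c ^ 6 + 13440 *
      PowerSeries.X ^ 2 * PowerSeries.C c ^ 4 - 360 * PowerSeries.X * PowerSeries.C c ^ 2 + 3) (g
      := 128000000 * PowerSeries.X ^ 4 * PowerSeries.C c ^ 9 - 16128000 * PowerSeries.X ^ 3 *
      PowerSeries.C c ^ 7 + 770688 * PowerSeries.X ^ 2 * PowerSeries.C c ^ 5 - 16560 *
      PowerSeries.X * PowerSeries.C c ^ 3 + 135 * PowerSeries.C c) (δ := 4194304000 * PowerSeries.X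
      ^ 6 * PowerSeries.C c ^ 12 - 789577728 * PowerSeries.X ^ 5 * PowerSeries.C c ^ 10 + 61931520
      * PowerSeries.X ^ 4 * PowerSeries.C c ^ 8 - 2590720 * PowerSeries.X ^ 3 * PowerSeries.C c ^ 6
      + 60960 * PowerSeries.X ^ 2 * PowerSeries.C c ^ 4 - 765 * PowerSeries.X * PowerSeries.C c ^ 2
      + 4) ?_ ?_ ?_ ?_ ?_ ?_
  iterate 3
    · simp only [fOrd, gOrd, discOrd, disc_eq, map_add, map_sub, map_mul, map_pow, map_neg,
        map_ofNat, map_zero, onDiskHom_z, onDiskHom_lift_X]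
      ring
  all_goals simp [fExact, gExact, map_ofNat]

theorem isComponent_I3_I5_IIIstar_0 {t : Base} (ht : t ≠ 0) : IsComponent ⟨400 * lift t ^ 3 - 15 *
    lift t * z, 480 * lift t ^ 4 * z - 45 * lift t ^ 2 * z ^ 2 + z ^ 3, 144 * lift t ^ 5 * z ^ 2 -
    5 * lift t ^ 3 * z ^ 3⟩ (0) (I 3) (some (400 * mero t ^ 3)) (some (131072 / 5 * mero t ^ 6)) :=
    by
  have hx : mero t ≠ 0 := fun h => ht (mero_injective (h.trans (map_zero _).symm))
  refine isComponent_of (f := -160000 * t ^ 6) (g := 128000000 * t ^ 9) (δ := 4194304000 * t ^ 12)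
    (by simp) (.of_eq (3 * z ^ 3 - 360 * z ^ 2 * lift t ^ 2 + 13440 * z * lift t ^ 4 - 160000 *
    lift t ^ 6) ?_ fun Q _ q hq => ?_) (.of_eq (135 * z ^ 4 * lift t - 16560 * z ^ 3 * lift t ^ 3 +
    770688 * z ^ 2 * lift t ^ 5 - 16128000 * z * lift t ^ 7 + 128000000 * lift t ^ 9) ?_ fun Q _ q
    hq => ?_) (.of_eq (4 * z ^ 6 - 765 * z ^ 5 * lift t ^ 2 + 60960 * z ^ 4 * lift t ^ 4 - 2590720
    * z ^ 3 * lift t ^ 6 + 61931520 * z ^ 2 * lift t ^ 8 - 789577728 * z * lift t ^ 10 + 4194304000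
    * lift t ^ 12) ?_ fun Q _ q hq => ?_) (by simp [fExact, ht]) (by simp [gExact, ht]) (by simp
    [ht]) ?_ ?_
  iterate 3
    · simp only [fOrd, gOrd, discOrd, disc_eq, curve, lift, map_add, map_sub, map_mul, map_pow,
      map_neg, map_ofNat, map_zero, map_one]
      ring
    · simp only [lift, map_add, map_sub, map_mul, map_pow, map_neg, map_ofNat, map_zero, map_one]
          at hq ⊢
      try simp only [hq]
      try ring
  all_goals
    simp only [betaOf, gammaOf, mero, map_add, map_sub, map_mul, map_pow, map_neg, map_ofNat,
      map_one, map_zero, ↓reduceIte, Nat.reduceMod, Nat.reduceLeDiff, OfNat.ofNat_ne_zero,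
      OfNat.ofNat_ne_one, one_ne_zero, Nat.zero_ne_one, Option.some.injEq] at hx ⊢
    try field_simp
    try norm_num
    try ring

theorem isComponent_I3_I5_IIIstar_1 {t : Base} (ht0 : PowerSeries.constantCoeff t = 0) (ht : t ≠ 0)
    : IsComponent ⟨400 * lift t ^ 3 - 15 * lift t * z, 480 * lift t ^ 4 * z - 45 * lift t ^ 2 * z ^
    2 + z ^ 3, 144 * lift t ^ 5 * z ^ 2 - 5 * lift t ^ 3 * z ^ 3⟩ (32 * t ^ 2) (I 5) (some (16 *
    mero t ^ 3)) (some (384 * mero t ^ 2)) := by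
  have hx : mero t ≠ 0 := fun h => ht (mero_injective (h.trans (map_zero _).symm))
  refine isComponent_of (f := -256 * t ^ 6) (g := 8192 * t ^ 9) (δ := 98304 * t ^ 8) (by simp
    [ht0]) (.of_eq (3 * z ^ 3 - 360 * z ^ 2 * lift t ^ 2 + 13440 * z * lift t ^ 4 - 160000 * lift t
    ^ 6) ?_ fun Q _ q hq => ?_) (.of_eq (135 * z ^ 4 * lift t - 16560 * z ^ 3 * lift t ^ 3 + 770688
    * z ^ 2 * lift t ^ 5 - 16128000 * z * lift t ^ 7 + 128000000 * lift t ^ 9) ?_ fun Q _ q hq =>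
    ?_) (.of_eq (4 * z ^ 4 - 125 * z ^ 3 * lift t ^ 2) ?_ fun Q _ q hq => ?_) (by simp [fExact,
    ht]) (by simp [gExact, ht]) (by simp [ht]) ?_ ?_
  iterate 3
    · simp only [fOrd, gOrd, discOrd, disc_eq, curve, lift, map_add, map_sub, map_mul, map_pow,
      map_neg, map_ofNat, map_zero, map_one]
      ring
    · simp only [lift, map_add, map_sub, map_mul, map_pow, map_neg, map_ofNat, map_zero, map_one]
          at hq ⊢
      try simp only [hq]
      try ring
  all_goals
    simp only [betaOf, gammaOf, mero, map_add, map_sub, map_mul, map_pow, map_neg, map_ofNat,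
      map_one, map_zero, ↓reduceIte, Nat.reduceMod, Nat.reduceLeDiff, OfNat.ofNat_ne_zero,
      OfNat.ofNat_ne_one, one_ne_zero, Nat.zero_ne_one, Option.some.injEq] at hx ⊢
    try field_simp
    try norm_num
    try ring

theorem verified_I3_I5_IIIstar : Verified ![I 3, I 5] IIIstar
        (fun t => ⟨400 * t ^ 3 - 15 * t * z, 480 * t ^ 4 * z - 45 * t ^ 2 * z ^ 2 + z ^ 3,
          144 * t ^ 5 * z ^ 2 - 5 * t ^ 3 * z ^ 3⟩)
        (fun t => z ^ 3 * (z - 32 * t ^ 2) ^ 5 * (4 * z - 125 * t ^ 2))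
        (fun t => ![0, 32 * t ^ 2]) 2
        (fun t => ![some (400 * t ^ 3), some (16 * t ^ 3)])
        (fun t => ![some (131072 / 5 * t ^ 6), some (384 * t ^ 2)])
        6 4 2 2
        (assemble fun
          | 0 => chain 3 ![simpleE7 6, simpleE7 5]
          | 1 => chain 5 ![simpleE7 0, simpleE7 2, simpleE7 3, simpleE7 1])
        (on ![I 3, I 5] 1 (fundA 5) + on ![I 3, I 5] 0 (fundA 3) * on ![I 3, I 5] 1 (fundA 5) +
          on ![I 3, I 5] 0 (fundA 3) * on ![I 3, I 5] 1 (extA 5 2)) := by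
  refine verified_of (fun t => ?_) (hasTypeOnDisk_I3_I5_IIIstar 0) (hasSpecialType_of_forall
      hasTypeOnDisk_I3_I5_IIIstar) ?_ ?_ branching_A3_A5_E7 balanced_I3_I5 (fun e => ?_) (fun e =>
      ?_) ?_ (fun e he => ?_) (fun t ht0 ht => ?_)
  · rw [disc_eq]
    ring
  · exact isHomogeneous_of (((((isHomog_ofNat 400).mul (isHomog_t.pow 3)).congr (m := 6) rfl).sub
        ((((isHomog_ofNat 15).mul isHomog_t).mul isHomog_z).congr rfl) : IsHomog 4 2 _ 6).congr
        rfl) ((((((((isHomog_ofNat 480).mul (isHomog_t.pow 4)).mul isHomog_z).congr (m := 12)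
        rfl).sub ((((isHomog_ofNat 45).mul (isHomog_t.pow 2)).mul (isHomog_z.pow 2)).congr
        rfl)).congr (m := 12) rfl).add ((isHomog_z.pow 3).congr rfl) : IsHomog 4 2 _ 12).congr rfl)
        ((((((isHomog_ofNat 144).mul (isHomog_t.pow 5)).mul (isHomog_z.pow 2)).congr (m := 18)
        rfl).sub ((((isHomog_ofNat 5).mul (isHomog_t.pow 3)).mul (isHomog_z.pow 3)).congr rfl) :
        IsHomog 4 2 _ 18).congr rfl)
  · norm_num [coxeter]
  · refine Fin.forall_fin_two.2 ⟨?_, ?_⟩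
    · exact ord_some_eq (c := 400) (k := 3) (by norm_num) (by simp [map_ofNat])
    · exact ord_some_eq (c := 16) (k := 3) (by norm_num) (by simp [map_ofNat])
  · refine Fin.forall_fin_two.2 ⟨?_, ?_⟩
    · exact ord_some_eq (c := 131072 / 5) (k := 6) (by norm_num) (by simp [map_ofNat])
    · exact ord_some_eq (c := 384) (k := 2) (by norm_num) (by simp [map_ofNat])
  · refine intersectionMult_of_monomials (φ := fun t => ![0, 32 * t ^ 2]) (A := ![0, 32]) (fun e =>
        ?_) ?_
    · refine Fin.forall_fin_two.2 ⟨?_, ?_⟩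
      · simp [map_ofNat]
      · simp [map_ofNat]
    · intro i j
      fin_cases i <;> fin_cases j <;> norm_num
  · refine noOtherGauge_of (m := ![3, 5]) (R := 4 * z - 125 * lift (PowerSeries.X ^ e) ^ 2) ?_ fun
        p hp h => ?_
    · rw [disc_eq, Fin.prod_univ_two]
      simp [curve, lift, map_ofNat]
      ring
    · refine absurd ?_ (not_sq_dvd_linear hp (a := 4) ?_ (-125 * (PowerSeries.X ^ e) ^ 2))
      · convert h using 1
        simp only [lift, map_add, map_sub, map_mul, map_pow, map_neg, map_ofNat]
        ring
      · exact PowerSeries.isUnit_iff_constantCoeff.2 (by simp [map_ofNat])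
  · refine Fin.forall_fin_two.2 ⟨?_, ?_⟩
    · exact isComponent_I3_I5_IIIstar_0 ht
    · exact isComponent_I3_I5_IIIstar_1 ht0 ht

theorem hasTypeOnDisk_I2_I3_I3_IVstar (c : ℂ) : HasTypeOnDisk ⟨-3 * lift PowerSeries.X ^ 4, -6 *
    lift PowerSeries.X ^ 2 * z ^ 2, 16 * lift PowerSeries.X ^ 6 * z ^ 2 + z ^ 4⟩ c IVstar := by
  refine hasTypeOnDisk_of (f := -9 * PowerSeries.X ^ 5 * PowerSeries.C c ^ 8 - 18 * PowerSeries.X *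
      PowerSeries.C c ^ 2) (g := -54 * PowerSeries.X ^ 8 * PowerSeries.C c ^ 12 + 270 *
      PowerSeries.X ^ 4 * PowerSeries.C c ^ 6 + 27) (δ := -1728 * PowerSeries.X ^ 12 *
      PowerSeries.C c ^ 18 + 1296 * PowerSeries.X ^ 8 * PowerSeries.C c ^ 12 - 324 * PowerSeries.X
      ^ 4 * PowerSeries.C c ^ 6 + 27) ?_ ?_ ?_ ?_ ?_ ?_
  iterate 3
    · simp only [fOrd, gOrd, discOrd, disc_eq, map_add, map_sub, map_mul, map_pow, map_neg,
        map_ofNat, map_zero, onDiskHom_z, onDiskHom_lift_X]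
      ring
  all_goals simp [fExact, gExact, map_ofNat]

theorem isComponent_I2_I3_I3_IVstar_0 {t : Base} (ht : t ≠ 0) : IsComponent ⟨-3 * lift t ^ 4, -6 *
    lift t ^ 2 * z ^ 2, 16 * lift t ^ 6 * z ^ 2 + z ^ 4⟩ (0) (I 2) none (some (-192 * mero t ^ 10))
    := by
  have hx : mero t ≠ 0 := fun h => ht (mero_injective (h.trans (map_zero _).symm))
  refine isComponent_of (f := -9 * t ^ 8) (g := -54 * t ^ 12) (δ := -1728 * t ^ 18) (by simp)
    (.of_eq (-18 * z ^ 2 * lift t ^ 2 - 9 * lift t ^ 8) ?_ fun Q _ q hq => ?_) (.of_eq (27 * z ^ 4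
    + 270 * z ^ 2 * lift t ^ 6 - 54 * lift t ^ 12) ?_ fun Q _ q hq => ?_) (.of_eq (27 * z ^ 6 - 324
    * z ^ 4 * lift t ^ 6 + 1296 * z ^ 2 * lift t ^ 12 - 1728 * lift t ^ 18) ?_ fun Q _ q hq => ?_)
    (by simp [fExact, ht]) (by simp [gExact, ht]) (by simp [ht]) ?_ ?_
  iterate 3
    · simp only [fOrd, gOrd, discOrd, disc_eq, curve, lift, map_add, map_sub, map_mul, map_pow,
      map_neg, map_ofNat, map_zero, map_one]
      ring
    · simp only [lift, map_add, map_sub, map_mul, map_pow, map_neg, map_ofNat, map_zero, map_one]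
          at hq ⊢
      try simp only [hq]
      try ring
  all_goals
    simp only [betaOf, gammaOf, mero, map_add, map_sub, map_mul, map_pow, map_neg, map_ofNat,
      map_one, map_zero, ↓reduceIte, Nat.reduceMod, Nat.reduceLeDiff, OfNat.ofNat_ne_zero,
      OfNat.ofNat_ne_one, one_ne_zero, Nat.zero_ne_one, Option.some.injEq] at hx ⊢
    try field_simp
    try norm_num
    try ring

theorem isComponent_I2_I3_I3_IVstar_1 {t : Base} (ht0 : PowerSeries.constantCoeff t = 0) (ht : t ≠
    0) : IsComponent ⟨-3 * lift t ^ 4, -6 * lift t ^ 2 * z ^ 2, 16 * lift t ^ 6 * z ^ 2 + z ^ 4⟩ (2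
    * t ^ 3) (I 3) (some (9 * mero t ^ 4)) (some (256 / 3 * mero t ^ 7)) := by
  have hx : mero t ≠ 0 := fun h => ht (mero_injective (h.trans (map_zero _).symm))
  refine isComponent_of (f := -81 * t ^ 8) (g := 1458 * t ^ 12) (δ := 6912 * t ^ 15) (by simp
    [ht0]) (.of_eq (-18 * z ^ 2 * lift t ^ 2 - 9 * lift t ^ 8) ?_ fun Q _ q hq => ?_) (.of_eq (27 *
    z ^ 4 + 270 * z ^ 2 * lift t ^ 6 - 54 * lift t ^ 12) ?_ fun Q _ q hq => ?_) (.of_eq (27 * z ^ 5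
    + 162 * z ^ 4 * lift t ^ 3 + 324 * z ^ 3 * lift t ^ 6 + 216 * z ^ 2 * lift t ^ 9) ?_ fun Q _ q
    hq => ?_) (by simp [fExact, ht]) (by simp [gExact, ht]) (by simp [ht]) ?_ ?_
  iterate 3
    · simp only [fOrd, gOrd, discOrd, disc_eq, curve, lift, map_add, map_sub, map_mul, map_pow,
      map_neg, map_ofNat, map_zero, map_one]
      ring
    · simp only [lift, map_add, map_sub, map_mul, map_pow, map_neg, map_ofNat, map_zero, map_one]
          at hq ⊢
      try simp only [hq]
      try ring
  all_goals
    simp only [betaOf, gammaOf, mero, map_add, map_sub, map_mul, map_pow, map_neg, map_ofNat,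
      map_one, map_zero, ↓reduceIte, Nat.reduceMod, Nat.reduceLeDiff, OfNat.ofNat_ne_zero,
      OfNat.ofNat_ne_one, one_ne_zero, Nat.zero_ne_one, Option.some.injEq] at hx ⊢
    try field_simp
    try norm_num
    try ring

theorem isComponent_I2_I3_I3_IVstar_2 {t : Base} (ht0 : PowerSeries.constantCoeff t = 0) (ht : t ≠
    0) : IsComponent ⟨-3 * lift t ^ 4, -6 * lift t ^ 2 * z ^ 2, 16 * lift t ^ 6 * z ^ 2 + z ^ 4⟩
    (-2 * t ^ 3) (I 3) (some (9 * mero t ^ 4)) (some (-(256 / 3) * mero t ^ 7)) := by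
  have hx : mero t ≠ 0 := fun h => ht (mero_injective (h.trans (map_zero _).symm))
  refine isComponent_of (f := -81 * t ^ 8) (g := 1458 * t ^ 12) (δ := -6912 * t ^ 15) (by simp
    [ht0]) (.of_eq (-18 * z ^ 2 * lift t ^ 2 - 9 * lift t ^ 8) ?_ fun Q _ q hq => ?_) (.of_eq (27 *
    z ^ 4 + 270 * z ^ 2 * lift t ^ 6 - 54 * lift t ^ 12) ?_ fun Q _ q hq => ?_) (.of_eq (27 * z ^ 5
    - 162 * z ^ 4 * lift t ^ 3 + 324 * z ^ 3 * lift t ^ 6 - 216 * z ^ 2 * lift t ^ 9) ?_ fun Q _ q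
    hq => ?_) (by simp [fExact, ht]) (by simp [gExact, ht]) (by simp [ht]) ?_ ?_
  iterate 3
    · simp only [fOrd, gOrd, discOrd, disc_eq, curve, lift, map_add, map_sub, map_mul, map_pow,
      map_neg, map_ofNat, map_zero, map_one]
      ring
    · simp only [lift, map_add, map_sub, map_mul, map_pow, map_neg, map_ofNat, map_zero, map_one]
          at hq ⊢
      try simp only [hq]
      try ring
  all_goals
    simp only [betaOf, gammaOf, mero, map_add, map_sub, map_mul, map_pow, map_neg, map_ofNat,
      map_one, map_zero, ↓reduceIte, Nat.reduceMod, Nat.reduceLeDiff, OfNat.ofNat_ne_zero,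
      OfNat.ofNat_ne_one, one_ne_zero, Nat.zero_ne_one, Option.some.injEq] at hx ⊢
    try field_simp
    try norm_num
    try ring

theorem verified_I2_I3_I3_IVstar : Verified ![I 2, I 3, I 3] IVstar
        (fun t => ⟨-3 * t ^ 4, -6 * t ^ 2 * z ^ 2, 16 * t ^ 6 * z ^ 2 + z ^ 4⟩)
        (fun t => 27 * z ^ 2 * (z - 2 * t ^ 3) ^ 3 * (z + 2 * t ^ 3) ^ 3)
        (fun t => ![0, 2 * t ^ 3, -2 * t ^ 3]) 3
        (fun t => ![none, some (9 * t ^ 4), some (9 * t ^ 4)])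
        (fun t => ![some (-192 * t ^ 10), some (256 / 3 * t ^ 7), some (-(256 / 3) * t ^ 7)])
        4 3 1 1
        (assemble fun
          | 0 => chain 2 ![simpleE6 1]
          | 1 => chain 3 ![simpleE6 2, simpleE6 0]
          | 2 => chain 3 ![simpleE6 4, simpleE6 5])
        (on ![I 2, I 3, I 3] 1 (fundA 3) * on ![I 2, I 3, I 3] 2 (fundA 3) + on ![I 2, I 3, I 3] 0
            (fundA 2) +
          on ![I 2, I 3, I 3] 0 (fundA 2) * on ![I 2, I 3, I 3] 1 (fundA 3) * on ![I 2, I 3, I 3] 2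
              (fundA 3)) := by
  refine verified_of (fun t => ?_) (hasTypeOnDisk_I2_I3_I3_IVstar 0) (hasSpecialType_of_forall
      hasTypeOnDisk_I2_I3_I3_IVstar) ?_ ?_ branching_A2_A3_A3_E6 balanced_I2_I3_I3 (fun e => ?_)
      (fun e => ?_) ?_ (fun e he => ?_) (fun t ht0 ht => ?_)
  · rw [disc_eq]
    ring
  · exact isHomogeneous_of ((((isHomog_ofNat 3).neg).mul (isHomog_t.pow 4) : IsHomog 3 1 _ 4).congr
        rfl) (((((isHomog_ofNat 6).neg).mul (isHomog_t.pow 2)).mul (isHomog_z.pow 2) : IsHomog 3 1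
        _ 8).congr rfl) ((((((isHomog_ofNat 16).mul (isHomog_t.pow 6)).mul (isHomog_z.pow 2)).congr
        (m := 12) rfl).add ((isHomog_z.pow 4).congr rfl) : IsHomog 3 1 _ 12).congr rfl)
  · norm_num [coxeter]
  · refine Fin.forall_fin_succ.2 ⟨?_, Fin.forall_fin_two.2 ⟨?_, ?_⟩⟩
    · exact ord_none_eq e
    · exact ord_some_eq (c := 9) (k := 4) (by norm_num) (by simp [map_ofNat])
    · exact ord_some_eq (c := 9) (k := 4) (by norm_num) (by simp [map_ofNat])
  · refine Fin.forall_fin_succ.2 ⟨?_, Fin.forall_fin_two.2 ⟨?_, ?_⟩⟩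
    · exact ord_some_eq (c := -192) (k := 10) (by norm_num) (by simp [map_ofNat])
    · exact ord_some_eq (c := 256 / 3) (k := 7) (by norm_num) (by simp [map_ofNat])
    · exact ord_some_eq (c := -(256 / 3)) (k := 7) (by norm_num) (by simp [map_ofNat])
  · refine intersectionMult_of_monomials (φ := fun t => ![0, 2 * t ^ 3, -2 * t ^ 3]) (A := ![0, 2,
        -2]) (fun e => ?_) ?_
    · refine Fin.forall_fin_succ.2 ⟨?_, Fin.forall_fin_two.2 ⟨?_, ?_⟩⟩
      · simp [map_ofNat]
      · simp [map_ofNat]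
      · simp [map_ofNat]
    · intro i j
      fin_cases i <;> fin_cases j <;> norm_num
  · refine noOtherGauge_of (m := ![2, 3, 3]) (R := 27) ?_ fun p hp h => ?_
    · rw [disc_eq, Fin.prod_univ_three]
      simp [curve, lift, map_ofNat]
      ring
    · exact absurd h (not_sq_dvd_of_isUnit hp (isUnit_germ_iff.2 (by simp [map_ofNat])))
  · refine Fin.forall_fin_succ.2 ⟨?_, Fin.forall_fin_two.2 ⟨?_, ?_⟩⟩
    · exact isComponent_I2_I3_I3_IVstar_0 ht
    · exact isComponent_I2_I3_I3_IVstar_1 ht0 ht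
    · exact isComponent_I2_I3_I3_IVstar_2 ht0 ht

set_option linter.unusedSimpArgs false

theorem hasTypeOnDisk_Istar0 {a b c : ℂ} (h : 4 * a ^ 3 + 27 * (c + b) ^ 2 ≠ 0) :
    HasTypeOnDisk ⟨0, a • z ^ 2, lift PowerSeries.X * z ^ 2 + b • z ^ 3⟩ c (Istar 0) := by
  refine hasTypeOnDisk_of (f := PowerSeries.C (3 * a)) (g := PowerSeries.C (27 * (c + b)))
    (δ := PowerSeries.C (4 * a ^ 3 + 27 * (c + b) ^ 2)) ?_ ?_ ?_ (fun h => absurd rfl h)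
    (fun h => absurd rfl h) (by simpa using h)
  · simp only [fOrd, smul_eq_lift, map_add, map_sub, map_mul, map_pow, map_ofNat, map_zero,
      onDiskHom_z, onDiskHom_lift_X, onDiskHom_lift_C]
    ring
  · simp only [gOrd, smul_eq_lift, map_add, map_sub, map_mul, map_pow, map_ofNat, map_zero,
      onDiskHom_z, onDiskHom_lift_X, onDiskHom_lift_C]
    ring
  · rw [disc_eq]
    simp only [discOrd, smul_eq_lift, map_add, map_sub, map_mul, map_pow, map_ofNat, map_zero,
      onDiskHom_z, onDiskHom_lift_X, onDiskHom_lift_C]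
    ring

theorem hasSpecialType_Istar0 (a b : ℂ) :
    HasSpecialType ⟨0, a • z ^ 2, lift PowerSeries.X * z ^ 2 + b • z ^ 3⟩ (Istar 0) := by
  have hfin : {c : ℂ | 4 * a ^ 3 + 27 * (c + b) ^ 2 = 0}.Finite := by
    rcases Set.eq_empty_or_nonempty {c : ℂ | 4 * a ^ 3 + 27 * (c + b) ^ 2 = 0} with h | ⟨c₀, h₀⟩
    · rw [h]
      exact Set.finite_empty
    · refine Set.Finite.subset (Set.toFinite {c₀, -c₀ - 2 * b}) fun c hc => ?_
      have : (c - c₀) * (c - (-c₀ - 2 * b)) = 0 := by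
        rw [Set.mem_ofPred_eq] at h₀ hc
        linear_combination (hc - h₀) / 27
      rcases mul_eq_zero.1 this with h | h
      · exact Or.inl (sub_eq_zero.1 h)
      · exact Or.inr (sub_eq_zero.1 h)
  refine hfin.subset fun c hc => ?_
  by_contra h
  exact hc (hasTypeOnDisk_Istar0 h)

theorem verified_IV_Istar0 (a b : ℂ) (hab : 4 * a ^ 3 + 27 * b ^ 2 ≠ 0) :
    VerifiedOne IV (Istar 0) (fun t => ⟨0, a • z ^ 2, t * z ^ 2 + b • z ^ 3⟩)
      (fun t => z ^ 4 * ((4 * a ^ 3 + 27 * b ^ 2) • z ^ 2 + (54 * b) • (t * z) + 27 * t ^ 2))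
      (fun t => some t) (fun _ => none) 2 2 2 2 (embAD 3 4) ((3 : ℚ) • fundA 3) := by
  refine verifiedOne_of (fun t => ?_) (hasTypeOnDisk_Istar0 (by simpa using hab))
    (hasSpecialType_Istar0 a b) ?_ ?_ branching_A3_D4 balanced_IV (fun e => ?_)
    (fun e => ord_none_eq e) (m := 4)
    (fun t => (4 * a ^ 3 + 27 * b ^ 2) • z ^ 2 + (54 * b) • (t * z) + 27 * t ^ 2) (fun t => rfl)
    ?_ (f := fun _ => PowerSeries.C (3 * a)) (g := fun t => 27 * t) (δ := fun t => 27 * t ^ 2)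
    (fun t => ?_) (fun t => ?_) (fun t => ?_) (fun t ht => ?_) (fun t ht => ⟨?_, rfl⟩)
  · rw [disc_eq]
    simp only [smul_eq_lift, lift, map_add, map_mul, map_pow, map_ofNat]
    ring
  · exact isHomogeneous_of isHomog_zero (((isHomog_z.pow 2).smul a : IsHomog 2 2 _ 4).congr rfl)
      ((((isHomog_t.mul (isHomog_z.pow 2)).congr (m := 6) rfl).add
        (((isHomog_z.pow 3).smul b).congr rfl) : IsHomog 2 2 _ 6).congr rfl)
  · norm_num [coxeter]
  · exact ord_some_eq (c := 1) (k := 1) (by norm_num) (by rw [map_one, one_mul, zpow_one])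
  · intro e he p hp h
    obtain ⟨e, rfl⟩ := Nat.exists_eq_add_of_le' he
    rcases eq_or_ne a 0 with rfl | ha
    · have hb : b ≠ 0 := by
        rintro rfl
        simp at hab
      have hlin := not_sq_dvd_linear hp (a := PowerSeries.C b) (hb.isUnit.map PowerSeries.C)
        (PowerSeries.X ^ (e + 1))
      by_cases hz : p ∣ z
      · exact Or.inl hz
      have hw : (⟨0, (0 : ℂ) • z ^ 2, lift (PowerSeries.X ^ (e + 1)) * z ^ 2 + b • z ^ 3⟩ :
          Weierstrass).g = z ^ 2 * (lift (PowerSeries.C b) * z + lift (PowerSeries.X ^ (e + 1))) := by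
        simp only [Weierstrass.g, smul_eq_lift]
        ring
      have h27 : ¬ p ∣ 27 := fun h27 =>
        hp.not_isUnit (isUnit_of_dvd_unit h27 (isUnit_germ_iff.2 (by simp [map_ofNat])))
      refine Or.inr ⟨by simp [Weierstrass.f], ?_, ?_⟩
      · rw [hw]
        refine Dvd.dvd.mul_left ?_ _
        have h' : p ∣ 27 * (lift (PowerSeries.C b) * z + lift (PowerSeries.X ^ (e + 1))) ^ 2 := by
          refine ((dvd_pow_self p two_ne_zero).trans h).trans (dvd_of_eq ?_)
          simp only [smul_eq_lift, lift, map_add, map_mul, map_pow, map_ofNat, map_zero]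
          ring
        exact hp.dvd_of_dvd_pow ((hp.dvd_or_dvd h').resolve_left h27)
      · rw [hw]
        exact fun h2 => hlin (hp.pow_dvd_of_dvd_mul_left 2 (fun h => hz (hp.dvd_of_dvd_pow h)) h2)
    · refine Or.inl (dvd_z_of_sq_dvd_quadratic hp (a := PowerSeries.C (4 * a ^ 3 + 27 * b ^ 2))
        (b := PowerSeries.C (54 * b) * PowerSeries.X ^ e) (c := 27 * (PowerSeries.X ^ (e + 1)) ^ 2)
        (u := PowerSeries.C (432 * a ^ 3)) (n := (e + 1) * 2) (hab.isUnit.map PowerSeries.C)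
        (IsUnit.map PowerSeries.C (by simpa using ha)) ?_ ?_)
      · simp only [map_add, map_mul, map_pow, map_ofNat]
        ring
      · convert h using 1
        simp only [smul_eq_lift, lift, map_add, map_mul, map_pow, map_ofNat]
        ring
  · refine .of_eq (lift (PowerSeries.C (3 * a))) ?_ fun Q _ q hq => rfl
    simp only [fOrd, smul_eq_lift, curve, lift, map_zero, map_mul, map_ofNat]
    ring
  · refine .of_eq (27 * (lift t + lift (PowerSeries.C b) * z)) ?_ fun Q _ q hq => ?_
    · simp only [gOrd, smul_eq_lift, curve, lift, map_zero]
      ring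
    · simp only [lift, map_add, map_mul, map_ofNat, map_zero] at hq ⊢
      rw [hq, mul_zero, add_zero]
  · refine .of_eq (lift (PowerSeries.C (4 * a ^ 3 + 27 * b ^ 2)) * z ^ 2 +
      lift (PowerSeries.C (54 * b)) * (lift t * z) + 27 * lift t ^ 2) ?_ fun Q _ q hq => ?_
    · simp only [discOrd, smul_eq_lift, curve, lift, map_zero]
      ring
    · simp only [lift, map_add, map_mul, map_pow, map_ofNat, map_zero] at hq ⊢
      rw [hq]
      ring
  · simp [fExact, gExact, ht]
  · simp only [betaOf, mero, map_mul, map_ofNat, Option.some.injEq]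
    field_simp

/-! ### Families depending on arbitrary functions -/

theorem restrictsTo_zero {k : ℕ} {F H G : Germ} (h : F = z ^ k * H) (hG : z ∣ H - G) :
    RestrictsTo 0 k F (atZero G) := by
  refine ⟨H, by rw [h, curve_zero], ?_⟩
  rw [curve_zero]
  have : z ∣ G - lift (atZero G) := by
    rw [z, PowerSeries.X_dvd_iff]
    simp [atZero, lift]
  simpa using dvd_add hG this

theorem atZero_mul (F G : Germ) : atZero (F * G) = atZero F * atZero G := map_mul _ F G

theorem atZero_pow (F : Germ) (n : ℕ) : atZero (F ^ n) = atZero F ^ n := map_pow _ F n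

theorem atZero_neg (F : Germ) : atZero (-F) = -atZero F := map_neg _ F

theorem atZero_lift (a : Base) : atZero (lift a) = a := PowerSeries.constantCoeff_C a

theorem isUnit_atZero {F : Germ} (h : IsUnit F) : IsUnit (atZero F) :=
  h.map PowerSeries.constantCoeff

theorem ord_some_mero {a u : Base} {e b : ℕ} (hu : IsUnit u)
    (h : a = u * (PowerSeries.X ^ e) ^ b) : ord (some (mero a)) = e * (b : ℤ) := by
  rw [h, ← pow_mul]
  exact (order_mero_mul hu (e * b)).trans (Nat.cast_mul e b)

theorem mul_X_pow_ne_zero {u : Base} (hu : IsUnit u) (e b : ℕ) :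
    u * (PowerSeries.X ^ e) ^ b ≠ 0 :=
  mul_ne_zero hu.ne_zero (pow_ne_zero _ (pow_ne_zero _ PowerSeries.X_ne_zero))

section General

variable {W : Germ → Weierstrass} {Δ β γ : Germ → Germ} {N b c : ℕ} {k : ℚ} {T' : Kodaira}

theorem verifiedGeneral_I {m : ℕ} {ι : Cartan (A m) →ₗ[ℂ] Cartan T'.cover}
    {ρ : Rep (Cartan (A m))} (hm : 3 ≤ m)
    (hsp : HasSpecialType (W (lift PowerSeries.X)) T')
    (hbr : BranchingRule (fun _ : Fin 1 => I m) T' (assemble fun _ => ι)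
      (on (fun _ : Fin 1 => I m) 0 ρ))
    (hbal : IsBalanced (fun _ : Fin 1 => I m) k (on (fun _ : Fin 1 => I m) 0 ρ)
      (fun _ => (b : ℤ)) (fun _ => (c : ℤ)) 0)
    (hΔ : ∀ t, z ^ N ∣ (W t).disc - Δ t)
    (hf : ∀ t, z ∣ 3 * (W t).v - (W t).u ^ 2 - -β t ^ 2)
    (hg : ∀ t, z ∣ 2 * (W t).u ^ 3 - 9 * (W t).u * (W t).v + 27 * (W t).w - 2 * β t ^ 3)
    (hδ : ∀ t, ∃ H, (W t).disc = z ^ m * (β t ^ 2 * γ t + z * H))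
    (hβ : ∀ e : ℕ, 1 ≤ e → ∃ u, IsUnit u ∧
      atZero (β (lift (PowerSeries.X ^ e))) = u * (PowerSeries.X ^ e) ^ b)
    (hγ : ∀ e : ℕ, 1 ≤ e → ∃ u, IsUnit u ∧
      atZero (γ (lift (PowerSeries.X ^ e))) = u * (PowerSeries.X ^ e) ^ c) :
    VerifiedGeneral (I m) T' W Δ N β γ k ι ρ := by
  refine ⟨hsp, hbr, fun e he => ⟨hΔ _, ?_⟩⟩
  obtain ⟨u, hu, hβ⟩ := hβ e he
  obtain ⟨u', hu', hγ⟩ := hγ e he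
  refine anomaliesCancel_of hbal (fun _ => ord_some_mero hu hβ) (fun _ => ord_some_mero hu' hγ)
    (fun i j hij => absurd (Subsingleton.elim i j) hij) fun _ => ?_
  set t := lift (PowerSeries.X ^ e)
  have hx : atZero (β t) ≠ 0 := hβ ▸ mul_X_pow_ne_zero hu e b
  have hy : atZero (γ t) ≠ 0 := hγ ▸ mul_X_pow_ne_zero hu' e c
  obtain ⟨H, hH⟩ := hδ t
  have h2 : atZero (2 : Germ) = 2 := map_ofNat _ 2
  refine isComponent_of (map_zero _)
    (f := atZero (-β t ^ 2)) (g := atZero (2 * β t ^ 3)) (δ := atZero (β t ^ 2 * γ t))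
    (restrictsTo_zero (one_mul _).symm (hf t)) (restrictsTo_zero (one_mul _).symm (hg t))
    (restrictsTo_zero hH (by simp)) ?_ ?_ ?_ ?_ ?_
  · simp [atZero_neg, atZero_pow, hx]
  · simp [atZero_mul, atZero_pow, hx, h2]
  · simp [atZero_mul, atZero_pow, hx, hy]
  all_goals
    have hx' : mero (atZero (β t)) ≠ 0 := fun h => hx (mero_injective (h.trans (map_zero _).symm))
    simp only [betaOf, gammaOf, atZero_neg, atZero_mul, atZero_pow, h2, if_neg (show ¬ m ≤ 2 by omega), mero,
      map_neg, map_mul, map_pow, map_ofNat, Option.some.injEq] at hx' ⊢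
    field_simp
    try ring

theorem verifiedGeneral_Istar {j : ℕ} {ι : Cartan (D (j + 4)) →ₗ[ℂ] Cartan T'.cover}
    {ρ : Rep (Cartan (D (j + 4)))} (hj : j ≠ 0)
    (hsp : HasSpecialType (W (lift PowerSeries.X)) T')
    (hbr : BranchingRule (fun _ : Fin 1 => Istar j) T' (assemble fun _ => ι)
      (on (fun _ : Fin 1 => Istar j) 0 ρ))
    (hbal : IsBalanced (fun _ : Fin 1 => Istar j) k (on (fun _ : Fin 1 => Istar j) 0 ρ)
      (fun _ => (b : ℤ)) (fun _ => (c : ℤ)) 0)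
    (hΔ : ∀ t, z ^ N ∣ (W t).disc - Δ t)
    (hf : ∀ t, ∃ H, 3 * (W t).v - (W t).u ^ 2 = z ^ 2 * (-γ t ^ 2 + z * H))
    (hg : ∀ t, ∃ H, 2 * (W t).u ^ 3 - 9 * (W t).u * (W t).v + 27 * (W t).w =
      z ^ 3 * (2 * γ t ^ 3 + z * H))
    (hδ : ∀ t, ∃ H, (W t).disc =
      z ^ (6 + j) * ((if j % 2 = 1 then β t * γ t ^ 3 else -(β t * γ t ^ 2)) + z * H))
    (hβ : ∀ e : ℕ, 1 ≤ e → ∃ u, IsUnit u ∧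
      atZero (β (lift (PowerSeries.X ^ e))) = u * (PowerSeries.X ^ e) ^ b)
    (hγ : ∀ e : ℕ, 1 ≤ e → ∃ u, IsUnit u ∧
      atZero (γ (lift (PowerSeries.X ^ e))) = u * (PowerSeries.X ^ e) ^ c) :
    VerifiedGeneral (Istar j) T' W Δ N β γ k ι ρ := by
  refine ⟨hsp, hbr, fun e he => ⟨hΔ _, ?_⟩⟩
  obtain ⟨u, hu, hβ⟩ := hβ e he
  obtain ⟨u', hu', hγ⟩ := hγ e he
  refine anomaliesCancel_of hbal (fun _ => ord_some_mero hu hβ) (fun _ => ord_some_mero hu' hγ)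
    (fun i j hij => absurd (Subsingleton.elim i j) hij) fun _ => ?_
  set t := lift (PowerSeries.X ^ e)
  have hx : atZero (β t) ≠ 0 := hβ ▸ mul_X_pow_ne_zero hu e b
  have hy : atZero (γ t) ≠ 0 := hγ ▸ mul_X_pow_ne_zero hu' e c
  obtain ⟨F, hF⟩ := hf t
  obtain ⟨G, hG⟩ := hg t
  obtain ⟨H, hH⟩ := hδ t
  have h2 : atZero (2 : Germ) = 2 := map_ofNat _ 2
  refine isComponent_of (map_zero _) (restrictsTo_zero (G := -γ t ^ 2) hF (by simp))
    (restrictsTo_zero (G := 2 * γ t ^ 3) hG (by simp))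
    (restrictsTo_zero (G := if j % 2 = 1 then β t * γ t ^ 3 else -(β t * γ t ^ 2)) hH (by simp)) ?_ ?_ ?_ ?_ ?_
  · simp [atZero_neg, atZero_pow, hy]
  · simp [atZero_mul, atZero_pow, hy, h2]
  · split_ifs <;> simp [atZero_neg, atZero_mul, atZero_pow, hx, hy]
  all_goals
    have hy' : mero (atZero (γ t)) ≠ 0 := fun h => hy (mero_injective (h.trans (map_zero _).symm))
  · simp only [betaOf, if_neg hj]
    split_ifs <;>
      simp only [atZero_neg, atZero_mul, atZero_pow, h2, mero, map_neg, map_mul, map_pow, map_ofNat,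
        Option.some.injEq] at hy' ⊢ <;>
      field_simp <;> ring
  · simp only [gammaOf, if_neg hj, atZero_neg, atZero_mul, atZero_pow, h2, mero, map_neg, map_mul,
      map_pow, map_ofNat, Option.some.injEq] at hy' ⊢
    field_simp
    norm_num

end General

theorem hasSpecialType_of_finite {W : Weierstrass} {T : Kodaira} {S : Set ℂ} (hS : S.Finite)
    (h : ∀ c ∉ S, HasTypeOnDisk W c T) : HasSpecialType W T :=
  hS.subset fun c hc => by_contra fun hn => hc (h c hn)

theorem finite_linear {α : ℂ} (hα : α ≠ 0) (κ : ℂ) : {c : ℂ | α * c + κ = 0}.Finite := by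
  refine (Set.finite_singleton (-κ / α)).subset fun c hc => ?_
  rw [Set.mem_ofPred_eq] at hc
  rw [Set.mem_singleton_iff, eq_div_iff hα]
  linear_combination hc

theorem mul_lift_X_pow {F : Germ} (h : IsUnit F) (e b : ℕ) : ∃ u, IsUnit u ∧
    atZero (F * lift (PowerSeries.X ^ e) ^ b) = u * (PowerSeries.X ^ e) ^ b :=
  ⟨_, isUnit_atZero h, by rw [atZero_mul, atZero_pow, atZero_lift]⟩

theorem pow_eq_mul {a b : ℕ} (h : b ≤ a) : z ^ a = z ^ b * z ^ (a - b) := by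
  rw [← pow_add, Nat.add_sub_cancel' h]

theorem isUnit_four : IsUnit (4 : Germ) := isUnit_germ_iff.2 (by simp [map_ofNat])

/-! ### `I_m → I_{m+1}` -/

theorem disc_I_succ {m : ℕ} (a c h t : Germ) (hm : 3 ≤ m) (hc : m = 3 → z ∣ c) :
    ∃ K, (⟨a, 2 * a * c * z ^ (m / 2),
      a * c ^ 2 * z ^ (2 * (m / 2)) + t * z ^ m + h * z ^ (m + 1)⟩ : Weierstrass).disc =
        z ^ m * (4 * a ^ 3 * t + z * K) := by
  have h3 : ∃ Q, c ^ 3 * (z ^ (m / 2)) ^ 3 = z ^ m * z * Q := by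
    rcases eq_or_ne m 3 with rfl | hm3
    · obtain ⟨c, rfl⟩ := hc rfl
      exact ⟨z ^ 2 * c ^ 3, by ring⟩
    · refine ⟨c ^ 3 * z ^ (m / 2 * 3 - (m + 1)), ?_⟩
      rw [← pow_mul, pow_eq_mul (show m + 1 ≤ m / 2 * 3 by omega), pow_succ]
      ring
  obtain ⟨Q, h3⟩ := h3
  have h4 : (z ^ (m / 2)) ^ 4 = z ^ m * z * z ^ (m / 2 * 4 - (m + 1)) := by
    rw [← pow_mul, pow_eq_mul (show m + 1 ≤ m / 2 * 4 by omega), pow_succ]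
  have hy : z ^ (m / 2) = z * z ^ (m / 2 - 1) := by
    rw [pow_eq_mul (show 1 ≤ m / 2 by omega), pow_one]
  have hp : z ^ m = z * z ^ (m - 1) := by rw [pow_eq_mul (show 1 ≤ m by omega), pow_one]
  rw [disc_eq, pow_mul', pow_succ z m]
  generalize z ^ (m / 2) = y at *
  generalize z ^ (m / 2 * 4 - (m + 1)) = Q4 at *
  generalize z ^ (m / 2 - 1) = y' at *
  generalize z ^ (m - 1) = p' at *
  generalize z ^ m = p at *
  refine ⟨4 * a ^ 3 * h - 4 * a ^ 3 * Q - 36 * a ^ 2 * c * y' * (t + h * z) +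
    27 * (a ^ 2 * c ^ 4 * Q4 + 2 * a * c ^ 2 * y' * y * (t + h * z) + p' * (t + h * z) ^ 2), ?_⟩
  linear_combination (-4 * a ^ 3) * h3 - 36 * a ^ 2 * c * (t + h * z) * p * hy +
    27 * a ^ 2 * c ^ 4 * h4 + 54 * a * c ^ 2 * (t + h * z) * p * y * hy +
    27 * (t + h * z) ^ 2 * p * hp

theorem verified_I_succ (m : ℕ) (a₂ c h : Germ) (hm : 3 ≤ m) (ha : IsUnit a₂)
    (hc : m = 3 → z ∣ c) : VerifiedGeneral (I m) (I (m + 1))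
      (fun t => ⟨a₂, 2 * a₂ * c * z ^ (m / 2),
        a₂ * c ^ 2 * z ^ (2 * (m / 2)) + t * z ^ m + h * z ^ (m + 1)⟩)
      (fun t => 4 * a₂ ^ 3 * t * z ^ m) (m + 1) (fun _ => a₂) (fun t => 4 * a₂ * t)
      1 (embAA m) (fundA m) := by
  have hy : z ^ (m / 2) = z * z ^ (m / 2 - 1) := by
    rw [pow_eq_mul (show 1 ≤ m / 2 by omega), pow_one]
  have hp : z ^ m = z * z ^ (m - 1) := by rw [pow_eq_mul (show 1 ≤ m by omega), pow_one]
  have ef (t : Germ) : 3 * (2 * a₂ * c * z ^ (m / 2)) - a₂ ^ 2 =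
      -a₂ ^ 2 + z * (6 * a₂ * c * z ^ (m / 2 - 1)) := by
    rw [hy]
    ring
  have eg (t : Germ) : 2 * a₂ ^ 3 - 9 * a₂ * (2 * a₂ * c * z ^ (m / 2)) +
      27 * (a₂ * c ^ 2 * z ^ (2 * (m / 2)) + t * z ^ m + h * z ^ (m + 1)) =
      2 * a₂ ^ 3 + z * (-18 * a₂ ^ 2 * c * z ^ (m / 2 - 1) + 27 * (a₂ * c ^ 2 * z ^ (m / 2 - 1) *
        z ^ (m / 2) + (t + h * z) * z ^ (m - 1))) := by
    rw [pow_mul', pow_succ z m, hp]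
    linear_combination (-18 * a₂ ^ 2 * c + 27 * a₂ * c ^ 2 * z ^ (m / 2)) * hy
  have hd (t : Germ) := disc_I_succ a₂ c h t hm hc
  have h0 := isUnit_germ_iff.1 ha
  refine verifiedGeneral_I (b := 0) (c := 1) hm ?_ (branching_A_succ m) (balanced_I_fund m)
    (fun t => ?_) (fun t => ?_) (fun t => ?_) (fun t => ?_) (fun e _ => ?_) (fun e _ => ?_)
  · obtain ⟨K, hK⟩ := hd (lift PowerSeries.X)
    refine hasSpecialType_of_finite (finite_linear (α := 4 * _ ^ 3)
      (mul_ne_zero (by norm_num) (pow_ne_zero 3 h0)) (PowerSeries.constantCoeff (PowerSeries.constantCoeff K))) fun x hx => ?_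
    refine hasTypeOnDisk_of (f := onDiskHom x (-a₂ ^ 2 + z * (6 * a₂ * c * z ^ (m / 2 - 1))))
      (g := onDiskHom x (2 * a₂ ^ 3 + z * (-18 * a₂ ^ 2 * c * z ^ (m / 2 - 1) + 27 * (a₂ * c ^ 2 *
        z ^ (m / 2 - 1) * z ^ (m / 2) + (lift PowerSeries.X + h * z) * z ^ (m - 1)))))
      (δ := 4 * onDiskHom x a₂ ^ 3 * PowerSeries.C x + onDiskHom x K) ?_ ?_ ?_ ?_ ?_ ?_
    · rw [ef 0, fOrd, pow_zero, one_mul]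
    · rw [eg, gOrd, pow_zero, one_mul]
    · rw [hK]
      simp only [discOrd, map_add, map_mul, map_pow, map_ofNat, onDiskHom_z, onDiskHom_lift_X]
      ring
    · simp [onDiskHom_z, constantCoeff_onDiskHom, h0]
    · simp [onDiskHom_z, constantCoeff_onDiskHom, h0, map_ofNat]
    · simpa [constantCoeff_onDiskHom, map_ofNat] using hx
  · obtain ⟨K, hK⟩ := hd t
    exact ⟨K, by rw [hK]; ring⟩
  · exact ⟨6 * a₂ * c * z ^ (m / 2 - 1), by rw [ef t]; ring⟩
  · exact ⟨_, sub_eq_iff_eq_add'.2 (eg t)⟩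
  · obtain ⟨K, hK⟩ := hd t
    exact ⟨K, by rw [hK]; ring⟩
  · simpa using mul_lift_X_pow ha e 0
  · simpa using mul_lift_X_pow (isUnit_four.mul ha) e 1

/-! ### `I_m → I_j^*` -/

theorem disc_scaled (u v w y : Germ) : (⟨u, v * y, w * y ^ 2⟩ : Weierstrass).disc =
    y ^ 2 * (u ^ 2 * (4 * u * w - v ^ 2) + y * (4 * v ^ 3 - 18 * u * v * w + 27 * w ^ 2 * y)) := by
  rw [disc_eq]
  ring

theorem verified_I_even (n : ℕ) (a₄ a₆ : Germ) (hn : 2 ≤ n) (ha : IsUnit a₄) :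
    VerifiedGeneral (I (2 * n)) (Istar (2 * n - 4))
      (fun t => ⟨t, a₄ * z ^ n, a₆ * z ^ (2 * n)⟩)
      (fun t => t ^ 2 * (4 * t * a₆ - a₄ ^ 2) * z ^ (2 * n)) (2 * n + 2)
      (fun t => t) (fun t => 4 * t * a₆ - a₄ ^ 2)
      2 (embAD (2 * n) (2 * n - 4 + 4)) (extA (2 * n) 2) := by
  obtain ⟨n, rfl⟩ := Nat.exists_eq_add_of_le' hn
  have h0 := isUnit_germ_iff.1 ha
  have hj : 6 + (2 * (n + 2) - 4) = 2 * n + 6 := by omega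
  refine verifiedGeneral_I (b := 1) (c := 0) (by omega) ?_ (branching_A_D _ _ (by omega))
    (balanced_I_half_extA (by omega)) (fun t => ?_) (fun t => ?_) (fun t => ?_) (fun t => ?_)
    (fun e _ => ?_) (fun e he => ?_)
  · set α := PowerSeries.constantCoeff (PowerSeries.constantCoeff a₄)
    have hS : ({0} ∪ {x : ℂ | x ^ 2 = 4 * α}).Finite := by
      refine (Set.finite_singleton _).union ?_
      rcases Set.eq_empty_or_nonempty {x : ℂ | x ^ 2 = 4 * α} with h | ⟨x₀, h₀⟩
      · rw [h]
        exact Set.finite_empty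
      · refine Set.Finite.subset (Set.toFinite {x₀, -x₀}) fun x hx => ?_
        rw [Set.mem_ofPred_eq] at hx h₀
        exact sq_eq_sq_iff_eq_or_eq_neg.1 (hx.trans h₀.symm)
    refine hasSpecialType_of_finite hS fun x hx => ?_
    rw [Set.mem_union, Set.mem_singleton_iff, Set.mem_ofPred_eq, not_or] at hx
    refine hasTypeOnDisk_of
      (f := 3 * onDiskHom x a₄ * PowerSeries.X ^ n - PowerSeries.C x ^ 2)
      (g := 2 * PowerSeries.C x ^ 3 - 9 * PowerSeries.C x * onDiskHom x a₄ * PowerSeries.X ^ n +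
        27 * onDiskHom x a₆ * PowerSeries.X ^ (2 * n + 1))
      (δ := PowerSeries.C x ^ 2 * (4 * PowerSeries.C x * PowerSeries.X * onDiskHom x a₆ -
        onDiskHom x a₄ ^ 2) + PowerSeries.X ^ n * (4 * onDiskHom x a₄ ^ 3 - PowerSeries.X *
        (18 * PowerSeries.C x * onDiskHom x a₄ * onDiskHom x a₆) +
        27 * onDiskHom x a₆ ^ 2 * PowerSeries.X ^ (n + 2))) ?_ ?_ ?_ (fun h => ?_) (fun h => ?_) ?_
    · simp only [fOrd, map_sub, map_mul, map_pow, map_ofNat, onDiskHom_z, onDiskHom_lift_X]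
      ring
    · simp only [gOrd, map_add, map_sub, map_mul, map_pow, map_ofNat, onDiskHom_z, onDiskHom_lift_X]
      ring
    · rw [discOrd, hj, disc_eq]
      simp only [map_add, map_sub, map_mul, map_pow, map_ofNat, onDiskHom_z, onDiskHom_lift_X]
      ring
    · have hn : n ≠ 0 := by
        rintro rfl
        exact h rfl
      simp [hx.1, hn]
    · have hn : n ≠ 0 := by
        rintro rfl
        exact h rfl
      simp [hx.1, hn, map_ofNat]
    · rcases eq_or_ne n 0 with rfl | hn
      · simp only [pow_zero, one_mul, map_add, map_sub, map_mul, map_pow, map_ofNat,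
          PowerSeries.constantCoeff_C, PowerSeries.constantCoeff_X, constantCoeff_onDiskHom]
        intro h
        have : α ^ 2 * (4 * α - x ^ 2) = 0 := by linear_combination h
        rcases mul_eq_zero.1 this with h | h
        · exact h0 (pow_eq_zero_iff two_ne_zero |>.1 h)
        · exact hx.2 (sub_eq_zero.1 h).symm
      · simp [hx.1, hn, map_ofNat, constantCoeff_onDiskHom]
        exact h0
  · refine ⟨z ^ n * (4 * a₄ ^ 3 - 18 * t * a₄ * a₆ + 27 * a₆ ^ 2 * z ^ (n + 2)), ?_⟩
    rw [disc_eq]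
    ring
  · exact ⟨3 * a₄ * z ^ (n + 1), by ring⟩
  · exact ⟨-9 * t * a₄ * z ^ (n + 1) + 27 * a₆ * z ^ (2 * n + 3), by ring⟩
  · refine ⟨z ^ (n + 1) * (4 * a₄ ^ 3 - 18 * t * a₄ * a₆ + 27 * a₆ ^ 2 * z ^ (n + 2)), ?_⟩
    rw [disc_eq]
    ring
  · simpa using mul_lift_X_pow isUnit_one e 1
  · have hu : IsUnit (4 * lift (PowerSeries.X ^ e) * a₆ - a₄ ^ 2) := isUnit_germ_iff.2 (by
      simpa [lift, zero_pow (Nat.one_le_iff_ne_zero.1 he)] using h0)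
    simpa using mul_lift_X_pow hu e 0

theorem quarter_smul {F G : Germ} (h : F = 4 * G) : (1 / 4 : ℂ) • F = G := by
  rw [h, ← map_ofNat (algebraMap ℂ Germ) 4, ← Algebra.smul_def, smul_smul]
  norm_num

theorem half_smul {F G : Germ} (h : F = 2 * G) : (1 / 2 : ℂ) • F = G := by
  rw [h, ← map_ofNat (algebraMap ℂ Germ) 2, ← Algebra.smul_def, smul_smul]
  norm_num

theorem exists_eq_two_mul (F : Germ) : ∃ G, F = 2 * G := by
  refine ⟨(1 / 2 : ℂ) • F, ?_⟩
  rw [← map_ofNat (algebraMap ℂ Germ) 2, ← Algebra.smul_def, smul_smul]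
  norm_num

theorem exists_eq_four_mul (F : Germ) : ∃ G, F = 4 * G := by
  obtain ⟨G, rfl⟩ := exists_eq_two_mul F
  obtain ⟨H, rfl⟩ := exists_eq_two_mul G
  exact ⟨H, by ring⟩

theorem verifiedGeneral_I_odd {n N b c : ℕ} {T' : Kodaira} {k : ℚ}
    {ι : Cartan (A (2 * n + 1)) →ₗ[ℂ] Cartan T'.cover} {ρ : Rep (Cartan (A (2 * n + 1)))}
    {u v w β γ : Germ → Germ} {a κ : Germ}
    (hn : 2 ≤ n) (hN : N ≤ 3 * n) (hu : ∀ t, u t = β t + a * z)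
    (h : ∀ t, 4 * u t * w t - v t ^ 2 = z * (γ t + κ * z))
    (hsp : HasSpecialType ⟨u (lift PowerSeries.X), v (lift PowerSeries.X) * z ^ n,
      w (lift PowerSeries.X) * z ^ (2 * n)⟩ T')
    (hbr : BranchingRule (fun _ : Fin 1 => I (2 * n + 1)) T' (assemble fun _ => ι)
      (on (fun _ : Fin 1 => I (2 * n + 1)) 0 ρ))
    (hbal : IsBalanced (fun _ : Fin 1 => I (2 * n + 1)) k (on (fun _ : Fin 1 => I (2 * n + 1)) 0 ρ)
      (fun _ => (b : ℤ)) (fun _ => (c : ℤ)) 0)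
    (hβ : ∀ e, 1 ≤ e → ∃ u, IsUnit u ∧
      atZero (β (lift (PowerSeries.X ^ e))) = u * (PowerSeries.X ^ e) ^ b)
    (hγ : ∀ e, 1 ≤ e → ∃ u, IsUnit u ∧
      atZero (γ (lift (PowerSeries.X ^ e))) = u * (PowerSeries.X ^ e) ^ c) :
    VerifiedGeneral (I (2 * n + 1)) T' (fun t => ⟨u t, v t * z ^ n, w t * z ^ (2 * n)⟩)
      (fun t => u t ^ 2 * (γ t + κ * z) * z ^ (2 * n + 1)) N β γ k ι ρ := by
  have hd (t : Germ) : (⟨u t, v t * z ^ n, w t * z ^ (2 * n)⟩ : Weierstrass).disc =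
      u t ^ 2 * (γ t + κ * z) * z ^ (2 * n + 1) + z ^ (3 * n) *
        (4 * v t ^ 3 - 18 * u t * v t * w t + 27 * w t ^ 2 * z ^ n) := by
    rw [pow_mul', disc_scaled, h]
    ring
  refine verifiedGeneral_I (b := b) (c := c) (by omega) hsp hbr hbal (fun t => ?_) (fun t => ?_)
    (fun t => ?_) (fun t => ?_) hβ hγ
  · rw [hd, add_sub_cancel_left]
    exact (pow_dvd_pow z hN).mul_right _
  · refine ⟨3 * v t * z ^ (n - 1) - 2 * β t * a - a ^ 2 * z, ?_⟩
    rw [hu, pow_eq_mul (show 1 ≤ n by omega)]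
    ring
  · refine ⟨2 * (3 * β t ^ 2 * a + 3 * β t * a ^ 2 * z + a ^ 3 * z ^ 2) -
      9 * u t * v t * z ^ (n - 1) + 27 * w t * z ^ (2 * n - 1), ?_⟩
    rw [pow_eq_mul (show 1 ≤ n by omega), pow_eq_mul (show 1 ≤ 2 * n by omega), hu]
    ring
  · refine ⟨κ * (β t + a * z) ^ 2 + γ t * (2 * β t * a + a ^ 2 * z) + z ^ (n - 2) *
      (4 * v t ^ 3 - 18 * u t * v t * w t + 27 * w t ^ 2 * z ^ n), ?_⟩
    rw [hd, pow_eq_mul (show 2 * n + 2 ≤ 3 * n by omega), show 3 * n - (2 * n + 2) = n - 2 by omega,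
      pow_add z (2 * n) 2, pow_succ z (2 * n)]
    rw [hu]
    ring

theorem verified_I_odd (n : ℕ) (ν ξ a₂ a₄ a₆ : Germ) (hn : 4 ≤ n) (hν : IsUnit ν)
    (hθ : IsUnit (ξ ^ 2 * a₂ - ν * ξ * a₄ + ν ^ 2 * a₆)) :
    VerifiedGeneral (I (2 * n + 1)) (Istar (2 * n - 2))
      (fun t => ⟨(1 / 4 : ℂ) • (t * ν ^ 2) + a₂ * z,
        ((1 / 2 : ℂ) • (t * ν * ξ) + a₄ * z) * z ^ n,
        ((1 / 4 : ℂ) • (t * ξ ^ 2) + a₆ * z) * z ^ (2 * n)⟩)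
      (fun t => ((1 / 4 : ℂ) • (t * ν ^ 2) + a₂ * z) ^ 2 *
        (t * (ξ ^ 2 * a₂ - ν * ξ * a₄ + ν ^ 2 * a₆) + (4 * a₂ * a₆ - a₄ ^ 2) * z) *
          z ^ (2 * n + 1)) (2 * n + 4)
      (fun t => (1 / 4 : ℂ) • (t * ν ^ 2))
      (fun t => t * (ξ ^ 2 * a₂ - ν * ξ * a₄ + ν ^ 2 * a₆))
      2 (embAD (2 * n + 1) (2 * n - 2 + 4)) ((2 : ℚ) • fundA (2 * n + 1) + extA (2 * n + 1) 2) := by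
  obtain ⟨n, rfl⟩ := Nat.exists_eq_add_of_le' hn
  obtain ⟨ν, rfl⟩ := exists_eq_two_mul ν
  obtain ⟨ξ, rfl⟩ := exists_eq_two_mul ξ
  have e1 (t : Germ) : (1 / 4 : ℂ) • (t * (2 * ν) ^ 2) = t * ν ^ 2 := quarter_smul (by ring)
  have e2 (t : Germ) : (1 / 2 : ℂ) • (t * (2 * ν) * (2 * ξ)) = 2 * t * ν * ξ :=
    half_smul (by ring)
  have e3 (t : Germ) : (1 / 4 : ℂ) • (t * (2 * ξ) ^ 2) = t * ξ ^ 2 := quarter_smul (by ring)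
  simp only [e1, e2, e3]
  have hν' : IsUnit ν := isUnit_of_mul_isUnit_right hν
  have h0 := isUnit_germ_iff.1 hν'
  have hθ0 := isUnit_germ_iff.1 hθ
  have hj : 6 + (2 * (n + 4) - 2) = 2 * n + 12 := by omega
  refine verifiedGeneral_I_odd (b := 1) (c := 1) (u := fun t => t * ν ^ 2 + a₂ * z)
    (v := fun t => 2 * t * ν * ξ + a₄ * z) (w := fun t => t * ξ ^ 2 + a₆ * z)
    (κ := 4 * a₂ * a₆ - a₄ ^ 2) (by omega) (by omega) (fun t => rfl) (fun t => by ring) ?_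
    (branching_A_D_succ _ _ (by omega)) (balanced_I_fund_extA (by omega)) (fun e _ => ?_)
    (fun e _ => ?_)
  · have hS := (finite_linear (pow_ne_zero 2 h0)
      (PowerSeries.constantCoeff (PowerSeries.constantCoeff a₂))).union
      (finite_linear hθ0 (PowerSeries.constantCoeff
        (PowerSeries.constantCoeff (4 * a₂ * a₆ - a₄ ^ 2))))
    refine hasSpecialType_of_finite hS fun x hx => ?_
    rw [Set.mem_union, Set.mem_ofPred_eq, Set.mem_ofPred_eq, not_or] at hx
    obtain ⟨hx1, hx2⟩ := hx
    set C := PowerSeries.C x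
    set p := C * onDiskHom x ν ^ 2 + onDiskHom x a₂ with hp
    set q := 2 * C * onDiskHom x ν * onDiskHom x ξ + onDiskHom x a₄ with hq
    set r := C * onDiskHom x ξ ^ 2 + onDiskHom x a₆ with hr
    have hp0 : PowerSeries.constantCoeff p ≠ 0 := by
      rw [hp, mul_comm]
      simpa [C, constantCoeff_onDiskHom] using hx1
    have hpqr : PowerSeries.constantCoeff (4 * p * r - q ^ 2) ≠ 0 := by
      have : 4 * p * r - q ^ 2 = onDiskHom x ((2 * ξ) ^ 2 * a₂ - 2 * ν * (2 * ξ) * a₄ +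
          (2 * ν) ^ 2 * a₆) * C + onDiskHom x (4 * a₂ * a₆ - a₄ ^ 2) := by
        rw [hp, hq, hr]
        simp only [map_add, map_sub, map_mul, map_pow, map_ofNat]
        ring
      rw [this, map_add, map_mul, constantCoeff_onDiskHom, constantCoeff_onDiskHom,
        PowerSeries.constantCoeff_C]
      exact hx2
    obtain ⟨d, hd⟩ : ∃ d, d = 4 * p * r - q ^ 2 := ⟨_, rfl⟩
    rw [← hd] at hpqr
    have hu : onDiskHom x (lift PowerSeries.X * ν ^ 2 + a₂ * z) = PowerSeries.X * p := by
      simp only [map_add, map_mul, map_pow, onDiskHom_z, onDiskHom_lift_X, hp]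
      ring
    have hv : onDiskHom x (2 * lift PowerSeries.X * ν * ξ + a₄ * z) = PowerSeries.X * q := by
      simp only [map_add, map_mul, map_ofNat, onDiskHom_z, onDiskHom_lift_X, hq]
      ring
    have hw : onDiskHom x (lift PowerSeries.X * ξ ^ 2 + a₆ * z) = PowerSeries.X * r := by
      simp only [map_add, map_mul, map_pow, onDiskHom_z, onDiskHom_lift_X, hr]
      ring
    generalize lift PowerSeries.X * ν ^ 2 + a₂ * z = u at hu ⊢
    generalize 2 * lift PowerSeries.X * ν * ξ + a₄ * z = v at hv ⊢
    generalize lift PowerSeries.X * ξ ^ 2 + a₆ * z = w at hw ⊢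
    refine hasTypeOnDisk_of
      (f := 3 * q * PowerSeries.X ^ (n + 3) - p ^ 2)
      (g := 2 * p ^ 3 - 9 * p * q * PowerSeries.X ^ (n + 3) +
        27 * r * PowerSeries.X ^ (2 * n + 6))
      (δ := p ^ 2 * d + PowerSeries.X ^ (n + 3) * (4 * q ^ 3 - 18 * p * q * r) +
        27 * r ^ 2 * PowerSeries.X ^ (2 * n + 6)) ?_ ?_ ?_ (fun h => ?_) (fun h => ?_) ?_
    · simp only [fOrd, map_sub, map_mul, map_pow, map_ofNat, hu, hv, onDiskHom_z]
      ring
    · simp only [gOrd, map_add, map_sub, map_mul, map_pow, map_ofNat, hu, hv, hw, onDiskHom_z]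
      ring
    · rw [discOrd, hj, disc_eq]
      simp only [map_add, map_sub, map_mul, map_pow, map_ofNat, hu, hv, hw, onDiskHom_z]
      rw [hd]
      ring
    · simp [hp0]
    · simp [hp0, map_ofNat]
    · simp [hp0, hpqr]
  · simpa only [pow_one, mul_comm] using mul_lift_X_pow (hν'.pow 2) e 1
  · simpa only [pow_one, mul_comm] using mul_lift_X_pow hθ e 1

theorem verified_I_odd' (n : ℕ) (μ ξ a₂ a₄ a₆ : Germ) (hn : 3 ≤ n) (hμ : IsUnit μ) (hξ : IsUnit ξ)
    (ha : IsUnit a₂) : VerifiedGeneral (I (2 * n + 1)) (Istar (2 * n - 3))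
      (fun t => ⟨(1 / 4 : ℂ) • (μ * t ^ 2) + a₂ * z,
        ((1 / 2 : ℂ) • (μ * t * ξ) + a₄ * z) * z ^ n,
        ((1 / 4 : ℂ) • (μ * ξ ^ 2) + a₆ * z) * z ^ (2 * n)⟩)
      (fun t => ((1 / 4 : ℂ) • (μ * t ^ 2) + a₂ * z) ^ 2 *
        (μ * (ξ ^ 2 * a₂ - t * ξ * a₄ + t ^ 2 * a₆) + (4 * a₂ * a₆ - a₄ ^ 2) * z) *
          z ^ (2 * n + 1)) (2 * n + 3)
      (fun t => (1 / 4 : ℂ) • (μ * t ^ 2))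
      (fun t => μ * (ξ ^ 2 * a₂ - t * ξ * a₄ + t ^ 2 * a₆))
      1 (embAD (2 * n + 1) (2 * n - 3 + 4)) (extA (2 * n + 1) 2) := by
  obtain ⟨n, rfl⟩ := Nat.exists_eq_add_of_le' hn
  obtain ⟨μ, rfl⟩ := exists_eq_four_mul μ
  have e1 (t : Germ) : (1 / 4 : ℂ) • (4 * μ * t ^ 2) = μ * t ^ 2 := quarter_smul (by ring)
  have e2 (t : Germ) : (1 / 2 : ℂ) • (4 * μ * t * ξ) = 2 * μ * t * ξ := half_smul (by ring)
  simp only [e1, e2]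
  have hμ' : IsUnit μ := isUnit_of_mul_isUnit_right hμ
  have ha0 := isUnit_germ_iff.1 ha
  have hμ0 := isUnit_germ_iff.1 hμ'
  have hξ0 := isUnit_germ_iff.1 hξ
  have hj : 6 + (2 * (n + 3) - 3) = 2 * n + 9 := by omega
  refine verifiedGeneral_I_odd (b := 2) (c := 0) (u := fun t => μ * t ^ 2 + a₂ * z)
    (v := fun t => 2 * μ * t * ξ + a₄ * z) (w := fun _ => μ * ξ ^ 2 + a₆ * z)
    (κ := 4 * a₂ * a₆ - a₄ ^ 2) (by omega) (by omega) (fun t => rfl) (fun t => by ring) ?_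
    (branching_A_D _ _ (by omega)) (balanced_I_extA (by omega)) (fun e _ => ?_)
    (fun e he => ?_)
  · refine hasSpecialType_of_finite Set.finite_empty fun x _ => ?_
    set C := PowerSeries.C x
    set p := onDiskHom x μ * C ^ 2 * PowerSeries.X + onDiskHom x a₂ with hp
    set q := 2 * onDiskHom x μ * C * onDiskHom x ξ + onDiskHom x a₄ with hq
    set r := onDiskHom x μ * onDiskHom x ξ ^ 2 + PowerSeries.X * onDiskHom x a₆ with hr
    have hp0 : PowerSeries.constantCoeff p ≠ 0 := by
      simpa [hp, constantCoeff_onDiskHom] using ha0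
    have hr0 : PowerSeries.constantCoeff r ≠ 0 := by
      simpa [hr, constantCoeff_onDiskHom] using And.intro hμ0 hξ0
    have hu : onDiskHom x (μ * lift PowerSeries.X ^ 2 + a₂ * z) = PowerSeries.X * p := by
      simp only [map_add, map_mul, map_pow, onDiskHom_z, onDiskHom_lift_X, hp]
      ring
    have hv : onDiskHom x (2 * μ * lift PowerSeries.X * ξ + a₄ * z) = PowerSeries.X * q := by
      simp only [map_add, map_mul, map_ofNat, onDiskHom_z, onDiskHom_lift_X, hq]
      ring
    have hw : onDiskHom x (μ * ξ ^ 2 + a₆ * z) = r := by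
      simp only [map_add, map_mul, map_pow, onDiskHom_z, hr]
      ring
    generalize μ * lift PowerSeries.X ^ 2 + a₂ * z = u at hu ⊢
    generalize 2 * μ * lift PowerSeries.X * ξ + a₄ * z = v at hv ⊢
    generalize μ * ξ ^ 2 + a₆ * z = w at hw ⊢
    refine hasTypeOnDisk_of
      (f := 3 * q * PowerSeries.X ^ (n + 2) - p ^ 2)
      (g := 2 * p ^ 3 - 9 * p * q * PowerSeries.X ^ (n + 2) +
        27 * r * PowerSeries.X ^ (2 * n + 3))
      (δ := p ^ 2 * (4 * p * r - PowerSeries.X * q ^ 2) + PowerSeries.X ^ (n + 2) *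
        (4 * q ^ 3 * PowerSeries.X - 18 * p * q * r) +
        27 * r ^ 2 * PowerSeries.X ^ (2 * n + 3)) ?_ ?_ ?_ (fun h => ?_) (fun h => ?_) ?_
    · simp only [fOrd, map_sub, map_mul, map_pow, map_ofNat, hu, hv, onDiskHom_z]
      ring
    · simp only [gOrd, map_add, map_sub, map_mul, map_pow, map_ofNat, hu, hv, hw, onDiskHom_z]
      ring
    · rw [discOrd, hj, disc_eq]
      simp only [map_add, map_sub, map_mul, map_pow, map_ofNat, hu, hv, hw, onDiskHom_z]
      ring
    · simp [hp0]
    · simp [hp0, map_ofNat]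
    · simp [hp0, hr0, map_ofNat]
  · exact mul_lift_X_pow hμ' e 2
  · have hu : IsUnit (ξ ^ 2 * a₂ - lift (PowerSeries.X ^ e) * ξ * a₄ +
        lift (PowerSeries.X ^ e) ^ 2 * a₆) := isUnit_germ_iff.2 (by
      simpa [lift, zero_pow (Nat.one_le_iff_ne_zero.1 he)] using And.intro hξ0 ha0)
    simpa using mul_lift_X_pow (hμ.mul hu) e 0

/-! ### `I_j^* → I_{j+1}^*` -/

theorem disc_Istar_succ {m : ℕ} (a c h t : Germ) (hm : 7 ≤ m) :
    ∃ K, (⟨a * z, 2 * a * c * z ^ ((m - 1) / 2 + 1),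
      a * c ^ 2 * z ^ (2 * ((m - 1) / 2) + 1) + t * z ^ (m - 1) + h * z ^ m⟩ : Weierstrass).disc =
        z ^ (m + 2) * (4 * a ^ 3 * t + z * K) := by
  have h3 : (z ^ ((m - 1) / 2)) ^ 3 = z ^ (m - 1) * z * z ^ ((m - 1) / 2 * 3 - m) := by
    rw [← pow_mul, pow_eq_mul (show m ≤ (m - 1) / 2 * 3 by omega), ← pow_succ,
      Nat.sub_add_cancel (by omega)]
  have h4 : (z ^ ((m - 1) / 2)) ^ 4 = z ^ (m - 1) * z ^ 2 * z ^ ((m - 1) / 2 * 4 - (m + 1)) := by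
    rw [← pow_mul, pow_eq_mul (show m + 1 ≤ (m - 1) / 2 * 4 by omega),
      show z ^ (m + 1) = z ^ (m - 1) * z ^ 2 by rw [← pow_add, show m - 1 + 2 = m + 1 by omega]]
  have hy : z ^ ((m - 1) / 2) = z ^ 2 * z ^ ((m - 1) / 2 - 2) := pow_eq_mul (by omega)
  have hp : z ^ (m - 1) = z ^ 4 * z ^ (m - 5) := by
    rw [pow_eq_mul (show 4 ≤ m - 1 by omega), Nat.sub_sub]
  rw [disc_eq, pow_succ z (2 * _), pow_mul', pow_succ z ((m - 1) / 2),
    show z ^ m = z ^ (m - 1) * z by rw [← pow_succ, Nat.sub_add_cancel (by omega)],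
    show z ^ (m + 2) = z ^ (m - 1) * z ^ 3 by rw [← pow_add, show m - 1 + 3 = m + 2 by omega]]
  generalize z ^ ((m - 1) / 2 * 3 - m) = Q at *
  generalize z ^ ((m - 1) / 2 * 4 - (m + 1)) = R at *
  generalize z ^ ((m - 1) / 2 - 2) = y' at *
  generalize z ^ ((m - 1) / 2) = y at *
  generalize z ^ (m - 5) = p' at *
  generalize z ^ (m - 1) = p at *
  refine ⟨4 * a ^ 3 * h - 4 * a ^ 3 * c ^ 3 * Q - 36 * a ^ 2 * c * y' * (t + h * z) +
    27 * (a ^ 2 * c ^ 4 * R + 2 * a * c ^ 2 * (z * y' ^ 2) * (t + h * z) +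
      p' * (t + h * z) ^ 2), ?_⟩
  linear_combination (-4 * a ^ 3 * c ^ 3 * z ^ 3) * h3 -
    36 * a ^ 2 * c * z ^ 2 * (t + h * z) * p * hy + 27 * a ^ 2 * c ^ 4 * z ^ 2 * h4 +
    54 * a * c ^ 2 * z * (t + h * z) * p * (y + z ^ 2 * y') * hy +
    27 * (t + h * z) ^ 2 * p * hp

theorem verified_Istar_succ (m : ℕ) (a₂ c h : Germ) (hm : 7 ≤ m) (ha : IsUnit a₂) :
    VerifiedGeneral (Istar (m - 4)) (Istar (m - 3))
      (fun t => ⟨a₂ * z, 2 * a₂ * c * z ^ ((m - 1) / 2 + 1),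
        a₂ * c ^ 2 * z ^ (2 * ((m - 1) / 2) + 1) + t * z ^ (m - 1) + h * z ^ m⟩)
      (fun t => 4 * a₂ ^ 3 * t * z ^ (m + 2)) (m + 3)
      (fun t => if m % 2 = 1 then 4 * t else -4 * a₂ * t) (fun _ => a₂)
      2 (embDD (m - 4 + 4) (m - 3 + 4)) (vectD (m - 4 + 4)) := by
  have hy : z ^ ((m - 1) / 2 + 1) = z ^ 3 * z ^ ((m - 1) / 2 - 2) := by
    rw [pow_eq_mul (show 3 ≤ (m - 1) / 2 + 1 by omega),
      show (m - 1) / 2 + 1 - 3 = (m - 1) / 2 - 2 by omega]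
  have hY : z ^ (2 * ((m - 1) / 2) + 1) = z ^ 4 * z ^ (2 * ((m - 1) / 2) - 3) := by
    rw [pow_eq_mul (show 4 ≤ 2 * ((m - 1) / 2) + 1 by omega),
      show 2 * ((m - 1) / 2) + 1 - 4 = 2 * ((m - 1) / 2) - 3 by omega]
  have hp : z ^ (m - 1) = z ^ 4 * z ^ (m - 5) := by
    rw [pow_eq_mul (show 4 ≤ m - 1 by omega), Nat.sub_sub]
  have hz : z ^ m = z ^ 4 * z ^ (m - 4) := pow_eq_mul (by omega)
  have ef : 3 * (2 * a₂ * c * z ^ ((m - 1) / 2 + 1)) - (a₂ * z) ^ 2 =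
      z ^ 2 * (-a₂ ^ 2 + z * (6 * a₂ * c * z ^ ((m - 1) / 2 - 2))) := by
    rw [hy]
    ring
  have eg (t : Germ) : ∃ H, 2 * (a₂ * z) ^ 3 - 9 * (a₂ * z) * (2 * a₂ * c * z ^ ((m - 1) / 2 + 1)) +
      27 * (a₂ * c ^ 2 * z ^ (2 * ((m - 1) / 2) + 1) + t * z ^ (m - 1) + h * z ^ m) =
      z ^ 3 * (2 * a₂ ^ 3 + z * H) := by
    rw [hy, hY, hp, hz]
    refine ⟨-18 * a₂ ^ 2 * c * z ^ ((m - 1) / 2 - 2) + 27 * (a₂ * c ^ 2 *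
      z ^ (2 * ((m - 1) / 2) - 3) + t * z ^ (m - 5) + h * z ^ (m - 4)), ?_⟩
    ring
  have hd (t : Germ) := disc_Istar_succ a₂ c h t hm
  have h0 := isUnit_germ_iff.1 ha
  have hj : 6 + (m - 4) = m + 2 := by omega
  have hj' : 6 + (m - 3) = m + 3 := by omega
  have hpar : (m - 4) % 2 = m % 2 := by omega
  refine verifiedGeneral_Istar (b := 1) (c := 0) (by omega) ?_
    (branching_D_succ (m - 4) (m - 3) (by omega)) (balanced_Istar_vect (m - 4))
    (fun t => ?_) (fun t => ?_) (fun t => eg t) (fun t => ?_) (fun e _ => ?_) (fun e _ => ?_)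
  · obtain ⟨K, hK⟩ := hd (lift PowerSeries.X)
    obtain ⟨H, hH⟩ := eg (lift PowerSeries.X)
    refine hasSpecialType_of_finite (finite_linear (α := 4 * _ ^ 3)
      (mul_ne_zero (by norm_num) (pow_ne_zero 3 h0))
      (PowerSeries.constantCoeff (PowerSeries.constantCoeff K))) fun x hx => ?_
    refine hasTypeOnDisk_of
      (f := onDiskHom x (-a₂ ^ 2 + z * (6 * a₂ * c * z ^ ((m - 1) / 2 - 2))))
      (g := onDiskHom x (2 * a₂ ^ 3 + z * H))
      (δ := 4 * onDiskHom x a₂ ^ 3 * PowerSeries.C x + onDiskHom x K) ?_ ?_ ?_ (fun _ => ?_)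
      (fun _ => ?_) ?_
    · rw [ef, fOrd, map_mul, map_pow, onDiskHom_z]
    · rw [hH, gOrd, map_mul, map_pow, onDiskHom_z]
    · rw [hK, discOrd, hj']
      simp only [map_add, map_mul, map_pow, map_ofNat, onDiskHom_z, onDiskHom_lift_X]
      ring
    · simp [onDiskHom_z, constantCoeff_onDiskHom, h0]
    · simp [onDiskHom_z, constantCoeff_onDiskHom, h0, map_ofNat]
    · simpa [constantCoeff_onDiskHom, map_ofNat] using hx
  · obtain ⟨K, hK⟩ := hd t
    exact ⟨K, by rw [hK]; ring⟩
  · exact ⟨_, ef⟩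
  · obtain ⟨K, hK⟩ := hd t
    refine ⟨K, ?_⟩
    rw [hK, hj, hpar]
    split_ifs <;> ring
  · split_ifs
    · simpa using mul_lift_X_pow isUnit_four e 1
    · simpa using mul_lift_X_pow (isUnit_four.neg.mul ha) e 1
  · simpa using mul_lift_X_pow ha e 0

/-! ### Characters of `𝔰𝔭(n)` -/

theorem sum_axisVectors_two {M : Type*} [AddCommMonoid M] (n : ℕ) (f : (Fin n → ℚ) → M) :
    ∑ v ∈ axisVectors n 2, f v = ∑ i : Fin n, (f (ε i + ε i) + f (-ε i + -ε i)) := by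
  have h2 (i : Fin n) : (ε i + ε i : Fin n → ℚ) = (2 : ℚ) • ε i := by module
  have h2' (i : Fin n) : (-ε i + -ε i : Fin n → ℚ) = (-2 : ℚ) • ε i := by module
  simp only [h2, h2']
  exact sum_axisVectors_smul n two_pos f

theorem sum_signedε {M : Type*} [AddCommMonoid M] (n : ℕ) (f : (Fin n → ℚ) → M) :
    ∑ p : Fin n × Bool, f (signedε p) = ∑ i : Fin n, (f (ε i) + f (-ε i)) := by
  rw [Fintype.sum_prod_type]
  refine Finset.sum_congr rfl fun i _ => ?_
  rw [Fintype.sum_bool, add_comm]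
  rfl

theorem fundC_eq_epsD (n : ℕ) : fundC n = epsD n + conj (epsD n) := by
  rw [fundC_eq, sum_signedε n fun v => (AddMonoidAlgebra.single (wt (C n) v) 1 : Rep (Cartan (C n))),
    Finset.sum_add_distrib, epsD, conj_sum]
  simp only [wt_neg (C n), conj_single]
  rfl

theorem conj_extC (n k : ℕ) : conj (extC n k) = extC n k := by
  rw [extC, conj_sum]
  refine Finset.sum_nbij' (fun s => s.map ((Equiv.refl _).prodCongr Equiv.boolNot).toEmbedding)
    (fun s => s.map ((Equiv.refl _).prodCongr Equiv.boolNot).toEmbedding) ?_ ?_ ?_ ?_ ?_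
  · simp [Finset.mem_powersetCard]
  · simp [Finset.mem_powersetCard]
  · intro s _
    ext ⟨i, b⟩
    simp
  · intro s _
    ext ⟨i, b⟩
    simp
  · intro s _
    rw [conj_single, Finset.sum_map, ← wt_neg (C n), ← Finset.sum_neg_distrib]
    congr 2
    refine Finset.sum_congr rfl fun p _ => ?_
    rcases p with ⟨i, b | b⟩ <;> simp

theorem adj_C (n : ℕ) : adj (C n) = fundC n ^ 2 - extC n 2 := by
  have hdisj : Disjoint (rootsD n) (axisVectors n 2) := by
    rw [Finset.disjoint_left]
    intro v hv h
    have hv := dotProduct_rootsD hv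
    simp only [axisVectors, Finset.mem_union, Finset.mem_image, Finset.mem_univ, true_and] at h
    rcases h with ⟨i, rfl⟩ | ⟨i, rfl⟩ <;> simp [ε] at hv
  have hD : (∑ v ∈ rootsD n, AddMonoidAlgebra.single (wt (C n) v) 1 : Rep (Cartan (C n))) = _ :=
    ofWeights_rootsD n
  obtain ⟨E, hE⟩ : ∃ E : Rep (Cartan (C n)), E = epsD n := ⟨_, rfl⟩
  obtain ⟨L, hL⟩ : ∃ L : Rep (Cartan (C n)), L = extD n := ⟨_, rfl⟩
  obtain ⟨S, hS⟩ : ∃ S : Rep (Cartan (C n)),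
    S = ∑ i : Fin n, AddMonoidAlgebra.single (wt (C n) (ε i) + wt (C n) (ε i)) 1 := ⟨_, rfl⟩
  have hf : fundC n = E + conj E := hE ▸ fundC_eq_epsD n
  have h2 := two_smul_extC n
  rw [sum_signedε n fun v => (AddMonoidAlgebra.single (wt (C n) v + wt (C n) v) 1 :
    Rep (Cartan (C n))), Finset.sum_add_distrib, two_smul] at h2
  have hS' : conj S =
      ∑ i : Fin n, AddMonoidAlgebra.single (wt (C n) (-ε i) + wt (C n) (-ε i)) 1 := by
    rw [hS, conj_sum]
    simp only [conj_single, wt_neg (C n), neg_add]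
  have hL2 : (2 : ℚ) • L = E ^ 2 - S := by
    rw [hL, hE, hS]
    exact two_smul_extD n
  have hL2' := congrArg conj hL2
  rw [conj_smul, conj_sub, sq, conj_mul] at hL2'
  rw [two_smul] at hL2 hL2'
  have key : (2 : ℚ) • adj (C n) = (2 : ℚ) • (fundC n ^ 2 - extC n 2) := by
    rw [adj, ofWeights, show GaugeAlg.roots (C n) = rootsD n ∪ axisVectors n 2 from rfl,
      Finset.sum_union hdisj, hD, sum_axisVectors_two, Finset.sum_add_distrib]
    simp only [wt_add (C n), ← hS, ← hS']
    rw [← hE, ← hL]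
    rw [← hS, ← hS', hf] at h2
    rw [hf, two_smul, two_smul]
    change (n : ℚ) • 1 + _ + ((n : ℚ) • 1 + _) = _
    linear_combination hL2 + hL2' + h2
  exact smul_right_injective _ (two_ne_zero : (2 : ℚ) ≠ 0) key

theorem rhoZero_I_even {m : ℕ} (hm : m % 2 = 0) (h0 : m ≠ 0) :
    rhoZero (I m) = extC (m / 2) 2 - 1 := by
  have hc : conj (fundC (m / 2)) = fundC (m / 2) := conj_extC _ 1
  have hr : ((GaugeAlg.rank (A m) : ℕ) : ℚ) = m - 1 := by
    rw [GaugeAlg.rank, Nat.cast_sub (Nat.one_le_iff_ne_zero.2 h0), Nat.cast_one]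
  change pull (foldA m) (adj (A m)) - adj (C (m / 2)) = _
  rw [adj, ofWeights_rootsA, hr, pull_add, pull_sub, pull_mul, pull_conj, pull_fundA_even hm, hc,
    pull_smul, pull_smul, pull_one, adj_C]
  rw [sub_smul, one_smul]
  ring

theorem restrictTo_matter_one (T : Kodaira) (s : Fin 1 → Bool) (k : ℚ) (χ : Rep (Cartan T.cover)) :
    restrictTo (fun _ : Fin 1 => T) s 0
      (matter (fun _ : Fin 1 => T) s k (on (fun _ : Fin 1 => T) 0 χ)) =
        k⁻¹ • pull (foldMap T (s 0)) χ := by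
  rw [restrictTo, matter, pull_smul, pull_pull, pull_on]
  rfl

theorem coeff_extC (n k : ℕ) (v : Fin n → ℚ) : (extC n k).coeff (wt (C n) v) =
    (((Finset.univ : Finset (Fin n × Bool)).powersetCard k).filter
      fun s => ∑ p ∈ s, signedε p = v).card := by
  have hinj (v v' : Fin n → ℚ) : wt (C n) v = wt (C n) v' ↔ v = v' := by
    refine ⟨fun h => funext fun i => ?_, fun h => h ▸ rfl⟩
    have := LinearMap.congr_fun h ⟨Pi.single i 1, Submodule.mem_top⟩
    simpa [wt_apply (C n), Pi.single_apply] using this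
  rw [extC, AddMonoidAlgebra.coeff_sum, Finset.sum_apply', Finset.card_filter, Nat.cast_sum]
  refine Finset.sum_congr rfl fun s _ => ?_
  classical
  rw [AddMonoidAlgebra.coeff_single, Finsupp.single_apply]
  simp only [hinj]
  push_cast
  rfl

theorem card_weights (k : ℕ) (hk : k ≤ 4) :
    (((Finset.univ : Finset (Fin 4 × Bool)).powersetCard k).filter
      fun s => ∑ p ∈ s, signedε p = fun _ => 1).card = if k = 4 then 1 else 0 := by
  interval_cases k <;> decide +kernel

theorem extIrrC_two (n : ℕ) : extIrrC n 2 = extC n 2 - 1 := by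
  rw [extIrrC, Nat.sub_self, extC_zero]

theorem rhoZero_I8 : rhoZero (I 8) = extIrrC 4 2 := by
  rw [extIrrC_two]
  exact rhoZero_I_even (m := 8) rfl (by norm_num)

theorem matter_I8_first : restrictTo (fun _ : Fin 1 => I 8) (fun _ => false) 0
    (matter (fun _ : Fin 1 => I 8) (fun _ => false) 2 (on (fun _ : Fin 1 => I 8) 0
      (fundA 8 + extA 8 2 + extA 8 3))) =
    (1 / 2 : ℚ) • 1 + (1 / 2 : ℚ) • rhoZero (I 8) + fundC 4 + (1 / 2 : ℚ) • extIrrC 4 3 := by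
  have h2 : pull (foldMap (I 8) false) (extA 8 2) = extC 4 2 := pull_extA_foldA rfl 2
  have h3 : pull (foldMap (I 8) false) (extA 8 3) = extC 4 3 := pull_extA_foldA rfl 3
  have h1 : pull (foldMap (I 8) false) (fundA 8) = fundC 4 := pull_extA_foldA rfl 1
  have e : extIrrC 4 3 = extC 4 3 - fundC 4 := rfl
  rw [restrictTo_matter_one, pull_add, pull_add, h1, h2, h3, rhoZero_I8, extIrrC_two, e]
  module

theorem matter_I8_second : restrictTo (fun _ : Fin 1 => I 8) (fun _ => false) 0
    (matter (fun _ : Fin 1 => I 8) (fun _ => false) 2 (on (fun _ : Fin 1 => I 8) 0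
      (1 + (2 : ℚ) • extA 8 2 + (1 / 2 : ℚ) • extA 8 4))) =
    (7 / 4 : ℚ) • 1 + (1 / 2 : ℚ) • rhoZero (I 8) + (3 / 4 : ℚ) • extIrrC 4 2 +
      (1 / 4 : ℚ) • extIrrC 4 4 := by
  have h2 : pull (foldMap (I 8) false) (extA 8 2) = extC 4 2 := pull_extA_foldA rfl 2
  have h4 : pull (foldMap (I 8) false) (extA 8 4) = extC 4 4 := pull_extA_foldA rfl 4
  have h1 : pull (foldMap (I 8) false) (1 : Rep (Cartan (A 8))) = 1 := pull_one _
  have e : extIrrC 4 4 = extC 4 4 - extC 4 2 := rfl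
  rw [restrictTo_matter_one, pull_add, pull_add, pull_smul, pull_smul, h1, h2, h4, rhoZero_I8,
    extIrrC_two, e]
  module

theorem not_isPreQuaternionic_I8 (c : ℚ) : ¬ IsPreQuaternionic
    (restrictTo (fun _ : Fin 1 => I 8) (fun _ => false) 0
      (matter (fun _ : Fin 1 => I 8) (fun _ => false) 2 (on (fun _ : Fin 1 => I 8) 0
        (1 + (2 : ℚ) • extA 8 2 + (1 / 2 : ℚ) • extA 8 4))) - c • 1 -
          (1 / 2 : ℚ) • rhoZero (I 8)) := by
  rintro ⟨V, _, _, _, _, _, hV, -⟩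
  have h := hV (wt (C 4) fun _ => 1)
  have hw (k : ℕ) (hk : k ≤ 4) :
      (extC 4 k).coeff (wt (C 4) fun _ => 1) = if k = 4 then 1 else 0 := by
    rw [coeff_extC, card_weights k hk]
    split_ifs <;> simp
  have e : restrictTo (fun _ : Fin 1 => I 8) (fun _ => false) 0
      (matter (fun _ : Fin 1 => I 8) (fun _ => false) 2 (on (fun _ : Fin 1 => I 8) 0
        (1 + (2 : ℚ) • extA 8 2 + (1 / 2 : ℚ) • extA 8 4))) - c • 1 -
          (1 / 2 : ℚ) • rhoZero (I 8) =
      (1 - c) • extC 4 0 + (1 / 2 : ℚ) • extC 4 2 + (1 / 4 : ℚ) • extC 4 4 := by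
    have e : extIrrC 4 4 = extC 4 4 - extC 4 2 := rfl
    rw [matter_I8_second, e, extIrrC_two, extC_zero]
    module
  rw [e, conj_add, conj_add, conj_smul, conj_smul, conj_smul, conj_extC, conj_extC, conj_extC] at h
  simp only [AddMonoidAlgebra.coeff_add, AddMonoidAlgebra.coeff_smul, Finsupp.add_apply,
    Finsupp.smul_apply, hw _ (Nat.zero_le 4), hw 2 (by norm_num), hw 4 le_rfl] at h
  norm_num at h
  have h2 : ((2 * Module.finrank ℂ (weightSpace V (wt (C 4) fun _ => 1)) : ℕ) : ℚ) = (1 : ℕ) := by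
    push_cast
    rw [h]
    norm_num
  have := Nat.cast_injective h2
  omega

/-! ### Alternating functions -/

section AltForms

variable {K : Type} (d : K → ℕ) (J : Type)

/-- Families of alternating functions of `d κ` variables. -/
def altForms : Submodule ℂ ((κ : K) → (Fin (d κ) → J) → ℂ) where
  carrier := {f | ∀ κ (v : Fin (d κ) → J) (σ : Equiv.Perm (Fin (d κ))),
    f κ (v ∘ σ) = ((Equiv.Perm.sign σ : ℤ) : ℂ) * f κ v}
  add_mem' hf hg κ v σ := by simp [hf κ v σ, hg κ v σ, mul_add]
  zero_mem' κ v σ := by simp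
  smul_mem' c f hf κ v σ := by simp [hf κ v σ, mul_left_comm]

variable {d J}

theorem altForms_apply_of_not_injective {f : (κ : K) → (Fin (d κ) → J) → ℂ}
    (hf : f ∈ altForms d J) {κ : K} {v : Fin (d κ) → J} (hv : ¬ Function.Injective v) :
    f κ v = 0 := by
  simp only [Function.Injective, not_forall] at hv
  obtain ⟨i, j, hij, hne⟩ := hv
  have h := hf κ v (Equiv.swap i j)
  have hs : v ∘ Equiv.swap i j = v := by
    funext l
    simp only [Function.comp_apply, Equiv.swap_apply_def]
    split_ifs with h1 h2
    · rw [h1, hij]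
    · rw [h2, hij]
    · rfl
  rw [hs, Equiv.Perm.sign_swap hne] at h
  simp only [Units.val_neg, Units.val_one, Int.cast_neg, Int.cast_one, neg_mul, one_mul] at h
  exact self_eq_neg.1 h

theorem eq_zero_of_forall_strictMono [LinearOrder J] {f : (κ : K) → (Fin (d κ) → J) → ℂ}
    (hf : f ∈ altForms d J) (h : ∀ κ v, StrictMono v → f κ v = 0) : f = 0 := by
  funext κ v
  by_cases hv : Function.Injective v
  · have h1 := h κ (v ∘ Tuple.sort v)
      ((Tuple.monotone_sort v).strictMono_of_injective (hv.comp (Tuple.sort v).injective))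
    rw [hf] at h1
    exact (mul_eq_zero.1 h1).resolve_left (by simp)
  · exact altForms_apply_of_not_injective hf hv

/-- The alternating family with given values on increasing sequences. -/
def altExtend (G : (κ : K) → (Fin (d κ) → J) → ℂ) (κ : K) (v : Fin (d κ) → J) : ℂ :=
  ∑ σ : Equiv.Perm (Fin (d κ)), ((Equiv.Perm.sign σ : ℤ) : ℂ) * G κ (v ∘ σ)

theorem altExtend_mem (G : (κ : K) → (Fin (d κ) → J) → ℂ) : altExtend G ∈ altForms d J := by
  intro κ v σ
  rw [altExtend, altExtend, Finset.mul_sum]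
  refine ((Equiv.sum_comp (Equiv.mulLeft σ) _).symm.trans
    (Finset.sum_congr rfl fun τ _ => ?_)).symm
  have h : ((Equiv.Perm.sign σ : ℤ) : ℂ) * ((Equiv.Perm.sign σ : ℤ) : ℂ) = 1 := by
    rw [← Int.cast_mul, Int.units_coe_mul_self, Int.cast_one]
  simp only [Equiv.coe_mulLeft, Equiv.Perm.sign_mul, Units.val_mul, Int.cast_mul,
    Equiv.Perm.coe_mul]
  rw [← mul_assoc, ← mul_assoc, h, one_mul]
  rfl

theorem altExtend_apply [LinearOrder J] {G : (κ : K) → (Fin (d κ) → J) → ℂ}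
    (hG : ∀ κ v, ¬ StrictMono v → G κ v = 0) {κ : K} {v : Fin (d κ) → J} (hv : StrictMono v) :
    altExtend G κ v = G κ v := by
  rw [altExtend, Finset.sum_eq_single 1]
  · simp
  · intro σ _ hσ
    rw [hG, mul_zero]
    intro h
    refine hσ (Equiv.ext fun i => ?_)
    have hm : StrictMono σ := fun i j hij => hv.lt_iff_lt.1 (h hij)
    have := Subsingleton.elim (hm.orderIsoOfSurjective _ σ.surjective) (OrderIso.refl _)
    exact congrArg (fun e : Fin (d κ) ≃o Fin (d κ) => e i) this
  · simp

variable [Fintype K] [Fintype J]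

theorem card_orderEmb_filter [LinearOrder J] {W : Type} [AddCommMonoid W] [DecidableEq W]
    (k : ℕ) (ω : J → W) (w : W) :
    Nat.card {p : Fin k ↪o J // ∑ i, ω (p i) = w} =
      (((Finset.univ : Finset J).powersetCard k).filter fun s => ∑ j ∈ s, ω j = w).card := by
  rw [Nat.card_eq_fintype_card, Fintype.card_subtype]
  refine Finset.card_bij (fun p _ => Finset.univ.map p.toEmbedding) ?_ ?_ ?_
  · intro p hp
    simpa [Finset.mem_powersetCard] using hp
  · intro p _ q _ h
    have := congrArg (fun s : Finset J => (s : Set J)) h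
    simp only [Finset.coe_map, Finset.coe_univ, Set.image_univ] at this
    exact OrderEmbedding.range_inj.1 this
  · intro s hs
    simp only [Finset.mem_filter, Finset.mem_powersetCard, Finset.subset_univ, true_and] at hs
    obtain ⟨hs, hw⟩ := hs
    have h : Finset.univ.map (s.orderEmbOfFin hs).toEmbedding = s := by
      refine Finset.coe_injective ?_
      simp
    refine ⟨s.orderEmbOfFin hs, ?_, h⟩
    rw [Finset.mem_filter]
    refine ⟨Finset.mem_univ _, ?_⟩
    refine Eq.trans ?_ hw
    conv_rhs => rw [← h, Finset.sum_map]
    rfl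

theorem finrank_altForms_supported [LinearOrder J] {W : Type} [AddCommMonoid W] [DecidableEq W]
    (ω : J → W) (w : W) (S : Submodule ℂ (altForms d J))
    (hS : ∀ f, f ∈ S ↔ ∀ κ v, f.1 κ v ≠ 0 → ∑ i, ω (v i) = w) :
    Module.finrank ℂ S = ∑ κ, (((Finset.univ : Finset J).powersetCard (d κ)).filter
      fun s => ∑ j ∈ s, ω j = w).card := by
  let Φ : S →ₗ[ℂ] ((p : Σ κ, {p : Fin (d κ) ↪o J // ∑ i, ω (p i) = w}) → ℂ) :=
    { toFun := fun f p => f.1.1 p.1 p.2.1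
      map_add' := fun _ _ => rfl
      map_smul' := fun _ _ => rfl }
  have hΦ : Function.Bijective Φ := by
    constructor
    · rw [injective_iff_map_eq_zero]
      intro f hf
      refine Subtype.ext (Subtype.ext (eq_zero_of_forall_strictMono f.1.2 fun κ v hv => ?_))
      by_contra h
      exact h (congrFun hf ⟨κ, OrderEmbedding.ofStrictMono v hv, (hS f.1).1 f.2 κ v h⟩)
    · intro g
      let e (κ : K) (p : {p : Fin (d κ) ↪o J // ∑ i, ω (p i) = w}) : Fin (d κ) → J := p.1
      have he (κ : K) : Function.Injective (e κ) := fun p q h =>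
        Subtype.ext (DFunLike.coe_injective h)
      let G (κ : K) : (Fin (d κ) → J) → ℂ := Function.extend (e κ) (fun p => g ⟨κ, p⟩) 0
      have hG (κ : K) (v : Fin (d κ) → J) (h : G κ v ≠ 0) : ∃ p, e κ p = v := by
        by_contra hn
        exact h (Function.extend_apply' _ _ _ hn)
      refine ⟨⟨⟨altExtend G, altExtend_mem G⟩, (hS _).2 fun κ v h => ?_⟩, funext fun p => ?_⟩
      · obtain ⟨σ, -, hσ⟩ := Finset.exists_ne_zero_of_sum_ne_zero h
        obtain ⟨p, hp⟩ := hG κ _ (right_ne_zero_of_mul hσ)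
        rw [← p.2, ← Equiv.sum_comp σ]
        exact Finset.sum_congr rfl fun i _ => congrArg ω (congrFun hp i).symm
      · refine (altExtend_apply (fun κ v hv => ?_) p.2.1.strictMono).trans
          ((he p.1).extend_apply _ _ p.2)
        by_contra h
        obtain ⟨p, rfl⟩ := hG κ v h
        exact hv p.1.strictMono
  rw [(LinearEquiv.ofBijective Φ hΦ).finrank_eq, Module.finrank_fintype_fun_eq_card,
    Fintype.card_sigma]
  refine Finset.sum_congr rfl fun κ _ => ?_
  rw [← Nat.card_eq_fintype_card, card_orderEmb_filter]

end AltForms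

/-! ### The action of matrices on alternating functions -/

section Action

variable {K : Type} {d : K → ℕ} {J : Type} [Fintype J]

/-- The action of a matrix, as a derivation, on functions of several variables. -/
def slotSum (X : Matrix J J ℂ) (f : (κ : K) → (Fin (d κ) → J) → ℂ) (κ : K) (v : Fin (d κ) → J) :
    ℂ :=
  ∑ i, ∑ j, X (v i) j * f κ (Function.update v i j)

theorem slotSum_mem (X : Matrix J J ℂ) {f : (κ : K) → (Fin (d κ) → J) → ℂ}
    (hf : f ∈ altForms d J) : slotSum X f ∈ altForms d J := by
  intro κ v σ
  rw [slotSum, slotSum, Finset.mul_sum, ← Equiv.sum_comp σ fun i => _ * ∑ j, _]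
  refine Finset.sum_congr rfl fun i _ => ?_
  rw [Finset.mul_sum]
  refine Finset.sum_congr rfl fun j _ => ?_
  rw [← Function.update_comp_eq_of_injective v σ.injective i j, hf]
  simp only [Function.comp_apply]
  ring

theorem slotSum_lie (X Y : Matrix J J ℂ) (f : (κ : K) → (Fin (d κ) → J) → ℂ) :
    slotSum (X * Y - Y * X) f = slotSum X (slotSum Y f) - slotSum Y (slotSum X f) := by
  funext κ v
  let T (X Y : Matrix J J ℂ) (i i' : Fin (d κ)) : ℂ := ∑ j, ∑ j', X (v i) j *
    (Y (Function.update v i j i') j' * f κ (Function.update (Function.update v i j) i' j'))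
  have hT (X Y : Matrix J J ℂ) : slotSum X (slotSum Y f) κ v = ∑ i, ∑ i', T X Y i i' := by
    refine Finset.sum_congr rfl fun i _ => ?_
    rw [Finset.sum_comm]
    refine Finset.sum_congr rfl fun j _ => ?_
    simp only [slotSum, Finset.mul_sum]
  have hne {i i' : Fin (d κ)} (h : i' ≠ i) : T X Y i i' = T Y X i' i := by
    simp only [T]
    rw [Finset.sum_comm]
    refine Finset.sum_congr rfl fun j _ => Finset.sum_congr rfl fun j' _ => ?_
    rw [Function.update_of_ne h, Function.update_of_ne h.symm, Function.update_comm h]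
    ring
  have heq (X Y : Matrix J J ℂ) (i : Fin (d κ)) :
      T X Y i i = ∑ j, (X * Y) (v i) j * f κ (Function.update v i j) := by
    simp only [T, Function.update_self, Function.update_idem, Matrix.mul_apply, Finset.sum_mul]
    rw [Finset.sum_comm]
    simp only [mul_assoc]
  rw [Pi.sub_apply, Pi.sub_apply, hT, hT, Finset.sum_comm (f := T Y X), ← Finset.sum_sub_distrib,
    slotSum]
  refine Finset.sum_congr rfl fun i _ => ?_
  rw [← Finset.sum_sub_distrib, Finset.sum_eq_single i, heq, heq, ← Finset.sum_sub_distrib]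
  · simp only [Matrix.sub_apply, sub_mul]
  · intro i' _ h
    rw [hne h, sub_self]
  · simp

theorem slotSum_diagonal [DecidableEq J] (δ : J → ℂ) (f : (κ : K) → (Fin (d κ) → J) → ℂ) (κ : K)
    (v : Fin (d κ) → J) : slotSum (Matrix.diagonal δ) f κ v = (∑ i, δ (v i)) * f κ v := by
  rw [slotSum, Finset.sum_mul]
  refine Finset.sum_congr rfl fun i _ => ?_
  rw [Finset.sum_eq_single (v i)]
  · rw [Matrix.diagonal_apply_eq, Function.update_eq_self]
  · intro j _ h
    rw [Matrix.diagonal_apply_ne' _ h, zero_mul]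
  · simp

end Action

/-! ### The invariant form -/

section Form

variable {K : Type} [Fintype K] {d : K → ℕ} {J : Type} [Fintype J]

/-- The bilinear form on functions of several variables that is induced by the monomial matrix with
entries `s a` at `(a, τ a)`. -/
def monomialForm (d : K → ℕ) (s : J → ℂ) (τ : J → J) : LinearMap.BilinForm ℂ (altForms d J) :=
  LinearMap.mk₂ ℂ (fun f g => ∑ κ, ∑ v, (∏ i, s (v i)) * f.1 κ v * g.1 κ (τ ∘ v))
    (fun f f' g => by simp [mul_add, add_mul, Finset.sum_add_distrib])
    (fun c f g => by simp [Finset.mul_sum, mul_assoc, mul_left_comm])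
    (fun f g g' => by simp [mul_add, Finset.sum_add_distrib])
    (fun c f g => by simp [Finset.mul_sum, mul_left_comm])

theorem monomialForm_apply (s : J → ℂ) (τ : J → J) (f g : altForms d J) :
    monomialForm d s τ f g = ∑ κ, ∑ v, (∏ i, s (v i)) * f.1 κ v * g.1 κ (τ ∘ v) := rfl

variable {s : J → ℂ} {τ : J → J}

theorem monomialForm_isAlt (hτ : Function.Involutive τ) (hs : ∀ a, s (τ a) = -s a)
    (hd : ∀ κ, Odd (d κ)) : (monomialForm d s τ).IsAlt := by
  intro f
  rw [monomialForm_apply]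
  refine Finset.sum_eq_zero fun κ _ => self_eq_neg.1 ?_
  have hinv : Function.Involutive fun v : Fin (d κ) → J => τ ∘ v := fun v => by
    funext i
    exact hτ (v i)
  conv_lhs => rw [← Equiv.sum_comp hinv.toPerm]
  rw [← Finset.sum_neg_distrib]
  refine Finset.sum_congr rfl fun v _ => ?_
  have h1 : τ ∘ τ ∘ v = v := hinv v
  simp only [Function.Involutive.coe_toPerm, h1, Function.comp_apply, hs, Finset.prod_neg,
    Finset.card_univ, Fintype.card_fin, (hd κ).neg_one_pow]
  ring

theorem monomialForm_nondegenerate (hτ : Function.Involutive τ) (hs : ∀ a, s (τ a) = -s a)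
    (hs1 : ∀ a, s a ^ 2 = 1) (hd : ∀ κ, Odd (d κ)) : (monomialForm d s τ).Nondegenerate := by
  rw [LinearMap.BilinForm.Nondegenerate,
    (monomialForm_isAlt hτ hs hd).isRefl.nondegenerate_iff_separatingLeft]
  intro f hf
  let g (κ : K) (v : Fin (d κ) → J) : ℂ :=
    (∏ i, s (τ (v i))) * starRingEnd ℂ (f.1 κ (τ ∘ v))
  have hg : g ∈ altForms d J := by
    intro κ v σ
    have h1 : ∏ i, s (τ ((v ∘ σ) i)) = ∏ i, s (τ (v i)) :=
      Equiv.prod_comp σ fun i => s (τ (v i))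
    have h2 : f.1 κ (τ ∘ v ∘ σ) = _ := f.2 κ (τ ∘ v) σ
    simp only [g, h1, h2, map_mul, map_intCast]
    ring
  have h := hf ⟨g, hg⟩
  have h2 : ∑ κ, ∑ v, Complex.normSq (f.1 κ v) = 0 := by
    have : ((∑ κ, ∑ v, Complex.normSq (f.1 κ v) : ℝ) : ℂ) = 0 := by
      rw [← h, monomialForm_apply]
      push_cast
      refine Finset.sum_congr rfl fun κ _ => Finset.sum_congr rfl fun v _ => ?_
      have h1 : τ ∘ τ ∘ v = v := by
        funext i
        exact hτ (v i)
      have h2 : (∏ i, s (v i)) * ∏ i, s (v i) = 1 := by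
        rw [← Finset.prod_mul_distrib]
        exact Finset.prod_eq_one fun i _ => by rw [← sq, hs1]
      simp only [g, h1, Function.comp_apply, hτ _]
      rw [Complex.normSq_eq_conj_mul_self]
      linear_combination (-(starRingEnd ℂ (f.1 κ v) * f.1 κ v)) * h2
    exact_mod_cast this
  refine Subtype.ext (funext fun κ => funext fun v => ?_)
  have h3 := (Finset.sum_eq_zero_iff_of_nonneg
    fun κ _ => Finset.sum_nonneg fun v _ => Complex.normSq_nonneg (f.1 κ v)).1 h2 κ
      (Finset.mem_univ κ)
  exact Complex.normSq_eq_zero.1 ((Finset.sum_eq_zero_iff_of_nonneg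
    fun v _ => Complex.normSq_nonneg (f.1 κ v)).1 h3 v (Finset.mem_univ v))

theorem monomialForm_lie (hτ : Function.Involutive τ) {X : Matrix J J ℂ}
    (hX : ∀ a b, s a * X a b + s b * X (τ b) (τ a) = 0) (f g : altForms d J) :
    monomialForm d s τ ⟨slotSum X f.1, slotSum_mem X f.2⟩ g +
      monomialForm d s τ f ⟨slotSum X g.1, slotSum_mem X g.2⟩ = 0 := by
  rw [monomialForm_apply, monomialForm_apply, ← Finset.sum_add_distrib]
  refine Finset.sum_eq_zero fun κ _ => ?_
  have h1 : ∑ v, (∏ i, s (v i)) * slotSum X f.1 κ v * g.1 κ (τ ∘ v) =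
      ∑ i, ∑ p : (Fin (d κ) → J) × J, (∏ l, s (p.1 l)) * X (p.1 i) p.2 *
        f.1 κ (Function.update p.1 i p.2) * g.1 κ (τ ∘ p.1) := by
    simp only [Fintype.sum_prod_type]
    rw [Finset.sum_comm]
    refine Finset.sum_congr rfl fun v _ => ?_
    rw [slotSum, Finset.mul_sum, Finset.sum_mul]
    refine Finset.sum_congr rfl fun i _ => ?_
    rw [Finset.mul_sum, Finset.sum_mul]
    exact Finset.sum_congr rfl fun j _ => by ring
  have h2 : ∑ v, (∏ i, s (v i)) * f.1 κ v * slotSum X g.1 κ (τ ∘ v) =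
      ∑ i, ∑ p : (Fin (d κ) → J) × J, (∏ l, s (p.1 l)) * X (τ (p.1 i)) (τ p.2) *
        f.1 κ p.1 * g.1 κ (τ ∘ Function.update p.1 i p.2) := by
    simp only [Fintype.sum_prod_type]
    rw [Finset.sum_comm]
    refine Finset.sum_congr rfl fun v _ => ?_
    rw [slotSum, Finset.mul_sum]
    refine Finset.sum_congr rfl fun i _ => ?_
    rw [← Equiv.sum_comp hτ.toPerm, Finset.mul_sum]
    refine Finset.sum_congr rfl fun j _ => ?_
    rw [Function.Involutive.coe_toPerm, ← Function.comp_update, Function.comp_apply]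
    ring
  rw [h1, h2, ← Finset.sum_add_distrib]
  refine Finset.sum_eq_zero fun i _ => ?_
  have hinv : Function.Involutive fun p : (Fin (d κ) → J) × J =>
      (Function.update p.1 i p.2, p.1 i) := fun p => by simp
  rw [← Equiv.sum_comp hinv.toPerm fun p => (∏ l, s (p.1 l)) * X (τ (p.1 i)) (τ p.2) *
    f.1 κ p.1 * g.1 κ (τ ∘ Function.update p.1 i p.2), ← Finset.sum_add_distrib]
  refine Finset.sum_eq_zero fun p _ => ?_
  have hp (v : Fin (d κ) → J) : ∏ l, s (v l) = s (v i) * ∏ l ∈ Finset.univ.erase i, s (v l) :=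
    (Finset.mul_prod_erase _ _ (Finset.mem_univ i)).symm
  have hu : ∏ l ∈ Finset.univ.erase i, s (Function.update p.1 i p.2 l) =
      ∏ l ∈ Finset.univ.erase i, s (p.1 l) :=
    Finset.prod_congr rfl fun l hl => by rw [Function.update_of_ne (Finset.ne_of_mem_erase hl)]
  simp only [Function.Involutive.coe_toPerm, Function.update_self, Function.update_idem,
    Function.update_eq_self]
  rw [hp p.1, hp (Function.update _ _ _), hu, Function.update_self]
  linear_combination (∏ l ∈ Finset.univ.erase i, s (p.1 l)) *
    f.1 κ (Function.update p.1 i p.2) * g.1 κ (τ ∘ p.1) * hX (p.1 i) p.2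

end Form

/-! ### Quaternionic representations of `𝔰𝔭(n)` -/

section Symplectic

variable {n : ℕ}

/-- The sign in the standard symplectic form. -/
def spSign : Fin n ⊕ Fin n → ℂ := Sum.elim 1 (-1)

theorem spSign_swap (a : Fin n ⊕ Fin n) : spSign a.swap = -spSign a := by
  cases a <;> simp [spSign]

theorem spSign_sq (a : Fin n ⊕ Fin n) : spSign a ^ 2 = 1 := by
  cases a <;> simp [spSign]

theorem mem_sp_iff {X : Matrix (Fin n ⊕ Fin n) (Fin n ⊕ Fin n) ℂ} :
    X ∈ LieAlgebra.Symplectic.sp (Fin n) ℂ ↔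
      ∀ a b, spSign a * X a b + spSign b * X b.swap a.swap = 0 := by
  rw [LieAlgebra.Symplectic.sp, mem_skewAdjointMatricesLieSubalgebra,
    mem_skewAdjointMatricesSubmodule, Matrix.IsSkewAdjoint, Matrix.IsAdjointPair, ← Matrix.ext_iff]
  have h1 (a b) : (X.transpose * Matrix.J (Fin n) ℂ) a b = spSign b * X b.swap a := by
    rw [Matrix.mul_apply, Finset.sum_eq_single b.swap]
    · cases b <;> simp [Matrix.J, spSign]
    · intro c _ hc
      cases b <;> cases c <;> simp_all [Matrix.J]
    · simp
  have h2 (a b) : (Matrix.J (Fin n) ℂ * -X) a b = spSign a * X a.swap b := by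
    rw [Matrix.mul_apply, Finset.sum_eq_single a.swap]
    · cases a <;> simp [Matrix.J, spSign]
    · intro c _ hc
      cases a <;> cases c <;> simp_all [Matrix.J, eq_comm]
    · simp
  simp only [h1, h2]
  refine ⟨fun h a b => ?_, fun h a b => ?_⟩
  · have := h a.swap b
    rw [spSign_swap, Sum.swap_swap] at this
    linear_combination this
  · have := h a.swap b
    rw [spSign_swap, Sum.swap_swap] at this
    linear_combination this

variable {K : Type} {d : K → ℕ}

instance : LieRingModule (LieAlgebra.Symplectic.sp (Fin n) ℂ) (altForms d (Fin n ⊕ Fin n)) where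
  bracket X f := ⟨slotSum X.1 f.1, slotSum_mem X.1 f.2⟩
  add_lie X Y f := Subtype.ext (by
    funext κ v
    simp [slotSum, add_mul, Finset.sum_add_distrib])
  lie_add X f g := Subtype.ext (by
    funext κ v
    simp [slotSum, mul_add, Finset.sum_add_distrib])
  leibniz_lie X Y f := Subtype.ext (by
    have h : slotSum (⁅X, Y⁆ : LieAlgebra.Symplectic.sp (Fin n) ℂ).1 f.1 = _ :=
      slotSum_lie X.1 Y.1 f.1
    simp only [Submodule.coe_add, h]
    abel)

theorem coe_lie (X : LieAlgebra.Symplectic.sp (Fin n) ℂ) (f : altForms d (Fin n ⊕ Fin n)) :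
    (⁅X, f⁆ : altForms d (Fin n ⊕ Fin n)).1 = slotSum X.1 f.1 := rfl

instance : LieModule ℂ (LieAlgebra.Symplectic.sp (Fin n) ℂ) (altForms d (Fin n ⊕ Fin n)) where
  smul_lie c X f := Subtype.ext (by
    funext κ v
    simp [coe_lie, slotSum, Finset.mul_sum, mul_assoc, mul_add])
  lie_smul c X f := Subtype.ext (by
    funext κ v
    simp [coe_lie, slotSum, Finset.mul_sum, mul_left_comm, mul_add])

/-- The weights of the standard representation, as linear forms. -/
def stdWeight (a : Fin n ⊕ Fin n) : Module.Dual ℂ (Cartan (C n)) :=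
  wt (C n) (Sum.elim ε (fun i => -ε i) a)

theorem diag_mem_sp (x : Fin n → ℂ) :
    Matrix.fromBlocks (Matrix.diagonal x) 0 0 (-Matrix.diagonal x) ∈
      LieAlgebra.Symplectic.sp (Fin n) ℂ := by
  rw [mem_sp_iff]
  rintro (a | a) (b | b) <;> simp [spSign, Matrix.diagonal_apply, eq_comm]
  all_goals
    split_ifs with h
    · simp [h]
    · simp

theorem fromBlocks_eq_diagonal (x : Cartan (C n)) :
    Matrix.fromBlocks (Matrix.diagonal x.1) 0 0 (-Matrix.diagonal x.1) =
      Matrix.diagonal fun a => stdWeight a x := by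
  rw [Matrix.diagonal_neg, Matrix.fromBlocks_diagonal]
  congr 1
  funext a
  rcases a with i | i
  · exact (wt_ε_apply (C n) i x).symm
  · simp only [stdWeight, Sum.elim_inr, wt_neg (C n), LinearMap.neg_apply]
    rw [wt_ε_apply (C n)]

theorem mem_weightSpace_altForms (w : Module.Dual ℂ (Cartan (C n)))
    (f : altForms d (Fin n ⊕ Fin n)) : f ∈ weightSpace (altForms d (Fin n ⊕ Fin n)) w ↔
      ∀ κ v, f.1 κ v ≠ 0 → ∑ i, stdWeight (v i) = w := by
  have key (X : LieAlgebra.Symplectic.sp (Fin n) ℂ) (x : Cartan (C n))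
      (hX : X.1 = Matrix.fromBlocks (Matrix.diagonal x.1) 0 0 (-Matrix.diagonal x.1)) (κ : K)
      (v : Fin (d κ) → Fin n ⊕ Fin n) : (⁅X, f⁆ : altForms d (Fin n ⊕ Fin n)).1 κ v =
        (∑ i, stdWeight (v i)) x * f.1 κ v := by
    rw [coe_lie, hX, fromBlocks_eq_diagonal, slotSum_diagonal, LinearMap.sum_apply]
  simp only [weightSpace, Submodule.mem_iInf, LinearMap.mem_ker, LinearMap.sub_apply,
    LieModule.toEnd_apply_apply, LinearMap.smul_apply, LinearMap.id_apply, sub_eq_zero]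
  refine ⟨fun h κ v hv => LinearMap.ext fun x => ?_, fun h X x hX => ?_⟩
  · have h1 := congrFun (congrFun (congrArg Subtype.val (h ⟨_, diag_mem_sp x.1⟩ x rfl)) κ) v
    rw [key _ x rfl] at h1
    exact mul_right_cancel₀ hv h1
  · refine Subtype.ext (funext fun κ => funext fun v => ?_)
    rw [key X x hX]
    by_cases hv : f.1 κ v = 0
    · simp [hv]
    · rw [h κ v hv]
      rfl

theorem coeff_extC_eq [DecidableEq (Module.Dual ℂ (Cartan (C n)))] (k : ℕ)
    (w : Module.Dual ℂ (Cartan (C n))) : (extC n k).coeff w =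
      (((Finset.univ : Finset (Fin n ⊕ Fin n)).powersetCard k).filter
        fun s => ∑ a ∈ s, stdWeight a = w).card := by
  let e : Fin n × Bool ≃ Fin n ⊕ Fin n := (Equiv.prodComm _ _).trans (Equiv.boolProdEquivSum _)
  have he (p : Fin n × Bool) : stdWeight (e p) = wt (C n) (if p.2 then -ε p.1 else ε p.1) := by
    rcases p with ⟨i, _ | _⟩ <;> rfl
  have hu : (Finset.univ : Finset (Fin n ⊕ Fin n)) = Finset.univ.map e.toEmbedding := by simp
  rw [extC, AddMonoidAlgebra.coeff_sum, Finset.sum_apply', Finset.card_filter, Nat.cast_sum, hu,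
    Finset.powersetCard_map, Finset.sum_map]
  refine Finset.sum_congr rfl fun s _ => ?_
  have hs : ∑ a ∈ s.map e.toEmbedding, stdWeight a =
      wt (C n) (∑ p ∈ s, if p.2 then -ε p.1 else ε p.1) := by
    rw [Finset.sum_map, wt_sum (C n)]
    exact Finset.sum_congr rfl fun p _ => he p
  rw [AddMonoidAlgebra.coeff_single, Finsupp.single_apply, ← hs]
  push_cast
  rfl

theorem isPreQuaternionic_of_odd {χ : Rep (Cartan (C n))} [Fintype K] (hd : ∀ κ, Odd (d κ))
    (h : χ + conj χ = ∑ κ, extC n (d κ)) : IsPreQuaternionic χ := by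
  classical
  refine ⟨altForms d (Fin n ⊕ Fin n), inferInstance, inferInstance, inferInstance, inferInstance,
    inferInstance, fun w => ?_, monomialForm d spSign Sum.swap,
    monomialForm_isAlt Sum.swap_swap spSign_swap hd,
    monomialForm_nondegenerate Sum.swap_swap spSign_swap spSign_sq hd, fun X f g =>
    monomialForm_lie Sum.swap_swap (mem_sp_iff.1 X.2) f g⟩
  let o : LinearOrder (Fin n ⊕ Fin n) := LinearOrder.lift' finSumFinEquiv finSumFinEquiv.injective
  rw [finrank_altForms_supported stdWeight w _ (mem_weightSpace_altForms w), h,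
    AddMonoidAlgebra.coeff_sum, Finset.sum_apply', Nat.cast_sum]
  exact Finset.sum_congr rfl fun κ _ => (coeff_extC_eq _ _).symm

end Symplectic

theorem isPreQuaternionic_I8 : IsPreQuaternionic
    (restrictTo (fun _ : Fin 1 => I 8) (fun _ => false) 0
      (matter (fun _ : Fin 1 => I 8) (fun _ => false) 2 (on (fun _ : Fin 1 => I 8) 0
        (fundA 8 + extA 8 2 + extA 8 3))) - (1 / 2 : ℚ) • 1 - (1 / 2 : ℚ) • rhoZero (I 8)) := by
  refine isPreQuaternionic_of_odd (K := Bool) (d := fun b => if b then 1 else 3)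
    (fun b => by cases b <;> decide) ?_
  have e : extIrrC 4 3 = extC 4 3 - extC 4 1 := rfl
  have e' : restrictTo (fun _ : Fin 1 => I 8) (fun _ => false) 0
      (matter (fun _ : Fin 1 => I 8) (fun _ => false) 2 (on (fun _ : Fin 1 => I 8) 0
        (fundA 8 + extA 8 2 + extA 8 3))) - (1 / 2 : ℚ) • 1 - (1 / 2 : ℚ) • rhoZero (I 8) =
      (1 / 2 : ℚ) • extC 4 1 + (1 / 2 : ℚ) • extC 4 3 := by
    rw [matter_I8_first, e, fundC]
    module
  rw [e', conj_add, conj_smul, conj_smul, conj_extC, conj_extC, Fintype.sum_bool]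
  simp only [if_true, Bool.false_eq_true, if_false]
  module

end
end EllipticAnomaly

theorem mainTheorem4 :
    -- Example 1
    (∀ (m : ℕ) (a₂ c h : Germ), 3 ≤ m → IsUnit a₂ → (m = 3 → z ∣ c) →
      VerifiedGeneral (I m) (I (m + 1))
        (fun t => ⟨a₂, 2 * a₂ * c * z ^ (m / 2),
          a₂ * c ^ 2 * z ^ (2 * (m / 2)) + t * z ^ m + h * z ^ (m + 1)⟩)
        (fun t => 4 * a₂ ^ 3 * t * z ^ m) (m + 1)
        (fun _ => a₂) (fun t => 4 * a₂ * t)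
        1 (embAA m) (fundA m)) ∧
    -- Example 2
    (∀ (n : ℕ) (a₄ a₆ : Germ), 2 ≤ n → IsUnit a₄ →
      VerifiedGeneral (I (2 * n)) (Istar (2 * n - 4))
        (fun t => ⟨t, a₄ * z ^ n, a₆ * z ^ (2 * n)⟩)
        (fun t => t ^ 2 * (4 * t * a₆ - a₄ ^ 2) * z ^ (2 * n)) (2 * n + 2)
        (fun t => t) (fun t => 4 * t * a₆ - a₄ ^ 2)
        2 (embAD (2 * n) (2 * n - 4 + 4)) (extA (2 * n) 2)) ∧
    -- Example 3
    (∀ (n : ℕ) (ν ξ a₂ a₄ a₆ : Germ), 4 ≤ n → IsUnit ν →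
      IsUnit (ξ ^ 2 * a₂ - ν * ξ * a₄ + ν ^ 2 * a₆) →
      VerifiedGeneral (I (2 * n + 1)) (Istar (2 * n - 2))
        (fun t => ⟨(1 / 4 : ℂ) • (t * ν ^ 2) + a₂ * z,
          ((1 / 2 : ℂ) • (t * ν * ξ) + a₄ * z) * z ^ n,
          ((1 / 4 : ℂ) • (t * ξ ^ 2) + a₆ * z) * z ^ (2 * n)⟩)
        (fun t => ((1 / 4 : ℂ) • (t * ν ^ 2) + a₂ * z) ^ 2 *
          (t * (ξ ^ 2 * a₂ - ν * ξ * a₄ + ν ^ 2 * a₆) + (4 * a₂ * a₆ - a₄ ^ 2) * z) *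
            z ^ (2 * n + 1)) (2 * n + 4)
        (fun t => (1 / 4 : ℂ) • (t * ν ^ 2))
        (fun t => t * (ξ ^ 2 * a₂ - ν * ξ * a₄ + ν ^ 2 * a₆))
        2 (embAD (2 * n + 1) (2 * n - 2 + 4))
        ((2 : ℚ) • fundA (2 * n + 1) + extA (2 * n + 1) 2)) ∧
    -- Example 4
    (∀ (n : ℕ) (μ ξ a₂ a₄ a₆ : Germ), 3 ≤ n → IsUnit μ → IsUnit ξ → IsUnit a₂ →
      VerifiedGeneral (I (2 * n + 1)) (Istar (2 * n - 3))
        (fun t => ⟨(1 / 4 : ℂ) • (μ * t ^ 2) + a₂ * z,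
          ((1 / 2 : ℂ) • (μ * t * ξ) + a₄ * z) * z ^ n,
          ((1 / 4 : ℂ) • (μ * ξ ^ 2) + a₆ * z) * z ^ (2 * n)⟩)
        (fun t => ((1 / 4 : ℂ) • (μ * t ^ 2) + a₂ * z) ^ 2 *
          (μ * (ξ ^ 2 * a₂ - t * ξ * a₄ + t ^ 2 * a₆) + (4 * a₂ * a₆ - a₄ ^ 2) * z) *
            z ^ (2 * n + 1)) (2 * n + 3)
        (fun t => (1 / 4 : ℂ) • (μ * t ^ 2))
        (fun t => μ * (ξ ^ 2 * a₂ - t * ξ * a₄ + t ^ 2 * a₆))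
        1 (embAD (2 * n + 1) (2 * n - 3 + 4)) (extA (2 * n + 1) 2)) ∧
    -- Example 5
    (∀ (m : ℕ) (a₂ c h : Germ), 7 ≤ m → IsUnit a₂ →
      VerifiedGeneral (Istar (m - 4)) (Istar (m - 3))
        (fun t => ⟨a₂ * z, 2 * a₂ * c * z ^ ((m - 1) / 2 + 1),
          a₂ * c ^ 2 * z ^ (2 * ((m - 1) / 2) + 1) + t * z ^ (m - 1) + h * z ^ m⟩)
        (fun t => 4 * a₂ ^ 3 * t * z ^ (m + 2)) (m + 3)
        (fun t => if m % 2 = 1 then 4 * t else -4 * a₂ * t) (fun _ => a₂)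
        2 (embDD (m - 4 + 4) (m - 3 + 4)) (vectD (m - 4 + 4))) ∧
    -- Example 6
    VerifiedOne III IV (fun t => ⟨0, 2 * t * z, z ^ 2⟩)
      (fun t => z ^ 3 * (27 * z + 32 * t ^ 3))
      (fun _ => none) (fun t => some (2 * t)) 2 3 1 (1 / 2) (embAA 2) (fundA 2) ∧
    -- Example 7
    (∀ a b : ℂ, 4 * a ^ 3 + 27 * b ^ 2 ≠ 0 →
      VerifiedOne IV (Istar 0) (fun t => ⟨0, a • z ^ 2, t * z ^ 2 + b • z ^ 3⟩)
        (fun t => z ^ 4 *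
          ((4 * a ^ 3 + 27 * b ^ 2) • z ^ 2 + (54 * b) • (t * z) + 27 * t ^ 2))
        (fun t => some t) (fun _ => none) 2 2 2 2 (embAD 3 4) ((3 : ℚ) • fundA 3)) ∧
    -- Example 8
    VerifiedOne (I 6) IVstar (fun t => ⟨t ^ 2, 2 * t * z ^ 2, z ^ 4⟩)
      (fun t => z ^ 6 * (27 * z ^ 2 - 4 * t ^ 3))
      (fun t => some (t ^ 2)) (fun t => some (-4 * t⁻¹)) 4 3 2 2
      (chain 6 ![simpleE6 0, simpleE6 2, simpleE6 3, simpleE6 4, simpleE6 5])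
      (1 + extA 6 3) ∧
    -- Example 9
    VerifiedOne (I 7) IIIstar
      (fun t => ⟨-4 * t * z + 16 * t ^ 3, z ^ 3 - 8 * t ^ 2 * z ^ 2, t * z ^ 4⟩)
      (fun t => z ^ 7 * (4 * z ^ 2 - 13 * t ^ 2 * z + 32 * t ^ 4))
      (fun t => some (16 * t ^ 3)) (fun t => some (1 / 8 * (t ^ 2)⁻¹)) 6 4 2 2
      (chain 7 ![simpleE7 0, simpleE7 2, simpleE7 3, simpleE7 4, simpleE7 5, simpleE7 6])
      (fundA 7 + extA 7 3) ∧
    -- Example 10, with the two embeddings of `A₇` in `E₈`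
    (let W : Germ → Weierstrass := fun t =>
        ⟨3 * t ^ 2 * z + t ^ 5, -(4 * t * z ^ 3 + 2 * t ^ 4 * z ^ 2), z ^ 5 + t ^ 3 * z ^ 4⟩;
      let Δ : Germ → Germ := fun t => z ^ 8 * (27 * z ^ 2 + 14 * t ^ 3 * z + 3 * t ^ 6)
      let β : Mero → Option Mero := fun t => some (t ^ 5)
      let γ : Mero → Option Mero := fun t => some (3 * (t ^ 4)⁻¹)
      let ρ : Rep (Cartan (A 8)) := fundA 8 + extA 8 2 + extA 8 3
      let ρ' : Rep (Cartan (A 8)) := 1 + (2 : ℚ) • extA 8 2 + (1 / 2 : ℚ) • extA 8 4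
      let M : Rep (Cartan (A 8)) → Rep (Cartan (C 4)) := fun χ =>
        restrictTo (fun _ : Fin 1 => I 8) (fun _ => false) 0
          (matter (fun _ : Fin 1 => I 8) (fun _ => false) 2 (on (fun _ : Fin 1 => I 8) 0 χ));
      VerifiedOne (I 8) IIstar W Δ β γ 10 6 2 2 embA7E8 ρ ∧
      VerifiedOne (I 8) IIstar W Δ β γ 10 6 2 2 embA7E8' ρ' ∧
      M ρ = (1 / 2 : ℚ) • 1 + (1 / 2 : ℚ) • rhoZero (I 8) + fundC 4 + (1 / 2 : ℚ) • extIrrC 4 3 ∧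
      M ρ' = (7 / 4 : ℚ) • 1 + (1 / 2 : ℚ) • rhoZero (I 8) + (3 / 4 : ℚ) • extIrrC 4 2 +
        (1 / 4 : ℚ) • extIrrC 4 4 ∧
      IsPreQuaternionic (M ρ - (1 / 2 : ℚ) • 1 - (1 / 2 : ℚ) • rhoZero (I 8)) ∧
      ∀ c : ℚ, ¬ IsPreQuaternionic (M ρ' - c • 1 - (1 / 2 : ℚ) • rhoZero (I 8))) ∧
    -- Example 11
    VerifiedOne (Istar 1) IVstar (fun t => ⟨t * z, 0, z ^ 4⟩)
      (fun t => z ^ 7 * (27 * z + 4 * t ^ 3))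
      (fun _ => some 4) (fun t => some t) 4 3 1 1 embD5E6 (spinD 5) ∧
    -- Example 12
    VerifiedOne (Istar 2) IIIstar (fun t => ⟨t * z, z ^ 3, 0⟩)
      (fun t => z ^ 8 * (4 * z - t ^ 2))
      (fun _ => some 1) (fun t => some t) 6 4 2 2 (embDE7 6 le_rfl) (1 + spinD' 6) ∧
    -- Example 13
    VerifiedOne (Istar 3) IIstar (fun t => ⟨t ^ 2 * z, 2 * t * z ^ 3, z ^ 5⟩)
      (fun t => z ^ 9 * (27 * z - 4 * t ^ 3))
      (fun t => some (-4 * (t ^ 3)⁻¹)) (fun t => some (t ^ 2)) 10 6 2 2 embD7E8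
      (vectD 7 + spinD 7) ∧
    -- Example 14
    VerifiedOne IVstar IIIstar (fun t => ⟨0, z ^ 3, t * z ^ 4⟩)
      (fun t => z ^ 8 * (4 * z + 27 * t ^ 2))
      (fun t => some t) (fun _ => none) 6 4 2 2 embE6E7 rep27 ∧
    -- Example 15
    VerifiedOne IIIstar IIstar (fun t => ⟨0, t * z ^ 3, z ^ 5⟩)
      (fun t => z ^ 9 * (27 * z + 4 * t ^ 3))
      (fun _ => none) (fun t => some t) 10 6 2 2 embE7E8 (1 + rep56) ∧
    -- Example 16
    (let T : Fin 2 → Kodaira := ![I 2, I 5];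
      Verified T IVstar (fun t => ⟨4 * t * z + t ^ 4, 2 * t ^ 2 * z ^ 2, z ^ 4⟩)
        (fun t => (z + 2 * t ^ 3) ^ 2 * z ^ 5 * (27 * z + 4 * t ^ 3))
        (fun t => ![-2 * t ^ 3, 0]) 3
        (fun t => ![none, some (t ^ 4)]) (fun t => ![some (64 * t ^ 10), some (16 * t)])
        4 3 1 1
        (assemble fun
          | 0 => chain 2 ![simpleE6 0]
          | 1 => chain 5 ![simpleE6 1, simpleE6 3, simpleE6 4, simpleE6 5])
        (on T 1 (fundA 5) + on T 0 (fundA 2) * on T 1 (extA 5 2))) ∧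
    -- Example 17
    (let T : Fin 2 → Kodaira := ![I 2, Istar 1];
      Verified T IIIstar (fun t => ⟨t * z, z ^ 3, t * z ^ 4⟩)
        (fun t => 4 * (z + t ^ 2) ^ 2 * z ^ 7)
        (fun t => ![-t ^ 2, 0]) 2
        (fun t => ![none, some (4 * t)]) (fun t => ![some (-t ^ 8), some t])
        6 4 2 2
        (assemble fun
          | 0 => chain 2 ![coroot78]
          | 1 => embDE7 5 (by norm_num))
        (on T 1 (vectD 5) + on T 0 (fundA 2) * on T 1 (spinD 5))) ∧
    -- Example 18
    (let T : Fin 2 → Kodaira := ![I 2, IVstar];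
      Verified T IIstar (fun t => ⟨0, -3 * t * z ^ 3, z ^ 5 + t ^ 3 * z ^ 4⟩)
        (fun t => 27 * (z - t ^ 3) ^ 2 * z ^ 8)
        (fun t => ![t ^ 3, 0]) 3
        (fun t => ![none, some (t ^ 3)]) (fun t => ![some (3 * t ^ 14), none])
        10 6 2 2
        (assemble fun
          | 0 => chain 2 ![simpleE8 7]
          | 1 => embE6E8)
        (on T 1 rep27 + on T 0 (fundA 2) + on T 0 (fundA 2) * on T 1 rep27)) ∧
    -- Example 19
    (let T : Fin 2 → Kodaira := ![I 3, I 5];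
      Verified T IIIstar
        (fun t => ⟨400 * t ^ 3 - 15 * t * z, 480 * t ^ 4 * z - 45 * t ^ 2 * z ^ 2 + z ^ 3,
          144 * t ^ 5 * z ^ 2 - 5 * t ^ 3 * z ^ 3⟩)
        (fun t => z ^ 3 * (z - 32 * t ^ 2) ^ 5 * (4 * z - 125 * t ^ 2))
        (fun t => ![0, 32 * t ^ 2]) 2
        (fun t => ![some (400 * t ^ 3), some (16 * t ^ 3)])
        (fun t => ![some (131072 / 5 * t ^ 6), some (384 * t ^ 2)])
        6 4 2 2
        (assemble fun
          | 0 => chain 3 ![simpleE7 6, simpleE7 5]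
          | 1 => chain 5 ![simpleE7 0, simpleE7 2, simpleE7 3, simpleE7 1])
        (on T 1 (fundA 5) + on T 0 (fundA 3) * on T 1 (fundA 5) +
          on T 0 (fundA 3) * on T 1 (extA 5 2))) ∧
    -- Example 20
    (let T : Fin 3 → Kodaira := ![I 2, I 3, I 3];
      Verified T IVstar
        (fun t => ⟨-3 * t ^ 4, -6 * t ^ 2 * z ^ 2, 16 * t ^ 6 * z ^ 2 + z ^ 4⟩)
        (fun t => 27 * z ^ 2 * (z - 2 * t ^ 3) ^ 3 * (z + 2 * t ^ 3) ^ 3)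
        (fun t => ![0, 2 * t ^ 3, -2 * t ^ 3]) 3
        (fun t => ![none, some (9 * t ^ 4), some (9 * t ^ 4)])
        (fun t => ![some (-192 * t ^ 10), some (256 / 3 * t ^ 7), some (-(256 / 3) * t ^ 7)])
        4 3 1 1
        (assemble fun
          | 0 => chain 2 ![simpleE6 1]
          | 1 => chain 3 ![simpleE6 2, simpleE6 0]
          | 2 => chain 3 ![simpleE6 4, simpleE6 5])
        (on T 1 (fundA 3) * on T 2 (fundA 3) + on T 0 (fundA 2) +
          on T 0 (fundA 2) * on T 1 (fundA 3) * on T 2 (fundA 3))) := by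
  refine ⟨verified_I_succ, verified_I_even, verified_I_odd, verified_I_odd', verified_Istar_succ,
    verified_III_IV, verified_IV_Istar0, verified_I6_IVstar,
    verified_I7_IIIstar, ⟨verified_I8_IIstar_of branching_A8_E8 balanced_I8,
      verified_I8_IIstar_of branching_A8_D8_E8 balanced_I8', matter_I8_first, matter_I8_second,
      isPreQuaternionic_I8, not_isPreQuaternionic_I8⟩,
    verified_Istar1_IVstar, verified_Istar2_IIIstar, verified_Istar3_IIstar,
    verified_IVstar_IIIstar, verified_IIIstar_IIstar, verified_I2_I5_IVstar,
    verified_I2_Istar1_IIIstar, verified_I2_IVstar_IIstar, verified_I3_I5_IIIstar,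
    verified_I2_I3_I3_IVstar⟩
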